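/- Let $\mathbb F$ be a field of characteristic $2$ and let $1\to P\to G\to Q\to 1$ be a short exact sequence of finite groups with $P\cong \mathbb Z/2\times\mathbb Z/2$. Let $\varepsilon^*\to\mathbb F$ be a projective resolution of the trivial $\mathbb F[G]$-module $\mathbb F$. For a cochain complex $C^*$ of $\mathbb F[G]$-modules put $\operatorname{Ext}^*_{\mathbb F[P]}(\mathbb F,C^*)=H^*(\operatorname{Hom}_{\mathbb F[P]}(\varepsilon^*,C^*))$, with the action of $Q$ induced by $(gf)(x)=g f(g^{-1}x)$ for $g\in G$, and $H^*(BP)=\operatorname{Ext}^*_{\mathbb F[P]}(\mathbb F,\mathbb F)=H^*(\operatorname{Hom}_{\mathbb F[P]}(\varepsilon^*,\varepsilon^*))$, a graded ring with $Q$-action which acts on $\operatorname{Ext}^*_{\mathbb F[P]}(\mathbb F,C^*)$ by precomposition. Let $I\subset\mathbb F[P]$ be the augmentation ideal, filter $C^*$ by $F^kC^*=\{x\mid \lambda x=0 \text{ for all }\lambda\in I^{k+1}\}$, let $F^kH^*(C^*)$ be the set of classes represented by cocycles in $F^kC^*$, and let $\operatorname{gr}H^*(C^*)=\bigoplus_{k\ge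 0} F^kH^*(C^*)/F^{k-1}H^*(C^*)$, on which $G$ acts through $Q$. Let $C^*$ be a perfect $\mathbb F[G]$-cochain complex, i.e. a bounded complex of finitely generated projective $\mathbb F[G]$-modules, whose total cohomology $H^*(C^*)$ is four-dimensional over $\mathbb F$ with a homogeneous basis in degrees $0\le m\le n\le t$ (counted with multiplicity). Let $J\subset H^*(BP)$ be the annihilator ideal of $\operatorname{Ext}^*_{\mathbb F[P]}(\mathbb F,C^*)$. Then $H^*(BP)\cong\mathbb F[x_1,x_2]$ with $x_1,x_2$ of degree one (so that $(x_1,x_2)=H^{>0}(BP)$), and: 1. there is a $Q$-equivariant isomorphism of graded $H^*(BP)$-modules $\operatorname{Ext}^*_{\mathbb F[P]}(\mathbb F,C^*)\cong \operatorname{Ext}^0_{\mathbb F[P]}(\mathbb F,C^*)\otimes_{\mathbb F} H^*(BP)/J$; 2. $J$ is generated by a regular sequence of two parameters, i.e. by two homogeneous elements of positive degree which form a regular sequence and for which $H^*(BP)/J$ is finite-dimensional over $\mathbb F$; 3. $H^*(BP)/J$ is a (local) complete intersection ring: it is a Noetherian local ring whose completion is a quotient of a regular local ring by an ideal generated by a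 regular sequence; 4. there is an isomorphism of graded $\mathbb F[Q]$-modules $\operatorname{Ext}^0_{\mathbb F[P]}(\mathbb F,C^*)\otimes_{\mathbb F}\Lambda\bigl(\Sigma^{-1}J/(x_1,x_2)J\bigr)\cong \operatorname{gr}H^*(C^*)$, where $\Sigma^{-1}$ lowers degrees by one and $\Lambda$ is the exterior algebra over $\mathbb F$, graded by total degree, with the induced $Q$-action; 5. $t=m+n$. -/

import Mathlib

open CategoryTheory CochainComplex.HomComplex
open scoped DirectSum TensorProduct

universe u

noncomputable section
namespace EquivExt

section HomCohomology

variable (F : Type*) [Field F] {𝒞 : Type*} [Category 𝒞] [Preadditive 𝒞] [Linear F 𝒞]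
  (K L M : CochainComplex 𝒞 ℤ)

/-- Cocycles of degree `n` in the complex of morphisms from `K` to `L`. -/
def cocycles (n : ℤ) : Submodule F (Cochain K L n) :=
  LinearMap.ker (δ_hom F K L n (n + 1))

/-- Coboundaries of degree `n` in the complex of morphisms from `K` to `L`. -/
def coboundaries (n : ℤ) : Submodule F (Cochain K L n) :=
  LinearMap.range (δ_hom F K L (n - 1) n)

/-- The cohomology `Hⁿ(Hom(K, L))` of the complex of morphisms from `K` to `L`. -/
def HomCoh (n : ℤ) : Type _ :=
  ↥(cocycles F K L n) ⧸ (coboundaries F K L n).submoduleOf (cocycles F K L n)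

instance (n : ℤ) : AddCommGroup (HomCoh F K L n) :=
  inferInstanceAs (AddCommGroup (_ ⧸ (coboundaries F K L n).submoduleOf (cocycles F K L n)))

instance (n : ℤ) : Module F (HomCoh F K L n) :=
  inferInstanceAs (Module F (_ ⧸ (coboundaries F K L n).submoduleOf (cocycles F K L n)))

/-- The class of a cocycle. -/
def HomCoh.mk (n : ℤ) : ↥(cocycles F K L n) →ₗ[F] HomCoh F K L n :=
  ((coboundaries F K L n).submoduleOf (cocycles F K L n)).mkQ

variable {F K L M}

lemma HomCoh.mk_surjective (n : ℤ) : Function.Surjective (HomCoh.mk F K L n) :=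
  Submodule.mkQ_surjective _

lemma mem_cocycles {n : ℤ} {z : Cochain K L n} :
    z ∈ cocycles F K L n ↔ δ n (n + 1) z = 0 := Iff.rfl

lemma HomCoh.mk_eq_zero {n : ℤ} (z : ↥(cocycles F K L n)) :
    HomCoh.mk F K L n z = 0 ↔ ∃ w, δ (n - 1) n w = z.1 :=
  (Submodule.Quotient.mk_eq_zero _).trans Iff.rfl

/-- The descent of a bilinear map to quotients. -/
def liftBilin {A B D : Type*} [AddCommGroup A] [AddCommGroup B] [AddCommGroup D]
    [Module F A] [Module F B] [Module F D] (p : Submodule F A) (q : Submodule F B)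
    (f : A →ₗ[F] B →ₗ[F] D) (hp : ∀ a ∈ p, ∀ b, f a b = 0) (hq : ∀ b ∈ q, ∀ a, f a b = 0) :
    (A ⧸ p) →ₗ[F] (B ⧸ q) →ₗ[F] D :=
  p.liftQ (q.liftQ f.flip fun b hb => LinearMap.ext fun a => hq b hb a).flip fun a ha =>
    LinearMap.ext fun b => by
      obtain ⟨b, rfl⟩ := q.mkQ_surjective b
      exact hp a ha b

lemma comp_mem_cocycles {i j : ℤ} {z : Cochain K L i} {w : Cochain L M j}
    (hz : z ∈ cocycles F K L i) (hw : w ∈ cocycles F L M j) :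
    z.comp w rfl ∈ cocycles F K M (i + j) := by
  rw [mem_cocycles] at *
  rw [δ_comp z w rfl (i + 1) (j + 1) (i + j + 1) rfl rfl rfl, hz, hw]
  simp

/-- Composition of classes (first argument applied first). -/
def HomCoh.comp (i j : ℤ) :
    HomCoh F K L i →ₗ[F] HomCoh F L M j →ₗ[F] HomCoh F K M (i + j) :=
  liftBilin _ _
    (LinearMap.mk₂ F
      (fun (z : ↥(cocycles F K L i)) (w : ↥(cocycles F L M j)) =>
        HomCoh.mk F K M (i + j) ⟨z.1.comp w.1 rfl, comp_mem_cocycles z.2 w.2⟩)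
      (fun z z' w => by rw [← map_add]; exact congrArg _ (Subtype.ext (Cochain.add_comp _ _ _ rfl)))
      (fun c z w => by rw [← map_smul]; exact congrArg _ (Subtype.ext (Cochain.smul_comp _ _ _ rfl)))
      (fun z w w' => by rw [← map_add]; exact congrArg _ (Subtype.ext (Cochain.comp_add _ _ _ rfl)))
      (fun c z w => by rw [← map_smul]; exact congrArg _ (Subtype.ext (Cochain.comp_smul _ _ _ rfl))))
    (fun z hz w => by
      obtain ⟨y, hy⟩ := hz
      refine (HomCoh.mk_eq_zero _).2 ⟨j.negOnePow • y.comp w.1 (by lia), ?_⟩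
      have hw : δ j (j + 1) w.1 = 0 := w.2
      have hy' : δ (i - 1) i y = z.1 := hy
      rw [δ_units_smul, δ_comp y w.1 (by lia) i (j + 1) (i + j) (by lia) (by lia) (by lia), hw, hy']
      simp [smul_smul])
    (fun w hw z => by
      obtain ⟨y, hy⟩ := hw
      refine (HomCoh.mk_eq_zero _).2 ⟨z.1.comp y (by lia), ?_⟩
      have hz : δ i (i + 1) z.1 = 0 := z.2
      have hy' : δ (j - 1) j y = w.1 := hy
      rw [δ_comp z.1 y (by lia) (i + 1) j (i + j) (by lia) (by lia) (by lia), hz, hy']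
      simp)

lemma HomCoh.comp_mk {i j : ℤ} (z : ↥(cocycles F K L i)) (w : ↥(cocycles F L M j)) :
    HomCoh.comp i j (HomCoh.mk F K L i z) (HomCoh.mk F L M j w) =
      HomCoh.mk F K M (i + j) ⟨z.1.comp w.1 rfl, comp_mem_cocycles z.2 w.2⟩ := rfl

lemma HomCoh.gradedMk_eq {i j : ℤ} (h : i = j) (z : ↥(cocycles F K L i))
    (w : ↥(cocycles F K L j))
    (hv : ∀ p q (hp : p + i = q) (hq : p + j = q), z.1.v p q hp = w.1.v p q hq) :
    GradedMonoid.mk (A := fun n => HomCoh F K L n) i (HomCoh.mk F K L i z) =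
      GradedMonoid.mk j (HomCoh.mk F K L j w) := by
  subst h
  congr 2
  ext p q hp
  exact hv p q hp hp

variable (F K) in
/-- The class of the identity. -/
def HomCoh.one : HomCoh F K K 0 :=
  HomCoh.mk F K K 0 ⟨Cochain.ofHom (𝟙 K), by rw [mem_cocycles]; simp⟩

lemma HomCoh.one_comp_mk {j : ℤ} (x : HomCoh F K L j) :
    GradedMonoid.mk (A := fun n => HomCoh F K L n) (0 + j) (HomCoh.comp 0 j (HomCoh.one F K) x) =
      GradedMonoid.mk j x := by
  obtain ⟨x, rfl⟩ := HomCoh.mk_surjective _ x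
  refine HomCoh.gradedMk_eq (zero_add j) _ _ fun p q hp hq => ?_
  have h := Cochain.comp_v (Cochain.ofHom (𝟙 K)) x.1 rfl p p q (by lia) hq
  simpa using h

lemma HomCoh.comp_one_mk {i : ℤ} (x : HomCoh F K L i) :
    GradedMonoid.mk (A := fun n => HomCoh F K L n) (i + 0) (HomCoh.comp i 0 x (HomCoh.one F L)) =
      GradedMonoid.mk i x := by
  obtain ⟨x, rfl⟩ := HomCoh.mk_surjective _ x
  refine HomCoh.gradedMk_eq (add_zero i) _ _ fun p q hp hq => ?_
  have h := Cochain.comp_v x.1 (Cochain.ofHom (𝟙 L)) rfl p q q hq (by lia)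
  simpa using h

lemma HomCoh.comp_assoc_mk {N : CochainComplex 𝒞 ℤ} {i j k : ℤ} (x : HomCoh F K L i)
    (y : HomCoh F L M j) (z : HomCoh F M N k) :
    GradedMonoid.mk (A := fun n => HomCoh F K N n) (i + j + k)
        (HomCoh.comp (i + j) k (HomCoh.comp i j x y) z) =
      GradedMonoid.mk (i + (j + k)) (HomCoh.comp i (j + k) x (HomCoh.comp j k y z)) := by
  obtain ⟨x, rfl⟩ := HomCoh.mk_surjective _ x
  obtain ⟨y, rfl⟩ := HomCoh.mk_surjective _ y
  obtain ⟨z, rfl⟩ := HomCoh.mk_surjective _ z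
  refine HomCoh.gradedMk_eq (add_assoc i j k) _ _ fun p q hp hq => ?_
  have h1 := Cochain.comp_v (x.1.comp y.1 rfl) z.1 rfl p (p + (i + j)) q rfl (by lia)
  have h2 := Cochain.comp_v x.1 y.1 rfl p (p + i) (p + (i + j)) rfl (by lia)
  have h3 := Cochain.comp_v x.1 (y.1.comp z.1 rfl) rfl p (p + i) q rfl (by lia)
  have h4 := Cochain.comp_v y.1 z.1 rfl (p + i) (p + (i + j)) q (by lia) (by lia)
  rw [h1, h2, h3, h4, Category.assoc]

instance : GradedMonoid.GOne (fun n => HomCoh F K K n) where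
  one := HomCoh.one F K

instance : GradedMonoid.GMul (fun n => HomCoh F K K n) where
  mul {i j} a b := HomCoh.comp i j a b

instance : GradedMonoid.GMonoid (fun n => HomCoh F K K n) where
  one_mul a := HomCoh.one_comp_mk a.2
  mul_one a := HomCoh.comp_one_mk a.2
  mul_assoc a b c := HomCoh.comp_assoc_mk a.2 b.2 c.2

instance : DirectSum.GRing (fun n => HomCoh F K K n) where
  mul_zero {i j} a := map_zero (HomCoh.comp i j a)
  zero_mul {i j} b := LinearMap.congr_fun (map_zero (HomCoh.comp i j)) b
  mul_add {i j} a b c := map_add (HomCoh.comp i j a) b c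
  add_mul {i j} a b c := LinearMap.congr_fun (map_add (HomCoh.comp i j) a b) c
  natCast k := k • HomCoh.one F K
  natCast_zero := zero_smul _ _
  natCast_succ _ := succ_nsmul _ _
  intCast k := k • HomCoh.one F K
  intCast_ofNat _ := natCast_zsmul _ _
  intCast_negSucc_ofNat _ := negSucc_zsmul _ _

instance : Algebra F (⨁ n, HomCoh F K K n) :=
  Algebra.ofModule
    (fun r x y => by
      induction x using DirectSum.induction_on with
      | zero => simp
      | add x x' hx hx' => simp [add_mul, hx, hx']
      | of i x =>
        induction y using DirectSum.induction_on with
        | zero => simp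
        | add y y' hy hy' => simp only [mul_add, hy, hy', smul_add]
        | of j y =>
          rw [← DirectSum.of_smul, DirectSum.of_mul_of, DirectSum.of_mul_of, ← DirectSum.of_smul]
          congr 1
          exact LinearMap.congr_fun (map_smul (HomCoh.comp i j) r x) y)
    (fun r x y => by
      induction x using DirectSum.induction_on with
      | zero => simp
      | add x x' hx hx' => simp [add_mul, hx, hx']
      | of i x =>
        induction y using DirectSum.induction_on with
        | zero => simp
        | add y y' hy hy' => simp only [mul_add, hy, hy', smul_add]
        | of j y =>
          rw [← DirectSum.of_smul, DirectSum.of_mul_of, DirectSum.of_mul_of, ← DirectSum.of_smul]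
          congr 1
          exact map_smul (HomCoh.comp i j x) r y)

instance : DirectSum.Gmodule (fun n => HomCoh F K K n) (fun n => HomCoh F K L n) where
  smul {i j} a b := HomCoh.comp i j a b
  smul_zero {i j} a := map_zero (HomCoh.comp i j a)
  zero_smul {i j} b := LinearMap.congr_fun (map_zero (HomCoh.comp i j)) b
  smul_add {i j} a b c := map_add (HomCoh.comp i j a) b c
  add_smul {i j} a b c := LinearMap.congr_fun (map_add (HomCoh.comp i j) a b) c
  one_smul a := HomCoh.one_comp_mk a.2
  mul_smul a b c := HomCoh.comp_assoc_mk a.2 b.2 c.2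

end HomCohomology

section Extensions

variable {F : Type u} [Field F] {G : Type u} [Group G]

/-- `E` is a projective resolution of the trivial module `F` over `F[G]`, written as a cochain
complex concentrated in degrees `≤ 0`. -/
structure IsProjectiveResolution (E : CochainComplex (Rep.{u} F G) ℤ) : Prop where
  projective : ∀ i, Module.Projective (MonoidAlgebra F G) (E.X i).ρ.asModule
  isZero : ∀ i, 0 < i → Limits.IsZero (E.X i)
  quasiIso : ∃ η : E ⟶ (HomologicalComplex.single (Rep.{u} F G) (ComplexShape.up ℤ) 0).obj
    (Rep.trivial F G F), QuasiIso η

/-- `C` is a perfect complex: a bounded cochain complex of finitely generated projective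
`F[G]`-modules. -/
structure IsPerfect (C : CochainComplex (Rep.{u} F G) ℤ) : Prop where
  projective : ∀ i, Module.Projective (MonoidAlgebra F G) (C.X i).ρ.asModule
  finite : ∀ i, Module.Finite (MonoidAlgebra F G) (C.X i).ρ.asModule
  bounded : ∃ a b : ℤ, ∀ i, i < a ∨ b < i → Limits.IsZero (C.X i)

variable (P : Subgroup G)

/-- Restriction of a complex of `F[G]`-modules to `F[P]`. -/
abbrev resCx (C : CochainComplex (Rep.{u} F G) ℤ) : CochainComplex (Rep.{u} F P) ℤ :=
  ((Rep.resFunctor P.subtype).mapHomologicalComplex (ComplexShape.up ℤ)).obj C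

section Conj

variable {P} in
lemma hom_eq {X Y : Rep.{u} F G} {f f' : Rep.res P.subtype X ⟶ Rep.res P.subtype Y}
    (h : ∀ x : X, f.hom.toLinearMap x = f'.hom.toLinearMap x) : f = f' :=
  Rep.hom_ext (Representation.IntertwiningMap.ext (LinearMap.ext h))

variable [P.Normal]

/-- The action of `g` on an `F[P]`-linear map: `(g f)(x) = g f(g⁻¹ x)`. -/
def conjHom {X Y : Rep.{u} F G} (g : G)
    (f : Rep.res P.subtype X ⟶ Rep.res P.subtype Y) :
    Rep.res P.subtype X ⟶ Rep.res P.subtype Y :=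
  Rep.ofHom ⟨Y.ρ g ∘ₗ f.hom.toLinearMap ∘ₗ X.ρ g⁻¹, fun p => by
    ext x
    have h := LinearMap.congr_fun (f.hom.isIntertwining'
      ⟨g⁻¹ * p * g, by simpa using ‹P.Normal›.conj_mem p p.2 g⁻¹⟩) (X.ρ g⁻¹ x)
    have h' := congrArg (Y.ρ g) h
    simpa [← Module.End.mul_apply, ← map_mul, mul_assoc] using h'⟩

variable {P} {X Y Z : Rep.{u} F G}

lemma conjHom_comp (g : G) (f : Rep.res P.subtype X ⟶ Rep.res P.subtype Y)
    (f' : Rep.res P.subtype Y ⟶ Rep.res P.subtype Z) :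
    conjHom P g (f ≫ f') = conjHom P g f ≫ conjHom P g f' := by
  refine hom_eq fun x => ?_
  change Z.ρ g (f'.hom.toLinearMap (f.hom.toLinearMap (X.ρ g⁻¹ x))) =
    Z.ρ g (f'.hom.toLinearMap (Y.ρ g⁻¹ (Y.ρ g (f.hom.toLinearMap (X.ρ g⁻¹ x)))))
  simp

lemma conjHom_res (g : G) (f : X ⟶ Y) :
    conjHom P g ((Rep.resFunctor P.subtype).map f) = (Rep.resFunctor P.subtype).map f := by
  refine hom_eq fun x => ?_
  have h := Rep.hom_comm_apply f g (X.ρ g⁻¹ x)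
  rw [Representation.self_inv_apply] at h
  exact h.symm

lemma conjHom_mem (p : P) (f : Rep.res P.subtype X ⟶ Rep.res P.subtype Y) :
    conjHom P (p : G) f = f := by
  refine hom_eq fun x => ?_
  have h := Rep.hom_comm_apply f p (X.ρ (p : G)⁻¹ x)
  have h' : (Rep.res P.subtype X).ρ p (X.ρ (p : G)⁻¹ x) = x :=
    Representation.self_inv_apply _ _ _
  rw [h'] at h
  exact h.symm

end Conj

section Action

variable [P.Normal] (E C D : CochainComplex (Rep.{u} F G) ℤ)

/-- The action of `G` on `Hom_{F[P]}(E, C)` by `(g f)(x) = g f(g⁻¹ x)`. -/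
def cochainRep (n : ℤ) : Representation F G (Cochain (resCx P E) (resCx P C) n) where
  toFun g :=
    { toFun := fun z => Cochain.mk fun p q h => conjHom P g (z.v p q h)
      map_add' := fun z w => by
        refine Cochain.ext _ _ fun p q h => ?_
        exact hom_eq fun x => map_add ((C.X q).ρ g) _ _
      map_smul' := fun r z => by
        refine Cochain.ext _ _ fun p q h => ?_
        exact hom_eq fun x => map_smul ((C.X q).ρ g) r _ }
  map_one' := by
    refine LinearMap.ext fun z => Cochain.ext _ _ fun p q h => ?_
    refine hom_eq fun x => ?_
    change (C.X q).ρ 1 ((z.v p q h).hom.toLinearMap ((E.X p).ρ 1⁻¹ x)) = _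
    simp [Module.End.one_apply]
    rfl
  map_mul' g g' := by
    refine LinearMap.ext fun z => Cochain.ext _ _ fun p q h => ?_
    refine hom_eq fun x => ?_
    change (C.X q).ρ (g * g') ((z.v p q h).hom.toLinearMap ((E.X p).ρ (g * g')⁻¹ x)) =
      (C.X q).ρ g ((C.X q).ρ g' ((z.v p q h).hom.toLinearMap
        ((E.X p).ρ g'⁻¹ ((E.X p).ρ g⁻¹ x))))
    rw [mul_inv_rev, map_mul, map_mul]
    rfl

variable {E C D}

lemma cochainRep_v (g : G) {n : ℤ} (z : Cochain (resCx P E) (resCx P C) n) (p q : ℤ)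
    (h : p + n = q) : (cochainRep P E C n g z).v p q h = conjHom P g (z.v p q h) := rfl

lemma conjHom_add {X Y : Rep.{u} F G} (g : G) (f f' : Rep.res P.subtype X ⟶ Rep.res P.subtype Y) :
    conjHom P g (f + f') = conjHom P g f + conjHom P g f' :=
  hom_eq fun _ => map_add (Y.ρ g) _ _

lemma conjHom_units_smul {X Y : Rep.{u} F G} (g : G) (r : ℤˣ)
    (f : Rep.res P.subtype X ⟶ Rep.res P.subtype Y) :
    conjHom P g (r • f) = r • conjHom P g f := by
  obtain rfl | rfl := Int.units_eq_one_or r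
  · simp
  · rw [Units.neg_smul, one_smul, Units.neg_smul, one_smul]
    exact hom_eq fun _ => map_neg (Y.ρ g) _

lemma cochainRep_δ (g : G) (n m : ℤ) (z : Cochain (resCx P E) (resCx P C) n) :
    δ n m (cochainRep P E C n g z) = cochainRep P E C m g (δ n m z) := by
  by_cases hnm : n + 1 = m
  · refine Cochain.ext _ _ fun p q h => ?_
    have h1 := δ_v n m hnm (cochainRep P E C n g z) p q h (q - 1) (p + 1) rfl rfl
    have h2 := δ_v n m hnm z p q h (q - 1) (p + 1) rfl rfl
    have h3 := conjHom_comp g (z.v p (q - 1) (by lia)) ((Rep.resFunctor P.subtype).map (C.d (q - 1) q))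
    have h4 := conjHom_comp g ((Rep.resFunctor P.subtype).map (E.d p (p + 1))) (z.v (p + 1) q (by lia))
    rw [conjHom_res] at h3 h4
    refine h1.trans (Eq.trans ?_ (congrArg (conjHom P g) h2).symm)
    exact ((conjHom_add P g _ _).trans (congrArg₂ (· + ·) h3
      ((conjHom_units_smul P g _ _).trans (congrArg (m.negOnePow • ·) h4)))).symm
  · rw [δ_shape _ _ hnm, δ_shape _ _ hnm, map_zero]

lemma cochainRep_comp (g : G) {i j k : ℤ} (h : i + j = k)
    (z : Cochain (resCx P E) (resCx P C) i) (w : Cochain (resCx P C) (resCx P D) j) :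
    cochainRep P E D k g (z.comp w h) =
      (cochainRep P E C i g z).comp (cochainRep P C D j g w) h := by
  refine Cochain.ext _ _ fun p q hq => ?_
  exact conjHom_comp (P := P) (X := E.X p) (Y := C.X (p + i)) (Z := D.X q) g
    (z.v p (p + i) rfl) (w.v (p + i) q (by lia))

lemma cochainRep_mem_cocycles (g : G) (n : ℤ) :
    cocycles F (resCx P E) (resCx P C) n ≤
      (cocycles F (resCx P E) (resCx P C) n).comap (cochainRep P E C n g) := fun z hz => by
  rw [mem_cocycles] at hz
  rw [Submodule.mem_comap, mem_cocycles, cochainRep_δ, hz, map_zero]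

variable (E C D)

/-- `Extⁿ_{F[P]}(F, C) = Hⁿ(Hom_{F[P]}(E, C))`, for a projective resolution `E` of `F`. -/
abbrev ExtP (n : ℤ) : Type u := HomCoh F (resCx P E) (resCx P C) n

/-- The action of `G` on `Extⁿ_{F[P]}(F, C)` induced by `(g f)(x) = g f(g⁻¹ x)`. -/
def extRepG (n : ℤ) : Representation F G (ExtP P E C n) :=
  ((cochainRep P E C n).subrepresentation (cocycles F (resCx P E) (resCx P C) n)
    fun g => cochainRep_mem_cocycles P g n).quotient _ fun g z hz => by
      obtain ⟨w, hw⟩ := hz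
      refine ⟨cochainRep P E C (n - 1) g w, ?_⟩
      exact (cochainRep_δ P g _ _ w).trans (congrArg _ hw)

lemma extRepG_mk (n : ℤ) (g : G) (z : ↥(cocycles F (resCx P E) (resCx P C) n)) :
    extRepG P E C n g (HomCoh.mk F _ _ n z) =
      HomCoh.mk F _ _ n ⟨cochainRep P E C n g z.1, cochainRep_mem_cocycles P g n z.2⟩ := rfl

instance (n : ℤ) : Representation.IsTrivial ((extRepG P E C n).comp P.subtype) where
  out p := by
    refine LinearMap.ext fun x => ?_
    obtain ⟨z, rfl⟩ := HomCoh.mk_surjective n x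
    refine (extRepG_mk P E C n p z).trans ?_
    refine congrArg (HomCoh.mk F _ _ n) (Subtype.ext (Cochain.ext _ _ fun a b h => ?_))
    exact conjHom_mem (P := P) (X := E.X a) (Y := C.X b) p (z.1.v a b h)

/-- The action of `Q = G/P` on `Extⁿ_{F[P]}(F, C)`. -/
def extRep (n : ℤ) : Representation F (G ⧸ P) (ExtP P E C n) :=
  (extRepG P E C n).ofQuotient P

lemma extRep_comp (q : G ⧸ P) {i j : ℤ} (x : ExtP P E C i) (y : ExtP P C D j) :
    extRep P E D (i + j) q (HomCoh.comp i j x y) =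
      HomCoh.comp i j (extRep P E C i q x) (extRep P C D j q y) := by
  obtain ⟨g, rfl⟩ := QuotientGroup.mk_surjective q
  obtain ⟨z, rfl⟩ := HomCoh.mk_surjective i x
  obtain ⟨w, rfl⟩ := HomCoh.mk_surjective j y
  exact congrArg (HomCoh.mk F (resCx P E) (resCx P D) (i + j)) (Subtype.ext (cochainRep_comp P g rfl z.1 w.1))

/-- The graded module `Ext*_{F[P]}(F, C)`. -/
abbrev ExtTot : Type u := ⨁ n : ℤ, ExtP P E C n

/-- The graded ring `H*(BP) = Ext*_{F[P]}(F, F)`, as the cohomology of the endomorphism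
complex of a projective resolution `E` of `F`. The product `a * b` is `a` followed by `b`, and the ring acts on `Ext*_{F[P]}(F, C)` by precomposition. -/
abbrev CohRing : Type u := ⨁ n : ℤ, ExtP P E E n

/-- The action of `Q = G/P` on `Ext*_{F[P]}(F, C)`. -/
def extTotRep : Representation F (G ⧸ P) (ExtTot P E C) :=
  Representation.directSum fun n => extRep P E C n

lemma extTotRep_of (q : G ⧸ P) (n : ℤ) (x : ExtP P E C n) :
    extTotRep P E C q (DirectSum.of (fun n => ExtP P E C n) n x) =
      DirectSum.of (fun n => ExtP P E C n) n (extRep P E C n q x) :=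
  DirectSum.lmap_lof _ _ _

lemma extTotRep_smul (q : G ⧸ P) (a : CohRing P E) (x : ExtTot P E C) :
    extTotRep P E C q (a • x) = extTotRep P E E q a • extTotRep P E C q x := by
  induction a using DirectSum.induction_on with
  | zero => simp only [zero_smul, map_zero]
  | add a b ha hb => simp only [add_smul, map_add, ha, hb]
  | of i a =>
    induction x using DirectSum.induction_on with
    | zero => simp only [smul_zero, map_zero]
    | add x y hx hy => simp only [smul_add, map_add, hx, hy]
    | of j x =>
      rw [DirectSum.Gmodule.of_smul_of, extTotRep_of P E E q i a, extTotRep_of P E C q j x,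
        DirectSum.Gmodule.of_smul_of]
      exact (extTotRep_of P E C q (i + j) _).trans (congrArg _ (extRep_comp P E E C q a x))

lemma extTotRep_mul (q : G ⧸ P) (a b : CohRing P E) :
    extTotRep P E E q (a * b) = extTotRep P E E q a * extTotRep P E E q b := by
  induction a using DirectSum.induction_on with
  | zero => simp only [zero_mul, map_zero]
  | add a b ha hb => simp only [add_mul, map_add, ha, hb]
  | of i a =>
    induction b using DirectSum.induction_on with
    | zero => simp only [mul_zero, map_zero]
    | add x y hx hy => simp only [mul_add, map_add, hx, hy]
    | of j x =>
      rw [DirectSum.of_mul_of, extTotRep_of P E E q i a, extTotRep_of P E E q j x,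
        DirectSum.of_mul_of, extTotRep_of P E E q (i + j)]
      exact congrArg _ (extRep_comp P E E E q a x)

/-- The annihilator `J` of the `H*(BP)`-module `Ext*_{F[P]}(F, C)`. -/
abbrev annIdeal : Ideal (CohRing P E) := Module.annihilator (CohRing P E) (ExtTot P E C)

/-- The homogeneous part of degree `n` of `Ext*_{F[P]}(F, C)`. -/
def extDeg (n : ℤ) : Submodule F (ExtTot P E C) :=
  LinearMap.range (DirectSum.lof F ℤ (fun n => ExtP P E C n) n)

/-- The ideal `H^{>0}(BP)` of `H*(BP)` generated by the elements of positive degree. -/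
def posIdeal : Ideal (CohRing P E) :=
  Ideal.span {a | ∃ n : ℤ, 0 < n ∧ a ∈ extDeg P E E n}

/-- `J` as a graded vector space. -/
abbrev annSub : Submodule F (CohRing P E) := (annIdeal P E C).restrictScalars F

/-- The subspace `H^{>0}(BP) J` of `J`. -/
abbrev decSub : Submodule F (annSub P E C) :=
  ((posIdeal P E * annIdeal P E C).restrictScalars F).submoduleOf (annSub P E C)

lemma extTotRep_mem_ann (q : G ⧸ P) (a : CohRing P E) (ha : a ∈ annIdeal P E C) :
    extTotRep P E E q a ∈ annIdeal P E C := by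
  rw [Module.mem_annihilator] at ha ⊢
  intro x
  have h := extTotRep_smul P E C q a (extTotRep P E C q⁻¹ x)
  rw [ha, map_zero, Representation.self_inv_apply] at h
  exact h.symm

lemma extTotRep_mem_pos (q : G ⧸ P) (a : CohRing P E) (ha : a ∈ posIdeal P E) :
    extTotRep P E E q a ∈ posIdeal P E := by
  refine Submodule.span_induction (fun a ha => ?_) ?_ (fun a b _ _ ha hb => ?_)
    (fun r a _ ha => ?_) ha
  · obtain ⟨n, hn, y, rfl⟩ := ha
    exact Ideal.subset_span ⟨n, hn, extRep P E E n q y, (extTotRep_of P E E q n y).symm⟩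
  · rw [map_zero]; exact zero_mem _
  · rw [map_add]; exact add_mem ha hb
  · rw [smul_eq_mul, extTotRep_mul]; exact Ideal.mul_mem_left _ _ ha

lemma extTotRep_mem_mul (q : G ⧸ P) (a : CohRing P E)
    (ha : a ∈ posIdeal P E * annIdeal P E C) :
    extTotRep P E E q a ∈ posIdeal P E * annIdeal P E C := by
  refine Submodule.smul_induction_on ha (fun a ha b hb => ?_) (fun a b ha hb => ?_)
  · rw [smul_eq_mul, extTotRep_mul]
    exact Submodule.smul_mem_smul (extTotRep_mem_pos P E q a ha) (extTotRep_mem_ann P E C q b hb)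
  · rw [map_add]; exact add_mem ha hb

/-- The action of `Q` on `H*(BP) / J`. -/
def quotRep : Representation F (G ⧸ P) (CohRing P E ⧸ annIdeal P E C) :=
  (extTotRep P E E).quotient (annSub P E C) (extTotRep_mem_ann P E C)

lemma quotRep_mk (q : G ⧸ P) (a : CohRing P E) :
    quotRep P E C q (Submodule.Quotient.mk a) = Submodule.Quotient.mk (extTotRep P E E q a) := rfl

/-- The vector space `J / H^{>0}(BP) J`. -/
abbrev JQuot : Type u := ↥(annSub P E C) ⧸ decSub P E C

/-- The action of `Q` on `J / H^{>0}(BP) J`. -/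
def jQuotRep : Representation F (G ⧸ P) (JQuot P E C) :=
  ((extTotRep P E E).subrepresentation (annSub P E C) (extTotRep_mem_ann P E C)).quotient
    (decSub P E C) fun q a ha => extTotRep_mem_mul P E C q a.1 ha

/-- The part of degree `i` of the desuspension `Σ⁻¹ (J / H^{>0}(BP) J)`, i.e. the image of
the elements of `J` of degree `i + 1`. -/
def jQuotDeg (i : ℤ) : Submodule F (JQuot P E C) :=
  ((extDeg P E E (i + 1)).submoduleOf (annSub P E C)).map (decSub P E C).mkQ

end Action

/-- For a graded vector space `V`, the part of degree `t` of the exterior algebra `Λ(V)`,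
spanned by the products `v₁ ∧ ⋯ ∧ vₖ` of homogeneous elements with `|v₁| + ⋯ + |vₖ| = t`. -/
def extAlgDeg {V : Type*} [AddCommGroup V] [Module F V] (𝒱 : ℤ → Submodule F V) (t : ℤ) :
    Submodule F (ExteriorAlgebra F V) :=
  Submodule.span F {w | ∃ l : List (Σ i, 𝒱 i), (l.map Sigma.fst).sum = t ∧
    w = (l.map fun v => ExteriorAlgebra.ι F (v.2 : V)).prod}

/-- The action on the exterior algebra induced by an action on `V`. -/
def extAlgRep {Q V : Type*} [Group Q] [AddCommGroup V] [Module F V] (ρ : Representation F Q V) :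
    Representation F Q (ExteriorAlgebra F V) where
  toFun q := (ExteriorAlgebra.map (ρ q)).toLinearMap
  map_one' := by
    rw [map_one, show (1 : Module.End F V) = LinearMap.id from rfl, ExteriorAlgebra.map_id]; rfl
  map_mul' q q' := by
    rw [map_mul, Module.End.mul_eq_comp, ← ExteriorAlgebra.map_comp_map]; rfl

section Filtration

/-- The augmentation ideal of `F[P]`. -/
def augIdeal (F : Type u) [Field F] : Ideal (MonoidAlgebra F P) :=
  RingHom.ker (MonoidAlgebra.lift F F P (1 : P →* F))

/-- The subspace `{x | λ x = 0 for all λ ∈ Iᵏ}` of an `F[G]`-module, with `I` the augmentation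
ideal of `F[P]`; this is `F^{k-1}`. -/
def filMod (X : Rep.{u} F G) (k : ℕ) : Submodule F X where
  carrier := {x | ∀ a ∈ augIdeal P F ^ k,
    Representation.asAlgebraHom (X.ρ.comp P.subtype) a x = 0}
  zero_mem' := by simp
  add_mem' hx hy a ha := by rw [map_add, hx a ha, hy a ha, add_zero]
  smul_mem' r x hx a ha := by rw [map_smul, hx a ha, smul_zero]

lemma filMod_sub (X : Rep.{u} F G) (k : ℕ) (p : P) (x : X) (hx : x ∈ filMod P X (k + 1)) :
    X.ρ p x - x ∈ filMod P X k := fun a ha => by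
  have hp : (MonoidAlgebra.of F P p - 1) ∈ augIdeal P F := by
    rw [augIdeal, RingHom.mem_ker]
    simp
  have h := hx (a * (MonoidAlgebra.of F P p - 1)) (by
    rw [Submodule.pow_succ]; exact Submodule.smul_mem_smul ha hp)
  rw [map_mul, Module.End.mul_apply] at h
  simpa using h

/-- The filtration on `Hᵗ(C)`: the classes represented by cocycles in the `k`-th step of the
filtration of `Cᵗ`. -/
def filH (C : CochainComplex (Rep.{u} F G) ℤ) (t : ℤ) (k : ℕ) : Submodule F (C.homology t) :=
  ((filMod P (C.X t) k).comap (C.iCycles t).hom.toLinearMap).map (C.homologyπ t).hom.toLinearMap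

variable [P.Normal]

/-- Conjugation by `g` on `F[P]`. -/
def conjAlg (F : Type u) [Field F] (g : G) : MonoidAlgebra F P →ₐ[F] MonoidAlgebra F P :=
  MonoidAlgebra.mapDomainAlgHom F F (MulAut.conjNormal (H := P) g).toMonoidHom

lemma conjAlg_mem (g : G) (k : ℕ) (a : MonoidAlgebra F P) (ha : a ∈ augIdeal P F ^ k) :
    conjAlg P F g a ∈ augIdeal P F ^ k := by
  induction k generalizing a with
  | zero => rw [Submodule.pow_zero, Ideal.one_eq_top]; trivial
  | succ k ih =>
    rw [Submodule.pow_succ] at ha ⊢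
    refine Submodule.smul_induction_on ha (fun a ha b hb => ?_) (fun a b ha hb => ?_)
    · rw [smul_eq_mul, map_mul]
      refine Submodule.smul_mem_smul (ih a ha) ?_
      have h : (MonoidAlgebra.lift F F P (1 : P →* F)).comp (conjAlg P F g) =
          MonoidAlgebra.lift F F P (1 : P →* F) := by
        ext p
        simp [conjAlg]
      rw [augIdeal, RingHom.mem_ker] at hb ⊢
      exact (DFunLike.congr_fun h b).trans hb
    · rw [map_add]; exact add_mem ha hb

lemma asAlgebraHom_conj (X : Rep.{u} F G) (g : G) (a : MonoidAlgebra F P) (x : X) :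
    Representation.asAlgebraHom (X.ρ.comp P.subtype) a (X.ρ g x) =
      X.ρ g (Representation.asAlgebraHom (X.ρ.comp P.subtype) (conjAlg P F g⁻¹ a) x) := by
  induction a using MonoidAlgebra.induction_on with
  | of p =>
    simp only [conjAlg, MonoidAlgebra.of_apply, MonoidAlgebra.mapDomainAlgHom_apply,
      MonoidAlgebra.mapDomain_single, Representation.asAlgebraHom_single, one_smul]
    simp [← Module.End.mul_apply, ← map_mul, mul_assoc]
  | add a b ha hb => simp only [map_add, LinearMap.add_apply, ha, hb]
  | smul r a ha => simp only [map_smul, LinearMap.smul_apply, ha]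

lemma filMod_inv (X : Rep.{u} F G) (k : ℕ) (g : G) :
    filMod P X k ≤ (filMod P X k).comap (X.ρ g) := fun x hx a ha => by
  rw [asAlgebraHom_conj, hx _ (conjAlg_mem P g⁻¹ k a ha), map_zero]

variable (C : CochainComplex (Rep.{u} F G) ℤ)

lemma filH_inv (t : ℤ) (k : ℕ) (g : G) :
    filH P C t k ≤ (filH P C t k).comap ((C.homology t).ρ g) := by
  rintro _ ⟨z, hz, rfl⟩
  refine ⟨(C.cycles t).ρ g z, ?_, Rep.hom_comm_apply (C.homologyπ t) g z⟩
  have h := filMod_inv P (C.X t) k g hz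
  rw [Submodule.mem_comap] at h
  exact (congrArg (· ∈ filMod P (C.X t) k) (Rep.hom_comm_apply (C.iCycles t) g z)).mpr h

/-- The subquotient `Fᵏ Hᵗ(C) / Fᵏ⁻¹ Hᵗ(C)`. -/
abbrev GrPiece (t : ℤ) (k : ℕ) : Type u :=
  ↥(filH P C t (k + 1)) ⧸ (filH P C t k).submoduleOf (filH P C t (k + 1))

/-- The action of `G` on `Fᵏ Hᵗ(C) / Fᵏ⁻¹ Hᵗ(C)`. -/
def grPieceRepG (t : ℤ) (k : ℕ) : Representation F G (GrPiece P C t k) :=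
  ((C.homology t).ρ.subrepresentation (filH P C t (k + 1)) (filH_inv P C t (k + 1))).quotient
    ((filH P C t k).submoduleOf (filH P C t (k + 1))) fun g _ hx => filH_inv P C t k g hx

instance (t : ℤ) (k : ℕ) : Representation.IsTrivial ((grPieceRepG P C t k).comp P.subtype) where
  out p := by
    refine LinearMap.ext fun x => ?_
    obtain ⟨⟨_, z, hz, rfl⟩, rfl⟩ := Submodule.mkQ_surjective _ x
    refine (Submodule.Quotient.eq _).2 ⟨(C.cycles t).ρ p z - z, ?_, ?_⟩
    · have h := filMod_sub P (C.X t) k p _ hz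
      have h' := Rep.hom_comm_apply (C.iCycles t) p z
      change (C.iCycles t).hom.toLinearMap _ ∈ filMod P (C.X t) k
      rw [map_sub]
      exact (congrArg (· - _ ∈ filMod P (C.X t) k) h').mpr h
    · rw [map_sub]
      exact congrArg (· - _) (Rep.hom_comm_apply (C.homologyπ t) p z)

/-- The action of `Q = G/P` on `Fᵏ Hᵗ(C) / Fᵏ⁻¹ Hᵗ(C)`. -/
def grPieceRep (t : ℤ) (k : ℕ) : Representation F (G ⧸ P) (GrPiece P C t k) :=
  (grPieceRepG P C t k).ofQuotient P

/-- The part of degree `t` of `gr H*(C)`. -/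
abbrev GrDeg (t : ℤ) : Type u := ⨁ k : ℕ, GrPiece P C t k

/-- The graded vector space `gr H*(C)`. -/
abbrev Gr : Type u := ⨁ t : ℤ, GrDeg P C t

/-- The action of `Q = G/P` on `gr H*(C)`. -/
def grRep : Representation F (G ⧸ P) (Gr P C) :=
  Representation.directSum fun t => Representation.directSum fun k => grPieceRep P C t k

end Filtration

/-- A Noetherian local ring is a complete intersection if its completion is the quotient of
a regular local ring by an ideal generated by a regular sequence. -/
def IsCompleteIntersectionLocalRing (R : Type u) [CommRing R] : Prop :=
  IsNoetherianRing R ∧ ∃ _ : IsLocalRing R,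
    ∃ (S : Type u) (_ : CommRing S) (_ : IsRegularLocalRing S) (rs : List S),
      RingTheory.Sequence.IsRegular S rs ∧
        Nonempty (AdicCompletion (IsLocalRing.maximalIdeal R) R ≃+* S ⧸ Ideal.ofList rs)

end Extensions
end EquivExt

end

open EquivExt

/-! Let g_0, g_1 generate P and put λ_i = g_i - 1. Then F[P] = F[λ_0, λ_1]/(λ_0², λ_1²), with norm
element λ_0λ_1. The terms of C are projective over F[G], hence both projective and injective over
F[P]. So every P-fixed vector of C is a norm, and Ext*(F, C) is the cohomology of the fixed points
of C (`fixedClass_eq_zero_iff`, `fixedClass_surjective`). Evaluating cocycles on a copy of the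
minimal resolution inside E identifies H*(BP) with S = F[x_0, x_1] (`isCob_of_k_eq_zero`, `phi`).
The module structure is tied to C by one relation, `gen_comp_fixedClass_add`: x_0[λ_0 w] + x_1[λ_1
w] = [dw] whenever w is killed by the norm and the three classes make sense.

This relation compares gr H*(C) with the Koszul complex Ext → Ext² → Ext of (x_0, x_1). The bottom
of the filtration is a quotient of Ext. The middle maps to the quotient of Ext² by trivial
relations, via z ↦ ([λ_0 z], [λ_1 z]), and its image contains the middle Koszul homology. The top
maps to Ext by the norm. Since the alternating sum of the dimensions in the Koszul complex vanishes,
its middle homology has dimension dim coker + dim ker, and both are at least one, as the lowest and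
the highest degree of Ext show. The lowest degree also forces a nonzero bottom piece and the highest
a nonzero top piece. So dim H*(C) ≥ 1 + 2 + 1, and dimension four turns every inequality into an
equality (`hasShape`).

Hence Ext is generated by one class e of degree zero and is S/J up to the line Ext⁰. The middle
Koszul homology of S/J is J/(x_0, x_1)J, so by Nakayama J is generated by two elements y and z of
degrees m + 1 and n + 1 (`comap_annIdeal`). As Ext is finite-dimensional, y and z are coprime and
form a regular sequence. Writing y = x_0y_0 + x_1y_1 and z = x_0z_0 + x_1z_1, the socle of S/J is
spanned by the determinant y_0z_1 - y_1z_0 of degree m + n. The socle contains the top degree t, so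
t = m + n (`top_eq`).

The isomorphism with gr H*(C) sends 1, y, z, y ∧ z to the image of e, the two middle classes and the
top class whose norm is the determinant times e. It is equivariant because Q acts on the λ_i, modulo
the square of the augmentation ideal, and on the x_j by transposed matrices, of determinant one as
they come from GL_2(𝔽_2) (`conjCoef_det`, `rot_det`, `ev_twist_det`). -/

noncomputable section
namespace EquivExt

/-! ### Complexes of morphisms and quasi-isomorphisms. -/

section DerivedHom

universe w v

variable {𝒞 : Type w} [Category.{v} 𝒞] [Abelian 𝒞] {K K' L L' : CochainComplex 𝒞 ℤ} {n : ℤ}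

lemma isIso_Qh_map_quotient [HasDerivedCategory 𝒞] (f : L ⟶ L') [hf : QuasiIso f] :
    IsIso (DerivedCategory.Qh.map ((HomotopyCategory.quotient 𝒞 (ComplexShape.up ℤ)).map f)) := by
  have h : IsIso (DerivedCategory.Q.map f) := (DerivedCategory.isIso_Q_map_iff_quasiIso _ f).2 hf
  exact (NatIso.isIso_map_iff (DerivedCategory.quotientCompQhIso 𝒞) f).2 h

/-- Homotopy classes of maps out of a K-projective complex are maps in the derived category, where
the shift of `f` is invertible and can be cancelled. Applied to E → F, this reduces cocycles of
Hom(E, E) to linear forms on E. -/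
lemma mem_coboundaries_of_postcomp [K.IsKProjective] (f : L ⟶ L') [QuasiIso f]
    (z : Cocycle K L n) (hz : z.postcomp f ∈ CochainComplex.HomComplex.coboundaries K L' n) :
    z ∈ CochainComplex.HomComplex.coboundaries K L n := by
  let := HasDerivedCategory.standard 𝒞
  rw [← CohomologyClass.toHom_mk_eq_zero_iff, CohomologyClass.toHom_mk] at hz ⊢
  rw [Cocycle.equivHomShift_symm_postcomp, Functor.map_comp] at hz
  apply (CochainComplex.IsKProjective.Qh_map_bijective K _).injective
  have h := congrArg DerivedCategory.Qh.map hz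
  rw [Functor.map_comp, Functor.map_zero] at h
  have : QuasiIso (f⟦n⟧') := inferInstance
  have := isIso_Qh_map_quotient (f⟦n⟧')
  rw [Functor.map_zero]
  exact (cancel_mono (DerivedCategory.Qh.map
    ((HomotopyCategory.quotient 𝒞 (ComplexShape.up ℤ)).map (f⟦n⟧')))).1 (h.trans Limits.zero_comp.symm)

/-- Dual cancellation on the source. Together with the next lemma it says that precomposition with
`f` is a quasi-isomorphism of Hom complexes into a K-injective complex. -/
lemma mem_coboundaries_of_precomp [L.IsKInjective] (f : K ⟶ K') [QuasiIso f]
    (z : Cocycle K' L n) (hz : z.precomp f ∈ CochainComplex.HomComplex.coboundaries K L n) :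
    z ∈ CochainComplex.HomComplex.coboundaries K' L n := by
  let := HasDerivedCategory.standard 𝒞
  rw [← CohomologyClass.toHom_mk_eq_zero_iff, CohomologyClass.toHom_mk] at hz ⊢
  rw [Cocycle.equivHomShift_symm_precomp, Functor.map_comp] at hz
  apply (CochainComplex.IsKInjective.Qh_map_bijective _ (L⟦n⟧)).injective
  have h := congrArg DerivedCategory.Qh.map hz
  rw [Functor.map_comp, Functor.map_zero] at h
  have := isIso_Qh_map_quotient f
  rw [Functor.map_zero]
  exact (cancel_epi (DerivedCategory.Qh.map
    ((HomotopyCategory.quotient 𝒞 (ComplexShape.up ℤ)).map f))).1 (h.trans Limits.comp_zero.symm)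

lemma exists_precomp_sub_mem_coboundaries [L.IsKInjective] (f : K ⟶ K') [QuasiIso f]
    (z : Cocycle K L n) : ∃ w : Cocycle K' L n,
      w.precomp f - z ∈ CochainComplex.HomComplex.coboundaries K L n := by
  let := HasDerivedCategory.standard 𝒞
  have := isIso_Qh_map_quotient f
  obtain ⟨φ, hφ⟩ := (CochainComplex.IsKInjective.Qh_map_bijective _ (L⟦n⟧)).surjective
    (inv (DerivedCategory.Qh.map ((HomotopyCategory.quotient 𝒞 (ComplexShape.up ℤ)).map f)) ≫
      DerivedCategory.Qh.map ((HomotopyCategory.quotient 𝒞 _).map (Cocycle.equivHomShift.symm z)))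
  obtain ⟨φ, rfl⟩ := Functor.map_surjective _ φ
  refine ⟨Cocycle.equivHomShift φ, ?_⟩
  rw [← CohomologyClass.toHom_mk_eq_zero_iff, CohomologyClass.mk_sub, map_sub, sub_eq_zero,
    CohomologyClass.toHom_mk, CohomologyClass.toHom_mk]
  apply (CochainComplex.IsKInjective.Qh_map_bijective _ (L⟦n⟧)).injective
  rw [Cocycle.equivHomShift_symm_precomp, Functor.map_comp, Functor.map_comp,
    AddEquiv.symm_apply_apply, hφ, IsIso.hom_inv_id_assoc]

end DerivedHom


/-! ### Relative traces and projectivity (Higman's criterion). -/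

section RelativeTrace

variable {F : Type*} [Field F] {G : Type*} [Group G] {V : Type*} [AddCommGroup V] [Module F V]

/-- A linear endomorphism whose relative trace from the trivial group to `G` is the identity. -/
def IsTraceSplitting [Fintype G] (ρ : Representation F G V) (τ : V →ₗ[F] V) : Prop :=
  ∀ x, ∑ g : G, ρ g (τ (ρ g⁻¹ x)) = x

/-- Choose a section `s` of the canonical map from the free module on the underlying set. The map
`τ` keeps only the coefficients of `s x` at the identity element, and the translates by all `g`
recover the other coefficients. -/
lemma exists_isTraceSplitting [Fintype G] (ρ : Representation F G V)
    [h : Module.Projective (MonoidAlgebra F G) ρ.asModule] :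
    ∃ τ, IsTraceSplitting ρ τ := by
  obtain ⟨s, hs⟩ := Module.projective_def.1 h
  let c : MonoidAlgebra F G →ₗ[F] F :=
    { toFun := fun a => a.coeff 1, map_add' := fun _ _ => rfl, map_smul' := fun _ _ => rfl }
  let τ : ρ.asModule →ₗ[F] ρ.asModule :=
    Finsupp.linearCombination F id ∘ₗ Finsupp.mapRange.linearMap c ∘ₗ s.restrictScalars F
  -- The coefficient of g⁻¹a at 1 is the coefficient of a at g.
  have key (x : ρ.asModule) (g : G) : τ (MonoidAlgebra.single g⁻¹ (1 : F) • x) =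
      (s x).sum fun v a => a.coeff g • v := by
    change Finsupp.linearCombination F id (Finsupp.mapRange c (map_zero c) (s _)) = _
    rw [map_smul, Finsupp.linearCombination_apply, Finsupp.sum_mapRange_index (by simp),
      Finsupp.sum_smul_index' (by simp)]
    refine Finsupp.sum_congr fun v _ => ?_
    have : c (MonoidAlgebra.single g⁻¹ (1 : F) • (s x) v) = ((s x) v).coeff g := by
      change (MonoidAlgebra.single g⁻¹ (1 : F) * (s x) v).coeff 1 = _
      simp
    rw [this]; rfl
  let e := ρ.asModuleEquiv
  have he (g : G) (v : ρ.asModule) : ρ g (e v) = e (MonoidAlgebra.single g (1 : F) • v) := by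
    rw [Representation.asModuleEquiv_map_smul, Representation.asAlgebraHom_single, one_smul]
  have main (x : ρ.asModule) :
      ∑ g : G, MonoidAlgebra.single g (1 : F) • τ (MonoidAlgebra.single g⁻¹ (1 : F) • x) = x := by
    simp_rw [key, Finsupp.smul_sum, Finsupp.sum]
    rw [Finset.sum_comm]
    refine Eq.trans (Finset.sum_congr rfl fun v _ => ?_) (hs x)
    simp_rw [smul_comm (MonoidAlgebra.single _ (1 : F)) (MonoidAlgebra.coeff _ _), ← smul_assoc,
      ← Finset.sum_smul, MonoidAlgebra.smul_single, smul_eq_mul, mul_one]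
    congr 1
    refine MonoidAlgebra.ext (Finsupp.ext fun g => ?_)
    simp [MonoidAlgebra.coeff_sum]
  refine ⟨e.toLinearMap ∘ₗ τ ∘ₗ e.symm.toLinearMap, fun x => ?_⟩
  obtain ⟨x, rfl⟩ := e.surjective x
  simp only [LinearMap.comp_apply, LinearEquiv.coe_coe, he, LinearEquiv.symm_apply_apply,
    ← map_sum, main]

/-- Sum the conjugates of τ over a transversal T; since G = PT, the trace over P of this sum is the
trace of τ over G. -/
lemma IsTraceSplitting.exists_subgroup [Fintype G] {ρ : Representation F G V} {τ : V →ₗ[F] V}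
    (h : IsTraceSplitting ρ τ) (P : Subgroup G) [Fintype P] :
    ∃ σ, IsTraceSplitting (ρ.comp P.subtype) σ := by
  obtain ⟨T, hT, -⟩ := P.exists_isComplement_right 1
  have : Fintype T := Fintype.ofFinite _
  refine ⟨∑ t : T, ρ (t : G) ∘ₗ τ ∘ₗ ρ (t : G)⁻¹, fun x => ?_⟩
  refine Eq.trans ?_ (h x)
  rw [← Function.Bijective.sum_comp hT, Fintype.sum_prod_type]
  refine Finset.sum_congr rfl fun p _ => ?_
  simp only [LinearMap.sum_apply, map_sum]
  refine Finset.sum_congr rfl fun q _ => ?_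
  simp [Module.End.mul_apply]

lemma IsTraceSplitting.eq_sum_of_fixed [Fintype G] {ρ : Representation F G V} {τ : V →ₗ[F] V}
    (h : IsTraceSplitting ρ τ) {x : V} (hx : ∀ g, ρ g x = x) : ∑ g : G, ρ g (τ x) = x := by
  simpa only [hx] using h x

/-- The derivation along `χ : G → F` built from a trace splitting. -/
def derivation [Fintype G] (ρ : Representation F G V) (τ : V →ₗ[F] V) (χ : G → F) : V →ₗ[F] V :=
  ∑ g : G, χ g • (ρ g ∘ₗ τ ∘ₗ ρ g⁻¹)

/-- Translating the summation index by `g` replaces χ(p) by χ(g) + χ(p), and the extra term is χ(g)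
times the full trace of τ, the identity. So the failure of equivariance is exactly χ; this is where
the degree-one classes come from. -/
lemma IsTraceSplitting.derivation_apply [Fintype G] {ρ : Representation F G V} {τ : V →ₗ[F] V}
    (h : IsTraceSplitting ρ τ) {χ : G → F} (hχ : ∀ p q, χ (p * q) = χ p + χ q) (g : G) (x : V) :
    derivation ρ τ χ (ρ g x) = ρ g (derivation ρ τ χ x) + χ g • ρ g x := by
  have hx : ρ g x = ∑ p : G, ρ g (ρ p (τ (ρ p⁻¹ x))) := by rw [← map_sum, h x]
  rw [derivation, LinearMap.sum_apply, LinearMap.sum_apply, map_sum, ← Equiv.sum_comp (Equiv.mulLeft g)]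
  conv_rhs => rw [hx, Finset.smul_sum, ← Finset.sum_add_distrib]
  refine Finset.sum_congr rfl fun p _ => ?_
  simp only [Equiv.coe_mulLeft, LinearMap.smul_apply, LinearMap.comp_apply, mul_inv_rev, map_mul,
    Module.End.mul_apply, hχ, map_smul, Representation.inv_self_apply]
  rw [← add_smul, add_comm (χ g)]

end RelativeTrace

/-! ### Averaging linear maps. -/

section Average

variable {F : Type u} [Field F] {H : Type u} [Group H] [Fintype H] {X Y : Rep.{u} F H}

/-- The average of a linear map, as a morphism of representations. -/
def averageHom (f : X →ₗ[F] Y) : X ⟶ Y :=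
  Rep.ofHom ⟨∑ g : H, Y.ρ g ∘ₗ f ∘ₗ X.ρ g⁻¹, fun h => by
    ext x
    simp only [LinearMap.comp_apply, LinearMap.sum_apply, map_sum]
    rw [← Equiv.sum_comp (Equiv.mulLeft h)]
    simp [map_mul, Module.End.mul_apply]⟩

lemma averageHom_apply (f : X →ₗ[F] Y) (x : X) :
    (averageHom f).hom.toLinearMap x = ∑ g : H, Y.ρ g (f (X.ρ g⁻¹ x)) := by
  simp [averageHom]

/-- Apply τ, lift linearly and average: the result is equivariant, and the trace identity makes it a
lift of the given map. -/
lemma projective_of_isTraceSplitting {τ : X →ₗ[F] X} (h : IsTraceSplitting X.ρ τ) :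
    Projective X where
  factors {A B} f e he := by
    obtain ⟨s, hs⟩ := e.hom.toLinearMap.exists_rightInverse_of_surjective
      (LinearMap.range_eq_top.2 ((Rep.epi_iff_surjective e).1 he))
    refine ⟨averageHom (s ∘ₗ f.hom.toLinearMap ∘ₗ τ), Rep.hom_ext
      (Representation.IntertwiningMap.ext (LinearMap.ext fun x => ?_))⟩
    change e.hom.toLinearMap ((averageHom _).hom.toLinearMap x) = f.hom.toLinearMap x
    rw [averageHom_apply, map_sum]
    conv_rhs => rw [← h x, map_sum]
    refine Finset.sum_congr rfl fun g _ => ?_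
    refine (Rep.hom_comm_apply e g _).trans ((congrArg (B.ρ g) ?_).trans
      (Rep.hom_comm_apply f g _).symm)
    exact LinearMap.congr_fun hs _

/-- The same τ, used on the other side: extend linearly, apply τ, average. -/
lemma injective_of_isTraceSplitting {τ : X →ₗ[F] X} (h : IsTraceSplitting X.ρ τ) :
    Injective X where
  factors {A B} f i hi := by
    obtain ⟨r, hr⟩ := i.hom.toLinearMap.exists_leftInverse_of_injective
      (LinearMap.ker_eq_bot.2 ((Rep.mono_iff_injective i).1 hi))
    refine ⟨averageHom (τ ∘ₗ f.hom.toLinearMap ∘ₗ r), Rep.hom_ext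
      (Representation.IntertwiningMap.ext (LinearMap.ext fun x => ?_))⟩
    change (averageHom _).hom.toLinearMap (i.hom.toLinearMap x) = f.hom.toLinearMap x
    rw [averageHom_apply]
    conv_rhs => rw [← h (f.hom.toLinearMap x)]
    refine Finset.sum_congr rfl fun g _ => ?_
    refine congrArg (fun y => X.ρ g (τ y)) ?_
    refine (congrArg (fun y => f.hom.toLinearMap (r y)) (Rep.hom_comm_apply i g⁻¹ x).symm).trans ?_
    exact (congrArg f.hom.toLinearMap (LinearMap.congr_fun hr _)).trans (Rep.hom_comm_apply f g⁻¹ x)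

end Average


/-! ### Cohomology of complexes of representations in terms of elements. -/

section RepHomology

variable {F : Type u} [Field F] {G : Type u} [Group G]

lemma exists_preimage_of_exact {S : ShortComplex (Rep.{u} F G)} (hS : S.Exact) {x : S.X₂}
    (hx : S.g.hom.toLinearMap x = 0) : ∃ y, S.f.hom.toLinearMap y = x :=
  (ShortComplex.moduleCat_exact_iff (S.map (forget₂ (Rep.{u} F G) (ModuleCat.{u} F)))).1
    (hS.map _) x hx

/-- The differential of a complex of representations as a linear map. -/
abbrev dLin (K : CochainComplex (Rep.{u} F G) ℤ) (i j : ℤ) : K.X i →ₗ[F] K.X j :=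
  (K.d i j).hom.toLinearMap

variable (K L : CochainComplex (Rep.{u} F G) ℤ)

lemma dLin_dLin (i j k : ℤ) (x : K.X i) : dLin K j k (dLin K i j x) = 0 := by
  have := congrArg (fun f => f.hom.toLinearMap x) (K.d_comp_d i j k)
  exact this

lemma dLin_rho (i j : ℤ) (g : G) (x : K.X i) :
    dLin K i j ((K.X i).ρ g x) = (K.X j).ρ g (dLin K i j x) :=
  Rep.hom_comm_apply (K.d i j) g x

lemma homologyπ_surjective (n : ℤ) : Function.Surjective (K.homologyπ n).hom.toLinearMap :=
  (Rep.epi_iff_surjective _).1 inferInstance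

lemma iCycles_injective (n : ℤ) : Function.Injective (K.iCycles n).hom.toLinearMap :=
  (Rep.mono_iff_injective _).1 inferInstance

lemma dLin_iCycles (n j : ℤ) (z : K.cycles n) :
    dLin K n j ((K.iCycles n).hom.toLinearMap z) = 0 :=
  congrArg (fun f => f.hom.toLinearMap z) (K.iCycles_d n j)

lemma exists_cycle {n j : ℤ} (hj : n + 1 = j) {x : K.X n} (hx : dLin K n j x = 0) :
    ∃ z, (K.iCycles n).hom.toLinearMap z = x := by
  have hS : (ShortComplex.mk (K.iCycles n) (K.d n j) (K.iCycles_d n j)).Exact :=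
    ShortComplex.exact_of_f_is_kernel _ (K.cyclesIsKernel n j (by simp [← hj]))
  exact exists_preimage_of_exact hS hx

lemma homologyπ_eq_zero_iff {i n : ℤ} (hi : i + 1 = n) (z : K.cycles n) :
    (K.homologyπ n).hom.toLinearMap z = 0 ↔
      ∃ y, dLin K i n y = (K.iCycles n).hom.toLinearMap z := by
  have hS : (ShortComplex.mk (K.toCycles i n) (K.homologyπ n) (by simp)).Exact :=
    ShortComplex.exact_of_g_is_cokernel _ (K.homologyIsCokernel i n (by simp [← hi]))
  have hd (y : K.X i) : (K.iCycles n).hom.toLinearMap ((K.toCycles i n).hom.toLinearMap y) =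
      dLin K i n y := congrArg (fun f => f.hom.toLinearMap y) (K.toCycles_i i n)
  constructor
  · intro h
    obtain ⟨y, hy⟩ := exists_preimage_of_exact hS h
    exact ⟨y, (hd y).symm.trans (congrArg _ hy)⟩
  · rintro ⟨y, hy⟩
    rw [← hd] at hy
    rw [← iCycles_injective K n hy]
    exact congrArg (fun f => f.hom.toLinearMap y) (K.toCycles_comp_homologyπ i n)

variable {K L}

lemma exists_dLin_eq_of_quasiIso (f : K ⟶ L) [QuasiIso f] {i n j : ℤ} (hi : i + 1 = n)
    (hj : n + 1 = j) {x : K.X n} (hx : dLin K n j x = 0) {y : L.X i}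
    (hy : dLin L i n y = (f.f n).hom.toLinearMap x) : ∃ w, dLin K i n w = x := by
  obtain ⟨z, rfl⟩ := exists_cycle K hj hx
  refine (homologyπ_eq_zero_iff K hi z).1 ?_
  have h1 : (HomologicalComplex.homologyMap f n).hom.toLinearMap
      ((K.homologyπ n).hom.toLinearMap z) = 0 := by
    refine (congrArg (fun f => f.hom.toLinearMap z)
      (HomologicalComplex.homologyπ_naturality f n)).trans ?_
    refine (homologyπ_eq_zero_iff L hi _).2 ⟨y, hy.trans ?_⟩
    exact (congrArg (fun f => f.hom.toLinearMap z) (HomologicalComplex.cyclesMap_i f n)).symm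
  have h2 : Mono (HomologicalComplex.homologyMap f n) := inferInstance
  exact (Rep.mono_iff_injective _).1 h2 (h1.trans (map_zero _).symm)

lemma exists_add_dLin_eq_of_quasiIso (f : K ⟶ L) [QuasiIso f] {i n j : ℤ} (hi : i + 1 = n)
    (hj : n + 1 = j) {y : L.X n} (hy : dLin L n j y = 0) :
    ∃ x w, dLin K n j x = 0 ∧ dLin L i n w = y - (f.f n).hom.toLinearMap x := by
  obtain ⟨z, rfl⟩ := exists_cycle L hj hy
  have h2 : Epi (HomologicalComplex.homologyMap f n) := inferInstance
  obtain ⟨h, hh⟩ := (Rep.epi_iff_surjective _).1 h2 ((L.homologyπ n).hom.toLinearMap z)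
  obtain ⟨z', rfl⟩ := homologyπ_surjective K n h
  have h3 := congrArg (fun f => f.hom.toLinearMap z') (HomologicalComplex.homologyπ_naturality f n)
  have h4 := h3.symm.trans hh
  have h5 : (L.homologyπ n).hom.toLinearMap
      (z - (HomologicalComplex.cyclesMap f n).hom.toLinearMap z') = 0 := by
    rw [map_sub, sub_eq_zero]; exact h4.symm
  obtain ⟨w, hw⟩ := (homologyπ_eq_zero_iff L hi _).1 h5
  refine ⟨(K.iCycles n).hom.toLinearMap z', w, dLin_iCycles K n j z', hw.trans ?_⟩
  rw [map_sub]
  exact congrArg (_ - ·) (congrArg (fun f => f.hom.toLinearMap z') (HomologicalComplex.cyclesMap_i f n))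

end RepHomology


set_option linter.unusedSectionVars false

/-! ### The Klein four-group and the operators λ_0, λ_1 in characteristic two. -/

section Klein

variable (H : Type u) [Group H] [IsKleinFour H]

/-- An identification of a Klein four-group with `ℤ/2 × ℤ/2`. -/
def kleinEquiv : H ≃* Multiplicative (ZMod 2 × ZMod 2) :=
  Classical.choice IsKleinFour.nonempty_mulEquiv

variable {H}

/-- The coordinates of an element of a Klein four-group. -/
def coord (i : Fin 2) (p : H) : ZMod 2 :=
  ![(kleinEquiv H p).toAdd.1, (kleinEquiv H p).toAdd.2] i

variable (H) in
/-- The generators of a Klein four-group dual to `coord`. -/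
def gen (i : Fin 2) : H :=
  (kleinEquiv H).symm (Multiplicative.ofAdd (![(1, 0), (0, 1)] i))

lemma coord_mul (i : Fin 2) (p q : H) : coord i (p * q) = coord i p + coord i q := by
  fin_cases i <;> simp [coord]

lemma coord_gen (i j : Fin 2) : coord i (gen H j) = if i = j then 1 else 0 := by
  fin_cases i <;> fin_cases j <;> simp [coord, gen]

lemma coord_ext {p q : H} (h : ∀ i, coord i p = coord i q) : p = q := by
  apply (kleinEquiv H).injective
  exact Multiplicative.toAdd.injective (Prod.ext (h 0) (h 1))

lemma coord_one (i : Fin 2) : coord i (1 : H) = 0 := by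
  fin_cases i <;> simp [coord]

lemma klein_cases (p : H) : p = 1 ∨ p = gen H 0 ∨ p = gen H 1 ∨ p = gen H 0 * gen H 1 := by
  have h2 : ∀ a b : ZMod 2, (a = 0 ∧ b = 0) ∨ (a = 1 ∧ b = 0) ∨ (a = 0 ∧ b = 1) ∨ (a = 1 ∧ b = 1) := by
    decide
  rcases h2 (coord 0 p) (coord 1 p) with ⟨h0, h1⟩ | ⟨h0, h1⟩ | ⟨h0, h1⟩ | ⟨h0, h1⟩
  · exact Or.inl (coord_ext fun i => by fin_cases i <;> simp [h0, h1, coord_one])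
  · exact Or.inr (Or.inl (coord_ext fun i => by fin_cases i <;> simp [h0, h1, coord_gen]))
  · exact Or.inr (Or.inr (Or.inl (coord_ext fun i => by fin_cases i <;> simp [h0, h1, coord_gen])))
  · exact Or.inr (Or.inr (Or.inr (coord_ext fun i => by
      fin_cases i <;> simp [h0, h1, coord_gen, coord_mul])))

lemma klein_sum {M : Type*} [AddCommMonoid M] [Fintype H] (f : H → M) :
    ∑ p, f p = f 1 + f (gen H 0) + f (gen H 1) + f (gen H 0 * gen H 1) := by
  have h : ∑ p, f p = ∑ x : ZMod 2 × ZMod 2, f ((kleinEquiv H).symm (Multiplicative.ofAdd x)) :=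
    ((Multiplicative.ofAdd.trans (kleinEquiv H).symm.toEquiv).sum_comp f).symm
  rw [h, Fintype.sum_prod_type]
  have h2 (g : ZMod 2 → M) : ∑ x, g x = g 0 + g 1 := Fin.sum_univ_two g
  have h3 : gen H 0 * gen H 1 = (kleinEquiv H).symm (Multiplicative.ofAdd (1, 1)) := by
    rw [gen, gen, ← map_mul, ← ofAdd_add]; rfl
  rw [h2, h2, h2, h3, show Multiplicative.ofAdd ((0 : ZMod 2), (0 : ZMod 2)) = 1 from rfl, map_one,
    ← add_assoc, add_right_comm (f 1)]
  rfl

variable (F : Type*) [Field F] [CharP F 2]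

/-- The coordinates of an element of a Klein four-group, in a field of characteristic two. -/
def chi (i : Fin 2) (p : H) : F := ZMod.castHom (dvd_refl 2) F (coord i p)

lemma chi_mul (i : Fin 2) (p q : H) : chi F i (p * q) = chi F i p + chi F i q := by
  simp only [chi, coord_mul, map_add]

lemma chi_gen (i j : Fin 2) : chi F i (gen H j) = if i = j then 1 else 0 := by
  simp only [chi, coord_gen]; split_ifs <;> simp

lemma chi_one (i : Fin 2) : chi F i (1 : H) = 0 := by simp only [chi, coord_one, map_zero]

lemma add_self_of_charTwo {V : Type*} [AddCommGroup V] [Module F V] (v : V) : v + v = 0 := by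
  rw [← two_smul F v, CharTwo.two_eq_zero, zero_smul]

lemma neg_eq_of_charTwo {V : Type*} [AddCommGroup V] [Module F V] (v : V) : -v = v :=
  neg_eq_of_add_eq_zero_left (add_self_of_charTwo F v)

lemma sub_eq_add_of_charTwo {V : Type*} [AddCommGroup V] [Module F V] (v w : V) : v - w = v + w := by
  rw [sub_eq_add_neg, neg_eq_of_charTwo F]

lemma add_eq_zero_iff_of_charTwo {V : Type*} [AddCommGroup V] [Module F V] (v w : V) :
    v + w = 0 ↔ v = w := by
  rw [← sub_eq_add_of_charTwo F, sub_eq_zero]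

variable {F} {V W : Type*} [AddCommGroup V] [Module F V] [AddCommGroup W] [Module F W]
  (ρ : Representation F H V)

/-- The action of `g - 1`, for a generator `g` of a Klein four-group, in characteristic two. -/
def lam (i : Fin 2) : V →ₗ[F] V := ρ (gen H i) + LinearMap.id

lemma lam_apply (i : Fin 2) (x : V) : lam ρ i x = ρ (gen H i) x + x := rfl

lemma gen_mul_self (i : Fin 2) : gen H i * gen H i = 1 := IsKleinFour.mul_self _

lemma gen_comm : gen H 1 * gen H 0 = gen H 0 * gen H 1 :=
  coord_ext fun i => by rw [coord_mul, coord_mul, add_comm]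

lemma lam_lam_self (i : Fin 2) (x : V) : lam ρ i (lam ρ i x) = 0 := by
  simp only [lam_apply, map_add]
  rw [← Module.End.mul_apply, ← map_mul, gen_mul_self, map_one, Module.End.one_apply,
    add_comm x, add_self_of_charTwo F]

lemma lam_comm (x : V) : lam ρ 1 (lam ρ 0 x) = lam ρ 0 (lam ρ 1 x) := by
  simp only [lam_apply, map_add]
  rw [← Module.End.mul_apply, ← map_mul, gen_comm, map_mul, Module.End.mul_apply]
  abel

/-- Write p = g_0^a g_1^b with g_i = 1 + λ_i and expand (1 + λ_0)^a (1 + λ_1)^b. This reduces every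
question about P to the two operators λ_i. -/
lemma rho_eq (p : H) (x : V) : ρ p x = x + chi F 0 p • lam ρ 0 x + chi F 1 p • lam ρ 1 x +
    (chi F 0 p * chi F 1 p) • lam ρ 0 (lam ρ 1 x) := by
  have h (v w : V) : v = w + (v + w) := by
    rw [add_comm v, ← add_assoc, add_self_of_charTwo F, zero_add]
  rcases klein_cases p with rfl | rfl | rfl | rfl
  · simp [chi_one]
  · simpa [chi_gen, lam_apply] using h _ _
  · simpa [chi_gen, lam_apply] using h _ _
  · simp only [chi_mul, chi_gen, lam_apply, map_add, map_mul, Module.End.mul_apply]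
    have h1 := add_self_of_charTwo F (ρ (gen H 0) x)
    have h2 := add_self_of_charTwo F (ρ (gen H 1) x)
    have h3 := add_self_of_charTwo F x
    simp only [if_true, if_false, zero_ne_one, one_ne_zero, add_zero, zero_add, one_smul, one_mul]
    generalize ρ (gen H 0) (ρ (gen H 1) x) = a at *
    generalize ρ (gen H 0) x = b at *
    generalize ρ (gen H 1) x = c at *
    linear_combination (norm := module) (-1 : F) • h1 + (-1 : F) • h2 + (-2 : F) • h3

lemma sum_rho [Fintype H] (x : V) : ∑ p, ρ p x = lam ρ 0 (lam ρ 1 x) := by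
  rw [klein_sum]
  simp only [lam_apply, map_add, map_one, map_mul, Module.End.mul_apply, Module.End.one_apply]
  abel

lemma fixed_iff (x : V) : (∀ p, ρ p x = x) ↔ ∀ i, lam ρ i x = 0 := by
  constructor
  · intro h i; rw [lam_apply, h, add_self_of_charTwo F]
  · intro h p; simp [rho_eq ρ p x, h]

lemma comp_rho_iff (f : V →ₗ[F] W) : (∀ p x, f (ρ p x) = f x) ↔ ∀ i x, f (lam ρ i x) = 0 := by
  constructor
  · intro h i x; rw [lam_apply, map_add, h, add_self_of_charTwo F]
  · intro h p x; simp [rho_eq ρ p x, h]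

lemma lam_intertwining {ρ : Representation F H V} {σ : Representation F H W} {f : V →ₗ[F] W}
    (hf : ∀ p x, f (ρ p x) = σ p (f x)) (i : Fin 2) (x : V) : f (lam ρ i x) = lam σ i (f x) := by
  rw [lam_apply, lam_apply, map_add, hf]

lemma intertwining_of_lam {ρ : Representation F H V} {σ : Representation F H W} {f : V →ₗ[F] W}
    (hf : ∀ i x, f (lam ρ i x) = lam σ i (f x)) (p : H) (x : V) : f (ρ p x) = σ p (f x) := by
  simp [rho_eq ρ p x, rho_eq σ p (f x), hf]

/-- On a fixed vector the trace identity reads x = Σ p(τ x), and the sum over P is λ_0λ_1. -/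
lemma IsTraceSplitting.exists_lam_lam_eq [Fintype H] {ρ : Representation F H V} {τ : V →ₗ[F] V}
    (h : IsTraceSplitting ρ τ) {x : V} (hx : ∀ i, lam ρ i x = 0) :
    ∃ v, lam ρ 0 (lam ρ 1 v) = x :=
  ⟨τ x, by rw [← sum_rho]; exact h.eq_sum_of_fixed ((fixed_iff ρ x).2 hx)⟩

/-- A functional with prescribed values on the image of the norm. -/
lemma IsTraceSplitting.comp_lam_lam [Fintype H] {ρ : Representation F H V} {τ : V →ₗ[F] V}
    (h : IsTraceSplitting ρ τ) {f : V →ₗ[F] W} (hf : ∀ i x, f (lam ρ i x) = 0) (x : V) :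
    f (τ (lam ρ 0 (lam ρ 1 x))) = f x := by
  rw [← sum_rho, map_sum, map_sum]
  conv_rhs => rw [← h x, map_sum]
  rw [← Equiv.sum_comp (Equiv.inv H)]
  refine Finset.sum_congr rfl fun p _ => ?_
  rw [(comp_rho_iff ρ f).2 hf, Equiv.inv_apply]

end Klein


/-! ### The augmentation of a projective resolution. -/

section Augmentation

variable {F : Type u} [Field F] {G : Type u} [Group G]

variable (F G) in
/-- The trivial module, as a complex concentrated in degree zero. -/
abbrev trivCx : CochainComplex (Rep.{u} F G) ℤ :=
  (HomologicalComplex.single (Rep.{u} F G) (ComplexShape.up ℤ) 0).obj (Rep.trivial F G F)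

variable {E : CochainComplex (Rep.{u} F G) ℤ}

/-- The linear form underlying an augmentation. -/
def aug (η : E ⟶ trivCx F G) : E.X 0 →ₗ[F] F :=
  (η.f 0 ≫ (HomologicalComplex.singleObjXSelf (ComplexShape.up ℤ) 0
    (Rep.trivial F G F)).hom).hom.toLinearMap

variable (η : E ⟶ trivCx F G)

lemma aug_rho (g : G) (x : E.X 0) : aug η ((E.X 0).ρ g x) = aug η x :=
  Rep.hom_comm_apply (η.f 0 ≫ (HomologicalComplex.singleObjXSelf (ComplexShape.up ℤ) 0
    (Rep.trivial F G F)).hom) g x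

lemma aug_dLin (i : ℤ) (x : E.X i) : aug η (dLin E i 0 x) = 0 := by
  have h : E.d i 0 ≫ η.f 0 ≫ (HomologicalComplex.singleObjXSelf (ComplexShape.up ℤ) 0
      (Rep.trivial F G F)).hom = 0 := by
    rw [← Category.assoc, ← η.comm, HomologicalComplex.single_obj_d, Limits.comp_zero,
      Limits.zero_comp]
  exact congrArg (fun f => f.hom.toLinearMap x) h

lemma aug_eq_zero_iff (x : E.X 0) : aug η x = 0 ↔ (η.f 0).hom.toLinearMap x = 0 := by
  have h := (Rep.mono_iff_injective (HomologicalComplex.singleObjXSelf (ComplexShape.up ℤ) 0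
      (Rep.trivial F G F)).hom).1 inferInstance
  exact map_eq_zero_iff (HomologicalComplex.singleObjXSelf (ComplexShape.up ℤ) 0
      (Rep.trivial F G F)).hom.hom h

lemma subsingleton_trivCx {i : ℤ} (hi : i ≠ 0) : Subsingleton ((trivCx F G).X i) :=
  (Rep.isZero_iff _ _ _).1 (HomologicalComplex.isZero_single_obj_X _ _ _ _ hi)

variable {η}

lemma exists_dLin_eq_of_neg (hη : QuasiIso η) {i p j : ℤ} (hi : i + 1 = p) (hj : p + 1 = j)
    (hp : p < 0) {x : E.X p} (hx : dLin E p j x = 0) : ∃ w, dLin E i p w = x := by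
  have := subsingleton_trivCx (F := F) (G := G) hp.ne
  exact exists_dLin_eq_of_quasiIso η hi hj hx (y := 0) (Subsingleton.elim _ _)

lemma exists_dLin_eq_of_aug (hE : IsProjectiveResolution E) (hη : QuasiIso η) {i : ℤ}
    (hi : i + 1 = 0) {x : E.X 0} (hx : aug η x = 0) : ∃ w, dLin E i 0 w = x := by
  have h1 : Subsingleton (E.X 1) := (Rep.isZero_iff _ _ _).1 (hE.isZero 1 one_pos)
  refine exists_dLin_eq_of_quasiIso η hi (zero_add 1) (Subsingleton.elim _ _) (y := 0) ?_
  rw [map_zero, (aug_eq_zero_iff η x).1 hx]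

lemma exists_aug_eq_one (hη : QuasiIso η) : ∃ x, aug η x = 1 := by
  set e := HomologicalComplex.singleObjXSelf (ComplexShape.up ℤ) 0 (Rep.trivial F G F)
  have h1 := subsingleton_trivCx (F := F) (G := G) (i := 1) one_ne_zero
  have h2 := subsingleton_trivCx (F := F) (G := G) (i := -1) (by lia)
  obtain ⟨x, w, -, hw⟩ := exists_add_dLin_eq_of_quasiIso η (neg_add_cancel 1) (zero_add 1)
    (y := e.inv.hom.toLinearMap (1 : F)) (Subsingleton.elim _ _)
  rw [Subsingleton.elim w 0, map_zero] at hw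
  refine ⟨x, ?_⟩
  have h3 := congrArg e.hom.hom.toLinearMap (sub_eq_zero.1 hw.symm)
  exact h3.symm.trans (congrArg (fun f => f.hom.toLinearMap (1 : F)) e.inv_hom_id)

end Augmentation

/-! ### Restriction to P: K-projectivity of E and K-injectivity of C. -/

section Restriction

variable {F : Type u} [Field F] {G : Type u} [Group G] (P : Subgroup G)
  {E C : CochainComplex (Rep.{u} F G) ℤ}

instance (E : CochainComplex (Rep.{u} F G) ℤ) (d : ℤ) [E.IsStrictlyLE d] : (resCx P E).IsStrictlyLE d := by
  rw [CochainComplex.isStrictlyLE_iff]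
  exact fun i hi => (Rep.isZero_res_iff _ _).2 (E.isZero_of_isStrictlyLE d i hi)

instance (C : CochainComplex (Rep.{u} F G) ℤ) (d : ℤ) [C.IsStrictlyGE d] : (resCx P C).IsStrictlyGE d := by
  rw [CochainComplex.isStrictlyGE_iff]
  exact fun i hi => (Rep.isZero_res_iff _ _).2 (C.isZero_of_isStrictlyGE d i hi)

lemma exists_isTraceSplitting_subgroup [Finite G] [Fintype P] (X : Rep.{u} F G)
    (hX : Module.Projective (MonoidAlgebra F G) X.ρ.asModule) :
    ∃ τ, IsTraceSplitting (X.ρ.comp P.subtype) τ := by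
  have := Fintype.ofFinite G
  obtain ⟨τ, hτ⟩ := exists_isTraceSplitting X.ρ
  exact hτ.exists_subgroup P

lemma projective_res [Finite G] (X : Rep.{u} F G)
    (hX : Module.Projective (MonoidAlgebra F G) X.ρ.asModule) :
    Projective (Rep.res P.subtype X) := by
  have := Fintype.ofFinite P
  obtain ⟨τ, hτ⟩ := exists_isTraceSplitting_subgroup P X hX
  exact projective_of_isTraceSplitting (X := Rep.res P.subtype X) hτ

lemma injective_res [Finite G] (X : Rep.{u} F G)
    (hX : Module.Projective (MonoidAlgebra F G) X.ρ.asModule) :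
    Injective (Rep.res P.subtype X) := by
  have := Fintype.ofFinite P
  obtain ⟨τ, hτ⟩ := exists_isTraceSplitting_subgroup P X hX
  exact injective_of_isTraceSplitting (X := Rep.res P.subtype X) hτ

lemma IsProjectiveResolution.isKProjective_res [Finite G] (hE : IsProjectiveResolution E) :
    (resCx P E).IsKProjective := by
  have h1 : E.IsStrictlyLE 0 := by
    rw [CochainComplex.isStrictlyLE_iff]
    exact fun i hi => hE.isZero i hi
  have h2 (n : ℤ) : Projective ((resCx P E).X n) := projective_res P _ (hE.projective n)
  exact CochainComplex.isKProjective_of_projective _ 0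

lemma IsPerfect.isKInjective_res [Finite G] (hC : IsPerfect C) :
    (resCx P C).IsKInjective := by
  obtain ⟨a, b, hab⟩ := hC.bounded
  have h1 : C.IsStrictlyGE a := by
    rw [CochainComplex.isStrictlyGE_iff]
    exact fun i hi => hab i (Or.inl hi)
  have h2 (n : ℤ) : Injective ((resCx P C).X n) := injective_res P _ (hC.projective n)
  exact CochainComplex.isKInjective_of_injective _ a

variable (F) in
/-- The restriction of the trivial module, as a complex. -/
abbrev trivResCx : CochainComplex (Rep.{u} F P) ℤ :=
  (CochainComplex.singleFunctor (Rep.{u} F P) 0).obj (Rep.res P.subtype (Rep.trivial F G F))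

variable (F) in
/-- Restriction to a subgroup commutes with single complexes. -/
def trivResIso : resCx P (trivCx F G) ≅ trivResCx F P :=
  (HomologicalComplex.singleMapHomologicalComplex (Rep.resFunctor P.subtype)
    (ComplexShape.up ℤ) 0).app (Rep.trivial F G F)

variable (F) in
lemma trivResIso_hom_f_zero : (trivResIso F P).hom.f 0 =
    (Rep.resFunctor P.subtype).map (HomologicalComplex.singleObjXSelf
      (ComplexShape.up ℤ) 0 (Rep.trivial F G F)).hom ≫
      (HomologicalComplex.singleObjXSelf (ComplexShape.up ℤ) 0
        (Rep.res P.subtype (Rep.trivial F G F))).inv :=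
  HomologicalComplex.singleMapHomologicalComplex_hom_app_self (Rep.resFunctor P.subtype)
    (ComplexShape.up ℤ) 0 (Rep.trivial F G F)

/-- The augmentation of the restriction of a complex to a subgroup. -/
def augRes (η : E ⟶ trivCx F G) : resCx P E ⟶ trivResCx F P :=
  ((Rep.resFunctor P.subtype).mapHomologicalComplex _).map η ≫ (trivResIso F P).hom

instance (η : E ⟶ trivCx F G) [QuasiIso η] : QuasiIso (augRes P η) :=
  quasiIso_comp _ _

lemma augRes_f_zero (η : E ⟶ trivCx F G) :
    (augRes P η).f 0 = (Rep.resFunctor P.subtype).map (η.f 0 ≫ (HomologicalComplex.singleObjXSelf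
        (ComplexShape.up ℤ) 0 (Rep.trivial F G F)).hom) ≫
      (HomologicalComplex.singleObjXSelf (ComplexShape.up ℤ) 0
        (Rep.res P.subtype (Rep.trivial F G F))).inv := by
  rw [Functor.map_comp, Category.assoc, ← trivResIso_hom_f_zero]
  rfl

end Restriction


lemma comp_inv_comp_hom_comp {𝒞 : Type*} [Category 𝒞] {X Y Z W : 𝒞} (f : X ⟶ Y) (e : Z ≅ Y)
    (g : Y ⟶ W) : (f ≫ e.inv) ≫ e.hom ≫ g = f ≫ g := by simp

/-! ### Ext as the cohomology of the fixed points. -/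

section ConstantCochains

variable {F : Type u} [Field F] {G : Type u} [Group G] (P : Subgroup G)
  {E C : CochainComplex (Rep.{u} F G) ℤ} (η : E ⟶ trivCx F G)

/-- A linear map commuting with the action of `P`, as a morphism of restrictions. -/
def resHom {X Y : Rep.{u} F G} (f : X →ₗ[F] Y) (hf : ∀ (p : P) x, f (X.ρ p x) = Y.ρ p (f x)) :
    Rep.res P.subtype X ⟶ Rep.res P.subtype Y :=
  Rep.ofHom ⟨f, fun p => LinearMap.ext fun x => hf p x⟩

variable (C) in
/-- The cocycles of a complex that are fixed by `P`. -/
def fixedCocycles (n : ℤ) : Submodule F (C.X n) where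
  carrier := {c | (∀ p : P, (C.X n).ρ p c = c) ∧ dLin C n (n + 1) c = 0}
  zero_mem' := by simp
  add_mem' := by
    rintro a b ⟨ha, ha'⟩ ⟨hb, hb'⟩
    exact ⟨fun p => by rw [map_add, ha, hb], by rw [map_add, ha', hb', add_zero]⟩
  smul_mem' := by
    rintro r a ⟨ha, ha'⟩
    exact ⟨fun p => by rw [map_smul, ha], by rw [map_smul, ha', smul_zero]⟩

/-- The map `x ↦ ε(x) c`, for a vector `c` fixed by `P`. -/
def constHom {X : Rep.{u} F G} (c : X) (hc : ∀ p : P, X.ρ p c = c) :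
    Rep.res P.subtype (E.X 0) ⟶ Rep.res P.subtype X :=
  resHom P ((aug η).smulRight c) fun p x => by
    rw [LinearMap.smulRight_apply, LinearMap.smulRight_apply, aug_rho, map_smul, hc]

/-- The cochain `x ↦ ε(x) c`, for a vector `c` fixed by `P`. -/
def constCochain {n : ℤ} (c : C.X n) (hc : ∀ p : P, (C.X n).ρ p c = c) :
    Cochain (resCx P E) (resCx P C) n :=
  Cochain.single (K := resCx P E) (L := resCx P C) (p := 0) (q := n) (constHom P η c hc) n

variable {P}

lemma constCochain_v {n : ℤ} (c : C.X n) (hc : ∀ p : P, (C.X n).ρ p c = c) (h : 0 + n = n) :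
    (constCochain P η c hc).v 0 n h = constHom P η c hc :=
  Cochain.single_v (K := resCx P E) (L := resCx P C) _ _ _

lemma constCochain_v_ne {n : ℤ} (c : C.X n) (hc : ∀ p : P, (C.X n).ρ p c = c) {p q : ℤ}
    (h : p + n = q) (hp : p ≠ 0) : (constCochain P η c hc).v p q h = 0 :=
  Cochain.single_v_eq_zero (K := resCx P E) (L := resCx P C) _ _ _ _ _ hp

/-- The inclusion of a fixed vector. -/
def inclHom {X : Rep.{u} F G} (c : X) (hc : ∀ p : P, X.ρ p c = c) :
    Rep.res P.subtype (Rep.trivial F G F) ⟶ Rep.res P.subtype X :=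
  resHom P (LinearMap.toSpanSingleton F X c) fun p x => by
    rw [LinearMap.toSpanSingleton_apply, LinearMap.toSpanSingleton_apply, map_smul, hc]
    rfl

/-- Factoring through E → F makes these cochains images of cocycles on a complex concentrated in one
degree. -/
lemma constCochain_eq {n : ℤ} (c : C.X n) (hc : ∀ p : P, (C.X n).ρ p c = c) :
    constCochain P η c hc = (Cochain.ofHom (augRes P η)).comp
      (Cochain.fromSingleMk (K := resCx P C) (inclHom c hc) (zero_add n)) (zero_add n) := by
  refine Cochain.ext _ _ fun p q hpq => ?_
  refine Eq.trans ?_ (Cochain.comp_v (Cochain.ofHom (augRes P η)) _ (zero_add n) p p q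
    (by lia) hpq).symm
  by_cases hp : p = 0
  · subst hp
    obtain rfl : q = n := by lia
    have h1 := Cochain.fromSingleMk_v (K := resCx P C) (p := 0) (q := q) (inclHom c hc) (zero_add q)
    rw [constCochain_v]
    refine Eq.trans ?_ (congrArg₂ (· ≫ ·) ((Cochain.ofHom_v (augRes P η) 0).trans
      (augRes_f_zero P η)).symm h1.symm)
    exact (comp_inv_comp_hom_comp ((Rep.resFunctor P.subtype).map (η.f 0 ≫
      (HomologicalComplex.singleObjXSelf (ComplexShape.up ℤ) 0 (Rep.trivial F G F)).hom))
      (HomologicalComplex.singleObjXSelf (ComplexShape.up ℤ) 0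
        (Rep.res P.subtype (Rep.trivial F G F))) (inclHom c hc)).symm
  · have h1 := Cochain.fromSingleMk_v_eq_zero (K := resCx P C) (inclHom c hc) (zero_add n) p q hpq hp
    refine (constCochain_v_ne η c hc hpq hp).trans (Eq.trans ?_ (congrArg (_ ≫ ·) h1).symm)
    exact Limits.comp_zero.symm

lemma inclHom_comp_d {n n' : ℤ} {c : C.X n} (hc : ∀ p : P, (C.X n).ρ p c = c)
    (hd : dLin C n n' c = 0) :
    inclHom c hc ≫ (resCx P C).d n n' = 0 := by
  refine hom_eq fun x => ?_
  change dLin C n n' ((x : F) • c) = 0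
  rw [map_smul, hd, smul_zero]

variable (P) in
/-- The cocycles of the Hom complex given by the fixed cocycles. -/
def fixedCocycle (n : ℤ) :
    fixedCocycles P C n →ₗ[F] cocycles F (resCx P E) (resCx P C) n where
  toFun := fun c => ⟨constCochain P η c.1 c.2.1, by
        rw [mem_cocycles, constCochain_eq]
        exact ((Cocycle.fromSingleMk (K := resCx P C) (inclHom c.1 c.2.1) (zero_add n) (n + 1)
          rfl (inclHom_comp_d c.2.1 c.2.2)).precomp (augRes P η)).δ_eq_zero (n + 1)⟩
  map_add' := fun a b => by
        refine Subtype.ext (Cochain.ext _ _ fun p q hpq => ?_)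
        by_cases hp : p = 0
        · subst hp
          obtain rfl : q = n := by lia
          change (constCochain P η (a.1 + b.1) _).v 0 q hpq = (constCochain P η a.1 _).v 0 q hpq +
            (constCochain P η b.1 _).v 0 q hpq
          rw [constCochain_v, constCochain_v, constCochain_v]
          exact hom_eq fun x => smul_add _ _ _
        · change (constCochain P η (a.1 + b.1) _).v p q hpq = (constCochain P η a.1 _).v p q hpq +
            (constCochain P η b.1 _).v p q hpq
          rw [constCochain_v_ne _ _ _ _ hp, constCochain_v_ne _ _ _ _ hp,
            constCochain_v_ne _ _ _ _ hp, add_zero]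
  map_smul' := fun r a => by
        refine Subtype.ext (Cochain.ext _ _ fun p q hpq => ?_)
        by_cases hp : p = 0
        · subst hp
          obtain rfl : q = n := by lia
          change (constCochain P η (r • a.1) _).v 0 q hpq = r • (constCochain P η a.1 _).v 0 q hpq
          rw [constCochain_v, constCochain_v]
          exact hom_eq fun x => smul_comm _ _ _
        · change (constCochain P η (r • a.1) _).v p q hpq = r • (constCochain P η a.1 _).v p q hpq
          rw [constCochain_v_ne _ _ _ _ hp, constCochain_v_ne _ _ _ _ hp, smul_zero]

variable (P) in
/-- The classes in `Extⁿ` given by the fixed cocycles. -/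
def fixedClass (n : ℤ) : fixedCocycles P C n →ₗ[F] ExtP P E C n :=
  HomCoh.mk F _ _ n ∘ₗ fixedCocycle P η n

/-- As C is K-injective over P, precomposition with E → F loses no information, and a primitive in
Hom(F, C) is the same as a fixed vector. With `fixedClass_surjective` this computes Ext as the
cohomology of the fixed points. -/
lemma fixedClass_eq_zero_iff [QuasiIso η] [(resCx P C).IsKInjective] {n n' : ℤ} (hn : n' + 1 = n)
    (c : fixedCocycles P C n) : fixedClass P η n c = 0 ↔
      ∃ b : C.X n', (∀ p : P, (C.X n').ρ p b = b) ∧ dLin C n' n b = c.1 := by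
  obtain rfl : n' = n - 1 := by lia
  have hz : fixedClass P η n c = 0 ↔ ∃ w, δ (n - 1) n w = constCochain P η c.1 c.2.1 :=
    HomCoh.mk_eq_zero _
  let z := Cocycle.fromSingleMk (K := resCx P C) (inclHom c.1 c.2.1) (zero_add n) (n + 1)
          rfl (inclHom_comp_d c.2.1 c.2.2)
  have h1 : fixedClass P η n c = 0 ↔
      z ∈ CochainComplex.HomComplex.coboundaries (trivResCx F P) (resCx P C) n := by
    rw [hz]
    constructor
    · rintro ⟨w, hw⟩
      refine mem_coboundaries_of_precomp (augRes P η) z ?_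
      rw [mem_coboundaries_iff _ (n - 1) (by lia)]
      exact ⟨w, hw.trans (constCochain_eq η c.1 c.2.1)⟩
    · intro h
      rw [mem_coboundaries_iff _ (n - 1) (by lia)] at h
      obtain ⟨β, hβ⟩ := h
      refine ⟨(Cochain.ofHom (augRes P η)).comp β (zero_add _), ?_⟩
      rw [δ_ofHom_comp, hβ, constCochain_eq]
      rfl
  refine h1.trans ((Cocycle.fromSingleMk_mem_coboundaries_iff (K := resCx P C) _ _ _ _ _ (n - 1)
    (by lia)).trans ?_)
  constructor
  · rintro ⟨g, hg⟩
    refine ⟨g.hom.toLinearMap (1 : F), fun p => (Rep.hom_comm_apply g p (1 : F)).symm, ?_⟩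
    refine (congrArg (fun f => f.hom.toLinearMap (1 : F)) hg).trans ?_
    exact one_smul F c.1
  · rintro ⟨b, hb, hd⟩
    refine ⟨inclHom b hb, hom_eq fun x => ?_⟩
    change dLin C (n - 1) n ((x : F) • b) = (x : F) • c.1
    rw [map_smul, hd]

lemma fixedClass_surjective [QuasiIso η] [(resCx P C).IsKInjective] (n : ℤ) :
    Function.Surjective (fixedClass (C := C) P η n) := by
  intro x
  obtain ⟨⟨z, hz⟩, rfl⟩ := HomCoh.mk_surjective n x
  obtain ⟨w, hw⟩ := exists_precomp_sub_mem_coboundaries (augRes P η) (Cocycle.mk z (n + 1) rfl hz)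
  obtain ⟨f, hf, rfl⟩ := Cocycle.fromSingleMk_surjective w n (zero_add n) (n + 1) rfl
  have hf1 (p : P) : (C.X n).ρ p (f.hom.toLinearMap (1 : F)) = f.hom.toLinearMap (1 : F) :=
    (Rep.hom_comm_apply f p (1 : F)).symm
  have hf2 : f = inclHom (P := P) (X := C.X n) (f.hom.toLinearMap (1 : F)) hf1 :=
    hom_eq (X := Rep.trivial F G F) (Y := C.X n) fun x => by
      change f.hom.toLinearMap (x : F) = (x : F) • f.hom.toLinearMap (1 : F)
      rw [← map_smul]
      exact congrArg f.hom.toLinearMap (mul_one (x : F)).symm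
  refine ⟨⟨f.hom.toLinearMap (1 : F), hf1, ?_⟩, ?_⟩
  · exact congrArg (fun f => f.hom.toLinearMap (1 : F)) hf
  · rw [← sub_eq_zero, fixedClass, LinearMap.comp_apply, ← map_sub, HomCoh.mk_eq_zero]
    rw [mem_coboundaries_iff _ (n - 1) (by lia)] at hw
    obtain ⟨β, hβ⟩ := hw
    refine ⟨β, hβ.trans ?_⟩
    change _ = constCochain P η _ _ - z
    rw [constCochain_eq, ← hf2]
    rfl

variable [P.Normal]

lemma rho_mem_fixedCocycles {n : ℤ} (g : G) {c : C.X n} (hc : c ∈ fixedCocycles P C n) :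
    (C.X n).ρ g c ∈ fixedCocycles P C n := by
  refine ⟨fun p => ?_, by rw [dLin_rho, hc.2, map_zero]⟩
  have h := hc.1 ⟨g⁻¹ * p * g, by simpa using ‹P.Normal›.conj_mem p p.2 g⁻¹⟩
  have h' := congrArg ((C.X n).ρ g) h
  simpa [← Module.End.mul_apply, ← map_mul, mul_assoc] using h'

lemma extRepG_fixedClass (n : ℤ) (g : G) (c : fixedCocycles P C n) :
    extRepG P E C n g (fixedClass P η n c) =
      fixedClass P η n ⟨(C.X n).ρ g c.1, rho_mem_fixedCocycles g c.2⟩ := by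
  refine (extRepG_mk P E C n g _).trans (congrArg (HomCoh.mk F _ _ n) (Subtype.ext ?_))
  refine Cochain.ext _ _ fun p q hpq => ?_
  refine (cochainRep_v P g _ p q hpq).trans ?_
  change conjHom P g ((constCochain P η c.1 _).v p q hpq) =
    (constCochain P η ((C.X n).ρ g c.1) _).v p q hpq
  by_cases hp : p = 0
  · subst hp
    obtain rfl : q = n := by lia
    rw [constCochain_v, constCochain_v]
    refine hom_eq fun x => ?_
    change (C.X q).ρ g (aug η ((E.X 0).ρ g⁻¹ x) • c.1) = aug η x • (C.X q).ρ g c.1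
    rw [aug_rho, map_smul]
  · rw [constCochain_v_ne _ _ _ _ hp, constCochain_v_ne _ _ _ _ hp]
    exact hom_eq fun x => map_zero ((C.X q).ρ g)

end ConstantCochains


/-! ### Cohomology of the Klein four-group from an abstract resolution. -/

/-- A resolution of the trivial module over the group algebra of a Klein four-group in
characteristic two, with contractions along two derivations and a family of elements generating
a copy of the minimal resolution. -/
structure KleinResolution (F : Type u) [Field F] where
  V : ℕ → Type u
  [grp : ∀ n, AddCommGroup (V n)]
  [mod : ∀ n, Module F (V n)]
  D : ∀ n, V (n + 1) →ₗ[F] V n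
  aug : V 0 →ₗ[F] F
  l : ∀ n, Fin 2 → V n →ₗ[F] V n
  κ : ∀ n, Fin 2 → V n →ₗ[F] V n
  k : ∀ n, ℕ → V n
  add_self : ∀ a : F, a + a = 0
  D_D : ∀ n x, D n (D (n + 1) x) = 0
  exact_D : ∀ n x, D n x = 0 → ∃ y, D (n + 1) y = x
  aug_D : ∀ x, aug (D 0 x) = 0
  exact_aug : ∀ x, aug x = 0 → ∃ y, D 0 y = x
  aug_l : ∀ i x, aug (l 0 i x) = 0
  D_l : ∀ n i x, D n (l (n + 1) i x) = l n i (D n x)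
  l_l : ∀ n i x, l n i (l n i x) = 0
  l_comm : ∀ n x, l n 1 (l n 0 x) = l n 0 (l n 1 x)
  κ_l : ∀ n i j x, κ n j (l n i x) = l n i (κ n j x) + if i = j then l n i x + x else 0
  exists_norm : ∀ n (b : V n →ₗ[F] F), (∀ i x, b (l n i x) = 0) →
    ∃ b' : V n →ₗ[F] F, ∀ x, b' (l n 0 (l n 1 x)) = b x
  aug_k : aug (k 0 0) = 1
  k_eq_zero : ∀ n i, n < i → k n i = 0
  D_k_zero : ∀ n, D n (k (n + 1) 0) = l n 1 (k n 0)
  D_k_succ : ∀ n i, D n (k (n + 1) (i + 1)) = l n 0 (k n i) + l n 1 (k n (i + 1))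

attribute [instance] KleinResolution.grp KleinResolution.mod

namespace KleinResolution

variable {F : Type u} [Field F] (R : KleinResolution F) {n : ℕ}

/-- Invariance of a linear form. -/
def Inv (a : R.V n →ₗ[F] F) : Prop := ∀ i x, a (R.l n i x) = 0

/-- The cocycle condition for a linear form. -/
def Cyc (a : R.V n →ₗ[F] F) : Prop := ∀ x, a (R.D n x) = 0

/-- The product of an invariant cocycle with a generator. -/
def mulGen (j : Fin 2) (a : R.V n →ₗ[F] F) : R.V (n + 1) →ₗ[F] F := a ∘ₗ R.κ n j ∘ₗ R.D n

/-- Coboundaries of invariant linear forms. -/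
def IsCob : ∀ {n : ℕ}, (R.V n →ₗ[F] F) → Prop
  | 0, a => a = 0
  | n + 1, a => ∃ b : R.V n →ₗ[F] F, R.Inv b ∧ ∀ x, a x = b (R.D n x)

variable {R}

lemma mulGen_apply (j : Fin 2) (a : R.V n →ₗ[F] F) (x : R.V (n + 1)) :
    R.mulGen j a x = a (R.κ n j (R.D n x)) := rfl

lemma Inv.κ_l {a : R.V n →ₗ[F] F} (ha : R.Inv a) (i j : Fin 2) (x : R.V n) :
    a (R.κ n j (R.l n i x)) = if i = j then a x else 0 := by
  rw [R.κ_l, map_add, ha]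
  split_ifs
  · rw [map_add, ha, zero_add, zero_add]
  · rw [map_zero, zero_add]

lemma Inv.add {a b : R.V n →ₗ[F] F} (ha : R.Inv a) (hb : R.Inv b) : R.Inv (a + b) :=
  fun i x => by rw [LinearMap.add_apply, ha, hb, add_zero]

lemma Cyc.add {a b : R.V n →ₗ[F] F} (ha : R.Cyc a) (hb : R.Cyc b) : R.Cyc (a + b) :=
  fun x => by rw [LinearMap.add_apply, ha, hb, add_zero]

lemma Inv.mulGen {a : R.V n →ₗ[F] F} (ha : R.Inv a) (hc : R.Cyc a) (j : Fin 2) :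
    R.Inv (R.mulGen j a) := fun i x => by
  rw [mulGen_apply, R.D_l, ha.κ_l, hc, ite_self]

lemma cyc_mulGen (a : R.V n →ₗ[F] F) (j : Fin 2) : R.Cyc (R.mulGen j a) := fun x => by
  rw [mulGen_apply, R.D_D, map_zero, map_zero]

lemma Inv.D_k {b : R.V n →ₗ[F] F} (hb : R.Inv b) (i : ℕ) : b (R.D n (R.k (n + 1) i)) = 0 := by
  cases i with
  | zero => rw [R.D_k_zero, hb]
  | succ i => rw [R.D_k_succ, map_add, hb, hb, add_zero]

lemma Inv.mulGen_zero_k_zero {a : R.V n →ₗ[F] F} (ha : R.Inv a) :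
    R.mulGen 0 a (R.k (n + 1) 0) = 0 := by
  rw [mulGen_apply, R.D_k_zero, ha.κ_l, if_neg (by decide)]

/-- Think of `k n i` as dual to the monomial x_0^i x_1^(n-i). Multiplication by x_0 then shifts the
index, while multiplication by x_1 keeps it (`Inv.mulGen_one_k`). -/
lemma Inv.mulGen_zero_k_succ {a : R.V n →ₗ[F] F} (ha : R.Inv a) (i : ℕ) :
    R.mulGen 0 a (R.k (n + 1) (i + 1)) = a (R.k n i) := by
  rw [mulGen_apply, R.D_k_succ, map_add, map_add, ha.κ_l, ha.κ_l, if_pos rfl, if_neg (by decide),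
    add_zero]

lemma Inv.mulGen_one_k {a : R.V n →ₗ[F] F} (ha : R.Inv a) (i : ℕ) :
    R.mulGen 1 a (R.k (n + 1) i) = a (R.k n i) := by
  cases i with
  | zero => rw [mulGen_apply, R.D_k_zero, ha.κ_l, if_pos rfl]
  | succ i =>
    rw [mulGen_apply, R.D_k_succ, map_add, map_add, ha.κ_l, ha.κ_l, if_neg (by decide), if_pos rfl,
      zero_add]

/-- Subtracting Σ a_j κ_j from `h` removes its failure to be invariant, because a_j κ_j λ_i equals
δ_ij a_j. The subtracted terms composed with D are the products of the a_j with the generators. -/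
lemma leibniz {h : R.V n →ₗ[F] F} {a : Fin 2 → R.V n →ₗ[F] F} (ha : ∀ j, R.Inv (a j))
    (hh : ∀ i x, h (R.l n i x) = a i x) : ∃ b, R.Inv b ∧
      ∀ x, h (R.D n x) = b (R.D n x) + (R.mulGen 0 (a 0) x + R.mulGen 1 (a 1) x) := by
  refine ⟨h - (a 0 ∘ₗ R.κ n 0 + a 1 ∘ₗ R.κ n 1), fun i x => ?_, fun x => ?_⟩
  · rw [LinearMap.sub_apply, hh, LinearMap.add_apply, LinearMap.comp_apply, LinearMap.comp_apply,
      (ha 0).κ_l, (ha 1).κ_l]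
    fin_cases i <;> simp
  · rw [LinearMap.sub_apply]
    exact (sub_add_cancel _ _).symm

/-- A binary form of degree n + 1 is x_0 times the form with shifted coefficients plus x_1 times a
multiple of x_1^n. -/
lemma exists_k_eq (n : ℕ) (α : ℕ → F) :
    ∃ c : R.V n →ₗ[F] F, R.Inv c ∧ R.Cyc c ∧ ∀ i ≤ n, c (R.k n i) = α i := by
  induction n generalizing α with
  | zero =>
    refine ⟨α 0 • R.aug, fun i x => ?_, fun x => ?_, fun i hi => ?_⟩
    · rw [LinearMap.smul_apply, R.aug_l, smul_zero]
    · rw [LinearMap.smul_apply, R.aug_D, smul_zero]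
    · rw [Nat.le_zero.1 hi, LinearMap.smul_apply, R.aug_k, smul_eq_mul, mul_one]
  | succ n ih =>
    obtain ⟨a, ha, ha', hk⟩ := ih fun i => α (i + 1)
    obtain ⟨b, hb, hb', hl⟩ := ih fun i => if i = 0 then α 0 else 0
    refine ⟨R.mulGen 0 a + R.mulGen 1 b, (ha.mulGen ha' 0).add (hb.mulGen hb' 1),
      (cyc_mulGen a 0).add (cyc_mulGen b 1), fun i hi => ?_⟩
    rw [LinearMap.add_apply, hb.mulGen_one_k]
    cases i with
    | zero => rw [ha.mulGen_zero_k_zero, zero_add, hl 0 n.zero_le, if_pos rfl]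
    | succ i =>
      rw [ha.mulGen_zero_k_succ, hk i (by lia)]
      rcases Nat.lt_or_ge n (i + 1) with h | h
      · rw [R.k_eq_zero n _ h, map_zero, add_zero]
      · rw [hl _ h, if_neg (Nat.succ_ne_zero i), add_zero]

/-- Over a field, dualising preserves exactness. The resulting `h` is linear but in general not
invariant. -/
lemma exists_eq_comp_D {θ : R.V (n + 1) →ₗ[F] F} (hθ : R.Cyc θ) :
    ∃ h : R.V n →ₗ[F] F, ∀ x, θ x = h (R.D n x) := by
  have h : θ ∈ LinearMap.range (R.D n).dualMap := by
    rw [LinearMap.range_dualMap_eq_dualAnnihilator_ker, Submodule.mem_dualAnnihilator]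
    intro x hx
    obtain ⟨y, rfl⟩ := R.exact_D n x hx
    exact hθ y
  obtain ⟨g, rfl⟩ := h
  exact ⟨g, fun x => rfl⟩

lemma add_self_eq (x : R.V n) : x + x = 0 := by
  rw [← two_smul F, ← one_add_one_eq_two, R.add_self, zero_smul]

/-- The commutator of the two generators is homotopic to zero. -/
lemma exists_mulGen_mulGen {c : R.V n →ₗ[F] F} (hc : R.Inv c) (hc' : R.Cyc c) :
    ∃ b : R.V (n + 1) →ₗ[F] F, R.Inv b ∧ ∀ x,
      R.mulGen 0 (R.mulGen 1 c) x + R.mulGen 1 (R.mulGen 0 c) x = b (R.D (n + 1) x) := by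
  -- Since Dκ_1 + κ_1D commutes with the λ_i, the two summands have the same defect, namely c κ_1 D
  -- for i = 0 and zero for i = 1. In characteristic two the sum is therefore invariant.
  refine ⟨c ∘ₗ R.κ n 0 ∘ₗ (R.D n ∘ₗ R.κ (n + 1) 1 + R.κ n 1 ∘ₗ R.D n) +
    c ∘ₗ R.κ n 1 ∘ₗ R.D n ∘ₗ R.κ (n + 1) 0, fun i x => ?_, fun x => ?_⟩
  · have h1 : c (R.κ n 0 (R.D n (R.κ (n + 1) 1 (R.l (n + 1) i x)) +
        R.κ n 1 (R.D n (R.l (n + 1) i x)))) = if i = 0 then c (R.κ n 1 (R.D n x)) else 0 := by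
      have h2 : R.D n (R.κ (n + 1) 1 (R.l (n + 1) i x)) + R.κ n 1 (R.D n (R.l (n + 1) i x)) =
          R.l n i (R.D n (R.κ (n + 1) 1 x) + R.κ n 1 (R.D n x)) := by
        rw [R.κ_l, map_add, R.D_l, R.D_l, R.κ_l, map_add]
        split_ifs
        · rw [map_add, R.D_l, add_add_add_comm, add_self_eq, add_zero]
        · rw [map_zero, add_zero, add_zero]
      rw [h2, hc.κ_l, map_add, hc', zero_add]
    have h3 : c (R.κ n 1 (R.D n (R.κ (n + 1) 0 (R.l (n + 1) i x)))) =
        if i = 0 then c (R.κ n 1 (R.D n x)) else 0 := by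
      rw [R.κ_l, map_add, R.D_l, map_add, map_add, hc.κ_l, hc', ite_self, zero_add]
      split_ifs
      · rw [map_add, map_add, map_add, R.D_l, hc.κ_l, hc', ite_self, zero_add]
      · simp
    refine (congrArg₂ (· + ·) h1 h3).trans (R.add_self _)
  · change c (R.κ n 1 (R.D n (R.κ (n + 1) 0 (R.D (n + 1) x)))) + c (R.κ n 0 (R.D n (R.κ (n + 1) 1
      (R.D (n + 1) x)))) = c (R.κ n 0 (R.D n (R.κ (n + 1) 1 (R.D (n + 1) x)) +
        R.κ n 1 (R.D n (R.D (n + 1) x)))) + c (R.κ n 1 (R.D n (R.κ (n + 1) 0 (R.D (n + 1) x))))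
    rw [R.D_D, map_zero, add_zero, add_comm]

/-- A generator times a coboundary is a coboundary: Dκ_j + κ_jD commutes with the λ_i, so composing
`b` with it gives an invariant primitive. -/
lemma exists_mulGen_D {b : R.V n →ₗ[F] F} (hb : R.Inv b) (j : Fin 2) :
    ∃ b' : R.V (n + 1) →ₗ[F] F, R.Inv b' ∧ ∀ x,
      b (R.D n (R.κ (n + 1) j (R.D (n + 1) x))) = b' (R.D (n + 1) x) := by
  refine ⟨b ∘ₗ (R.D n ∘ₗ R.κ (n + 1) j + R.κ n j ∘ₗ R.D n), fun i x => ?_, fun x => ?_⟩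
  · change b (R.D n (R.κ (n + 1) j (R.l (n + 1) i x)) + R.κ n j (R.D n (R.l (n + 1) i x))) = 0
    rw [R.D_l, map_add, hb.κ_l, R.κ_l, map_add, R.D_l, map_add, hb, zero_add]
    split_ifs
    · rw [map_add, map_add, R.D_l, hb, zero_add, R.add_self]
    · rw [map_zero, map_zero, zero_add]
  · change _ = b (R.D n (R.κ (n + 1) j (R.D (n + 1) x)) + R.κ n j (R.D n (R.D (n + 1) x)))
    rw [R.D_D, map_zero, add_zero]

/-- An invariant cocycle which vanishes on the minimal resolution is a coboundary. -/
theorem isCob_of_k_eq_zero {θ : R.V n →ₗ[F] F} (hθ : R.Inv θ) (hθ' : R.Cyc θ)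
    (hk : ∀ i ≤ n, θ (R.k n i) = 0) : R.IsCob θ := by
  induction n with
  | zero =>
    refine LinearMap.ext fun x => ?_
    obtain ⟨y, hy⟩ := R.exact_aug (x - R.aug x • R.k 0 0) (by
      rw [map_sub, map_smul, R.aug_k, smul_eq_mul, mul_one, sub_self])
    have h := hθ' y
    rw [hy, map_sub, map_smul, hk 0 le_rfl, smul_zero, sub_zero] at h
    exact h
  | succ n ih =>
    -- Normalise a linear primitive h of θ so that it kills norms. The form h λ_0λ_1 is an invariant
    -- cocycle of degree n vanishing on the family, so by induction it is zero or a coboundary;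
    -- `exists_norm` then produces a correction of h absorbing it.
    have key : ∃ h : R.V n →ₗ[F] F, (∀ x, θ x = h (R.D n x)) ∧
        ∀ x, h (R.l n 0 (R.l n 1 x)) = 0 := by
      obtain ⟨h, hh⟩ := exists_eq_comp_D hθ'
      have h1 : R.Inv (h ∘ₗ R.l n 0 ∘ₗ R.l n 1) := fun i x => by
        change h (R.l n 0 (R.l n 1 (R.l n i x))) = 0
        fin_cases i
        · change h (R.l n 0 (R.l n 1 (R.l n 0 x))) = 0
          rw [R.l_comm, R.l_l, map_zero]
        · change h (R.l n 0 (R.l n 1 (R.l n 1 x))) = 0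
          rw [R.l_l, map_zero, map_zero]
      have h2 : R.Cyc (h ∘ₗ R.l n 0 ∘ₗ R.l n 1) := fun x => by
        change h (R.l n 0 (R.l n 1 (R.D n x))) = 0
        rw [← R.D_l, ← R.D_l, ← hh, hθ]
      have h3 : R.IsCob (h ∘ₗ R.l n 0 ∘ₗ R.l n 1) := by
        refine ih h1 h2 fun i _ => ?_
        -- The form h λ_0 has defect zero along λ_0 and h λ_0λ_1 along λ_1. Evaluated on the family,
        -- its composite with D is θλ_0 = 0, so only the value of h λ_0λ_1 remains.
        obtain ⟨b, hb, h4⟩ := leibniz (R := R) (h := h ∘ₗ R.l n 0)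
          (a := ![0, h ∘ₗ R.l n 0 ∘ₗ R.l n 1]) (fun j => by
            fin_cases j
            · exact fun _ _ => rfl
            · exact h1) (fun j x => by
            fin_cases j
            · change h (R.l n 0 (R.l n 0 x)) = 0
              rw [R.l_l, map_zero]
            · rfl)
        have h5 := h4 (R.k (n + 1) i)
        have h6 : R.mulGen 0 (0 : R.V n →ₗ[F] F) (R.k (n + 1) i) = 0 := rfl
        have h7 : (h ∘ₗ R.l n 0) (R.D n (R.k (n + 1) i)) = 0 := by
          rw [LinearMap.comp_apply, ← R.D_l, ← hh, hθ]
        rw [h7, hb.D_k, zero_add] at h5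
        change 0 = R.mulGen 0 0 _ + R.mulGen 1 (h ∘ₗ R.l n 0 ∘ₗ R.l n 1) _ at h5
        rw [h6, zero_add, h1.mulGen_one_k] at h5
        exact h5.symm
      cases n with
      | zero => exact ⟨h, hh, fun x => LinearMap.congr_fun h3 x⟩
      | succ n =>
        obtain ⟨b, hb, hb'⟩ := h3
        obtain ⟨b', hb2⟩ := R.exists_norm n b hb
        refine ⟨h - b' ∘ₗ R.D n, fun x => ?_, fun x => ?_⟩
        · rw [LinearMap.sub_apply, LinearMap.comp_apply, R.D_D, map_zero, sub_zero, hh]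
        · rw [LinearMap.sub_apply, LinearMap.comp_apply, R.D_l, R.D_l, hb2, ← hb', sub_eq_zero]
          rfl
    obtain ⟨h, hh, h0⟩ := key
    have hi (j : Fin 2) : R.Inv (h ∘ₗ R.l n j) := fun i x => by
      change h (R.l n j (R.l n i x)) = 0
      fin_cases i <;> fin_cases j
      · exact (congrArg h (R.l_l n 0 x)).trans h.map_zero
      · exact (congrArg h (R.l_comm n x)).trans (h0 x)
      · exact h0 x
      · exact (congrArg h (R.l_l n 1 x)).trans h.map_zero
    have hc (j : Fin 2) : R.Cyc (h ∘ₗ R.l n j) := fun x => by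
      rw [LinearMap.comp_apply, ← R.D_l, ← hh, hθ]
    -- Now h λ_0 and h λ_1 are invariant cocycles, and θ is x_0(h λ_0) + x_1(h λ_1) up to a
    -- coboundary. As θ vanishes on the family, their polynomials p and q satisfy x_0 p + x_1 q = 0.
    obtain ⟨b, hb, hl⟩ := leibniz (R := R) (h := h) (a := fun j => h ∘ₗ R.l n j) hi fun _ _ => rfl
    have hk0 : (h ∘ₗ R.l n 1) (R.k n 0) = 0 := by
      have h1 := hl (R.k (n + 1) 0)
      rw [← hh, hk 0 (by lia), hb.D_k, zero_add, (hi 0).mulGen_zero_k_zero, zero_add,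
        (hi 1).mulGen_one_k] at h1
      exact h1.symm
    have hk1 (i : ℕ) (hin : i ≤ n) : (h ∘ₗ R.l n 1) (R.k n (i + 1)) = (h ∘ₗ R.l n 0) (R.k n i) := by
      have h1 := hl (R.k (n + 1) (i + 1))
      rw [← hh, hk _ (by lia), hb.D_k, zero_add, (hi 0).mulGen_zero_k_succ,
        (hi 1).mulGen_one_k] at h1
      exact add_left_cancel (h1.symm.trans (R.add_self _).symm)
    -- In degree zero a coboundary is zero, and p = q = 0 already forces h λ_0 = h λ_1 = 0.
    cases n with
    | zero =>
      have e1 : h ∘ₗ R.l 0 1 = 0 := ih (hi 1) (hc 1) fun i hi => by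
        rw [Nat.le_zero.1 hi, hk0]
      have e0 : h ∘ₗ R.l 0 0 = 0 := ih (hi 0) (hc 0) fun i hi => by
        rw [← hk1 i hi, R.k_eq_zero 0 _ (by lia), map_zero]
      refine ⟨b, hb, fun x => ?_⟩
      rw [hh, hl, e0, e1]
      exact (congrArg (b (R.D 0 x) + ·) (add_zero (0 : F))).trans (add_zero _)
    | succ n =>
      -- The syzygy has the form p = x_1 c, q = x_0 c. The coefficients of c are those of p; the
      -- missing last one, of x_0^(n+1), is zero by `hk1`.
      obtain ⟨c, hci, hcc, hck⟩ := exists_k_eq (R := R) n fun i => (h ∘ₗ R.l (n + 1) 0) (R.k (n + 1) i)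
      have e0 : R.IsCob (h ∘ₗ R.l (n + 1) 0 + R.mulGen 1 c) := by
        refine ih ((hi 0).add (hci.mulGen hcc 1)) ((hc 0).add (cyc_mulGen c 1)) fun i hin => ?_
        rw [LinearMap.add_apply, hci.mulGen_one_k]
        rcases Nat.lt_or_ge n i with hn | hn
        · rw [R.k_eq_zero n i hn, map_zero, add_zero, ← hk1 i hin, R.k_eq_zero (n + 1) _ (by lia),
            map_zero]
        · rw [hck i hn, R.add_self]
      have e1 : R.IsCob (h ∘ₗ R.l (n + 1) 1 + R.mulGen 0 c) := by
        refine ih ((hi 1).add (hci.mulGen hcc 0)) ((hc 1).add (cyc_mulGen c 0)) fun i hin => ?_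
        rw [LinearMap.add_apply]
        cases i with
        | zero => rw [hk0, hci.mulGen_zero_k_zero, add_zero]
        | succ i => rw [hci.mulGen_zero_k_succ, hck i (by lia), hk1 i (by lia), R.add_self]
      obtain ⟨b0, hb0, e0⟩ := e0
      obtain ⟨b1, hb1, e1⟩ := e1
      obtain ⟨b2, hb2, e2⟩ := exists_mulGen_D hb0 0
      obtain ⟨b3, hb3, e3⟩ := exists_mulGen_D hb1 1
      -- By induction h λ_0 and h λ_1 are x_1c and x_0c up to coboundaries, so θ is x_0x_1c +
      -- x_1x_0c up to a coboundary, and this commutator is a coboundary too.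
      obtain ⟨b4, hb4, e4⟩ := exists_mulGen_mulGen hci hcc
      refine ⟨b + (b2 + b3 + b4), hb.add ((hb2.add hb3).add hb4), fun x => ?_⟩
      rw [hh, hl]
      have e5 := e0 (R.κ (n + 1) 0 (R.D (n + 1) x))
      have e6 := e1 (R.κ (n + 1) 1 (R.D (n + 1) x))
      rw [e2] at e5
      rw [e3] at e6
      change _ + _ = b _ + (b2 _ + b3 _ + b4 _)
      rw [← e5, ← e6, ← e4]
      change b (R.D (n + 1) x) + ((h ∘ₗ R.l (n + 1) 0) (R.κ (n + 1) 0 (R.D (n + 1) x)) +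
        (h ∘ₗ R.l (n + 1) 1) (R.κ (n + 1) 1 (R.D (n + 1) x))) = b (R.D (n + 1) x) +
        (((h ∘ₗ R.l (n + 1) 0) (R.κ (n + 1) 0 (R.D (n + 1) x)) +
            R.mulGen 1 c (R.κ (n + 1) 0 (R.D (n + 1) x))) +
          ((h ∘ₗ R.l (n + 1) 1) (R.κ (n + 1) 1 (R.D (n + 1) x)) +
            R.mulGen 0 c (R.κ (n + 1) 1 (R.D (n + 1) x))) +
          (R.mulGen 1 c (R.κ (n + 1) 0 (R.D (n + 1) x)) +
            R.mulGen 0 c (R.κ (n + 1) 1 (R.D (n + 1) x))))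
      have e7 := R.add_self (R.mulGen 1 c (R.κ (n + 1) 0 (R.D (n + 1) x)))
      have e8 := R.add_self (R.mulGen 0 c (R.κ (n + 1) 1 (R.D (n + 1) x)))
      linear_combination -e7 - e8

end KleinResolution


/-! ### A copy of the minimal resolution inside any resolution. -/

section MinimalFamily

variable {F : Type u} [Field F] {V : ℕ → Type u} [∀ n, AddCommGroup (V n)] [∀ n, Module F (V n)]

/-- The prescribed boundaries are cycles: applying D to them, the squares of the λ_i vanish and the
two copies of λ_0λ_1 k cancel in characteristic two. Exactness then provides the next row. -/
lemma exists_minimal_family (D : ∀ n, V (n + 1) →ₗ[F] V n) (ε : V 0 →ₗ[F] F)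
    (l : ∀ n, Fin 2 → V n →ₗ[F] V n) (add_self : ∀ a : F, a + a = 0)
    (exact_D : ∀ n x, D n x = 0 → ∃ y, D (n + 1) y = x)
    (exact_ε : ∀ x, ε x = 0 → ∃ y, D 0 y = x) (ε_l : ∀ i x, ε (l 0 i x) = 0)
    (D_l : ∀ n i x, D n (l (n + 1) i x) = l n i (D n x)) (l_l : ∀ n i x, l n i (l n i x) = 0)
    (l_comm : ∀ n x, l n 1 (l n 0 x) = l n 0 (l n 1 x)) (hε : ∃ x, ε x = 1) :
    ∃ k : ∀ n, ℕ → V n, ε (k 0 0) = 1 ∧ (∀ n i, n < i → k n i = 0) ∧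
      (∀ n, D n (k (n + 1) 0) = l n 1 (k n 0)) ∧
      ∀ n i, D n (k (n + 1) (i + 1)) = l n 0 (k n i) + l n 1 (k n (i + 1)) := by
  let Lift (n : ℕ) (f : ℕ → V n) (g : ℕ → V (n + 1)) : Prop :=
    D n (g 0) = l n 1 (f 0) ∧ ∀ i, D n (g (i + 1)) = l n 0 (f i) + l n 1 (f (i + 1))
  -- The recursion carries the existence of the next row as part of its invariant, since the cycle
  -- condition involves two consecutive rows.
  let T (n : ℕ) (f : ℕ → V n) : Prop :=
    (∀ i, n < i → f i = 0) ∧ ∃ g, (∀ i, n + 1 < i → g i = 0) ∧ Lift n f g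
  have lift (n : ℕ) (f : ℕ → V n) (hf : ∀ i, n < i → f i = 0)
      (h0 : ∃ y, D n y = l n 1 (f 0)) (h1 : ∀ i, ∃ y, D n y = l n 0 (f i) + l n 1 (f (i + 1))) :
      T n f := by
    obtain ⟨y, hy⟩ := h0
    choose g hg using h1
    refine ⟨hf, fun i => i.casesOn y fun i => if n < i then 0 else g i, fun i hi => ?_, hy,
      fun i => ?_⟩
    · cases i with
      | zero => lia
      | succ i => exact if_pos (by lia)
    · change D n (if n < i then 0 else g i) = _
      split_ifs with h
      · rw [hf i h, hf (i + 1) (by lia), map_zero, map_zero, map_zero, add_zero]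
      · exact hg i
  have step (n : ℕ) (f : ℕ → V n) (hf : T n f) : ∃ g, T (n + 1) g ∧ Lift n f g := by
    obtain ⟨-, g, hg, h⟩ := hf
    refine ⟨g, lift (n + 1) g hg (exact_D n _ ?_) (fun i => exact_D n _ ?_), h⟩
    · rw [D_l, h.1, l_l]
    · rw [map_add, D_l, D_l, h.2]
      cases i with
      | zero => rw [h.1, map_add, l_l, add_zero, l_comm]; rw [← two_smul F, ← one_add_one_eq_two, add_self, zero_smul]
      | succ i =>
        rw [h.2, map_add, map_add, l_l, l_l, l_comm, zero_add, add_zero]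
        rw [← two_smul F, ← one_add_one_eq_two, add_self, zero_smul]
  have start : ∃ f, T 0 f ∧ ε (f 0) = 1 := by
    obtain ⟨x, hx⟩ := hε
    refine ⟨fun i => i.casesOn x fun _ => 0, lift 0 _ (fun i hi => ?_) (exact_ε _ (ε_l _ _))
      (fun i => exact_ε _ (by rw [map_add, ε_l, ε_l, add_zero])), hx⟩
    cases i with
    | zero => lia
    | succ i => rfl
  obtain ⟨f0, hf0, hε0⟩ := start
  choose nxt hT hL using step
  let K : ∀ n, {f : ℕ → V n // T n f} := fun n =>
    Nat.rec ⟨f0, hf0⟩ (fun n f => ⟨nxt n f.1 f.2, hT n f.1 f.2⟩) n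
  exact ⟨fun n => (K n).1, hε0, fun n => (K n).2.1, fun n => (hL n (K n).1 (K n).2).1,
    fun n => (hL n (K n).1 (K n).2).2⟩

end MinimalFamily

/-! ### The chosen data on a projective resolution E. -/

section ResolutionData

variable {F : Type u} [Field F] [CharP F 2] {G : Type u} [Group G] (P : Subgroup G)
  [IsKleinFour P]

/-- The operators `g - 1` on a module, for generators `g` of a Klein four-subgroup. -/
abbrev lamP (X : Rep.{u} F G) (i : Fin 2) : X →ₗ[F] X := lam (X.ρ.comp P.subtype) i

/-- Auxiliary choices for a projective resolution: an augmentation, derivations, and generators of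
a minimal resolution over a Klein four-subgroup. -/
structure ResData (E : CochainComplex (Rep.{u} F G) ℤ) where
  isRes : IsProjectiveResolution E
  η : E ⟶ trivCx F G
  quasiIso : QuasiIso η
  κ : ∀ p : ℤ, Fin 2 → E.X p →ₗ[F] E.X p
  κ_rho : ∀ p j (g : P) x, κ p j ((E.X p).ρ g x) =
    (E.X p).ρ g (κ p j x) + chi F j g • (E.X p).ρ g x
  k : ∀ n : ℕ, ℕ → E.X (-(n : ℤ))
  aug_k : aug η (k 0 0) = 1
  k_eq_zero : ∀ n i, n < i → k n i = 0
  D_k_zero : ∀ n : ℕ, dLin E (-((n + 1 : ℕ) : ℤ)) (-(n : ℤ)) (k (n + 1) 0) = lamP P _ 1 (k n 0)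
  D_k_succ : ∀ (n : ℕ) i, dLin E (-((n + 1 : ℕ) : ℤ)) (-(n : ℤ)) (k (n + 1) (i + 1)) =
    lamP P _ 0 (k n i) + lamP P _ 1 (k n (i + 1))

attribute [instance] ResData.quasiIso

variable {P} {E : CochainComplex (Rep.{u} F G) ℤ}

lemma dLin_lamP (p q : ℤ) (i : Fin 2) (x : E.X p) :
    dLin E p q (lamP P _ i x) = lamP P _ i (dLin E p q x) :=
  lam_intertwining (ρ := (E.X p).ρ.comp P.subtype) (σ := (E.X q).ρ.comp P.subtype)
    (fun g x => dLin_rho E p q g x) i x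

lemma aug_lamP (η : E ⟶ trivCx F G) (i : Fin 2) (x : E.X 0) : aug η (lamP P _ i x) = 0 := by
  rw [lam_apply, map_add]
  refine (congrArg (· + _) (aug_rho η _ x)).trans ?_
  exact CharTwo.add_self_eq_zero _

lemma nonempty_resData [Finite G] (hE : IsProjectiveResolution E) : Nonempty (ResData P E) := by
  have := Fintype.ofFinite P
  obtain ⟨η, hη⟩ := hE.quasiIso
  choose τ hτ using fun p => exists_isTraceSplitting_subgroup P (E.X p) (hE.projective p)
  obtain ⟨k, h1, h2, h3, h4⟩ := exists_minimal_family (V := fun n => E.X (-(n : ℤ)))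
    (fun n => dLin E (-((n + 1 : ℕ) : ℤ)) (-(n : ℤ))) (aug η) (fun n => lamP P _)
    CharTwo.add_self_eq_zero
    (fun n x hx => exists_dLin_eq_of_neg hη (by lia) (j := -(n : ℤ)) (by lia) (by lia) hx)
    (fun x hx => exists_dLin_eq_of_aug hE hη (by lia) hx)
    (aug_lamP η) (fun n i x => dLin_lamP _ _ i x) (fun n => lam_lam_self _) (fun n => lam_comm _)
    (exists_aug_eq_one hη)
  exact ⟨⟨hE, η, hη, fun p j => derivation ((E.X p).ρ.comp P.subtype) (τ p) (chi F j),
    fun p j g x => (hτ p).derivation_apply (chi_mul F j) g x, k, h1, h2, h3, h4⟩⟩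

namespace ResData

variable (R : ResData P E)

lemma κ_lam (p : ℤ) (i j : Fin 2) (x : E.X p) : R.κ p j (lamP P _ i x) =
    lamP P _ i (R.κ p j x) + if i = j then lamP P _ i x + x else 0 := by
  have h := R.κ_rho p j (gen P i) x
  rw [lam_apply, map_add]
  refine (congrArg (· + _) h).trans ?_
  rw [chi_gen, lam_apply]
  by_cases hij : i = j
  · subst hij
    rw [if_pos rfl, if_pos rfl, one_smul, add_assoc (((E.X p).ρ.comp P.subtype) (gen P i) x), add_self_of_charTwo F x,
      add_zero, add_right_comm]
    rfl
  · rw [if_neg hij, if_neg (Ne.symm hij), zero_smul, add_zero, add_zero]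
    rfl

/-- The resolution data in terms of modules indexed by natural numbers. -/
def toKlein [Finite G] : KleinResolution F where
  V n := E.X (-(n : ℤ))
  D n := dLin E (-((n + 1 : ℕ) : ℤ)) (-(n : ℤ))
  aug := aug R.η
  l n := lamP P _
  κ n := R.κ _
  k := R.k
  add_self := CharTwo.add_self_eq_zero
  D_D n x := dLin_dLin _ _ _ _ x
  exact_D n x hx := exists_dLin_eq_of_neg R.quasiIso (by lia) (j := -(n : ℤ)) (by lia) (by lia) hx
  aug_D x := aug_dLin _ _ x
  exact_aug x hx := exists_dLin_eq_of_aug R.isRes R.quasiIso (by lia) hx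
  aug_l := aug_lamP R.η
  D_l n i x := dLin_lamP _ _ i x
  l_l n := lam_lam_self _
  l_comm n := lam_comm _
  κ_l n := R.κ_lam _
  exists_norm n b hb := by
    have := Fintype.ofFinite P
    obtain ⟨τ, hτ⟩ := exists_isTraceSplitting_subgroup P _ (R.isRes.projective (-(n : ℤ)))
    exact ⟨b ∘ₗ τ, fun x => hτ.comp_lam_lam hb x⟩
  aug_k := R.aug_k
  k_eq_zero := R.k_eq_zero
  D_k_zero := R.D_k_zero
  D_k_succ := R.D_k_succ

end ResData

end ResolutionData


/-! ### Reduction of cochains of Hom(E, E) to linear forms. -/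

section Form

variable {F : Type u} [Field F] {G : Type u} [Group G] {P : Subgroup G}
  {E : CochainComplex (Rep.{u} F G) ℤ} (η : E ⟶ trivCx F G)

/-- The components of a cochain, as linear maps. -/
def cv {C : CochainComplex (Rep.{u} F G) ℤ} {n : ℤ} (z : Cochain (resCx P E) (resCx P C) n)
    (p q : ℤ) (h : p + n = q) : E.X p →ₗ[F] C.X q := (z.v p q h).hom.toLinearMap

/-- The linear form obtained from a cochain by composition with the augmentation. -/
def form {n p : ℤ} (h : p + n = 0) : Cochain (resCx P E) (resCx P E) n →ₗ[F] (E.X p →ₗ[F] F) where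
  toFun z := aug η ∘ₗ cv z p 0 h
  map_add' _ _ := LinearMap.ext fun _ => map_add (aug η) _ _
  map_smul' _ _ := LinearMap.ext fun _ => map_smul (aug η) _ _

lemma form_apply {n p : ℤ} (h : p + n = 0) (z : Cochain (resCx P E) (resCx P E) n) (x : E.X p) :
    form η h z x = aug η (cv z p 0 h x) := rfl

lemma form_rho {n p : ℤ} (h : p + n = 0) (z : Cochain (resCx P E) (resCx P E) n) (g : P)
    (x : E.X p) : form η h z ((E.X p).ρ g x) = form η h z x :=
  (congrArg (aug η) (Rep.hom_comm_apply (z.v p 0 h) g x)).trans (aug_rho η _ _)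

lemma augRes_f_zero_apply (x : E.X 0) : ((augRes P η).f 0).hom.toLinearMap x =
    (HomologicalComplex.singleObjXSelf (ComplexShape.up ℤ) 0
      (Rep.res P.subtype (Rep.trivial F G F))).inv.hom.toLinearMap (aug η x) :=
  congrArg (fun f => f.hom.toLinearMap x) (augRes_f_zero P η)

/-- E is K-projective and E → F a quasi-isomorphism, so a cocycle is a coboundary as soon as its
composite with the augmentation is one. An invariant form `b` is precisely a P-morphism to F giving
the required primitive. -/
lemma exists_δ_eq_of_form [QuasiIso η] [(resCx P E).IsKProjective] {n p q : ℤ} (h : p + n = 0)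
    (hq : p + 1 = q) (z : cocycles F (resCx P E) (resCx P E) n) (b : E.X q →ₗ[F] F)
    (hb : ∀ (g : P) x, b ((E.X q).ρ g x) = b x) (hz : ∀ x, form η h z.1 x = b (dLin E p q x)) :
    ∃ w, δ (n - 1) n w = z.1 := by
  have key := mem_coboundaries_of_postcomp (augRes P η) (Cocycle.mk z.1 (n + 1) rfl z.2) (by
    obtain ⟨f, hf, hfz⟩ := Cocycle.toSingleMk_surjective
      ((Cocycle.mk z.1 (n + 1) rfl z.2).postcomp (augRes P η)) p h (p - 1) (by lia)
    rw [← hfz]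
    refine (Cocycle.toSingleMk_mem_coboundaries_iff (K := resCx P E) f h (p - 1) (by lia) hf
      q hq).2 ⟨resHom P (X := E.X q) (Y := Rep.trivial F G F) b hb, ?_⟩
    refine hom_eq (X := E.X p) (Y := Rep.trivial F G F) fun x => ?_
    have h1 : (z.1.v p 0 h) ≫ (augRes P η).f 0 = f ≫ (HomologicalComplex.singleObjXSelf
        (ComplexShape.up ℤ) 0 (Rep.res P.subtype (Rep.trivial F G F))).inv := by
      have h2 := congrArg (fun c => (c : Cocycle (resCx P E) (trivResCx F P) n).1.v p 0 h) hfz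
      refine Eq.trans ?_ (h2.symm.trans (Cochain.toSingleMk_v f h))
      exact ((Cochain.comp_v z.1 (Cochain.ofHom (augRes P η)) (add_zero n) p 0 0 h (by lia)).trans
        (congrArg (_ ≫ ·) (Cochain.ofHom_v _ _))).symm
    have h3 := congrArg (fun f => f.hom.toLinearMap x) h1
    have h4 := (augRes_f_zero_apply (P := P) η ((z.1.v p 0 h).hom.toLinearMap x)).symm.trans h3
    have h5 := (Rep.mono_iff_injective (HomologicalComplex.singleObjXSelf
        (ComplexShape.up ℤ) 0 (Rep.res P.subtype (Rep.trivial F G F))).inv).1 inferInstance h4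
    exact (hz x).symm.trans h5)
  rw [mem_coboundaries_iff _ (n - 1) (by lia)] at key
  exact key

lemma units_smul_of_charTwo [CharP F 2] {M : Type*} [AddCommGroup M] [Module F M] (r : ℤˣ) (v : M) :
    r • v = v := by
  obtain rfl | rfl := Int.units_eq_one_or r
  · exact one_smul _ _
  · rw [Units.neg_smul, one_smul, neg_eq_of_charTwo F]

variable {C : CochainComplex (Rep.{u} F G) ℤ}

variable [CharP F 2]

lemma cv_δ {n m : ℤ} (hnm : n + 1 = m) (z : Cochain (resCx P E) (resCx P C) n) (p q : ℤ)
    (h : p + m = q) (q₁ p₁ : ℤ) (hq : q₁ = q - 1) (hp : p + 1 = p₁) (x : E.X p) :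
    cv (δ n m z) p q h x =
      dLin C q₁ q (cv z p q₁ (by lia) x) + cv z p₁ q (by lia) (dLin E p p₁ x) := by
  have h1 := δ_v n m hnm z p q h q₁ p₁ hq hp
  rw [units_smul_of_charTwo (F := F)] at h1
  exact congrArg (fun f => f.hom.toLinearMap x) h1

lemma dLin_cv {n : ℤ} {z : Cochain (resCx P E) (resCx P C) n}
    (hz : z ∈ cocycles F (resCx P E) (resCx P C) n) {p p' q q' : ℤ}
    (h : p + n = q) (h' : p' + n = q') (hp : p + 1 = p') (x : E.X p) :
    dLin C q q' (cv z p q h x) = cv z p' q' h' (dLin E p p' x) := by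
  have h1 := cv_δ (n := n) rfl z p q' (by lia) q p' (by lia) hp x
  rw [mem_cocycles.1 hz] at h1
  exact (add_eq_zero_iff_of_charTwo F _ _).1 h1.symm

lemma form_dLin {n p p' : ℤ} (h : p + n = 0) (hp : p' + 1 = p)
    {z : Cochain (resCx P E) (resCx P E) n} (hz : z ∈ cocycles F (resCx P E) (resCx P E) n)
    (x : E.X p') : form η h z (dLin E p' p x) = 0 := by
  rw [form_apply, ← dLin_cv hz (show p' + n = -1 by lia) h hp]
  exact aug_dLin η _ _

lemma form_δ {n m p p' : ℤ} (hnm : n + 1 = m) (h : p + m = 0) (h' : p' + n = 0)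
    (w : Cochain (resCx P E) (resCx P E) n) (x : E.X p) :
    form η h (δ n m w) x = form η h' w (dLin E p p' x) := by
  rw [form_apply, cv_δ hnm w p 0 h (-1) p' (by lia) (by lia) x, map_add]
  exact (congrArg (· + _) (aug_dLin η _ _)).trans (zero_add _)

end Form

/-! ### The degree-one classes. -/

section Generators

variable {F : Type u} [Field F] [CharP F 2] {G : Type u} [Group G] {P : Subgroup G}
  [IsKleinFour P] {E : CochainComplex (Rep.{u} F G) ℤ} (R : ResData P E)

namespace ResData

/-- The chain map of degree one attached to a derivation. -/
def genMap (j : Fin 2) (p q : ℤ) : Rep.res P.subtype (E.X p) ⟶ Rep.res P.subtype (E.X q) :=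
  resHom P (dLin E p q ∘ₗ R.κ p j + R.κ q j ∘ₗ dLin E p q) fun g x => by
    have h1 := dLin_rho E p q (g : G) (R.κ p j x)
    have h2 := dLin_rho E p q (g : G) x
    have h3 := R.κ_rho q j g (dLin E p q x)
    -- The defects of dκ and κd are both χ(g) g d, so they cancel in characteristic two: dκ + κd is
    -- P-linear although κ is not.
    have h4 := add_self_of_charTwo F (chi F j g • (E.X q).ρ g (dLin E p q x))
    change dLin E p q (R.κ p j ((E.X p).ρ g x)) + R.κ q j (dLin E p q ((E.X p).ρ g x)) =
      (E.X q).ρ g (dLin E p q (R.κ p j x) + R.κ q j (dLin E p q x))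
    rw [R.κ_rho, map_add, map_smul, h1, h2, h3, map_add, add_add_add_comm, add_comm (chi F j g • _),
      add_assoc, h4, add_zero]

/-- The cocycle attached to a derivation. -/
def genCocycle (j : Fin 2) : cocycles F (resCx P E) (resCx P E) 1 :=
  ⟨Cochain.mk fun p q _ => R.genMap j p q, by
    rw [mem_cocycles]
    refine Cochain.ext _ _ fun p q h => hom_eq (X := E.X p) (Y := E.X q) fun x => ?_
    obtain rfl : q = p + 1 + 1 := by lia
    refine (cv_δ rfl _ p _ h (p + 1) (p + 1) (by lia) rfl x).trans ?_
    change dLin E _ _ (dLin E p _ (R.κ p j x) + R.κ _ j (dLin E p _ x)) +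
      (dLin E _ _ (R.κ _ j (dLin E p _ x)) + R.κ _ j (dLin E _ _ (dLin E p _ x))) = 0
    rw [dLin_dLin, map_zero, add_zero, map_add, dLin_dLin, zero_add, add_self_of_charTwo F]⟩

/-- The generators of the cohomology of a Klein four-group. -/
def gen (j : Fin 2) : ExtP P E E 1 := HomCoh.mk F _ _ 1 (R.genCocycle j)

end ResData

end Generators


/-! ### Vanishing in negative degrees. -/

section Negative

variable {F : Type u} [Field F] {G : Type u} [Group G] [Finite G] {P : Subgroup G}
  {E : CochainComplex (Rep.{u} F G) ℤ}

lemma subsingleton_ext_of_neg (hE : IsProjectiveResolution E) {n : ℤ} (hn : n < 0) :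
    Subsingleton (ExtP P E E n) := by
  obtain ⟨η, hη⟩ := hE.quasiIso
  refine subsingleton_of_forall_eq 0 fun x => ?_
  obtain ⟨z, rfl⟩ := HomCoh.mk_surjective n x
  have h1 := hE.isKProjective_res P
  have h2 : Subsingleton (E.X (-n)) := (Rep.isZero_iff _ _ _).1 (hE.isZero _ (by lia))
  refine (HomCoh.mk_eq_zero _).2 (exists_δ_eq_of_form η (neg_add_cancel n) rfl z 0
    (fun _ _ => rfl) fun x => ?_)
  rw [Subsingleton.elim x 0, map_zero, map_zero, map_zero]

end Negative

/-! ### Coefficients of cohomology classes. -/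

section Theta

variable {F : Type u} [Field F] [CharP F 2] {G : Type u} [Group G] {P : Subgroup G}
  [IsKleinFour P] {E : CochainComplex (Rep.{u} F G) ℤ} (R : ResData P E)

lemma form_lamP (η : E ⟶ trivCx F G) {n p : ℤ} (h : p + n = 0)
    (z : Cochain (resCx P E) (resCx P E) n) (i : Fin 2) (x : E.X p) :
    form η h z (lamP P _ i x) = 0 :=
  (comp_rho_iff ((E.X p).ρ.comp P.subtype) (form η h z)).1 (form_rho η h z) i x

namespace ResData

/-- This is minimality: the differential sends the family into the images of the λ_i, where
invariant forms vanish. Hence the coefficients depend only on the class. -/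
lemma form_δ_k {n : ℤ} {m : ℕ} (h : -(m : ℤ) + n = 0) (w : Cochain (resCx P E) (resCx P E) (n - 1))
    (i : ℕ) : form R.η h (δ (n - 1) n w) (R.k m i) = 0 := by
  cases m with
  | zero =>
    rw [form_δ R.η (sub_add_cancel n 1) h (show (1 : ℤ) + (n - 1) = 0 by lia)]
    have h1 : Subsingleton (E.X 1) := (Rep.isZero_iff _ _ _).1 (R.isRes.isZero 1 one_pos)
    rw [Subsingleton.elim (dLin E _ 1 _) 0, map_zero]
  | succ m =>
    rw [form_δ R.η (sub_add_cancel n 1) h (show -(m : ℤ) + (n - 1) = 0 by lia)]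
    cases i with
    | zero => rw [R.D_k_zero, form_lamP]
    | succ i => rw [R.D_k_succ, map_add, form_lamP, form_lamP, add_zero]

/-- The coefficients of a cohomology class. -/
def coef {n : ℤ} {m : ℕ} (h : -(m : ℤ) + n = 0) (i : ℕ) : ExtP P E E n →ₗ[F] F :=
  ((coboundaries F (resCx P E) (resCx P E) n).submoduleOf
      (cocycles F (resCx P E) (resCx P E) n)).liftQ
    (LinearMap.applyₗ (R.k m i) ∘ₗ form R.η h ∘ₗ Submodule.subtype _) (by
      rintro z ⟨w, hw⟩
      have h1 := R.form_δ_k h w i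
      refine Eq.trans ?_ h1
      exact congrArg (fun c => form R.η h c (R.k m i)) hw.symm)

lemma coef_mk {n : ℤ} {m : ℕ} (h : -(m : ℤ) + n = 0) (i : ℕ)
    (z : cocycles F (resCx P E) (resCx P E) n) :
    R.coef h i (HomCoh.mk F _ _ n z) = form R.η h z.1 (R.k m i) := rfl

lemma coef_eq_zero {n : ℤ} {m : ℕ} (h : -(m : ℤ) + n = 0) {i : ℕ} (hi : m < i)
    (x : ExtP P E E n) : R.coef h i x = 0 := by
  obtain ⟨z, rfl⟩ := HomCoh.mk_surjective n x
  rw [coef_mk, R.k_eq_zero m i hi, map_zero]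

variable [Finite G]

lemma inv_form {n : ℤ} {m : ℕ} (h : -(m : ℤ) + n = 0) (z : Cochain (resCx P E) (resCx P E) n) :
    R.toKlein.Inv (n := m) (form R.η h z) := form_lamP R.η h z

lemma cyc_form {n : ℤ} {m : ℕ} (h : -(m : ℤ) + n = 0)
    {z : Cochain (resCx P E) (resCx P E) n} (hz : z ∈ cocycles F (resCx P E) (resCx P E) n) :
    R.toKlein.Cyc (n := m) (form R.η h z) := form_dLin R.η h (by lia) hz

/-- The generator acts through dκ + κd, and the summand dκ disappears because the form of a cocycle
kills boundaries. -/
lemma form_gen_comp {n n' : ℤ} {m : ℕ} (h : -(m : ℤ) + n = 0)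
    (h' : -((m + 1 : ℕ) : ℤ) + n' = 0) (hn : 1 + n = n')
    {z : Cochain (resCx P E) (resCx P E) n} (hz : z ∈ cocycles F (resCx P E) (resCx P E) n)
    (j : Fin 2) : form R.η h' ((R.genCocycle j).1.comp z hn) =
      R.toKlein.mulGen (n := m) j (form R.η h z) := by
  refine LinearMap.ext fun x => ?_
  have h1 := Cochain.comp_v (R.genCocycle j).1 z hn (-((m + 1 : ℕ) : ℤ)) (-(m : ℤ)) 0 (by lia) h
  refine (congrArg (fun f => aug R.η (f.hom.toLinearMap x)) h1).trans ?_
  change form R.η h z (dLin E _ _ (R.κ _ j x) + R.κ _ j (dLin E _ _ x)) = _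
  rw [map_add, form_dLin R.η h (by lia) hz, zero_add]
  rfl

lemma coef_gen_zero_comp_zero {n : ℤ} {m : ℕ} (h : -(m : ℤ) + n = 0)
    (h' : -((m + 1 : ℕ) : ℤ) + (1 + n) = 0) (x : ExtP P E E n) :
    R.coef h' 0 (HomCoh.comp 1 n (R.gen 0) x) = 0 := by
  obtain ⟨z, rfl⟩ := HomCoh.mk_surjective n x
  rw [gen, HomCoh.comp_mk, coef_mk, R.form_gen_comp h h' rfl z.2]
  exact (R.inv_form h z.1).mulGen_zero_k_zero

lemma coef_gen_zero_comp_succ {n : ℤ} {m : ℕ} (h : -(m : ℤ) + n = 0)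
    (h' : -((m + 1 : ℕ) : ℤ) + (1 + n) = 0) (i : ℕ) (x : ExtP P E E n) :
    R.coef h' (i + 1) (HomCoh.comp 1 n (R.gen 0) x) = R.coef h i x := by
  obtain ⟨z, rfl⟩ := HomCoh.mk_surjective n x
  rw [gen, HomCoh.comp_mk, coef_mk, R.form_gen_comp h h' rfl z.2]
  exact (R.inv_form h z.1).mulGen_zero_k_succ i

lemma coef_gen_one_comp {n : ℤ} {m : ℕ} (h : -(m : ℤ) + n = 0)
    (h' : -((m + 1 : ℕ) : ℤ) + (1 + n) = 0) (i : ℕ) (x : ExtP P E E n) :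
    R.coef h' i (HomCoh.comp 1 n (R.gen 1) x) = R.coef h i x := by
  obtain ⟨z, rfl⟩ := HomCoh.mk_surjective n x
  rw [gen, HomCoh.comp_mk, coef_mk, R.form_gen_comp h h' rfl z.2]
  exact (R.inv_form h z.1).mulGen_one_k i

lemma eq_zero_of_coef {n : ℤ} {m : ℕ} (h : -(m : ℤ) + n = 0) {x : ExtP P E E n}
    (hx : ∀ i ≤ m, R.coef h i x = 0) : x = 0 := by
  obtain ⟨z, rfl⟩ := HomCoh.mk_surjective n x
  have h1 := R.isRes.isKProjective_res P
  have h2 := KleinResolution.isCob_of_k_eq_zero (R.inv_form h z.1) (R.cyc_form h z.2) hx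
  refine (HomCoh.mk_eq_zero _).2 ?_
  cases m with
  | zero =>
    refine exists_δ_eq_of_form R.η h rfl z 0 (fun _ _ => rfl) fun x => ?_
    exact LinearMap.congr_fun h2 x
  | succ m =>
    obtain ⟨b, hb, hb'⟩ := h2
    exact exists_δ_eq_of_form R.η h (q := -(m : ℤ)) (by lia) z b
      ((comp_rho_iff ((E.X _).ρ.comp P.subtype) b).2 hb) hb'

end ResData

end Theta

/-! ### Binary forms. -/

section Polynomial

variable {F : Type u} [Field F]

/-- The binary form of degree `m` with given coefficients. -/
def binForm (m : ℕ) (c : ℕ → F) : MvPolynomial (Fin 2) F :=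
  ∑ i ∈ Finset.range (m + 1), MvPolynomial.monomial (Finsupp.single 0 i + Finsupp.single 1 (m - i)) (c i)

lemma isHomogeneous_binForm (m : ℕ) (c : ℕ → F) : (binForm m c).IsHomogeneous m := by
  refine MvPolynomial.IsHomogeneous.sum _ _ _ fun i hi => ?_
  refine MvPolynomial.isHomogeneous_monomial _ ?_
  have := Finset.mem_range.1 hi
  rw [map_add, Finsupp.degree_single, Finsupp.degree_single]
  lia

lemma binForm_coef {m : ℕ} {c : ℕ → F} {i : ℕ} (hi : i ≤ m) :
    (binForm m c).coeff (Finsupp.single 0 i + Finsupp.single 1 (m - i)) = c i := by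
  rw [binForm, MvPolynomial.coeff_sum, Finset.sum_eq_single i]
  · rw [MvPolynomial.coeff_monomial, if_pos rfl]
  · intro j _ hj
    rw [MvPolynomial.coeff_monomial, if_neg]
    intro h
    have := DFunLike.congr_fun h 0
    simp at this
    exact hj this
  · intro h
    exact absurd (Finset.mem_range.2 (by lia)) h

lemma binForm_zero_mul {m : ℕ} {c d : ℕ → F} (h0 : d 0 = 0) (h : ∀ i, d (i + 1) = c i) :
    binForm (m + 1) d = MvPolynomial.X 0 * binForm m c := by
  rw [binForm, Finset.sum_range_succ', h0, map_zero, add_zero, binForm, Finset.mul_sum]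
  refine Finset.sum_congr rfl fun i _ => ?_
  rw [h, MvPolynomial.X, MvPolynomial.monomial_mul, one_mul, Nat.add_sub_add_right,
    ← add_assoc, ← Finsupp.single_add, add_comm 1 i]

lemma binForm_one_mul {m : ℕ} {c d : ℕ → F} (h0 : c (m + 1) = 0) (h : ∀ i, d i = c i) :
    binForm (m + 1) d = MvPolynomial.X 1 * binForm m c := by
  rw [binForm, Finset.sum_range_succ, h, h0, map_zero, add_zero, binForm, Finset.mul_sum]
  refine Finset.sum_congr rfl fun i hi => ?_
  have := Finset.mem_range.1 hi
  rw [h, MvPolynomial.X, MvPolynomial.monomial_mul, one_mul, add_left_comm,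
    ← Finsupp.single_add, show m + 1 - i = 1 + (m - i) by lia]

lemma binForm_add (m : ℕ) (c d : ℕ → F) : binForm m (c + d) = binForm m c + binForm m d := by
  rw [binForm, binForm, binForm, ← Finset.sum_add_distrib]
  exact Finset.sum_congr rfl fun i _ => map_add _ _ _

lemma binForm_smul (m : ℕ) (r : F) (c : ℕ → F) : binForm m (r • c) = r • binForm m c := by
  rw [binForm, binForm, Finset.smul_sum]
  exact Finset.sum_congr rfl fun i _ => map_smul (MvPolynomial.monomial _) r (c i)

lemma sub_C_constantCoeff_mem (f : MvPolynomial (Fin 2) F) :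
    f - MvPolynomial.C (MvPolynomial.constantCoeff f) ∈
      Ideal.span {(MvPolynomial.X 0 : MvPolynomial (Fin 2) F), MvPolynomial.X 1} := by
  induction f using MvPolynomial.induction_on with
  | C r => rw [MvPolynomial.constantCoeff_C, sub_self]; exact zero_mem _
  | add f g hf hg =>
    rw [map_add, map_add, add_sub_add_comm]
    exact add_mem hf hg
  | mul_X f j _ =>
    rw [map_mul, MvPolynomial.constantCoeff_X, mul_zero, map_zero, sub_zero]
    refine Ideal.mul_mem_left _ _ (Ideal.subset_span ?_)
    fin_cases j
    · exact Or.inl rfl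
    · exact Or.inr rfl

end Polynomial

/-! ### The isomorphism of H*(BP) with a polynomial ring. -/

section Iso

variable {F : Type u} [Field F] [CharP F 2] {G : Type u} [Group G] {P : Subgroup G}
  [IsKleinFour P] {E : CochainComplex (Rep.{u} F G) ℤ} (R : ResData P E)

namespace ResData

/-- The polynomial attached to a homogeneous cohomology class. -/
def theta (n : ℤ) : ExtP P E E n →ₗ[F] MvPolynomial (Fin 2) F :=
  if h : 0 ≤ n then
    { toFun := fun x => binForm n.toNat fun i => R.coef (m := n.toNat) (by lia) i x
      map_add' := fun x y => by
        rw [← binForm_add]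
        exact congrArg _ (funext fun i => map_add _ x y)
      map_smul' := fun r x => by
        rw [RingHom.id_apply, ← binForm_smul]
        exact congrArg _ (funext fun i => map_smul _ r x) }
  else 0

lemma theta_apply {n : ℤ} {m : ℕ} (h : -(m : ℤ) + n = 0) (x : ExtP P E E n) :
    R.theta n x = binForm m fun i => R.coef h i x := by
  obtain rfl : m = n.toNat := by lia
  rw [theta, dif_pos (by lia)]
  rfl

lemma isHomogeneous_theta (n : ℤ) (x : ExtP P E E n) : (R.theta n x).IsHomogeneous n.toNat := by
  rcases lt_or_ge n 0 with h | h
  · rw [theta, dif_neg (by lia)]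
    exact MvPolynomial.isHomogeneous_zero _ _ _
  · rw [R.theta_apply (m := n.toNat) (by lia)]
    exact isHomogeneous_binForm _ _

variable [Finite G]

lemma theta_injective (n : ℤ) : Function.Injective (R.theta n) := by
  refine (injective_iff_map_eq_zero _).2 fun x hx => ?_
  rcases lt_or_ge n 0 with h | h
  · have := subsingleton_ext_of_neg (P := P) R.isRes h
    exact Subsingleton.elim _ _
  · have hm : -(n.toNat : ℤ) + n = 0 := by lia
    rw [R.theta_apply hm] at hx
    refine R.eq_zero_of_coef hm fun i hi => ?_
    rw [← binForm_coef (c := fun i => R.coef hm i x) hi, hx, MvPolynomial.coeff_zero]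

lemma theta_gen_comp (j : Fin 2) (n : ℤ) (x : ExtP P E E n) :
    R.theta (1 + n) (HomCoh.comp 1 n (R.gen j) x) = MvPolynomial.X j * R.theta n x := by
  rcases lt_or_ge n 0 with h | h
  · have := subsingleton_ext_of_neg (P := P) R.isRes h
    rw [Subsingleton.elim x 0, map_zero, map_zero, map_zero, mul_zero]
  · have hm : -(n.toNat : ℤ) + n = 0 := by lia
    have hm' : -((n.toNat + 1 : ℕ) : ℤ) + (1 + n) = 0 := by lia
    rw [R.theta_apply hm, R.theta_apply hm']
    fin_cases j
    · exact binForm_zero_mul (R.coef_gen_zero_comp_zero hm hm' x)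
        fun i => R.coef_gen_zero_comp_succ hm hm' i x
    · exact binForm_one_mul (R.coef_eq_zero hm (by lia) x)
        fun i => R.coef_gen_one_comp hm hm' i x

variable [P.Normal]

variable (P E) in
/-- The polynomial attached to a cohomology class. -/
def thetaTot (R : ResData P E) : CohRing P E →ₗ[F] MvPolynomial (Fin 2) F :=
  DirectSum.toModule F ℤ _ R.theta

lemma thetaTot_of (n : ℤ) (x : ExtP P E E n) :
    thetaTot P E R (DirectSum.of (fun n => ExtP P E E n) n x) = R.theta n x :=
  DirectSum.toModule_lof F n x

/-- The generators of the cohomology ring of a Klein four-group. -/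
def x (j : Fin 2) : CohRing P E := DirectSum.of (fun n => ExtP P E E n) 1 (R.gen j)

lemma thetaTot_x_mul (j : Fin 2) (a : CohRing P E) :
    thetaTot P E R (R.x j * a) = MvPolynomial.X j * thetaTot P E R a := by
  induction a using DirectSum.induction_on with
  | zero => rw [mul_zero, map_zero, mul_zero]
  | add a b ha hb => rw [mul_add, map_add, map_add, mul_add, ha, hb]
  | of n a =>
    rw [x, DirectSum.of_mul_of]
    refine (R.thetaTot_of (1 + n) _).trans ((R.theta_gen_comp j n a).trans ?_)
    exact congrArg _ (R.thetaTot_of n a).symm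

lemma thetaTot_one : thetaTot P E R 1 = 1 := by
  refine (R.thetaTot_of 0 (HomCoh.one F _)).trans ?_
  rw [R.theta_apply (m := 0) (by lia), binForm, Finset.sum_range_one]
  have h : R.coef (n := 0) (m := 0) (by lia) 0 (HomCoh.one F (resCx P E)) = 1 :=
    (congrArg (fun f => aug R.η (f.hom.toLinearMap (R.k 0 0)))
      (Cochain.ofHom_v (𝟙 (resCx P E)) 0)).trans R.aug_k
  rw [h, Finsupp.single_zero, Nat.sub_zero, Finsupp.single_zero, add_zero]
  rfl

lemma homogeneousComponent_thetaTot (m : ℕ) (a : CohRing P E) :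
    MvPolynomial.homogeneousComponent m (thetaTot P E R a) = R.theta m (a m) := by
  induction a using DirectSum.induction_on with
  | zero => rw [map_zero, map_zero, DirectSum.zero_apply, map_zero]
  | add a b ha hb => rw [map_add, map_add, ha, hb, DirectSum.add_apply, map_add]
  | of n a =>
    rw [thetaTot_of]
    rcases lt_or_ge n 0 with h | h
    · have := subsingleton_ext_of_neg (P := P) R.isRes h
      rw [Subsingleton.elim a 0, map_zero, map_zero, map_zero, DirectSum.zero_apply, map_zero]
    · obtain ⟨n, rfl⟩ := Int.eq_ofNat_of_zero_le h
      rw [MvPolynomial.homogeneousComponent_of_mem (R.isHomogeneous_theta _ a), Int.toNat_natCast]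
      split_ifs with hmn
      · subst hmn
        rw [DirectSum.of_eq_same]
      · rw [DirectSum.of_eq_of_ne _ _ _ (by exact_mod_cast hmn), map_zero]

lemma thetaTot_injective : Function.Injective (thetaTot P E R) := by
  refine (injective_iff_map_eq_zero _).2 fun a ha => DFinsupp.ext fun n => ?_
  rcases lt_or_ge n 0 with h | h
  · have := subsingleton_ext_of_neg (P := P) R.isRes h
    exact Subsingleton.elim _ _
  · obtain ⟨n, rfl⟩ := Int.eq_ofNat_of_zero_le h
    apply R.theta_injective
    rw [← R.homogeneousComponent_thetaTot, ha, map_zero]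
    exact (map_zero _).symm

lemma thetaTot_surjective : Function.Surjective (thetaTot P E R) := fun f => by
  induction f using MvPolynomial.induction_on with
  | C r => exact ⟨r • 1, by rw [map_smul, thetaTot_one, MvPolynomial.C_eq_smul_one]⟩
  | add f g hf hg =>
    obtain ⟨a, rfl⟩ := hf
    obtain ⟨b, rfl⟩ := hg
    exact ⟨a + b, map_add _ _ _⟩
  | mul_X f j hf =>
    obtain ⟨a, rfl⟩ := hf
    exact ⟨R.x j * a, by rw [thetaTot_x_mul, mul_comm]⟩

/-- The evaluations only give compatibility with left multiplication by a generator. Bijectivity,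
already established, permits induction on the polynomial of the left factor. -/
lemma thetaTot_mul (a b : CohRing P E) :
    thetaTot P E R (a * b) = thetaTot P E R a * thetaTot P E R b := by
  suffices h : ∀ f a, thetaTot P E R a = f → thetaTot P E R (a * b) = f * thetaTot P E R b from
    h _ a rfl
  intro f
  induction f using MvPolynomial.induction_on with
  | C r =>
    intro a ha
    obtain rfl : a = r • 1 := R.thetaTot_injective (by
      rw [ha, map_smul, thetaTot_one, MvPolynomial.C_eq_smul_one])
    rw [smul_mul_assoc, one_mul, map_smul, MvPolynomial.C_mul']
  | add f g hf hg =>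
    intro a ha
    obtain ⟨a', rfl⟩ := R.thetaTot_surjective f
    obtain ⟨b', rfl⟩ := R.thetaTot_surjective g
    obtain rfl : a = a' + b' := R.thetaTot_injective (by rw [ha, map_add])
    rw [add_mul, map_add, hf a' rfl, hg b' rfl, add_mul]
  | mul_X f j hf =>
    intro a ha
    obtain ⟨a', rfl⟩ := R.thetaTot_surjective f
    obtain rfl : a = R.x j * a' := R.thetaTot_injective (by rw [ha, thetaTot_x_mul, mul_comm])
    rw [mul_assoc, thetaTot_x_mul, hf a' rfl, ← mul_assoc, mul_comm (MvPolynomial.X j)]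

/-- The cohomology ring of a Klein four-group is a polynomial ring. -/
def phi : MvPolynomial (Fin 2) F ≃ₐ[F] CohRing P E :=
  (AlgEquiv.ofLinearEquiv (LinearEquiv.ofBijective (thetaTot P E R)
    ⟨R.thetaTot_injective, R.thetaTot_surjective⟩) R.thetaTot_one R.thetaTot_mul).symm

lemma phi_symm_apply (a : CohRing P E) : R.phi.symm a = thetaTot P E R a := rfl

lemma phi_X (j : Fin 2) : R.phi (MvPolynomial.X j) = R.x j := by
  refine (AlgEquiv.symm_apply_eq _).1 ?_ |>.symm
  rw [phi_symm_apply]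
  have h := R.thetaTot_x_mul j 1
  rwa [mul_one, thetaTot_one, mul_one] at h

lemma phi_mem_extDeg {m : ℕ} {f : MvPolynomial (Fin 2) F} (hf : f.IsHomogeneous m) :
    R.phi f ∈ extDeg P E E m := by
  refine ⟨(R.phi f) m, R.phi.symm.injective ?_⟩
  rw [AlgEquiv.symm_apply_apply]
  have h := R.homogeneousComponent_thetaTot m (R.phi f)
  rw [← phi_symm_apply, AlgEquiv.symm_apply_apply,
    MvPolynomial.homogeneousComponent_of_mem hf, if_pos rfl] at h
  exact (R.thetaTot_of m _).trans h.symm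

lemma isHomogeneous_phi_symm {m : ℕ} {a : CohRing P E} (ha : a ∈ extDeg P E E m) :
    (R.phi.symm a).IsHomogeneous m := by
  obtain ⟨x, rfl⟩ := ha
  exact (R.thetaTot_of m x) ▸ R.isHomogeneous_theta m x

lemma posIdeal_eq : posIdeal P E = Ideal.span {R.x 0, R.x 1} := by
  refine le_antisymm (Ideal.span_le.2 ?_) (Ideal.span_le.2 ?_)
  · rintro a ⟨n, hn, ha⟩
    have h1 : (R.phi.symm a).IsHomogeneous n.toNat :=
      R.isHomogeneous_phi_symm (by rwa [Int.toNat_of_nonneg hn.le])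
    have h2 := sub_C_constantCoeff_mem (R.phi.symm a)
    rw [MvPolynomial.constantCoeff_eq, h1.coeff_eq_zero (by rw [map_zero]; lia), map_zero, sub_zero,
      Ideal.mem_span_pair] at h2
    obtain ⟨f, g, hfg⟩ := h2
    have h3 := congrArg R.phi hfg
    rw [AlgEquiv.apply_symm_apply, map_add, map_mul, map_mul, phi_X, phi_X] at h3
    rw [← h3]
    exact add_mem (Ideal.mul_mem_left _ _ (Ideal.subset_span (Or.inl rfl)))
      (Ideal.mul_mem_left _ _ (Ideal.subset_span (Or.inr rfl)))
  · rintro _ (rfl | rfl)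
    · exact Ideal.subset_span ⟨1, one_pos, R.gen 0, rfl⟩
    · exact Ideal.subset_span ⟨1, one_pos, R.gen 1, rfl⟩

end ResData

end Iso


/-! ### Conjugation by G on the generators. -/

section Conj

variable {F : Type u} [Field F] [CharP F 2]

lemma chi_comp {H : Type u} [Group H] [IsKleinFour H] (θ : H →* H) (j : Fin 2) (p : H) :
    chi F j (θ p) = ∑ i, chi F j (θ (gen H i)) * chi F i p := by
  rw [Fin.sum_univ_two]
  rcases klein_cases p with rfl | rfl | rfl | rfl <;>
    simp [chi_mul, chi_gen, chi_one]

variable {G : Type u} [Group G] {P : Subgroup G} [P.Normal] [IsKleinFour P]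

variable (F P) in
/-- The matrix of the conjugation action on a Klein four-subgroup. -/
def conjCoef (g : G) (i j : Fin 2) : F := chi F j (MulAut.conjNormal (H := P) g⁻¹ (gen P i))

lemma rho_conjNormal (X : Rep.{u} F G) (g : G) (h : P) (x : X) :
    X.ρ g (X.ρ (MulAut.conjNormal (H := P) g⁻¹ h) x) = X.ρ h (X.ρ g x) := by
  simp [← Module.End.mul_apply, ← map_mul, mul_assoc]

/-- Move `g` to the left: λ_i g = g(g⁻¹g_i g - 1), then expand the conjugate of g_i by `rho_eq`. -/
lemma lamP_rho (X : Rep.{u} F G) (g : G) (i : Fin 2) (x : X) :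
    lamP P X i (X.ρ g x) = X.ρ g (conjCoef F P g i 0 • lamP P X 0 x +
      conjCoef F P g i 1 • lamP P X 1 x +
      (conjCoef F P g i 0 * conjCoef F P g i 1) • lamP P X 0 (lamP P X 1 x)) := by
  have h1 := rho_eq (X.ρ.comp P.subtype) (MulAut.conjNormal (H := P) g⁻¹ (gen P i)) x
  have h2 := congrArg (X.ρ g) h1
  rw [lam_apply]
  refine (congrArg (· + _) (rho_conjNormal X g (gen P i) x).symm).trans ?_
  refine (congrArg (· + _) h2).trans ?_
  rw [add_assoc, add_assoc, map_add, add_comm, ← add_assoc, add_self_of_charTwo F, zero_add,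
    add_assoc]
  rfl

variable {E : CochainComplex (Rep.{u} F G) ℤ} (R : ResData P E)

namespace ResData

lemma κ_conj (p : ℤ) (g : G) (j : Fin 2) (h : P) (x : E.X p) :
    (E.X p).ρ g (R.κ p j ((E.X p).ρ g⁻¹ ((E.X p).ρ h x))) =
      (E.X p).ρ h ((E.X p).ρ g (R.κ p j ((E.X p).ρ g⁻¹ x))) +
        chi F j (MulAut.conjNormal (H := P) g⁻¹ h) • (E.X p).ρ h x := by
  have h1 : (E.X p).ρ g⁻¹ ((E.X p).ρ h x) =
      (E.X p).ρ (MulAut.conjNormal (H := P) g⁻¹ h) ((E.X p).ρ g⁻¹ x) := by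
    simp [← Module.End.mul_apply, ← map_mul, mul_assoc]
  rw [h1, R.κ_rho, map_add, map_smul, rho_conjNormal, rho_conjNormal,
    Representation.self_inv_apply]

/-- The homotopy between a conjugate of a generator and a combination of generators. -/
def conjHomotopy (g : G) (j : Fin 2) (p : ℤ) :
    Rep.res P.subtype (E.X p) ⟶ Rep.res P.subtype (E.X p) :=
  resHom P ((E.X p).ρ g ∘ₗ R.κ p j ∘ₗ (E.X p).ρ g⁻¹ + ∑ i, conjCoef F P g i j • R.κ p i)
    fun h x => by
      rw [LinearMap.add_apply, LinearMap.add_apply, LinearMap.sum_apply, LinearMap.sum_apply,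
        map_add, map_sum]
      have h1 := R.κ_conj p g j h x
      -- The conjugate of κ_j and the combination of the κ_i are derivations along the same
      -- character of P, since a character is determined by its values on the generators. Their sum
      -- is therefore P-linear.
      have h2 : ∑ i, (conjCoef F P g i j • R.κ p i) ((E.X p).ρ h x) =
          ∑ i, (E.X p).ρ h ((conjCoef F P g i j • R.κ p i) x) +
            chi F j (MulAut.conjNormal (H := P) g⁻¹ h) • (E.X p).ρ h x := by
        have h3 := chi_comp (F := F) (MulAut.conjNormal (H := P) g⁻¹).toMonoidHom j h
        refine Eq.trans ?_ (congrArg (_ + · • (E.X p).ρ h x) h3.symm)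
        rw [Finset.sum_smul, ← Finset.sum_add_distrib]
        refine Finset.sum_congr rfl fun i _ => ?_
        rw [LinearMap.smul_apply, R.κ_rho, smul_add, LinearMap.smul_apply, map_smul, smul_smul]
        rfl
      refine (congrArg₂ (· + ·) h1 h2).trans ?_
      rw [add_add_add_comm, add_self_of_charTwo F, add_zero]
      rfl

/-- The P-linear difference `conjHomotopy` of the two derivations is a homotopy between the
conjugate of the generator and the linear combination. -/
lemma extRepG_gen (g : G) (j : Fin 2) :
    extRepG P E E 1 g (R.gen j) = ∑ i, conjCoef F P g i j • R.gen i := by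
  rw [← sub_eq_zero]
  have h1 : ∑ i, conjCoef F P g i j • R.gen i =
      HomCoh.mk F _ _ 1 (∑ i, conjCoef F P g i j • R.genCocycle i) := by
    rw [map_sum]
    exact Finset.sum_congr rfl fun i _ => (map_smul _ _ _).symm
  rw [h1, gen, extRepG_mk, ← map_sub, HomCoh.mk_eq_zero]
  refine ⟨(Cochain.ofHoms (R.conjHomotopy g j) : Cochain (resCx P E) (resCx P E) 0), ?_⟩
  refine Cochain.ext _ _ fun p q h => hom_eq (X := E.X p) (Y := E.X q) fun x => ?_
  refine (cv_δ (zero_add 1) _ p q h p q (by lia) h x).trans ?_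
  have h2 (p : ℤ) (h : p + 0 = p) (x : E.X p) : cv (Cochain.ofHoms (R.conjHomotopy g j) :
      Cochain (resCx P E) (resCx P E) 0) p p h x =
        (E.X p).ρ g (R.κ p j ((E.X p).ρ g⁻¹ x)) + ∑ i, conjCoef F P g i j • R.κ p i x := by
    refine (congrArg (fun f : Rep.res P.subtype (E.X p) ⟶ Rep.res P.subtype (E.X p) =>
      f.hom.toLinearMap x) (Cochain.ofHoms_v (F := resCx P E) (G := resCx P E)
        (R.conjHomotopy g j) p)).trans ?_
    exact congrArg ((E.X p).ρ g (R.κ p j ((E.X p).ρ g⁻¹ x)) + ·)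
      (LinearMap.sum_apply (M := E.X p) (M₂ := E.X p) _ _ x)
  have h3 : cv (∑ i, conjCoef F P g i j • R.genCocycle i :
      cocycles F (resCx P E) (resCx P E) 1).1 p q h x =
      ∑ i, conjCoef F P g i j • (dLin E p q (R.κ p i x) + R.κ q i (dLin E p q x)) := by
    rw [Fin.sum_univ_two, Fin.sum_univ_two]
    rfl
  rw [h2, h2]
  change _ = (E.X q).ρ g (dLin E p q (R.κ p j ((E.X p).ρ g⁻¹ x)) +
    R.κ q j (dLin E p q ((E.X p).ρ g⁻¹ x))) - cv (∑ i, conjCoef F P g i j • R.genCocycle i :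
      cocycles F (resCx P E) (resCx P E) 1).1 p q h x
  rw [h3, sub_eq_add_of_charTwo F, map_add, map_add, dLin_rho, dLin_rho, add_add_add_comm, map_sum]
  congr 1
  rw [← Finset.sum_add_distrib]
  refine Finset.sum_congr rfl fun i _ => ?_
  rw [map_smul, smul_add]

lemma extTotRep_x (g : G) (j : Fin 2) :
    extTotRep P E E (g : G ⧸ P) (R.x j) = ∑ i, conjCoef F P g i j • R.x i := by
  refine (extTotRep_of P E E (g : G ⧸ P) 1 (R.gen j)).trans ?_
  have h : extRep P E E 1 (g : G ⧸ P) (R.gen j) = ∑ i, conjCoef F P g i j • R.gen i :=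
    R.extRepG_gen g j
  rw [h]
  refine (map_sum (DirectSum.lof F ℤ (fun n => ExtP P E E n) 1) _ _).trans ?_
  exact Finset.sum_congr rfl fun i _ => map_smul _ _ _

end ResData

end Conj

/-! ### The fundamental relation x_0[λ_0 w] + x_1[λ_1 w] = [dw]. -/

section Relation

variable {F : Type u} [Field F] [CharP F 2] {G : Type u} [Group G] {P : Subgroup G}
  [IsKleinFour P] {E C : CochainComplex (Rep.{u} F G) ℤ} (R : ResData P E)

lemma mem_fixedCocycles_iff {n : ℤ} {c : C.X n} : c ∈ fixedCocycles P C n ↔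
    (∀ i, lamP P (C.X n) i c = 0) ∧ dLin C n (n + 1) c = 0 :=
  and_congr_left fun _ => fixed_iff ((C.X n).ρ.comp P.subtype) c

lemma cv_single {n m : ℤ} (f : Rep.res P.subtype (E.X 0) ⟶ Rep.res P.subtype (C.X n))
    (h : 0 + m = n) (x : E.X 0) :
    cv (Cochain.single (K := resCx P E) (L := resCx P C) (p := 0) (q := n) f m) 0 n h x =
      f.hom.toLinearMap x := by
  obtain rfl : m = n := by lia
  exact congrArg (fun f => f.hom.toLinearMap x)
    (Cochain.single_v (K := resCx P E) (L := resCx P C) f _ _)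

lemma cv_single_ne {n m p q : ℤ} (f : Rep.res P.subtype (E.X 0) ⟶ Rep.res P.subtype (C.X n))
    (h : p + m = q) (hp : p ≠ 0) (x : E.X p) :
    cv (Cochain.single (K := resCx P E) (L := resCx P C) (p := 0) (q := n) f m) p q h x = 0 :=
  congrArg (fun f : Rep.res P.subtype (E.X p) ⟶ Rep.res P.subtype (C.X q) => f.hom.toLinearMap x)
    (Cochain.single_v_eq_zero (K := resCx P E) (L := resCx P C) f _ _ _ _ hp)

lemma cv_const (η : E ⟶ trivCx F G) {n : ℤ} {c : C.X n} (hc : ∀ p : P, (C.X n).ρ p c = c)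
    (h : 0 + n = n) (x : E.X 0) : cv (constCochain P η c hc) 0 n h x = aug η x • c :=
  congrArg (fun f => f.hom.toLinearMap x) (constCochain_v η c hc h)

lemma cv_const_ne (η : E ⟶ trivCx F G) {n p q : ℤ} {c : C.X n} (hc : ∀ p : P, (C.X n).ρ p c = c)
    (h : p + n = q) (hp : p ≠ 0) (x : E.X p) : cv (constCochain P η c hc) p q h x = 0 :=
  congrArg (fun f => f.hom.toLinearMap x) (constCochain_v_ne η c hc h hp)

namespace ResData

/-- The homotopy attached to a vector which is annihilated by the square of the
augmentation ideal. -/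
def relHom {X : Rep.{u} F G} (w : X) (hw : lamP P X 0 (lamP P X 1 w) = 0) :
    Rep.res P.subtype (E.X 0) ⟶ Rep.res P.subtype X :=
  resHom P ((aug R.η).smulRight w + ∑ j, (aug R.η ∘ₗ R.κ 0 j).smulRight (lamP P X j w)) <|
    intertwining_of_lam (ρ := (E.X 0).ρ.comp P.subtype) (σ := X.ρ.comp P.subtype) fun i x => by
      -- The defect of κ_j supplies the term ε(x) λ_i w that x ↦ ε(x) w alone lacks for
      -- equivariance.
      have h1 (j : Fin 2) : aug R.η (R.κ 0 j (lamP P _ i x)) = if i = j then aug R.η x else 0 := by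
        rw [R.κ_lam, map_add, aug_lamP, zero_add]
        split_ifs
        · rw [map_add, aug_lamP, zero_add]
        · rw [map_zero]
      have h2 (j : Fin 2) : lamP P X i (lamP P X j w) = 0 := by
        fin_cases i <;> fin_cases j
        · exact lam_lam_self _ _ _
        · exact hw
        · exact (lam_comm _ _).trans hw
        · exact lam_lam_self _ _ _
      simp only [LinearMap.add_apply, LinearMap.sum_apply, LinearMap.smulRight_apply, map_add,
        map_sum, map_smul, LinearMap.comp_apply, h2, smul_zero, Finset.sum_const_zero, add_zero]
      rw [aug_lamP, zero_smul, zero_add]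
      simp only [h1, ite_smul, zero_smul, Finset.sum_ite_eq, Finset.mem_univ, if_true]

lemma relHom_apply {X : Rep.{u} F G} (w : X) (hw : lamP P X 0 (lamP P X 1 w) = 0) (x : E.X 0) :
    (R.relHom w hw).hom.toLinearMap x =
      aug R.η x • w + (aug R.η (R.κ 0 0 x) • lamP P X 0 w + aug R.η (R.κ 0 1 x) • lamP P X 1 w) := by
  refine (LinearMap.add_apply _ _ x).trans ?_
  rw [LinearMap.sum_apply, Fin.sum_univ_two]
  rfl

variable {n : ℤ}

/-- Both sides differ by the coboundary of `relHom`, placed in source degree zero. In source degree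
0 the coboundary is ε(x) dw, as the λ_j w are cocycles; in source degree -1 it is Σ ε(κ_j dx) λ_j w,
which represents the products with the generators. -/
lemma gen_comp_fixedClass_add (w : C.X n) (hw : lamP P (C.X n) 0 (lamP P (C.X n) 1 w) = 0)
    (h : ∀ j, lamP P (C.X n) j w ∈ fixedCocycles P C n)
    (hd : dLin C n (1 + n) w ∈ fixedCocycles P C (1 + n)) :
    HomCoh.comp 1 n (R.gen 0) (fixedClass P R.η n ⟨_, h 0⟩) +
      HomCoh.comp 1 n (R.gen 1) (fixedClass P R.η n ⟨_, h 1⟩) =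
      fixedClass P R.η (1 + n) ⟨_, hd⟩ := by
  have h0 : HomCoh.mk F _ _ (1 + n)
      (⟨_, comp_mem_cocycles (R.genCocycle 0).2 (fixedCocycle P R.η n ⟨_, h 0⟩).2⟩ +
        ⟨_, comp_mem_cocycles (R.genCocycle 1).2 (fixedCocycle P R.η n ⟨_, h 1⟩).2⟩ -
        fixedCocycle P R.η (1 + n) ⟨_, hd⟩) = 0 := by
    rw [HomCoh.mk_eq_zero]
    refine ⟨Cochain.single (K := resCx P E) (L := resCx P C) (p := 0) (q := n)
      (R.relHom w hw) _, ?_⟩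
    refine Cochain.ext _ _ fun p q hpq => hom_eq (X := E.X p) (Y := C.X q) fun x => ?_
    have hr : cv ((R.genCocycle 0).1.comp (constCochain P R.η _ (h 0).1) rfl +
        (R.genCocycle 1).1.comp (constCochain P R.η _ (h 1).1) rfl -
          constCochain P R.η _ hd.1) p q hpq x =
        cv (constCochain P R.η (lamP P _ 0 w) (h 0).1) (p + 1) q (by lia)
          (dLin E p (p + 1) (R.κ p 0 x) + R.κ (p + 1) 0 (dLin E p (p + 1) x)) +
        cv (constCochain P R.η (lamP P _ 1 w) (h 1).1) (p + 1) q (by lia)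
          (dLin E p (p + 1) (R.κ p 1 x) + R.κ (p + 1) 1 (dLin E p (p + 1) x)) +
        cv (constCochain P R.η _ hd.1) p q hpq x := by
      rw [← sub_eq_add_of_charTwo F (cv _ _ _ _ _ + cv _ _ _ _ _)]
      have h1 := Cochain.comp_v (R.genCocycle 0).1 (constCochain P R.η _ (h 0).1) rfl p (p + 1) q
        rfl (by lia)
      have h2 := Cochain.comp_v (R.genCocycle 1).1 (constCochain P R.η _ (h 1).1) rfl p (p + 1) q
        rfl (by lia)
      exact congrArg₂ (· - ·) (congrArg₂ (· + ·) (congrArg (fun f => f.hom.toLinearMap x) h1)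
        (congrArg (fun f => f.hom.toLinearMap x) h2)) rfl
    refine Eq.trans ?_ hr.symm
    by_cases hp : p = 0
    · subst hp
      obtain rfl : q = 1 + n := by lia
      have h1 : Subsingleton (E.X (0 + 1)) :=
        (Rep.isZero_iff _ _ _).1 (R.isRes.isZero _ (by lia))
      refine (cv_δ (by lia) _ 0 _ hpq n (0 + 1) (by lia) rfl x).trans ?_
      rw [Subsingleton.elim (dLin E 0 (0 + 1) x) 0, cv_single, cv_const]
      simp only [Subsingleton.elim (dLin E 0 (0 + 1) _) 0, map_zero, add_zero, zero_add]
      rw [relHom_apply, map_add, map_add, map_smul, map_smul, map_smul]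
      have h2 (j : Fin 2) : dLin C n (1 + n) (lamP P (C.X n) j w) = 0 := by
        rw [add_comm 1 n]; exact (h j).2
      rw [h2, h2, smul_zero, smul_zero, add_zero, add_zero]
    by_cases hp1 : p = -1
    · subst hp1
      obtain rfl : q = n := by lia
      refine (cv_δ (by lia) _ (-1) _ hpq (q - 1) 0 rfl rfl x).trans ?_
      have h3 : aug R.η (dLin E (-1) 0 x) = 0 := aug_dLin _ _ _
      rw [cv_single_ne _ _ (by lia), map_zero, zero_add, cv_single, relHom_apply, h3, zero_smul,
        zero_add, cv_const_ne _ _ _ (by lia : (-1 : ℤ) ≠ 0), add_zero]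
      -- The augmentation kills boundaries, so the missing summand dκ_j of the generator may be
      -- added freely.
      have h4 (j : Fin 2) : aug R.η (R.κ 0 j (dLin E (-1) 0 x)) =
          aug R.η (dLin E (-1) 0 (R.κ (-1) j x) + R.κ 0 j (dLin E (-1) 0 x)) := by
        rw [map_add, aug_dLin, zero_add]
      rw [h4, h4]
      exact congrArg₂ (· + ·) (cv_const R.η _ _ _).symm (cv_const R.η _ _ _).symm
    · refine (cv_δ (by lia) _ p q hpq (q - 1) (p + 1) rfl rfl x).trans ?_
      rw [cv_single_ne _ _ hp, cv_single_ne _ _ (by lia), cv_const_ne _ _ _ hp,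
        cv_const_ne _ _ _ (by lia), cv_const_ne _ _ _ (by lia), map_zero, add_zero, add_zero]
  rw [map_sub, map_add, sub_eq_zero] at h0
  exact h0

end ResData

end Relation


/-! ### The filtration in terms of λ_0 and λ_1. -/

section FilMod

variable {F : Type u} [Field F] [CharP F 2] {G : Type u} [Group G] {P : Subgroup G}
  [IsKleinFour P] {X : Rep.{u} F G}

lemma mem_filMod_zero {x : X} : x ∈ filMod P X 0 ↔ x = 0 := by
  constructor
  · intro h
    have h1 := h 1 (by rw [Submodule.pow_zero, Ideal.one_eq_top]; trivial)
    rwa [map_one, Module.End.one_apply] at h1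
  · rintro rfl
    exact zero_mem _

lemma filMod_rho [P.Normal] (k : ℕ) (p : P) {x : X} (hx : x ∈ filMod P X k) :
    X.ρ p x ∈ filMod P X k := filMod_inv P X k (p : G) hx

/-- By `rho_eq` each p - 1 is a combination of λ_0, λ_1 and λ_0λ_1, so λ_0 and λ_1 generate the
augmentation ideal. The index k stands for the vectors killed by the k-th power of that ideal. -/
lemma mem_filMod_succ [P.Normal] {k : ℕ} {x : X} :
    x ∈ filMod P X (k + 1) ↔ ∀ j, lamP P X j x ∈ filMod P X k := by
  constructor
  · intro h j
    have h1 := filMod_sub P X k (gen P j) x h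
    rw [sub_eq_add_of_charTwo F] at h1
    exact h1
  · intro h a ha
    have h1 (p : P) : X.ρ p x - x ∈ filMod P X k := by
      have h2 := rho_eq (X.ρ.comp P.subtype) p x
      have h3 : X.ρ p x - x = chi F 0 p • lamP P X 0 x + chi F 1 p • lamP P X 1 x +
          (chi F 0 p * chi F 1 p) • lamP P X 0 (lamP P X 1 x) := by
        rw [sub_eq_iff_eq_add']
        refine h2.trans ?_
        rw [add_assoc, add_assoc, add_assoc]
      rw [h3]
      refine add_mem (add_mem (Submodule.smul_mem _ _ (h 0)) (Submodule.smul_mem _ _ (h 1)))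
        (Submodule.smul_mem _ _ ?_)
      rw [lam_apply]
      exact add_mem (filMod_rho k (gen P 0) (h 1)) (h 1)
    have h2 (c : MonoidAlgebra F P) : Representation.asAlgebraHom (X.ρ.comp P.subtype) c x -
        MonoidAlgebra.lift F F P (1 : P →* F) c • x ∈ filMod P X k := by
      induction c using MonoidAlgebra.induction_on with
      | of p => simpa using h1 p
      | add a b ha hb =>
        rw [map_add, map_add, LinearMap.add_apply, add_smul, add_sub_add_comm]
        exact add_mem ha hb
      | smul r a ha =>
        rw [map_smul, map_smul, LinearMap.smul_apply, smul_assoc, ← smul_sub]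
        exact Submodule.smul_mem _ _ ha
    rw [Submodule.pow_succ] at ha
    refine Submodule.smul_induction_on ha (fun a ha b hb => ?_) (fun a b ha hb => ?_)
    · rw [smul_eq_mul, map_mul, Module.End.mul_apply]
      have h3 := h2 b
      rw [augIdeal, RingHom.mem_ker] at hb
      have h4 : MonoidAlgebra.lift F F P (1 : P →* F) b = 0 := hb
      rw [h4, zero_smul, sub_zero] at h3
      exact h3 a ha
    · rw [map_add, LinearMap.add_apply, ha, hb, add_zero]

variable [P.Normal]

lemma mem_filMod_one {x : X} : x ∈ filMod P X 1 ↔ ∀ j, lamP P X j x = 0 := by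
  rw [mem_filMod_succ]
  exact forall_congr' fun j => mem_filMod_zero

lemma mem_filMod_two {x : X} : x ∈ filMod P X 2 ↔ lamP P X 0 (lamP P X 1 x) = 0 := by
  rw [mem_filMod_succ]
  constructor
  · exact fun h => mem_filMod_one.1 (h 1) 0
  · intro h j
    refine mem_filMod_one.2 fun i => ?_
    fin_cases i <;> fin_cases j
    · exact lam_lam_self _ _ _
    · exact h
    · exact (lam_comm _ _).trans h
    · exact lam_lam_self _ _ _

/-- The third power of the augmentation ideal is zero, so gr has only the three pieces 0, 1 and 2.
-/
lemma filMod_eq_top {k : ℕ} (hk : 3 ≤ k) : filMod P X k = ⊤ := by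
  refine Nat.le_induction (Submodule.eq_top_iff'.2 fun x => ?_)
    (fun k _ ih => Submodule.eq_top_iff'.2 fun x => ?_) k hk
  · refine mem_filMod_succ.2 fun j => mem_filMod_two.2 ?_
    fin_cases j
    · exact (congrArg _ (lam_comm _ _)).trans (lam_lam_self _ _ _)
    · exact (congrArg _ (lam_lam_self _ _ _)).trans (map_zero _)
  · exact mem_filMod_succ.2 fun j => ih ▸ Submodule.mem_top

end FilMod

/-! ### Cocycles, cohomology classes and the associated graded space. -/

section HomologyClasses

variable {F : Type u} [Field F] {G : Type u} [Group G] (C : CochainComplex (Rep.{u} F G) ℤ)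

/-- The submodule of cocycles. -/
abbrev cyc (n : ℤ) : Submodule F (C.X n) := LinearMap.ker (dLin C n (n + 1))

/-- The identification of the two models of the cocycles. -/
def cyclesEquiv (n : ℤ) : C.cycles n ≃ₗ[F] cyc C n :=
  LinearEquiv.ofBijective ((C.iCycles n).hom.toLinearMap.codRestrict (cyc C n)
    fun z => dLin_iCycles C n (n + 1) z) <| by
      refine ⟨fun x y h => iCycles_injective C n (congrArg Subtype.val h), fun x => ?_⟩
      obtain ⟨z, hz⟩ := exists_cycle C rfl x.2
      exact ⟨z, Subtype.ext hz⟩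

/-- The cohomology class of a cocycle. -/
def hcls (n : ℤ) : cyc C n →ₗ[F] C.homology n :=
  (C.homologyπ n).hom.toLinearMap ∘ₗ (cyclesEquiv C n).symm.toLinearMap

variable {C} {n : ℤ}

lemma iCycles_cyclesEquiv_symm (z : cyc C n) :
    (C.iCycles n).hom.toLinearMap ((cyclesEquiv C n).symm z) = z.1 :=
  congrArg Subtype.val ((cyclesEquiv C n).apply_symm_apply z)

lemma hcls_cyclesEquiv (z : C.cycles n) :
    hcls C n (cyclesEquiv C n z) = (C.homologyπ n).hom.toLinearMap z :=
  congrArg (C.homologyπ n).hom.toLinearMap ((cyclesEquiv C n).symm_apply_apply z)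

lemma hcls_surjective : Function.Surjective (hcls C n) :=
  (homologyπ_surjective C n).comp (cyclesEquiv C n).symm.surjective

lemma hcls_eq_zero_iff {i : ℤ} (hi : i + 1 = n) (z : cyc C n) :
    hcls C n z = 0 ↔ ∃ y, dLin C i n y = z.1 := by
  refine (homologyπ_eq_zero_iff C hi _).trans (exists_congr fun y => ?_)
  exact Eq.congr_right (iCycles_cyclesEquiv_symm z)

lemma rho_mem_cyc (g : G) {z : C.X n} (hz : z ∈ cyc C n) : (C.X n).ρ g z ∈ cyc C n := by
  rw [LinearMap.mem_ker] at *
  rw [dLin_rho, hz, map_zero]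

lemma hcls_rho (g : G) (z : cyc C n) :
    (C.homology n).ρ g (hcls C n z) = hcls C n ⟨(C.X n).ρ g z.1, rho_mem_cyc g z.2⟩ := by
  obtain ⟨z, rfl⟩ := (cyclesEquiv C n).surjective z
  rw [hcls_cyclesEquiv]
  refine (Rep.hom_comm_apply (C.homologyπ n) g z).symm.trans ((hcls_cyclesEquiv _).symm.trans ?_)
  exact congrArg _ (Subtype.ext (Rep.hom_comm_apply (C.iCycles n) g z))

variable (P : Subgroup G)

lemma mem_filH_iff {k : ℕ} {x : C.homology n} :
    x ∈ filH P C n k ↔ ∃ z : cyc C n, z.1 ∈ filMod P (C.X n) k ∧ hcls C n z = x := by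
  constructor
  · rintro ⟨z, hz, rfl⟩
    exact ⟨cyclesEquiv C n z, hz, hcls_cyclesEquiv z⟩
  · rintro ⟨z, hz, rfl⟩
    refine ⟨(cyclesEquiv C n).symm z, ?_, rfl⟩
    exact (congrArg (· ∈ filMod P (C.X n) k) (iCycles_cyclesEquiv_symm z)).mpr hz

/-- The cocycles in a step of the filtration. -/
abbrev filCyc (C : CochainComplex (Rep.{u} F G) ℤ) (n : ℤ) (k : ℕ) : Submodule F (C.X n) :=
  filMod P (C.X n) k ⊓ cyc C n

/-- The class in the associated graded space of a cocycle in a step of the filtration. -/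
def grCls (C : CochainComplex (Rep.{u} F G) ℤ) (n : ℤ) (k : ℕ) :
    filCyc P C n (k + 1) →ₗ[F] GrPiece P C n k :=
  Submodule.mkQ _ ∘ₗ ((hcls C n ∘ₗ Submodule.inclusion inf_le_right).codRestrict
    (filH P C n (k + 1)) fun z => (mem_filH_iff P).2 ⟨⟨z.1, z.2.2⟩, z.2.1, rfl⟩)

variable {P}

lemma grCls_surjective (k : ℕ) : Function.Surjective (grCls P C n k) := by
  intro x
  obtain ⟨⟨x, hx⟩, rfl⟩ := Submodule.mkQ_surjective _ x
  obtain ⟨z, hz, rfl⟩ := (mem_filH_iff P).1 hx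
  exact ⟨⟨z.1, hz, z.2⟩, rfl⟩

lemma grCls_eq_zero_iff {i : ℤ} (hi : i + 1 = n) {k : ℕ} (z : filCyc P C n (k + 1)) :
    grCls P C n k z = 0 ↔ ∃ c ∈ filCyc P C n k, ∃ y, z.1 = c + dLin C i n y := by
  refine (Submodule.Quotient.mk_eq_zero _).trans ?_
  refine (mem_filH_iff P (C := C) (x := hcls C n ⟨z.1, z.2.2⟩)).trans ?_
  constructor
  · rintro ⟨c, hc, h⟩
    rw [eq_comm, ← sub_eq_zero, ← map_sub, hcls_eq_zero_iff hi] at h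
    obtain ⟨y, hy⟩ := h
    exact ⟨c.1, ⟨hc, c.2⟩, y, by rw [hy]; exact (add_sub_cancel _ _).symm⟩
  · rintro ⟨c, hc, y, h⟩
    refine ⟨⟨c, hc.2⟩, hc.1, ?_⟩
    rw [eq_comm, ← sub_eq_zero, ← map_sub, hcls_eq_zero_iff hi]
    exact ⟨y, (sub_eq_of_eq_add' h).symm⟩

variable [P.Normal]

lemma rho_mem_filCyc (g : G) {k : ℕ} {z : C.X n} (hz : z ∈ filCyc P C n k) :
    (C.X n).ρ g z ∈ filCyc P C n k :=
  ⟨filMod_inv P (C.X n) k g hz.1, rho_mem_cyc g hz.2⟩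

lemma grPieceRep_grCls (g : G) (k : ℕ) (z : filCyc P C n (k + 1)) :
    grPieceRep P C n k (g : G ⧸ P) (grCls P C n k z) =
      grCls P C n k ⟨(C.X n).ρ g z.1, rho_mem_filCyc g z.2⟩ :=
  congrArg (Submodule.mkQ _) (Subtype.ext (hcls_rho g ⟨z.1, z.2.2⟩))

end HomologyClasses


/-! ### Fixed vectors in perfect complexes. -/

section Norms

variable {F : Type u} [Field F] [CharP F 2] {G : Type u} [Group G] [Finite G] {P : Subgroup G}
  [IsKleinFour P] {C : CochainComplex (Rep.{u} F G) ℤ} {n : ℤ}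

lemma IsPerfect.exists_norm_eq (hC : IsPerfect C) {c : C.X n} (hc : ∀ j, lamP P (C.X n) j c = 0) :
    ∃ v, lamP P (C.X n) 0 (lamP P (C.X n) 1 v) = c := by
  have := Fintype.ofFinite P
  obtain ⟨τ, hτ⟩ := exists_isTraceSplitting_subgroup P _ (hC.projective n)
  exact hτ.exists_lam_lam_eq hc

/-- If c_i = λ_0λ_1 v_i, then w = λ_1 v_0 + λ_0 v_1 works, because the squares of the λ_j are zero.
-/
lemma IsPerfect.exists_lam_eq (hC : IsPerfect C) {c : Fin 2 → C.X n}
    (hc : ∀ i j, lamP P (C.X n) j (c i) = 0) :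
    ∃ w, (∀ j, lamP P (C.X n) j w = c j) ∧ lamP P (C.X n) 0 (lamP P (C.X n) 1 w) = 0 := by
  obtain ⟨v0, h0⟩ := hC.exists_norm_eq (hc 0)
  obtain ⟨v1, h1⟩ := hC.exists_norm_eq (hc 1)
  have h2 (j : Fin 2) : lamP P (C.X n) j (lamP P (C.X n) 1 v0 + lamP P (C.X n) 0 v1) = c j := by
    rw [map_add]
    fin_cases j
    · exact (congrArg₂ (· + ·) h0 (lam_lam_self _ _ _)).trans (add_zero _)
    · exact (congrArg₂ (· + ·) (lam_lam_self _ _ _) ((lam_comm _ _).trans h1)).trans (zero_add _)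
  exact ⟨_, h2, by rw [h2, hc]⟩

end Norms

/-! ### Consequences of the vanishing of Ext in one degree. -/

section Chase

variable {F : Type u} [Field F] [CharP F 2] {G : Type u} [Group G] {P : Subgroup G}
  [IsKleinFour P] {E C : CochainComplex (Rep.{u} F G) ℤ}

lemma lam_lam_of_norm {X : Rep.{u} F G} {w : X} (h : lamP P X 0 (lamP P X 1 w) = 0) (i j : Fin 2) :
    lamP P X i (lamP P X j w) = 0 := by
  fin_cases i <;> fin_cases j
  · exact lam_lam_self _ _ _
  · exact h
  · exact (lam_comm _ _).trans h
  · exact lam_lam_self _ _ _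

lemma lam_norm {X : Rep.{u} F G} (w : X) (i : Fin 2) :
    lamP P X i (lamP P X 0 (lamP P X 1 w)) = 0 := by
  fin_cases i
  · exact lam_lam_self _ _ _
  · exact (congrArg _ (lam_comm _ _).symm).trans (lam_lam_self _ _ _)

variable (P) in
/-- The operators `g - 1` on cocycles in the second step of the filtration. -/
def lamCyc [P.Normal] (C : CochainComplex (Rep.{u} F G) ℤ) (n : ℤ) (j : Fin 2) :
    filCyc P C n 2 →ₗ[F] fixedCocycles P C n :=
  (lamP P (C.X n) j ∘ₗ Submodule.subtype _).codRestrict _ fun z => mem_fixedCocycles_iff.2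
    ⟨fun i => lam_lam_of_norm (mem_filMod_two.1 z.2.1) i j, by
      have h := LinearMap.mem_ker.1 z.2.2
      rw [LinearMap.comp_apply, Submodule.subtype_apply, dLin_lamP, h, map_zero]⟩

variable (P) in
/-- The norm on cocycles. -/
def normCyc (C : CochainComplex (Rep.{u} F G) ℤ) (n : ℤ) :
    cyc C n →ₗ[F] fixedCocycles P C n :=
  (lamP P (C.X n) 0 ∘ₗ lamP P (C.X n) 1 ∘ₗ Submodule.subtype _).codRestrict _ fun z =>
    mem_fixedCocycles_iff.2 ⟨fun i => lam_norm _ i, by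
      have h := LinearMap.mem_ker.1 z.2
      rw [LinearMap.comp_apply, LinearMap.comp_apply, Submodule.subtype_apply, dLin_lamP,
        dLin_lamP, h, map_zero, map_zero]⟩

namespace ResData

variable (R : ResData P E) {n i : ℤ}

/-- The class of a fixed cocycle. -/
abbrev psi (C : CochainComplex (Rep.{u} F G) ℤ) (n : ℤ) : fixedCocycles P C n →ₗ[F] ExtP P E C n :=
  fixedClass P R.η n

variable [Finite G]

lemma psi_eq_zero_iff (hC : IsPerfect C) (hi : i + 1 = n) (c : fixedCocycles P C n) :
    R.psi C n c = 0 ↔ ∃ b, (∀ j, lamP P (C.X i) j b = 0) ∧ dLin C i n b = c.1 := by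
  have := hC.isKInjective_res P
  refine (fixedClass_eq_zero_iff R.η hi c).trans (exists_congr fun b => and_congr_left fun _ => ?_)
  exact fixed_iff ((C.X i).ρ.comp P.subtype) b

lemma psi_surjective (hC : IsPerfect C) : Function.Surjective (R.psi C n) := by
  have := hC.isKInjective_res P
  exact fixedClass_surjective R.η n

lemma exists_dLin_of_subsingleton (R : ResData P E) (hC : IsPerfect C) [Subsingleton (ExtP P E C n)] (hi : i + 1 = n)
    {c : C.X n} (hc : ∀ j, lamP P (C.X n) j c = 0) (hd : dLin C n (n + 1) c = 0) :
    ∃ b, (∀ j, lamP P (C.X i) j b = 0) ∧ dLin C i n b = c :=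
  (R.psi_eq_zero_iff hC hi ⟨c, mem_fixedCocycles_iff.2 ⟨hc, hd⟩⟩).1 (Subsingleton.elim _ _)

/-- The norm of `v` is a fixed cocycle, hence the boundary of a fixed vector, and that vector is
again a norm. -/
lemma exists_norm_sub_dLin (R : ResData P E) (hC : IsPerfect C) [Subsingleton (ExtP P E C n)] (hi : i + 1 = n)
    {v : C.X n} (hd : dLin C n (n + 1) (lamP P _ 0 (lamP P _ 1 v)) = 0) :
    ∃ y, lamP P _ 0 (lamP P _ 1 (v - dLin C i n y)) = 0 := by
  obtain ⟨b, hb, h⟩ := R.exists_dLin_of_subsingleton hC hi (lam_norm v) hd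
  obtain ⟨y, rfl⟩ := hC.exists_norm_eq hb
  exact ⟨y, by rw [map_sub, map_sub, ← h, dLin_lamP, dLin_lamP, sub_self]⟩

/-- Once the norm of `v` vanishes, the λ_j v are fixed cocycles, hence boundaries of fixed vectors,
and these can be written simultaneously as λ_j y. -/
lemma exists_lam_sub_dLin (R : ResData P E) (hC : IsPerfect C) [Subsingleton (ExtP P E C n)] (hi : i + 1 = n)
    {v : C.X n} (hv : lamP P _ 0 (lamP P _ 1 v) = 0)
    (hd : ∀ j, dLin C n (n + 1) (lamP P _ j v) = 0) :
    ∃ y, lamP P _ 0 (lamP P _ 1 y) = 0 ∧ ∀ j, lamP P _ j (v - dLin C i n y) = 0 := by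
  choose b hb h using fun j => R.exists_dLin_of_subsingleton hC hi
    (fun i => lam_lam_of_norm hv i j) (hd j)
  obtain ⟨y, hy, hy'⟩ := hC.exists_lam_eq hb
  exact ⟨y, hy', fun j => by rw [map_sub, ← h, ← dLin_lamP, hy, sub_self]⟩

lemma exists_fixed_sub_dLin (R : ResData P E) (hC : IsPerfect C) [Subsingleton (ExtP P E C n)] (hi : i + 1 = n)
    {v : C.X n} (hd : ∀ j, dLin C n (n + 1) (lamP P _ j v) = 0) :
    ∃ y, ∀ j, lamP P _ j (v - dLin C i n y) = 0 := by
  obtain ⟨y, hy⟩ := R.exists_norm_sub_dLin hC hi (v := v) (by rw [dLin_lamP, hd, map_zero])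
  obtain ⟨y', -, hy'⟩ := R.exists_lam_sub_dLin hC hi hy fun j => by
    rw [map_sub, map_sub, hd, dLin_lamP, dLin_dLin, map_zero, sub_zero]
  exact ⟨y + y', fun j => by rw [map_add, ← sub_sub, hy']⟩

/-- Boundaries push a cocycle down the filtration until it is fixed, and then the vanishing of Ext
makes it a boundary. -/
lemma subsingleton_homology (R : ResData P E) (hC : IsPerfect C) [Subsingleton (ExtP P E C n)] :
    Subsingleton (C.homology n) := by
  refine subsingleton_of_forall_eq 0 fun x => ?_
  obtain ⟨⟨z, hz⟩, rfl⟩ := hcls_surjective x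
  rw [LinearMap.mem_ker] at hz
  rw [hcls_eq_zero_iff (i := n - 1) (by lia)]
  obtain ⟨y, hy⟩ := R.exists_fixed_sub_dLin hC (i := n - 1) (by lia) (v := z)
    fun j => by rw [dLin_lamP, hz, map_zero]
  obtain ⟨b, -, hb⟩ := R.exists_dLin_of_subsingleton hC (i := n - 1) (by lia) hy (by
    rw [map_sub, dLin_dLin, hz, sub_zero])
  exact ⟨b + y, by rw [map_add, hb, sub_add_cancel]⟩

/-- If `Ext` vanishes in degree `i`, then `Ext` in degree `i + 1` embeds into cohomology. -/
lemma psi_eq_zero_of_dLin (hC : IsPerfect C) [Subsingleton (ExtP P E C i)] (hi : i + 1 = n)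
    {c : fixedCocycles P C n} {v : C.X i} (hv : dLin C i n v = c.1) : R.psi C n c = 0 := by
  rw [R.psi_eq_zero_iff hC hi]
  obtain ⟨hc, -⟩ := mem_fixedCocycles_iff.1 c.2
  obtain ⟨y, hy⟩ := R.exists_fixed_sub_dLin hC (i := i - 1) (n := i) (by lia) (v := v)
    fun j => by rw [dLin_lamP, hi, hv, hc]
  exact ⟨_, hy, by rw [map_sub, dLin_dLin, hv, sub_zero]⟩

/-- If `Ext` vanishes in degree `n + 1`, then the norm maps cohomology onto `Ext`. -/
lemma exists_psi_normCyc (hC : IsPerfect C) [Subsingleton (ExtP P E C (n + 1))]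
    (x : ExtP P E C n) : ∃ z, R.psi C n (normCyc P C n z) = x := by
  obtain ⟨c, rfl⟩ := R.psi_surjective hC x
  obtain ⟨hc, hd⟩ := mem_fixedCocycles_iff.1 c.2
  obtain ⟨v, hv⟩ := hC.exists_norm_eq hc
  -- Starting from v with norm c, the boundary dv is killed by the norm. Correct v first by y, so
  -- that dv becomes fixed, then by a fixed b, so that it becomes zero; neither correction changes
  -- the norm.
  have hd' (j : Fin 2) : dLin C (n + 1) (n + 1 + 1) (lamP P _ j (dLin C n (n + 1) v)) = 0 := by
    rw [← dLin_lamP, dLin_dLin]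
  obtain ⟨y, hy0, hy⟩ := R.exists_lam_sub_dLin hC (n := n + 1) (i := n) rfl
    (v := dLin C n (n + 1) v) (by rw [← dLin_lamP, ← dLin_lamP, hv, hd]) hd'
  obtain ⟨b, hb, hbd⟩ := R.exists_dLin_of_subsingleton hC (n := n + 1) (i := n) rfl hy (by
    rw [map_sub, dLin_dLin, dLin_dLin, sub_zero])
  refine ⟨⟨v - y - b, by rw [LinearMap.mem_ker, map_sub, map_sub, hbd, sub_self]⟩,
    congrArg _ (Subtype.ext ?_)⟩
  change lamP P _ 0 (lamP P _ 1 (v - y - b)) = c.1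
  rw [map_sub, map_sub, hb, map_sub, map_sub, hv, hy0, map_zero, sub_zero, sub_zero]

end ResData

end Chase

/-! ### Multiplication by the generators and the Koszul complex of Ext. -/

section Action

variable {F : Type u} [Field F] [CharP F 2] {G : Type u} [Group G] {P : Subgroup G} [P.Normal]
  [IsKleinFour P] {E C : CochainComplex (Rep.{u} F G) ℤ}

instance : IsScalarTower F (CohRing P E) (ExtTot P E C) where
  smul_assoc r a x := by
    induction a using DirectSum.induction_on with
    | zero => simp only [smul_zero, zero_smul]
    | add a b ha hb => simp only [smul_add, add_smul, ha, hb]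
    | of i a =>
      induction x using DirectSum.induction_on with
      | zero => simp only [smul_zero]
      | add x y hx hy => simp only [smul_add, hx, hy]
      | of j x =>
        rw [← DirectSum.of_smul, DirectSum.Gmodule.of_smul_of, DirectSum.Gmodule.of_smul_of,
          ← DirectSum.of_smul]
        exact congrArg _ (LinearMap.congr_fun (map_smul (HomCoh.comp i j) r a) x)

namespace ResData

variable (R : ResData P E)

/-- Multiplication by a generator, as a linear map. -/
def xEnd (C : CochainComplex (Rep.{u} F G) ℤ) (j : Fin 2) : ExtTot P E C →ₗ[F] ExtTot P E C where
  toFun t := R.x j • t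
  map_add' := smul_add _
  map_smul' r t := smul_comm _ r t

lemma xEnd_apply (j : Fin 2) (t : ExtTot P E C) : R.xEnd C j t = R.x j • t := rfl

lemma xEnd_of (j : Fin 2) (n : ℤ) (t : ExtP P E C n) :
    R.xEnd C j (DirectSum.lof F ℤ (fun n => ExtP P E C n) n t) =
      DirectSum.lof F ℤ (fun n => ExtP P E C n) (1 + n) (HomCoh.comp 1 n (R.gen j) t) :=
  DirectSum.Gmodule.of_smul_of _ _ _ _

/-- The class of a fixed cocycle in the total `Ext` group. -/
def psiTot (C : CochainComplex (Rep.{u} F G) ℤ) (n : ℤ) :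
    fixedCocycles P C n →ₗ[F] ExtTot P E C :=
  DirectSum.lof F ℤ (fun n => ExtP P E C n) n ∘ₗ R.psi C n

variable [Finite G]

lemma x_comm : R.x 0 * R.x 1 = R.x 1 * R.x 0 := by
  rw [← R.phi_X, ← R.phi_X, ← map_mul, ← map_mul, mul_comm]

lemma xEnd_comm (t : ExtTot P E C) : R.xEnd C 0 (R.xEnd C 1 t) = R.xEnd C 1 (R.xEnd C 0 t) := by
  rw [xEnd_apply, xEnd_apply, xEnd_apply, xEnd_apply, smul_smul, smul_smul, x_comm]

lemma xEnd_psiTot_add {n n' : ℤ} (hn : n + 1 = n') (w : C.X n)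
    (hw : lamP P (C.X n) 0 (lamP P (C.X n) 1 w) = 0)
    (h : ∀ j, lamP P (C.X n) j w ∈ fixedCocycles P C n)
    (hd : dLin C n n' w ∈ fixedCocycles P C n') :
    R.xEnd C 0 (R.psiTot C n ⟨_, h 0⟩) + R.xEnd C 1 (R.psiTot C n ⟨_, h 1⟩) =
      R.psiTot C n' ⟨_, hd⟩ := by
  obtain rfl : n' = 1 + n := by lia
  refine (congrArg₂ (· + ·) (R.xEnd_of 0 n _) (R.xEnd_of 1 n _)).trans ?_
  rw [← map_add, R.gen_comp_fixedClass_add w hw h hd]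
  rfl

variable (C) in
/-- The map `(a, b) ↦ x₀ a + x₁ b`. -/
def relMap : (ExtTot P E C × ExtTot P E C) →ₗ[F] ExtTot P E C :=
  (R.xEnd C 0).coprod (R.xEnd C 1)

variable (C) in
/-- The map `b ↦ (x₁ b, x₀ b)`. -/
def syzMap : ExtTot P E C →ₗ[F] (ExtTot P E C × ExtTot P E C) :=
  (R.xEnd C 1).prod (R.xEnd C 0)

lemma relMap_syzMap (t : ExtTot P E C) : R.relMap C (R.syzMap C t) = 0 := by
  change R.xEnd C 0 (R.xEnd C 1 t) + R.xEnd C 1 (R.xEnd C 0 t) = 0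
  rw [xEnd_comm, add_self_of_charTwo F]

variable (C) in
/-- The pair of classes attached to a cocycle in the second step of the filtration. -/
def pairCls (n : ℤ) : filCyc P C n 2 →ₗ[F] (ExtTot P E C × ExtTot P E C) :=
  (R.psiTot C n ∘ₗ lamCyc P C n 0).prod (R.psiTot C n ∘ₗ lamCyc P C n 1)

/-- This is the fundamental relation for a cocycle, where dw = 0. -/
lemma relMap_pairCls {n : ℤ} (z : filCyc P C n 2) : R.relMap C (R.pairCls C n z) = 0 := by
  have hd : dLin C n (n + 1) z.1 = 0 := z.2.2
  refine (R.xEnd_psiTot_add rfl z.1 (mem_filMod_two.1 z.2.1) (fun j => (lamCyc P C n j z).2)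
    (by rw [hd]; exact zero_mem _)).trans ?_
  refine Eq.trans (congrArg _ (Subtype.ext ?_)) (map_zero (R.psiTot C (n + 1)))
  exact hd

/-- Write z = c + dy with `c` fixed. The fundamental relation for λ_0 y and λ_1 y gives x_1[Ny] =
[λ_0 z] and x_0[Ny] = [λ_1 z], where Ny is the norm of `y`. So the pair depends on the class in gr
only up to trivial relations. -/
lemma pairCls_mem_range {n : ℤ} {z : filCyc P C n 2} (hz : grCls P C n 1 z = 0) :
    R.pairCls C n z ∈ LinearMap.range (R.syzMap C) := by
  obtain ⟨c, hc, y, h⟩ := (grCls_eq_zero_iff (i := n - 1) (by lia) z).1 hz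
  have hc1 := mem_filMod_one.1 hc.1
  have hz2 := mem_filMod_two.1 z.2.1
  have hy (j : Fin 2) : dLin C (n - 1) n (lamP P _ j y) = lamP P _ j z.1 := by
    rw [dLin_lamP, h, map_add, hc1, zero_add]
  have hN : dLin C (n - 1) n (lamP P _ 0 (lamP P _ 1 y)) = 0 := by
    rw [dLin_lamP, hy, hz2]
  have hNy : lamP P _ 0 (lamP P _ 1 y) ∈ fixedCocycles P C (n - 1) :=
    mem_fixedCocycles_iff.2 ⟨lam_norm y, by rw [sub_add_cancel, hN]⟩
  refine ⟨R.psiTot C (n - 1) ⟨_, hNy⟩, Prod.ext ?_ ?_⟩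
  · have h1 : lamP P _ 1 (lamP P _ 0 y) = lamP P _ 0 (lamP P _ 1 y) := lam_comm _ y
    have h2 : lamP P _ 0 (lamP P _ 0 y) = 0 := lam_lam_self _ _ _
    have h3 := R.xEnd_psiTot_add (n := n - 1) (n' := n) (by lia) (lamP P _ 0 y)
      (by rw [h1, lam_norm])
      (fun j => by
        fin_cases j
        · exact (congrArg (· ∈ fixedCocycles P C (n - 1)) h2).mpr (zero_mem _)
        · exact (congrArg (· ∈ fixedCocycles P C (n - 1)) h1).mpr hNy)
      (by rw [hy]; exact (lamCyc P C n 0 z).2)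
    have h4 : R.psiTot C (n - 1) ⟨lamP P _ 0 (lamP P _ 0 y),
        (congrArg (· ∈ fixedCocycles P C (n - 1)) h2).mpr (zero_mem _)⟩ = 0 :=
      Eq.trans (congrArg _ (Subtype.ext h2)) (map_zero (R.psiTot C (n - 1)))
    rw [h4, map_zero, zero_add] at h3
    refine Eq.trans (congrArg (R.xEnd C 1) (congrArg (R.psiTot C (n - 1)) (Subtype.ext h1.symm)))
      (h3.trans ?_)
    exact congrArg _ (Subtype.ext (hy 0))
  · have h1 : lamP P _ 1 (lamP P _ 1 y) = 0 := lam_lam_self _ _ _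
    have h3 := R.xEnd_psiTot_add (n := n - 1) (n' := n) (by lia) (lamP P _ 1 y)
      (by rw [h1, map_zero])
      (fun j => by
        fin_cases j
        · exact hNy
        · exact (congrArg (· ∈ fixedCocycles P C (n - 1)) h1).mpr (zero_mem _))
      (by rw [hy]; exact (lamCyc P C n 1 z).2)
    have h4 : R.psiTot C (n - 1) ⟨lamP P _ 1 (lamP P _ 1 y),
        (congrArg (· ∈ fixedCocycles P C (n - 1)) h1).mpr (zero_mem _)⟩ = 0 :=
      Eq.trans (congrArg _ (Subtype.ext h1)) (map_zero (R.psiTot C (n - 1)))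
    rw [h4, map_zero, add_zero] at h3
    exact h3.trans (congrArg _ (Subtype.ext (hy 1)))

/-- Choose w with λ_j w representing `a j`. By the fundamental relation [dw] = 0, so dw is the
boundary of a fixed b, and w - b is a cocycle giving the same pair. -/
lemma exists_pairCls (hC : IsPerfect C) {n : ℤ} {a : Fin 2 → ExtP P E C n}
    (ha : HomCoh.comp 1 n (R.gen 0) (a 0) + HomCoh.comp 1 n (R.gen 1) (a 1) = 0) :
    ∃ z : filCyc P C n 2, ∀ j, R.psi C n (lamCyc P C n j z) = a j := by
  choose c hc using fun j => R.psi_surjective hC (a j)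
  obtain ⟨w, hw, hN⟩ := hC.exists_lam_eq (c := fun j => (c j).1)
    fun i => (mem_fixedCocycles_iff.1 (c i).2).1
  have hw' (j : Fin 2) : lamP P (C.X n) j w ∈ fixedCocycles P C n := by
    rw [hw]; exact (c j).2
  have hd : dLin C n (1 + n) w ∈ fixedCocycles P C (1 + n) :=
    mem_fixedCocycles_iff.2 ⟨fun j => by
      rw [← dLin_lamP, hw, add_comm 1 n]; exact (c j).2.2, dLin_dLin _ _ _ _ _⟩
  have h1 := R.gen_comp_fixedClass_add w hN hw' hd
  have h2 (j : Fin 2) : fixedClass P R.η n ⟨_, hw' j⟩ = a j := by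
    rw [← hc]; exact congrArg _ (Subtype.ext (hw j))
  rw [h2, h2, ha] at h1
  obtain ⟨b, hb, hbd⟩ := (R.psi_eq_zero_iff hC (add_comm n 1) _).1 h1.symm
  refine ⟨⟨w - b, mem_filMod_two.2 ?_, ?_⟩, fun j => ?_⟩
  · rw [map_sub, hb, sub_zero, hN]
  · change dLin C n (n + 1) (w - b) = 0
    rw [add_comm n 1, map_sub, hbd, sub_self]
  · rw [← hc]
    refine congrArg _ (Subtype.ext ?_)
    change lamP P _ j (w - b) = (c j).1
    rw [map_sub, hb, sub_zero, hw]

end ResData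

end Action


/-! ### Linear algebra and dimension counts. -/

section Linear

variable {F : Type*} [Field F]

lemma exists_comp_eq_of_surjective {A B D : Type*} [AddCommGroup A] [AddCommGroup B]
    [AddCommGroup D] [Module F A] [Module F B] [Module F D] {p : A →ₗ[F] B} {g : A →ₗ[F] D}
    (hp : Function.Surjective p) (h : ∀ a, p a = 0 → g a = 0) :
    ∃ f : B →ₗ[F] D, ∀ a, f (p a) = g a := by
  obtain ⟨s, hs⟩ := p.exists_rightInverse_of_surjective (LinearMap.range_eq_top.2 hp)
  refine ⟨g ∘ₗ s, fun a => ?_⟩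
  rw [LinearMap.comp_apply, ← sub_eq_zero, ← map_sub]
  refine h _ ?_
  rw [map_sub, sub_eq_zero]
  exact LinearMap.congr_fun hs (p a)

lemma sum_lof_eq {M : ℤ → Type*} [∀ n, AddCommGroup (M n)] [∀ n, Module F (M n)]
    (s : Finset ℤ) (x : ∀ n, M n) (y : ⨁ n, M n) (h : ∀ n ∈ s, x n = y n)
    (h' : ∀ n ∉ s, y n = 0) : ∑ n ∈ s, DirectSum.lof F ℤ M n (x n) = y := by
  refine DFinsupp.ext fun k => ?_
  refine (DFinsupp.finsetSum_apply _ _ k).trans ?_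
  by_cases hk : k ∈ s
  · rw [Finset.sum_eq_single_of_mem k hk]
    · exact (DirectSum.lof_apply F k (x k)).trans (h k hk)
    · exact fun j _ hj => DFinsupp.single_eq_of_ne hj.symm
  · rw [h' k hk]
    exact Finset.sum_eq_zero fun j hj => DFinsupp.single_eq_of_ne fun h => hk (h ▸ hj)

/-- A direct sum with finitely many nonzero terms is a finite product. -/
lemma nonempty_directSum_equiv {M : ℤ → Type*} [∀ n, AddCommGroup (M n)] [∀ n, Module F (M n)]
    (s : Finset ℤ) (h : ∀ n ∉ s, Subsingleton (M n)) :
    Nonempty ((⨁ n, M n) ≃ₗ[F] ∀ n : s, M n) := by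
  refine ⟨LinearEquiv.ofBijective
    (LinearMap.pi fun n : s => DirectSum.component F ℤ M n) ⟨?_, ?_⟩⟩
  · refine fun x y hxy => DFinsupp.ext fun k => ?_
    by_cases hk : k ∈ s
    · exact congrFun hxy ⟨k, hk⟩
    · have := h k hk
      exact Subsingleton.elim _ _
  · intro y
    refine ⟨∑ n : s, DirectSum.lof F ℤ M n (y n), funext fun k => ?_⟩
    refine (DFinsupp.finsetSum_apply _ _ _).trans ?_
    rw [Finset.sum_eq_single_of_mem k (Finset.mem_univ _)]
    · exact DirectSum.lof_apply F _ _
    · exact fun j _ hj => DFinsupp.single_eq_of_ne fun h => hj (Subtype.ext h.symm)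

lemma finite_directSum {M : ℤ → Type*} [∀ n, AddCommGroup (M n)] [∀ n, Module F (M n)]
    [∀ n, Module.Finite F (M n)] (s : Finset ℤ) (h : ∀ n ∉ s, Subsingleton (M n)) :
    Module.Finite F (⨁ n, M n) := by
  obtain ⟨e⟩ := nonempty_directSum_equiv (F := F) s h
  exact Module.Finite.equiv e.symm

lemma finrank_directSum {M : ℤ → Type*} [∀ n, AddCommGroup (M n)] [∀ n, Module F (M n)]
    [∀ n, Module.Finite F (M n)] (s : Finset ℤ) (h : ∀ n ∉ s, Subsingleton (M n)) :
    Module.finrank F (⨁ n, M n) = ∑ n ∈ s, Module.finrank F (M n) := by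
  obtain ⟨e⟩ := nonempty_directSum_equiv (F := F) s h
  rw [e.finrank_eq, Module.finrank_pi_fintype, Finset.sum_coe_sort s fun n => Module.finrank F (M n)]

/-- The dimension of the first homology of `V → V² → V` is that of the cokernel and kernel. -/
lemma finrank_map_mkQ_ker {V W : Type*} [AddCommGroup V] [Module F V] [Module.Finite F V]
    [AddCommGroup W] [Module F W] [Module.Finite F W] (hW : Module.finrank F W = 2 * Module.finrank F V)
    (A : W →ₗ[F] V) (B : V →ₗ[F] W) (h : ∀ v, A (B v) = 0) :
    Module.finrank F ((LinearMap.ker A).map (LinearMap.range B).mkQ) +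
      Module.finrank F (LinearMap.range A) =
        Module.finrank F V + Module.finrank F (LinearMap.ker B) := by
  have h1 := A.finrank_range_add_finrank_ker
  have h2 := B.finrank_range_add_finrank_ker
  have h3 : LinearMap.range B ≤ LinearMap.ker A := by
    rintro _ ⟨v, rfl⟩
    exact h v
  have h4 := LinearMap.finrank_range_add_finrank_ker
    ((LinearMap.range B).mkQ ∘ₗ (LinearMap.ker A).subtype)
  have h5 : LinearMap.range ((LinearMap.range B).mkQ ∘ₗ (LinearMap.ker A).subtype) =
      (LinearMap.ker A).map (LinearMap.range B).mkQ := by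
    rw [LinearMap.range_comp, Submodule.range_subtype]
  have h6 : Module.finrank F
      (LinearMap.ker ((LinearMap.range B).mkQ ∘ₗ (LinearMap.ker A).subtype)) =
      Module.finrank F (LinearMap.range B) := by
    rw [LinearMap.ker_comp, Submodule.ker_mkQ]
    exact (Submodule.submoduleOfEquivOfLe h3).finrank_eq
  rw [h5, h6] at h4
  lia

lemma finrank_gr {V : Type*} [AddCommGroup V] [Module F V] [Module.Finite F V]
    {f : ℕ → Submodule F V} (hf : Monotone f) (h0 : f 0 = ⊥) (h3 : f 3 = ⊤) :
    Module.finrank F V = Module.finrank F (f 1 ⧸ (f 0).submoduleOf (f 1)) +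
      Module.finrank F (f 2 ⧸ (f 1).submoduleOf (f 2)) +
      Module.finrank F (f 3 ⧸ (f 2).submoduleOf (f 3)) := by
  have h (k : ℕ) : Module.finrank F (f (k + 1) ⧸ (f k).submoduleOf (f (k + 1))) +
      Module.finrank F (f k) = Module.finrank F (f (k + 1)) := by
    rw [← Submodule.finrank_quotient_add_finrank ((f k).submoduleOf (f (k + 1)))]
    congr 1
    exact (Submodule.submoduleOfEquivOfLe (hf k.le_succ)).finrank_eq.symm
  have h1 := h 0
  have h2 := h 1
  have h4 := h 2
  rw [h0, finrank_bot] at h1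
  rw [h3, finrank_top] at h4
  rw [h3, h0]
  simp only [Nat.reduceAdd] at *
  lia

lemma exists_pair_spanning {M : ℤ → Type*} [∀ n, AddCommGroup (M n)] [∀ n, Module F (M n)]
    [∀ n, Module.Finite F (M n)] {m n : ℤ}
    (h : ∀ k, Module.finrank F (M k) = Multiset.count k {m, n}) :
    ∃ (x : M m) (y : M n), (∀ k (g : M k), ∃ α β : F, (α = 0 ∨ k = m) ∧ (β = 0 ∨ k = n) ∧
      DirectSum.lof F ℤ M k g = α • DirectSum.lof F ℤ M m x + β • DirectSum.lof F ℤ M n y) ∧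
      ∀ α β : F, α • DirectSum.lof F ℤ M m x + β • DirectSum.lof F ℤ M n y = 0 →
        α = 0 ∧ β = 0 := by
  have h0 (k : ℤ) (hm : k ≠ m) (hn : k ≠ n) : Subsingleton (M k) := by
    refine Module.finrank_zero_iff.1 ((h k).trans ?_)
    simp [hm, hn]
  by_cases hmn : m = n
  · subst hmn
    have h2 : Module.finrank F (M m) = 2 := by rw [h]; simp
    let b := Module.finBasisOfFinrankEq F (M m) h2
    refine ⟨b 0, b 1, fun k g => ?_, fun α β h => ?_⟩
    rotate_left
    · rw [← (DirectSum.lof F ℤ M m).map_smul, ← (DirectSum.lof F ℤ M m).map_smul, ← map_add] at h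
      have h1 := DirectSum.of_injective (β := M) m (h.trans (map_zero _).symm)
      have h2 := Fintype.linearIndependent_iff.1 b.linearIndependent ![α, β] (by
        rw [Fin.sum_univ_two]; exact h1)
      exact ⟨h2 0, h2 1⟩
    by_cases hk : k = m
    · subst hk
      refine ⟨b.repr g 0, b.repr g 1, Or.inr rfl, Or.inr rfl, ?_⟩
      rw [← (DirectSum.lof F ℤ M k).map_smul, ← (DirectSum.lof F ℤ M k).map_smul, ← map_add]
      have h3 := b.sum_repr g
      rw [Fin.sum_univ_two] at h3
      rw [h3]
    · have := h0 k hk hk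
      exact ⟨0, 0, Or.inl rfl, Or.inl rfl, by rw [Subsingleton.elim g 0]; simp⟩
  · have hm : Module.finrank F (M m) = 1 := by rw [h]; simp [hmn]
    have hn : Module.finrank F (M n) = 1 := by rw [h]; simp [Ne.symm hmn]
    obtain ⟨x, hx0, hx⟩ := finrank_eq_one_iff'.1 hm
    obtain ⟨y, hy0, hy⟩ := finrank_eq_one_iff'.1 hn
    refine ⟨x, y, fun k g => ?_, fun α β h => ?_⟩
    rotate_left
    · have h1 := congrArg (DirectSum.component F ℤ M m) h
      have h2 := congrArg (DirectSum.component F ℤ M n) h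
      rw [map_add, map_smul, map_smul, DirectSum.component.lof_self, map_zero,
        DirectSum.component.of, dif_neg (Ne.symm hmn), smul_zero, add_zero] at h1
      rw [map_add, map_smul, map_smul, DirectSum.component.lof_self, map_zero,
        DirectSum.component.of, dif_neg hmn, smul_zero, zero_add] at h2
      exact ⟨(smul_eq_zero.1 h1).resolve_right hx0, (smul_eq_zero.1 h2).resolve_right hy0⟩
    by_cases hk : k = m
    · subst hk
      obtain ⟨c, rfl⟩ := hx g
      exact ⟨c, 0, Or.inr rfl, Or.inl rfl, by rw [map_smul, zero_smul, add_zero]⟩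
    by_cases hk' : k = n
    · subst hk'
      obtain ⟨c, rfl⟩ := hy g
      exact ⟨0, c, Or.inl rfl, Or.inr rfl, by rw [map_smul, zero_smul, zero_add]⟩
    · have := h0 k hk hk'
      exact ⟨0, 0, Or.inl rfl, Or.inl rfl, by rw [Subsingleton.elim g 0]; simp⟩

end Linear

/-! ### Finiteness, and the comparison maps for the three pieces of gr. -/

section Finiteness

variable {F : Type u} [Field F] [CharP F 2] {G : Type u} [Group G] [Finite G] {P : Subgroup G}
  [IsKleinFour P] {E C : CochainComplex (Rep.{u} F G) ℤ}

lemma IsPerfect.finite_X (hC : IsPerfect C) (n : ℤ) : Module.Finite F (C.X n) := by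
  have h := hC.finite n
  have h1 : Module.Finite F (MonoidAlgebra F G) := inferInstance
  have h2 : IsScalarTower F (MonoidAlgebra F G) (C.X n).ρ.asModule := ⟨fun r a x => by
    change (C.X n).ρ.asAlgebraHom (r • a) x = r • (C.X n).ρ.asAlgebraHom a x
    rw [map_smul]
    rfl⟩
  have h3 : Module.Finite F (C.X n).ρ.asModule := Module.Finite.trans (MonoidAlgebra F G) _
  exact h3

lemma IsPerfect.finite_homology (hC : IsPerfect C) (n : ℤ) : Module.Finite F (C.homology n) := by
  have := hC.finite_X n
  exact Module.Finite.of_surjective (hcls C n) hcls_surjective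

namespace ResData

lemma finite_ext (R : ResData P E) (hC : IsPerfect C) (n : ℤ) : Module.Finite F (ExtP P E C n) := by
  have := hC.finite_X n
  exact Module.Finite.of_surjective (R.psi C n) (R.psi_surjective hC)

lemma subsingleton_ext_of_X (R : ResData P E) (hC : IsPerfect C) {n : ℤ} [Subsingleton (C.X n)] :
    Subsingleton (ExtP P E C n) :=
  (R.psi_surjective hC).subsingleton

variable [P.Normal]

lemma finite_extTot (R : ResData P E) (hC : IsPerfect C) : Module.Finite F (ExtTot P E C) := by
  have := R.finite_ext hC
  obtain ⟨a, b, h⟩ := hC.bounded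
  refine finite_directSum (Finset.Icc a b) fun n hn => ?_
  rw [Finset.mem_Icc] at hn
  have : Subsingleton (C.X n) := (Rep.isZero_iff _ _ _).1 (h n (by lia))
  exact R.subsingleton_ext_of_X hC

/-- Boundedness of C bounds the degrees where Ext lives, and nonzero cohomology forces nonzero Ext
in the same degree. -/
lemma exists_extremal (R : ResData P E) (hC : IsPerfect C) {i : ℤ}
    (hi : Nontrivial (C.homology i)) : ∃ a s : ℤ, Nontrivial (ExtP P E C a) ∧
      Nontrivial (ExtP P E C s) ∧ (∀ n, Nontrivial (ExtP P E C n) → a ≤ n ∧ n ≤ s) := by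
  have h0 : Nontrivial (ExtP P E C i) := by
    by_contra h
    have := not_nontrivial_iff_subsingleton.1 h
    exact not_subsingleton_iff_nontrivial.2 hi (R.subsingleton_homology hC)
  obtain ⟨p, q, h⟩ := hC.bounded
  have h1 (n : ℤ) (hn : Nontrivial (ExtP P E C n)) : p ≤ n ∧ n ≤ q := by
    by_contra h2
    have : Subsingleton (C.X n) := (Rep.isZero_iff _ _ _).1 (h n (by lia))
    exact not_subsingleton_iff_nontrivial.2 hn (R.subsingleton_ext_of_X hC)
  obtain ⟨a, ha, ha'⟩ := Int.exists_least_of_bdd (P := fun n => Nontrivial (ExtP P E C n))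
    ⟨p, fun n hn => (h1 n hn).1⟩ ⟨i, h0⟩
  obtain ⟨s, hs, hs'⟩ := Int.exists_greatest_of_bdd (P := fun n => Nontrivial (ExtP P E C n))
    ⟨q, fun n hn => (h1 n hn).2⟩ ⟨i, h0⟩
  exact ⟨a, s, ha, hs, fun n hn => ⟨ha' n hn, hs' n hn⟩⟩

variable (R : ResData P E)

/-- The map from `Ext` to the bottom of the filtration. -/
lemma exists_iota (hC : IsPerfect C) (n : ℤ) : ∃ ι : ExtP P E C n →ₗ[F] GrPiece P C n 0,
    ∀ (c : C.X n) (h : c ∈ fixedCocycles P C n) (h' : c ∈ filCyc P C n 1),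
      ι (R.psi C n ⟨c, h⟩) = grCls P C n 0 ⟨c, h'⟩ := by
  have h0 (c : fixedCocycles P C n) : c.1 ∈ filCyc P C n 1 :=
    ⟨mem_filMod_one.2 (mem_fixedCocycles_iff.1 c.2).1, c.2.2⟩
  obtain ⟨ι, hι⟩ := exists_comp_eq_of_surjective (p := R.psi C n)
    (g := grCls P C n 0 ∘ₗ (Submodule.subtype _).codRestrict _ h0) (R.psi_surjective hC)
    fun c hc => by
      obtain ⟨b, -, hb⟩ := (R.psi_eq_zero_iff hC (i := n - 1) (by lia) c).1 hc
      exact (grCls_eq_zero_iff (i := n - 1) (by lia) _).2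
        ⟨0, zero_mem _, b, hb.symm.trans (zero_add _).symm⟩
  exact ⟨ι, fun c h h' => hι ⟨c, h⟩⟩

/-- The map from the middle of the filtration to pairs of `Ext` classes. -/
lemma exists_gamma (n : ℤ) : ∃ γ : GrPiece P C n 1 →ₗ[F]
      (ExtTot P E C × ExtTot P E C) ⧸ LinearMap.range (R.syzMap C),
    ∀ z, γ (grCls P C n 1 z) = Submodule.mkQ _ (R.pairCls C n z) :=
  exists_comp_eq_of_surjective (g := Submodule.mkQ _ ∘ₗ R.pairCls C n) (grCls_surjective 1)
    fun _ hz => (Submodule.Quotient.mk_eq_zero _).2 (R.pairCls_mem_range hz)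

/-- The map from the top of the filtration to `Ext`. -/
lemma exists_trace (hC : IsPerfect C) (n : ℤ) : ∃ τ : GrPiece P C n 2 →ₗ[F] ExtP P E C n,
    ∀ z, τ (grCls P C n 2 z) = R.psi C n (normCyc P C n ⟨z.1, z.2.2⟩) := by
  refine exists_comp_eq_of_surjective
    (g := R.psi C n ∘ₗ normCyc P C n ∘ₗ Submodule.inclusion inf_le_right) (grCls_surjective 2)
    fun z hz => ?_
  obtain ⟨c, hc, y, h⟩ := (grCls_eq_zero_iff (i := n - 1) (by lia) z).1 hz
  refine (R.psi_eq_zero_iff hC (i := n - 1) (by lia) _).2 ⟨_, lam_norm y, ?_⟩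
  change _ = lamP P _ 0 (lamP P _ 1 z.1)
  rw [h, map_add, map_add, mem_filMod_two.1 hc.1, zero_add, dLin_lamP, dLin_lamP]

/-- If Ext vanishes one degree below, a fixed cocycle that bounds in C already bounds among fixed
vectors. So a nonzero Ext class survives in cohomology. -/
lemma nontrivial_grPiece_zero (R : ResData P E) (hC : IsPerfect C) {n i : ℤ} (hi : i + 1 = n)
    [Subsingleton (ExtP P E C i)] [Nontrivial (ExtP P E C n)] : Nontrivial (GrPiece P C n 0) := by
  obtain ⟨x, hx⟩ := exists_ne (0 : ExtP P E C n)
  obtain ⟨c, rfl⟩ := R.psi_surjective hC x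
  refine ⟨grCls P C n 0 ⟨c.1, mem_filMod_one.2 (mem_fixedCocycles_iff.1 c.2).1, c.2.2⟩, 0, ?_⟩
  intro h
  obtain ⟨b, hb, y, hy⟩ := (grCls_eq_zero_iff hi _).1 h
  refine hx (R.psi_eq_zero_of_dLin hC hi (v := y) (hy.trans ?_).symm)
  exact (congrArg (· + _) (mem_filMod_zero.1 hb.1)).trans (zero_add _)

end ResData

end Finiteness


/-! ### The filtration on cohomology. -/

section FilH

variable {F : Type u} [Field F] [CharP F 2] {G : Type u} [Group G] {P : Subgroup G}
  [IsKleinFour P] [P.Normal] {C : CochainComplex (Rep.{u} F G) ℤ} {n : ℤ}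

lemma filH_zero : filH P C n 0 = ⊥ := by
  refine (Submodule.eq_bot_iff _).2 fun x hx => ?_
  obtain ⟨z, hz, rfl⟩ := (mem_filH_iff P).1 hx
  exact Eq.trans (congrArg _ (Subtype.ext (mem_filMod_zero.1 hz))) (map_zero (hcls C n))

lemma filH_eq_top {k : ℕ} (hk : 3 ≤ k) : filH P C n k = ⊤ := by
  refine Submodule.eq_top_iff'.2 fun x => ?_
  obtain ⟨z, rfl⟩ := hcls_surjective x
  exact (mem_filH_iff P).2 ⟨z, by rw [filMod_eq_top hk]; trivial, rfl⟩

lemma filH_mono : Monotone (filH P C n) :=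
  monotone_nat_of_le_succ fun _ => Submodule.map_mono (Submodule.comap_mono
    fun _ hx a ha => hx a (Ideal.pow_le_pow_right (Nat.le_succ _) ha))

lemma subsingleton_grPiece {k : ℕ} (hk : 3 ≤ k) : Subsingleton (GrPiece P C n k) := by
  refine Submodule.Quotient.subsingleton_iff.2 ?_
  rw [filH_eq_top hk]
  exact Submodule.comap_subtype_eq_top.2 le_top

lemma finrank_homology [Module.Finite F (C.homology n)] : Module.finrank F (C.homology n) =
    Module.finrank F (GrPiece P C n 0) + Module.finrank F (GrPiece P C n 1) +
      Module.finrank F (GrPiece P C n 2) :=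
  finrank_gr filH_mono filH_zero (filH_eq_top le_rfl)

end FilH

/-! ### Comparison of gr with the Koszul complex. -/

namespace ResData

variable {F : Type u} [Field F] [CharP F 2] {G : Type u} [Group G] [Finite G] {P : Subgroup G}
  [IsKleinFour P] [P.Normal] {E C : CochainComplex (Rep.{u} F G) ℤ}

section Maps

variable (R : ResData P E)

/-- The map from the bottom of the filtration. -/
def iota (hC : IsPerfect C) (n : ℤ) : ExtP P E C n →ₗ[F] GrPiece P C n 0 :=
  (R.exists_iota hC n).choose

lemma iota_psi (hC : IsPerfect C) {n : ℤ} (c : C.X n) (h : c ∈ fixedCocycles P C n)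
    (h' : c ∈ filCyc P C n 1) : R.iota hC n (R.psi C n ⟨c, h⟩) = grCls P C n 0 ⟨c, h'⟩ :=
  (R.exists_iota hC n).choose_spec c h h'

/-- The map from the middle of the filtration to relations modulo trivial relations. -/
def gamma (C : CochainComplex (Rep.{u} F G) ℤ) (n : ℤ) : GrPiece P C n 1 →ₗ[F]
    (ExtTot P E C × ExtTot P E C) ⧸ LinearMap.range (R.syzMap C) :=
  (R.exists_gamma n).choose

lemma gamma_grCls {n : ℤ} (z : filCyc P C n 2) :
    R.gamma C n (grCls P C n 1 z) = Submodule.mkQ _ (R.pairCls C n z) :=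
  (R.exists_gamma n).choose_spec z

/-- The map from the top of the filtration to `Ext`. -/
def trace (hC : IsPerfect C) (n : ℤ) : GrPiece P C n 2 →ₗ[F] ExtP P E C n :=
  (R.exists_trace hC n).choose

lemma trace_grCls (hC : IsPerfect C) {n : ℤ} (z : filCyc P C n 3) :
    R.trace hC n (grCls P C n 2 z) = R.psi C n (normCyc P C n ⟨z.1, z.2.2⟩) :=
  (R.exists_trace hC n).choose_spec z

/-- The total map from the middle of the filtration to relations modulo trivial relations. -/
def gammaTot (C : CochainComplex (Rep.{u} F G) ℤ) : (⨁ n, GrPiece P C n 1) →ₗ[F]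
    (ExtTot P E C × ExtTot P E C) ⧸ LinearMap.range (R.syzMap C) :=
  DirectSum.toModule F ℤ _ (R.gamma C)

lemma xEnd_component (j : Fin 2) (x : ExtTot P E C) {n n' : ℤ} (hn : 1 + n = n') :
    R.xEnd C j x n' = hn ▸ HomCoh.comp 1 n (R.gen j) (x n) := by
  subst hn
  induction x using DirectSum.induction_on with
  | zero => rw [map_zero]; exact (map_zero (HomCoh.comp 1 n (R.gen j))).symm
  | add x y hx hy =>
    rw [map_add]
    exact (congrArg₂ (· + ·) hx hy).trans (map_add (HomCoh.comp 1 n (R.gen j)) _ _).symm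
  | of k x =>
    refine (congrArg (fun y : ExtTot P E C => y (1 + n)) (R.xEnd_of j k x)).trans ?_
    by_cases h : k = n
    · subst h
      refine (DirectSum.lof_apply F _ _).trans ?_
      exact congrArg _ (DirectSum.of_eq_same _ _).symm
    · refine (DFinsupp.single_eq_of_ne fun h' => h (by lia)).trans ?_
      refine Eq.trans (map_zero (HomCoh.comp 1 n (R.gen j))).symm (congrArg _ ?_)
      exact (DFinsupp.single_eq_of_ne (Ne.symm h)).symm

lemma trace_surjective (hC : IsPerfect C) (n : ℤ) [Subsingleton (ExtP P E C (n + 1))] :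
    Function.Surjective (R.trace hC n) := by
  intro x
  obtain ⟨z, rfl⟩ := R.exists_psi_normCyc hC x
  exact ⟨_, R.trace_grCls hC ⟨z.1, by rw [filMod_eq_top le_rfl]; trivial, z.2⟩⟩

/-- Koszul cycles decompose into homogeneous components; each component comes from a cocycle by
`exists_pairCls`, and finitely many of these are summed. -/
lemma map_ker_relMap_le (hC : IsPerfect C) : (LinearMap.ker (R.relMap C)).map
    (LinearMap.range (R.syzMap C)).mkQ ≤ LinearMap.range (R.gammaTot C) := by
  rintro _ ⟨⟨a, b⟩, h, rfl⟩
  have h1 (n : ℤ) : ∃ z : filCyc P C n 2, ∀ j, R.psi C n (lamCyc P C n j z) = ![a n, b n] j := by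
    refine R.exists_pairCls hC ?_
    refine Eq.trans (congrArg₂ (· + ·) (R.xEnd_component 0 a rfl).symm
      (R.xEnd_component 1 b rfl).symm) ?_
    exact congrArg (fun y : ExtTot P E C => y (1 + n)) h
  choose z hz using h1
  classical
  refine ⟨∑ n ∈ DFinsupp.support a ∪ DFinsupp.support b,
    DirectSum.lof F ℤ (fun n => GrPiece P C n 1) n (grCls P C n 1 (z n)), ?_⟩
  rw [map_sum]
  have h2 (n : ℤ) : R.gammaTot C (DirectSum.lof F ℤ (fun n => GrPiece P C n 1) n
      (grCls P C n 1 (z n))) = Submodule.mkQ _ (R.pairCls C n (z n)) :=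
    (DirectSum.toModule_lof _ _ _).trans (R.gamma_grCls _)
  rw [Finset.sum_congr rfl fun n _ => h2 n, ← map_sum]
  refine congrArg _ (Prod.ext ?_ ?_)
  · rw [Prod.fst_sum]
    refine sum_lof_eq (F := F) _ (fun n => R.psi C n (lamCyc P C n 0 (z n))) a
      (fun n _ => hz n 0) fun n hn => ?_
    rw [Finset.mem_union, not_or] at hn
    exact DFinsupp.notMem_support_iff.1 hn.1
  · rw [Prod.snd_sum]
    refine sum_lof_eq (F := F) _ (fun n => R.psi C n (lamCyc P C n 1 (z n))) b
      (fun n _ => hz n 1) fun n hn => ?_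
    rw [Finset.mem_union, not_or] at hn
    exact DFinsupp.notMem_support_iff.1 hn.2

lemma relMap_apply_eq_zero {a : ℤ} [Subsingleton (ExtP P E C (a - 1))]
    (u : ExtTot P E C × ExtTot P E C) : R.relMap C u a = 0 := by
  have h1 (j : Fin 2) (w : ExtTot P E C) : R.xEnd C j w a = 0 := by
    have ha : 1 + (a - 1) = a := by lia
    rw [R.xEnd_component j w ha, Subsingleton.elim (w (a - 1)) 0]
    have h2 : ∀ (b : ℤ) (hb : 1 + (a - 1) = b), (hb ▸ HomCoh.comp 1 (a - 1) (R.gen j)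
      (0 : ExtP P E C (a - 1)) : ExtP P E C b) = 0 := by
      rintro b rfl
      exact map_zero (HomCoh.comp 1 (a - 1) (R.gen j))
    exact h2 a ha
  exact (congrArg₂ (· + ·) (h1 0 u.1) (h1 1 u.2)).trans (add_zero _)

/-- Multiplication by the generators raises degrees, so nothing reaches the lowest degree of Ext. -/
lemma relMap_ne_top {a : ℤ} [Subsingleton (ExtP P E C (a - 1))] [Nontrivial (ExtP P E C a)] :
    LinearMap.range (R.relMap C) ≠ ⊤ := by
  intro h
  obtain ⟨x, hx⟩ := exists_ne (0 : ExtP P E C a)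
  obtain ⟨u, hu⟩ := LinearMap.range_eq_top.1 h (DirectSum.lof F ℤ (fun n => ExtP P E C n) a x)
  refine hx ((DirectSum.lof_apply F a x).symm.trans ?_)
  exact (congrArg (fun y : ExtTot P E C => y a) hu).symm.trans (R.relMap_apply_eq_zero u)

/-- The generators push the highest degree of Ext into a zero group. -/
lemma lof_mem_ker_syzMap {s : ℤ} [Subsingleton (ExtP P E C (1 + s))] (x : ExtP P E C s) :
    DirectSum.lof F ℤ (fun n => ExtP P E C n) s x ∈ LinearMap.ker (R.syzMap C) := by
  refine Prod.ext ?_ ?_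
  · refine (R.xEnd_of 1 s x).trans ?_
    rw [Subsingleton.elim (HomCoh.comp 1 s (R.gen 1) x) 0]
    exact map_zero _
  · refine (R.xEnd_of 0 s x).trans ?_
    rw [Subsingleton.elim (HomCoh.comp 1 s (R.gen 0) x) 0]
    exact map_zero _

end Maps

/-! ### The dimension count. -/

section Counting

/-- The shape of the filtration and of `Ext` for a complex with four-dimensional cohomology. -/
structure HasShape (R : ResData P E) (C : CochainComplex (Rep.{u} F G) ℤ) (m n t : ℤ) : Prop where
  gr_zero (i : ℤ) : Module.finrank F (GrPiece P C i 0) = Multiset.count i {0}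
  gr_one (i : ℤ) : Module.finrank F (GrPiece P C i 1) = Multiset.count i {m, n}
  gr_two (i : ℤ) : Module.finrank F (GrPiece P C i 2) = Multiset.count i {t}
  nontrivial_zero : Nontrivial (ExtP P E C 0)
  nontrivial_top : Nontrivial (ExtP P E C t)
  bounded (i : ℤ) (h : Nontrivial (ExtP P E C i)) : 0 ≤ i ∧ i ≤ t
  finrank_relMap : Module.finrank F (LinearMap.range (R.relMap C)) + 1 =
    Module.finrank F (ExtTot P E C)
  gammaTot_injective : Function.Injective (R.gammaTot C)
  range_gammaTot : LinearMap.range (R.gammaTot C) = (LinearMap.ker (R.relMap C)).map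
    (LinearMap.range (R.syzMap C)).mkQ

lemma count_of_sum_eq_one {s : Finset ℤ} {f : ℤ → ℕ} (h : ∑ i ∈ s, f i = 1)
    (hf : ∀ i ∉ s, f i = 0) {a : ℤ} (ha : f a ≠ 0) (i : ℤ) : f i = Multiset.count i {a} := by
  have has : a ∈ s := by
    by_contra h'
    exact ha (hf a h')
  rw [← Finset.add_sum_erase s f has] at h
  by_cases hi : i = a
  · subst hi
    rw [Multiset.count_singleton_self]
    lia
  · rw [Multiset.count_singleton, if_neg hi]
    by_cases his : i ∈ s
    · have := Finset.single_le_sum (f := f) (fun _ _ => Nat.zero_le _)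
        (Finset.mem_erase.2 ⟨hi, his⟩)
      lia
    · exact hf i his

lemma finrank_range_directSum {M : ℤ → Type*} [∀ n, AddCommGroup (M n)]
    [∀ n, Module F (M n)] [∀ n, Module.Finite F (M n)] {V : Type*} [AddCommGroup V] [Module F V]
    (s : Finset ℤ) (h : ∀ n ∉ s, Subsingleton (M n)) (f : (⨁ n, M n) →ₗ[F] V) :
    Module.finrank F (LinearMap.range f) ≤ ∑ n ∈ s, Module.finrank F (M n) ∧
    (Module.finrank F (LinearMap.range f) = ∑ n ∈ s, Module.finrank F (M n) →
      Function.Injective f) := by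
  have h1 := finite_directSum (F := F) s h
  rw [← finrank_directSum s h]
  refine ⟨LinearMap.finrank_range_le f, fun h2 => ?_⟩
  have h3 := f.finrank_range_add_finrank_ker
  rw [h2] at h3
  exact LinearMap.ker_eq_bot.1 (Submodule.finrank_eq_zero.1 (Nat.add_left_cancel h3))

/-- The lower bounds 1, 2 and 1 for the three totals add up to four, the total dimension, so all of
them are attained. -/
lemma eq_counts {W : Multiset ℤ} (hW : W.card = 4) {f g h : ℤ → ℕ}
    (hs : ∀ i, f i + g i + h i = W.count i) {a s : ℤ} (ha : f a ≠ 0) (hs' : h s ≠ 0)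
    (hg : 2 ≤ ∑ i ∈ W.toFinset, g i) : a ∈ W ∧ s ∈ W ∧ ∑ i ∈ W.toFinset, g i = 2 ∧
      (∀ i, f i = Multiset.count i {a}) ∧ ∀ i, h i = Multiset.count i {s} := by
  have h1 (i : ℤ) (hi : i ∉ W.toFinset) : f i + g i + h i = 0 := by
    rw [hs, Multiset.count_eq_zero]
    exact fun h => hi (Multiset.mem_toFinset.2 h)
  have haW : a ∈ W.toFinset := by
    by_contra h
    have := h1 a h
    lia
  have hsW : s ∈ W.toFinset := by
    by_contra h
    have := h1 s h
    lia
  have htot := Multiset.toFinset_sum_count_eq W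
  rw [hW, ← Finset.sum_congr rfl fun i _ => hs i, Finset.sum_add_distrib,
    Finset.sum_add_distrib] at htot
  have hs0 := Finset.single_le_sum (f := f) (fun _ _ => Nat.zero_le _) haW
  have hs2 := Finset.single_le_sum (f := h) (fun _ _ => Nat.zero_le _) hsW
  refine ⟨Multiset.mem_toFinset.1 haW, Multiset.mem_toFinset.1 hsW, by lia,
    count_of_sum_eq_one (s := W.toFinset) (by lia) (fun i hi => ?_) ha,
    count_of_sum_eq_one (s := W.toFinset) (by lia) (fun i hi => ?_) hs'⟩
  · have := h1 i hi
    lia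
  · have := h1 i hi
    lia

lemma count_middle {m n t i : ℤ} {b : ℕ}
    (h : Multiset.count i {0} + b + Multiset.count i {t} = Multiset.count i {0, m, n, t}) :
    b = Multiset.count i {m, n} := by
  simp only [Multiset.insert_eq_cons, Multiset.count_cons, Multiset.count_singleton] at h ⊢
  lia

lemma one_le_finrank_ker_syzMap (R : ResData P E) [Module.Finite F (ExtTot P E C)] {s : ℤ}
    [Nontrivial (ExtP P E C s)] [Subsingleton (ExtP P E C (1 + s))] :
    1 ≤ Module.finrank F (LinearMap.ker (R.syzMap C)) := by
  obtain ⟨x, hx⟩ := exists_ne (0 : ExtP P E C s)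
  have : Nontrivial (LinearMap.ker (R.syzMap C)) :=
    ⟨⟨_, R.lof_mem_ker_syzMap x⟩, 0, fun h => hx (DirectSum.of_injective
      (β := fun n => ExtP P E C n) s ((congrArg Subtype.val h).trans (map_zero _).symm))⟩
  exact Module.finrank_pos

/-- Middle Koszul homology has dimension dim coker + dim ker. Both are at least one by the extremal
degrees, so a middle dimension of two makes both equal to one. -/
lemma two_le_finrank_map_ker (R : ResData P E) [Module.Finite F (ExtTot P E C)] {a s : ℤ}
    [Subsingleton (ExtP P E C (a - 1))] [Nontrivial (ExtP P E C a)]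
    [Nontrivial (ExtP P E C s)] [Subsingleton (ExtP P E C (1 + s))] :
    2 ≤ Module.finrank F ((LinearMap.ker (R.relMap C)).map (LinearMap.range (R.syzMap C)).mkQ) ∧
    (Module.finrank F ((LinearMap.ker (R.relMap C)).map
      (LinearMap.range (R.syzMap C)).mkQ) = 2 →
        Module.finrank F (LinearMap.range (R.relMap C)) + 1 = Module.finrank F (ExtTot P E C) ∧
        Module.finrank F (LinearMap.ker (R.syzMap C)) = 1) := by
  have hrel := Submodule.finrank_lt (R.relMap_ne_top (C := C) (a := a))
  have hsyz := R.one_le_finrank_ker_syzMap (C := C) (s := s)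
  have hker := finrank_map_mkQ_ker (by rw [Module.finrank_prod, two_mul]) (R.relMap C) (R.syzMap C)
    R.relMap_syzMap
  generalize Module.finrank F (LinearMap.range (R.relMap C)) = x1 at *
  generalize Module.finrank F (LinearMap.ker (R.syzMap C)) = x2 at *
  generalize Module.finrank F ((LinearMap.ker (R.relMap C)).map
      (LinearMap.range (R.syzMap C)).mkQ) = x3 at *
  generalize Module.finrank F (ExtTot P E C) = x4 at *
  clear * - hrel hsyz hker
  lia

/-- The bottom piece is nonzero in the lowest degree of Ext, the top piece in the highest, and the
middle pieces cover a space of dimension at least two. Four dimensions leave no slack. -/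
theorem hasShape (R : ResData P E) (hC : IsPerfect C) {m n t : ℤ} (hm : 0 ≤ m) (hmn : m ≤ n)
    (hnt : n ≤ t) (hH : ∀ i : ℤ, Module.finrank F (C.homology i) =
      Multiset.count i {0, m, n, t}) : R.HasShape C m n t := by
  have hfin := hC.finite_homology
  have hfinE := R.finite_ext hC
  have hfinT := R.finite_extTot hC
  have hgr (i : ℤ) (k : ℕ) : Module.Finite F (GrPiece P C i k) := inferInstance
  have hW (i : ℤ) (hi : i ∈ ({0, m, n, t} : Multiset ℤ)) : 0 ≤ i ∧ i ≤ t := by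
    simp only [Multiset.insert_eq_cons, Multiset.mem_cons, Multiset.mem_singleton] at hi
    clear * - hi hm hmn hnt
    lia
  have hnt' (i : ℤ) (h : i ∈ ({0, m, n, t} : Multiset ℤ)) : Nontrivial (C.homology i) :=
    Module.nontrivial_of_finrank_pos (R := F) (by rw [hH]; exact Multiset.count_pos.2 h)
  have hE (i : ℤ) (hi : i ∈ ({0, m, n, t} : Multiset ℤ)) : Nontrivial (ExtP P E C i) := by
    by_contra h
    have := not_nontrivial_iff_subsingleton.1 h
    exact not_subsingleton_iff_nontrivial.2 (hnt' i hi) (R.subsingleton_homology hC)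
  obtain ⟨a, s, ha, hs, hbd⟩ := R.exists_extremal hC (hnt' 0 (by simp))
  have hsub (i : ℤ) (hi : ¬ (a ≤ i ∧ i ≤ s)) : Subsingleton (ExtP P E C i) := by
    rw [← not_nontrivial_iff_subsingleton]
    exact fun h => hi (hbd i h)
  have hsub1 := hsub (a - 1) (by clear * -; lia)
  have hsub2 := hsub (s + 1) (by clear * -; lia)
  have hsub2' := hsub (1 + s) (by clear * -; lia)
  have h0 : Module.finrank F (GrPiece P C a 0) ≠ 0 := by
    have := R.nontrivial_grPiece_zero hC (sub_add_cancel a 1)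
    exact Module.finrank_pos.ne'
  have h2 : Module.finrank F (GrPiece P C s 2) ≠ 0 := by
    have := (R.trace_surjective hC s).nontrivial
    exact Module.finrank_pos.ne'
  have hsum (i : ℤ) := finrank_homology (P := P) (C := C) (n := i).symm.trans (hH i)
  have hsub3 (i : ℤ) (hi : i ∉ Multiset.toFinset {0, m, n, t}) :
      Subsingleton (GrPiece P C i 1) := by
    refine (Module.finrank_zero_iff (R := F)).1 ?_
    have h1 := hsum i
    rw [Multiset.count_eq_zero.2 fun h => hi (Multiset.mem_toFinset.2 h)] at h1
    exact (Nat.add_eq_zero_iff.1 (Nat.add_eq_zero_iff.1 h1).1).2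
  obtain ⟨hK, hK'⟩ := R.two_le_finrank_map_ker (C := C) (a := a) (s := s)
  have hle := R.map_ker_relMap_le hC
  have hle' := hK.trans (Submodule.finrank_mono hle)
  obtain ⟨hle2, hinj⟩ := finrank_range_directSum (M := fun n => GrPiece P C n 1) _ hsub3
    (R.gammaTot C)
  obtain ⟨haW, hsW, hg1, hg0, hg2⟩ := eq_counts (W := {0, m, n, t}) rfl hsum h0 h2
    (hle'.trans hle2)
  -- Ext is nonzero wherever cohomology is, so a ≤ 0; conversely gr, hence cohomology, is nonzero in
  -- degree a, so a ≥ 0. The same argument at the other end gives s = t.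
  obtain rfl : a = 0 := le_antisymm (hbd 0 (hE 0 (by simp))).1 (hW a haW).1
  obtain rfl : s = t := le_antisymm (hW s hsW).2 (hbd t (hE t (by simp))).2
  rw [hg1] at hle2
  have hr2 : Module.finrank F (LinearMap.range (R.gammaTot C)) = 2 :=
    le_antisymm hle2 hle'
  have hKe := Submodule.eq_of_le_of_finrank_le hle (hr2.trans_le hK)
  obtain ⟨h5, -⟩ := hK' (by rw [hKe, hr2])
  refine ⟨hg0, fun i => ?_, hg2, ha, hs, hbd, h5, ?_, hKe.symm⟩
  · have h1 := hsum i
    rw [hg0 i, hg2 i] at h1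
    exact count_middle h1
  · exact hinj (hr2.trans hg1.symm)

end Counting

end ResData


/-! ### The socle of a complete intersection in two variables. -/

section Relations

lemma exists_of_mul_eq_mul {A : Type*} [CommRing A] [IsDomain A] [DecompositionMonoid A] {p q : A}
    (h : IsRelPrime p q) (hp : p ≠ 0) {c d : A} (hcd : p * c = q * d) :
    ∃ l, c = q * l ∧ d = p * l := by
  obtain ⟨l, rfl⟩ := h.dvd_of_dvd_mul_left (Dvd.intro c hcd)
  exact ⟨l, mul_left_cancel₀ hp (by rw [hcd]; ring), rfl⟩

/-- The socle of a complete intersection of two elements in two variables is generated by the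
determinant of a matrix expressing the elements in the variables. -/
lemma exists_eq_det_add {A : Type*} [CommRing A] [IsDomain A] [DecompositionMonoid A]
    {p q y z y0 y1 z0 z1 u α β γ δ : A} (hpq : IsRelPrime p q) (hp : p ≠ 0)
    (hyz : IsRelPrime y z) (hy0 : y ≠ 0) (hy : y = p * y0 + q * y1) (hz : z = p * z0 + q * z1)
    (h0 : p * u = α * y + β * z) (h1 : q * u = γ * y + δ * z) :
    ∃ h k l, u = h * (y0 * z1 - y1 * z0) + k * y + l * z := by
  -- Computing pqu in two ways gives (qα - pγ)y = (pδ - qβ)z, so coprimality of y and z produces h.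
  -- Substituting the expressions of y and z in p and q, coprimality of p and q then produces l and
  -- k.
  obtain ⟨h, hh1, hh2⟩ := exists_of_mul_eq_mul (c := q * α - p * γ) (d := p * δ - q * β) hyz hy0
    (by linear_combination p * h1 - q * h0)
  obtain ⟨l, hl1, hl2⟩ := exists_of_mul_eq_mul (c := δ - h * y0) (d := β + h * y1) hpq hp
    (by linear_combination hh2 + h * hy)
  obtain ⟨k, hk1, hk2⟩ := exists_of_mul_eq_mul (c := γ + h * z0) (d := α - h * z1) hpq hp
    (by linear_combination -hh1 - h * hz)
  refine ⟨h, k, l, mul_left_cancel₀ hp ?_⟩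
  linear_combination h0 + y * hk2 + z * hl2 + h * z1 * hy - h * y1 * hz

end Relations

/-! ### Coprimality, Nakayama and regular sequences for binary polynomials. -/

section Polynomial

open MvPolynomial

variable {F : Type u} [Field F]

lemma isRelPrime_X : IsRelPrime (X 0 : MvPolynomial (Fin 2) F) (X 1) := by
  refine (X_prime.irreducible.isRelPrime_iff_not_dvd).2 fun h => ?_
  rw [X_dvd_X] at h
  exact absurd h (by decide)

/-- A common divisor divides powers of both variables, which are coprime. -/
lemma isRelPrime_of_X_pow_mem {y z : MvPolynomial (Fin 2) F} {N : ℕ}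
    (h : ∀ i, (X i : MvPolynomial (Fin 2) F) ^ N ∈ Ideal.span {y, z}) : IsRelPrime y z := by
  intro d hy hz
  have h1 (i : Fin 2) : d ∣ (X i : MvPolynomial (Fin 2) F) ^ N := by
    obtain ⟨a, b, hab⟩ := Ideal.mem_span_pair.1 (h i)
    rw [← hab]
    exact dvd_add (hy.mul_left a) (hz.mul_left b)
  exact (isRelPrime_X (F := F)).pow (m := N) (n := N) (h1 0) (h1 1)

lemma homogeneousComponent_succ_X_mul (i : Fin 2) (d : ℕ) (f : MvPolynomial (Fin 2) F) :
    homogeneousComponent (d + 1) (X i * f) = X i * homogeneousComponent d f := by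
  ext m
  rw [coeff_homogeneousComponent, coeff_X_mul', coeff_X_mul', coeff_homogeneousComponent]
  by_cases hi : i ∈ m.support
  · rw [if_pos hi, if_pos hi]
    have h1 : (m - Finsupp.single i 1).degree + 1 = m.degree := by
      have h2 : m - Finsupp.single i 1 + Finsupp.single i 1 = m :=
        tsub_add_cancel_of_le (Finsupp.single_le_iff.2
          (Nat.one_le_iff_ne_zero.2 (Finsupp.mem_support_iff.1 hi)))
      conv_rhs => rw [← h2]
      rw [map_add, Finsupp.degree_single]
    congr 1
    rw [← h1]
    exact propext Nat.succ_inj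
  · rw [if_neg hi, if_neg hi, ite_self]

lemma homogeneousComponent_zero_X_mul (i : Fin 2) (f : MvPolynomial (Fin 2) F) :
    homogeneousComponent 0 (X i * f) = 0 := by
  rw [homogeneousComponent_zero, coeff_X_mul', if_neg (by simp), map_zero]

/-- Graded Nakayama by induction on the degree of the homogeneous component: the remainder terms
carry a variable, so only components of lower degree of elements of J enter. -/
lemma le_span_of_nakayama {J : Ideal (MvPolynomial (Fin 2) F)} {y z : MvPolynomial (Fin 2) F}
    {a b : ℕ} (hy : y.IsHomogeneous a)
    (hz : z.IsHomogeneous b) (h : ∀ f ∈ J, ∃ α β : F, ∃ f0 ∈ J, ∃ f1 ∈ J,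
      f = C α * y + C β * z + (X 0 * f0 + X 1 * f1)) : J ≤ Ideal.span {y, z} := by
  have hyc (d : ℕ) (α : F) : homogeneousComponent d (C α * y) ∈ Ideal.span {y, z} := by
    rw [homogeneousComponent_C_mul, homogeneousComponent_of_mem hy]
    split_ifs
    · exact Ideal.mul_mem_left _ _ (Ideal.subset_span (Or.inl rfl))
    · rw [mul_zero]; exact zero_mem _
  have hzc (d : ℕ) (α : F) : homogeneousComponent d (C α * z) ∈ Ideal.span {y, z} := by
    rw [homogeneousComponent_C_mul, homogeneousComponent_of_mem hz]
    split_ifs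
    · exact Ideal.mul_mem_left _ _ (Ideal.subset_span (Or.inr rfl))
    · rw [mul_zero]; exact zero_mem _
  have key (d : ℕ) : ∀ f ∈ J, homogeneousComponent d f ∈ Ideal.span {y, z} := by
    induction d with
    | zero =>
      intro f hf
      obtain ⟨α, β, f0, -, f1, -, rfl⟩ := h f hf
      rw [map_add, map_add, map_add, homogeneousComponent_zero_X_mul,
        homogeneousComponent_zero_X_mul, add_zero, add_zero]
      exact add_mem (hyc 0 α) (hzc 0 β)
    | succ d ih =>
      intro f hf
      obtain ⟨α, β, f0, h0, f1, h1, rfl⟩ := h f hf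
      rw [map_add, map_add, map_add, homogeneousComponent_succ_X_mul,
        homogeneousComponent_succ_X_mul]
      exact add_mem (add_mem (hyc _ α) (hzc _ β)) (add_mem (Ideal.mul_mem_left _ _ (ih _ h0))
        (Ideal.mul_mem_left _ _ (ih _ h1)))
  intro f hf
  rw [← sum_homogeneousComponent f]
  exact sum_mem fun d _ => key d f hf

/-- If z a is divisible by y and y, z are coprime, then y divides a. -/
lemma isWeaklyRegular_pair {A : Type*} [CommRing A] [IsDomain A] [DecompositionMonoid A] {y z : A}
    (hy : y ≠ 0) (h : IsRelPrime y z) : RingTheory.Sequence.IsWeaklyRegular A [y, z] := by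
  refine (RingTheory.Sequence.isWeaklyRegular_cons_iff A y [z]).2
    ⟨fun a b hab => mul_left_cancel₀ hy hab, ?_⟩
  rw [RingTheory.Sequence.isWeaklyRegular_singleton_iff]
  refine (isSMulRegular_quotient_iff_mem_of_smul_mem _ _).2 fun a ha => ?_
  rw [Submodule.mem_smul_pointwise_iff_exists] at ha ⊢
  obtain ⟨b, -, hb⟩ := ha
  obtain ⟨c, rfl⟩ := h.dvd_of_dvd_mul_left (Dvd.intro b hb)
  exact ⟨c, trivial, rfl⟩

lemma isRegular_pair {y z : MvPolynomial (Fin 2) F} {a b : ℕ} (ha : 0 < a) (hb : 0 < b)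
    (hy : y.IsHomogeneous a) (hz : z.IsHomogeneous b) (hy0 : y ≠ 0) (h : IsRelPrime y z) :
    RingTheory.Sequence.IsRegular (MvPolynomial (Fin 2) F) [y, z] := by
  refine ⟨isWeaklyRegular_pair hy0 h, fun h1 => ?_⟩
  have h2 : (1 : MvPolynomial (Fin 2) F) ∈ Ideal.span {y, z} := by
    have h3 : (1 : MvPolynomial (Fin 2) F) ∈ (Ideal.ofList [y, z] • ⊤ : Ideal _) :=
      h1 ▸ Submodule.mem_top
    rwa [smul_eq_mul, Ideal.mul_top, Ideal.ofList_cons, Ideal.ofList_singleton,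
      ← Ideal.span_insert] at h3
  obtain ⟨c, d, hcd⟩ := Ideal.mem_span_pair.1 h2
  have h4 := congrArg constantCoeff hcd
  rw [map_add, map_mul, map_mul, map_one, constantCoeff_eq,
    hy.coeff_eq_zero (by rw [map_zero]; exact ha.ne), hz.coeff_eq_zero (by rw [map_zero]; exact hb.ne),
    mul_zero, mul_zero, add_zero] at h4
  exact zero_ne_one h4

end Polynomial

/-! ### The complete intersection property. -/

section CompleteIntersection

open MvPolynomial

variable {F : Type u} [Field F]

lemma isAdicComplete_of_pow_eq_bot {A : Type*} [CommRing A] {I : Ideal A} {N : ℕ}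
    (h : I ^ N = ⊥) : IsAdicComplete I A where
  haus' x hx := by
    have h1 := hx N
    rwa [h, smul_eq_mul, Ideal.bot_mul, SModEq.zero, Submodule.mem_bot] at h1
  prec' f hf := by
    refine ⟨f N, fun n => ?_⟩
    rcases le_total n N with hn | hn
    · exact hf hn
    · have h1 := hf hn
      rw [h, smul_eq_mul, Ideal.bot_mul, SModEq.bot] at h1
      rw [h1]

/-- The quotient of a polynomial ring by a regular sequence of homogeneous elements of positive
degree which generate an ideal containing powers of the variables is a complete intersection. -/
theorem isCompleteIntersectionLocalRing_quotient {J : Ideal (MvPolynomial (Fin 2) F)}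
    {y z : MvPolynomial (Fin 2) F} (hJ : J = Ideal.span {y, z})
    (hy : constantCoeff y = 0) (hz : constantCoeff z = 0) (hy0 : y ≠ 0) {N : ℕ}
    (hN : ∀ i, (X i : MvPolynomial (Fin 2) F) ^ N ∈ J) :
    IsCompleteIntersectionLocalRing (MvPolynomial (Fin 2) F ⧸ J) := by
  have hrel : IsRelPrime y z := isRelPrime_of_X_pow_mem (hJ ▸ hN)
  have hle : ∀ f ∈ J, constantCoeff f = 0 := by
    intro f hf
    rw [hJ] at hf
    obtain ⟨c, d, rfl⟩ := Ideal.mem_span_pair.1 hf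
    rw [map_add, map_mul, map_mul, hy, hz, mul_zero, mul_zero, add_zero]
  let π : MvPolynomial (Fin 2) F ⧸ J →+* F := Ideal.Quotient.lift J constantCoeff hle
  have hnil (f : MvPolynomial (Fin 2) F) (hf : constantCoeff f = 0) :
      IsNilpotent (Ideal.Quotient.mk J f) := by
    have h1 : f ∈ J.radical := by
      have h2 : Ideal.span {(X 0 : MvPolynomial (Fin 2) F), X 1} ≤ J.radical := by
        rw [Ideal.span_le]
        rintro _ (rfl | rfl)
        · exact ⟨N, hN 0⟩
        · exact ⟨N, hN 1⟩
      have h3 := sub_C_constantCoeff_mem f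
      rw [hf, map_zero, sub_zero] at h3
      exact h2 h3
    obtain ⟨k, hk⟩ := h1
    exact ⟨k, by rw [← map_pow]; exact Ideal.Quotient.eq_zero_iff_mem.2 hk⟩
  -- The variables are nilpotent modulo J, so a polynomial with nonzero constant term is a unit plus
  -- a nilpotent.
  have hunit (f : MvPolynomial (Fin 2) F) (hf : constantCoeff f ≠ 0) :
      IsUnit (Ideal.Quotient.mk J f) := by
    have h1 : IsUnit (Ideal.Quotient.mk J (C (constantCoeff f))) :=
      ((isUnit_iff_ne_zero.2 hf).map C).map _
    have h2 := hnil (f - C (constantCoeff f)) (by rw [map_sub, constantCoeff_C, sub_self])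
    have h3 := h2.isUnit_add_left_of_commute h1 (Commute.all _ _)
    rwa [← map_add, add_sub_cancel] at h3
  have hloc : IsLocalHom π := ⟨fun b hb => by
    obtain ⟨f, rfl⟩ := Ideal.Quotient.mk_surjective b
    exact hunit f hb.ne_zero⟩
  have hlocal : IsLocalRing (MvPolynomial (Fin 2) F ⧸ J) := π.domain_isLocalRing
  refine ⟨inferInstance, hlocal, ?_⟩
  have hmax : ∃ k, IsLocalRing.maximalIdeal (MvPolynomial (Fin 2) F ⧸ J) ^ k = ⊥ := by
    have h1 : IsLocalRing.maximalIdeal (MvPolynomial (Fin 2) F ⧸ J) ≤ (⊥ : Ideal _).radical := by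
      intro b hb
      obtain ⟨f, rfl⟩ := Ideal.Quotient.mk_surjective b
      obtain ⟨k, hk⟩ := hnil f (by
        by_contra h
        exact (IsLocalRing.mem_maximalIdeal _).1 hb (hunit f h))
      exact ⟨k, hk⟩
    obtain ⟨k, hk⟩ := Ideal.exists_pow_le_of_le_radical_of_fg h1 (IsNoetherian.noetherian _)
    exact ⟨k, le_bot_iff.1 hk⟩
  obtain ⟨k, hk⟩ := hmax
  -- The maximal ideal is nilpotent, so the ring is its own completion. The regular local ring will
  -- be the polynomial ring localised at the origin.
  have hcomp := isAdicComplete_of_pow_eq_bot hk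
  let p : Ideal (MvPolynomial (Fin 2) F) := RingHom.ker constantCoeff
  have hp : p.IsPrime := RingHom.ker_isPrime _
  let A := Localization.AtPrime p
  let ψ : MvPolynomial (Fin 2) F →+* A := algebraMap _ _
  have hsp : Ideal.ofList ([y, z].map ψ) = J.map ψ := by
    rw [hJ, ← Ideal.map_ofList, Ideal.ofList_cons, Ideal.ofList_singleton, ← Ideal.span_insert]
  -- Localising does not change the quotient by J, since the denominators are already units modulo
  -- J.
  have hiso : Function.Bijective (Ideal.quotientMap (J.map ψ) ψ Ideal.le_comap_map) := by
    constructor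
    · refine (injective_iff_map_eq_zero _).2 fun b hb => ?_
      obtain ⟨f, rfl⟩ := Ideal.Quotient.mk_surjective b
      rw [Ideal.quotientMap_mk, Ideal.Quotient.eq_zero_iff_mem,
        IsLocalization.algebraMap_mem_map_algebraMap_iff p.primeCompl] at hb
      obtain ⟨s, hs, hsf⟩ := hb
      have h1 := Ideal.Quotient.eq_zero_iff_mem.2 hsf
      rw [map_mul] at h1
      exact (hunit s hs).mul_right_eq_zero.1 h1
    · intro c
      obtain ⟨c, rfl⟩ := Ideal.Quotient.mk_surjective c
      obtain ⟨f, s, rfl⟩ := IsLocalization.exists_mk'_eq p.primeCompl c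
      obtain ⟨g, hg⟩ := Ideal.Quotient.mk_surjective ((hunit s.1 s.2).unit⁻¹ : (_)ˣ).1
      refine ⟨Ideal.Quotient.mk J (g * f), ?_⟩
      rw [Ideal.quotientMap_mk, Ideal.Quotient.eq]
      have h1 : s.1 * g - 1 ∈ J := by
        rw [← Ideal.Quotient.eq, map_mul, hg, map_one]
        exact (hunit s.1 s.2).mul_val_inv
      have h2 : ψ (g * f) - IsLocalization.mk' A f s = ψ (s.1 * g - 1) * IsLocalization.mk' A f s := by
        have h3 : IsLocalization.mk' A f s * ψ s.1 = ψ f := IsLocalization.mk'_spec A f s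
        rw [map_mul, map_sub, map_mul, map_one, ← h3]
        ring
      rw [h2]
      exact Ideal.mul_mem_right _ _ (Ideal.mem_map_of_mem _ h1)
  refine ⟨A, inferInstance, inferInstance, [y, z].map ψ, ?_, ⟨?_⟩⟩
  · exact (isWeaklyRegular_pair hy0 hrel).isRegular_of_isLocalization_of_mem A p fun r hr => by
      rw [List.mem_cons, List.mem_singleton] at hr
      rcases hr with rfl | rfl
      · exact hy
      · exact hz
  · exact (AdicCompletion.ofAlgEquiv _).symm.toRingEquiv.trans
      ((RingEquiv.ofBijective _ hiso).trans (Ideal.quotEquivOfEq hsp.symm))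

end CompleteIntersection


lemma exists_eq_smul_add {F V : Type*} [Field F] [AddCommGroup V] [Module F V] [Module.Finite F V]
    {W : Submodule F V} (h : Module.finrank F W + 1 = Module.finrank F V) {e : V} (he : e ∉ W)
    (v : V) : ∃ c : F, ∃ w ∈ W, v = c • e + w := by
  have h1 : W < W ⊔ Submodule.span F {e} := by
    refine lt_of_le_of_ne le_sup_left fun h2 => he ?_
    rw [h2]
    exact Submodule.mem_sup_right (Submodule.mem_span_singleton_self e)
  have h2 : W ⊔ Submodule.span F {e} = ⊤ := by
    refine Submodule.eq_top_of_finrank_eq (le_antisymm (Submodule.finrank_le _) ?_)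
    have h3 := Submodule.finrank_lt_finrank_of_lt h1
    lia
  have h3 : v ∈ W ⊔ Submodule.span F {e} := h2 ▸ Submodule.mem_top
  obtain ⟨w, hw, x, hx, rfl⟩ := Submodule.mem_sup.1 h3
  obtain ⟨c, rfl⟩ := Submodule.mem_span_singleton.1 hx
  exact ⟨c, w, hw, add_comm _ _⟩

/-! ### Ext is generated by one class of degree zero. -/

namespace ResData

open MvPolynomial

variable {F : Type u} [Field F] [CharP F 2] {G : Type u} [Group G] [Finite G] {P : Subgroup G}
  [IsKleinFour P] [P.Normal] {E C : CochainComplex (Rep.{u} F G) ℤ}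

section Evaluation

variable (R : ResData P E)

variable (P E C) in
/-- The inclusion of the homogeneous part of degree `n`. -/
abbrev lofE (n : ℤ) : ExtP P E C n →ₗ[F] ExtTot P E C :=
  DirectSum.lof F ℤ (fun n => ExtP P E C n) n

lemma lofE_injective (n : ℤ) : Function.Injective (lofE P E C n) :=
  DirectSum.of_injective (β := fun n => ExtP P E C n) n

lemma lofE_apply (n : ℤ) (x : ExtP P E C n) : lofE P E C n x n = x := DirectSum.lof_apply F n x

lemma lofE_apply_ne {n k : ℤ} (h : k ≠ n) (x : ExtP P E C n) : lofE P E C n x k = 0 :=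
  DFinsupp.single_eq_of_ne h

/-- The action of polynomials on a class of degree zero. -/
def ev (e : ExtP P E C 0) : MvPolynomial (Fin 2) F →ₗ[F] ExtTot P E C where
  toFun f := R.phi f • lofE P E C 0 e
  map_add' f g := by rw [map_add, add_smul]
  map_smul' c f := by rw [map_smul, smul_assoc, RingHom.id_apply]

variable (e : ExtP P E C 0)

lemma ev_apply (f : MvPolynomial (Fin 2) F) : R.ev e f = R.phi f • lofE P E C 0 e := rfl

lemma ev_C (c : F) : R.ev e (MvPolynomial.C c) = c • lofE P E C 0 e := by
  rw [C_eq_smul_one, map_smul, ev_apply, map_one, one_smul]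

lemma ev_mul (f g : MvPolynomial (Fin 2) F) : R.ev e (f * g) = R.phi f • R.ev e g := by
  rw [ev_apply, map_mul, mul_smul, ev_apply]

lemma ev_X_mul (j : Fin 2) (f : MvPolynomial (Fin 2) F) :
    R.ev e (X j * f) = R.xEnd C j (R.ev e f) := by
  rw [ev_mul, phi_X, xEnd_apply]

lemma relMap_ev (f g : MvPolynomial (Fin 2) F) :
    R.relMap C (R.ev e f, R.ev e g) = R.ev e (X 0 * f + X 1 * g) := by
  rw [map_add, ev_X_mul, ev_X_mul]
  rfl

lemma ev_mem {d : ℕ} {f : MvPolynomial (Fin 2) F} (hf : f.IsHomogeneous d) :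
    R.ev e f ∈ extDeg P E C d := by
  obtain ⟨a, ha⟩ := R.phi_mem_extDeg hf
  have h : R.ev e f = lofE P E C (d + 0) (HomCoh.comp (d : ℤ) 0 a e) := by
    rw [ev_apply, ← ha]
    exact DirectSum.Gmodule.of_smul_of _ _ _ _
  rw [h]
  have h1 : ∀ (k : ℤ) (_ : k = d) (x : ExtP P E C k), lofE P E C k x ∈ extDeg P E C d := by
    rintro _ rfl x
    exact ⟨x, rfl⟩
  exact h1 _ (add_zero _) _

lemma lofE_relMap {k k' : ℤ} (hk : 1 + k = k') (u v : ExtTot P E C) :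
    lofE P E C k' (R.relMap C (u, v) k') =
      R.xEnd C 0 (lofE P E C k (u k)) + R.xEnd C 1 (lofE P E C k (v k)) := by
  subst hk
  have h1 (j : Fin 2) (w : ExtTot P E C) :
      lofE P E C (1 + k) (R.xEnd C j w (1 + k)) = R.xEnd C j (lofE P E C k (w k)) :=
    (congrArg _ (R.xEnd_component j w rfl)).trans (R.xEnd_of j k (w k)).symm
  exact (map_add (lofE P E C (1 + k)) _ _).trans (congrArg₂ (· + ·) (h1 0 u) (h1 1 v))

variable {R e} {m n t : ℤ}

lemma HasShape.subsingleton (hs : R.HasShape C m n t) {i : ℤ} (hi : i < 0 ∨ t < i) :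
    Subsingleton (ExtP P E C i) := by
  rw [← not_nontrivial_iff_subsingleton]
  intro h
  have := hs.bounded i h
  lia

lemma HasShape.relMap_apply_zero (hs : R.HasShape C m n t) (u : ExtTot P E C × ExtTot P E C) :
    R.relMap C u 0 = 0 := by
  have := hs.subsingleton (i := 0 - 1) (by lia)
  exact R.relMap_apply_eq_zero u

lemma HasShape.notMem_range (hs : R.HasShape C m n t) (he : e ≠ 0) :
    lofE P E C 0 e ∉ LinearMap.range (R.relMap C) := by
  rintro ⟨u, hu⟩
  have h1 := congrArg (fun y : ExtTot P E C => y 0) hu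
  exact he ((lofE_apply 0 e).symm.trans (h1.symm.trans (hs.relMap_apply_zero u)))

/-- The image of `relMap` has codimension one and contains nothing in degree zero, so `e` spans a
complement. -/
lemma HasShape.exists_eq (hs : R.HasShape C m n t) (hC : IsPerfect C) (he : e ≠ 0)
    (v : ExtTot P E C) : ∃ (c : F) (u : ExtTot P E C × ExtTot P E C),
      v = c • lofE P E C 0 e + R.relMap C u := by
  have := R.finite_extTot hC
  obtain ⟨c, _, ⟨u, rfl⟩, h⟩ := exists_eq_smul_add hs.finrank_relMap (hs.notMem_range he) v
  exact ⟨c, u, h⟩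

lemma HasShape.exists_smul (hs : R.HasShape C m n t) (hC : IsPerfect C) (he : e ≠ 0)
    (x : ExtP P E C 0) : ∃ c : F, x = c • e := by
  obtain ⟨c, u, h⟩ := hs.exists_eq hC he (lofE P E C 0 x)
  refine ⟨c, ?_⟩
  have h1 := congrArg (fun y : ExtTot P E C => y 0) h
  refine (lofE_apply 0 x).symm.trans (h1.trans ?_)
  refine (congrArg₂ (· + ·) (congrArg (c • ·) (lofE_apply 0 e)) (hs.relMap_apply_zero u)).trans ?_
  exact add_zero _

/-- Nakayama by induction on the degree: a class of positive degree lies in x_0 Ext + x_1 Ext. -/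
lemma HasShape.exists_ev (hs : R.HasShape C m n t) (hC : IsPerfect C) (he : e ≠ 0) (d : ℕ) :
    ∀ x : ExtP P E C d, ∃ f, f.IsHomogeneous d ∧ R.ev e f = lofE P E C d x := by
  induction d with
  | zero =>
    intro x
    obtain ⟨c, rfl⟩ := hs.exists_smul hC he x
    exact ⟨MvPolynomial.C c, isHomogeneous_C _ _, (R.ev_C e c).trans (map_smul _ _ _).symm⟩
  | succ d ih =>
    intro x
    obtain ⟨c, ⟨a, b⟩, h⟩ := hs.exists_eq hC he (lofE P E C _ x)
    obtain ⟨f, hf, hf'⟩ := ih (a d)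
    obtain ⟨g, hg, hg'⟩ := ih (b d)
    refine ⟨X 0 * f + X 1 * g, ?_, ?_⟩
    · rw [add_comm d 1]
      exact ((isHomogeneous_X F 0).mul hf).add ((isHomogeneous_X F 1).mul hg)
    · rw [map_add, ev_X_mul, ev_X_mul, hf', hg']
      refine (R.lofE_relMap (k' := ((d + 1 : ℕ) : ℤ)) (by push_cast; ring) a b).symm.trans
        (congrArg _ ?_)
      have h1 := congrArg (fun y : ExtTot P E C => y ((d + 1 : ℕ) : ℤ)) h
      refine Eq.trans ?_ (h1.symm.trans (lofE_apply _ x))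
      refine Eq.trans (zero_add _).symm (congrArg (· + _) ?_)
      exact ((congrArg (c • ·) (lofE_apply_ne (by lia) e)).trans (smul_zero (A := ExtP P E C ((d + 1 : ℕ) : ℤ)) c)).symm

lemma HasShape.ev_surjective (hs : R.HasShape C m n t) (hC : IsPerfect C) (he : e ≠ 0) :
    Function.Surjective (R.ev e) := by
  intro x
  induction x using DirectSum.induction_on with
  | zero => exact ⟨0, map_zero _⟩
  | add x y hx hy =>
    obtain ⟨f, rfl⟩ := hx
    obtain ⟨g, rfl⟩ := hy
    exact ⟨f + g, map_add _ _ _⟩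
  | of k x =>
    rcases lt_or_ge k 0 with hk | hk
    · have := hs.subsingleton (Or.inl hk)
      exact ⟨0, by rw [Subsingleton.elim x 0, map_zero, map_zero]⟩
    · obtain ⟨d, rfl⟩ := Int.eq_ofNat_of_zero_le hk
      obtain ⟨f, -, hf⟩ := hs.exists_ev hC he d x
      exact ⟨f, hf⟩

/-- For a cyclic module over a commutative ring the annihilator is that of the generator. -/
lemma HasShape.phi_mem_annIdeal (hs : R.HasShape C m n t) (hC : IsPerfect C) (he : e ≠ 0)
    {f : MvPolynomial (Fin 2) F} : R.phi f ∈ annIdeal P E C ↔ R.ev e f = 0 := by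
  rw [Module.mem_annihilator]
  constructor
  · exact fun h => h _
  · intro h x
    obtain ⟨g, rfl⟩ := hs.ev_surjective hC he x
    rw [← ev_mul, mul_comm, ev_mul, h, smul_zero]

end Evaluation

/-! ### The two generators of J and the determinant. -/

section Frame

/-- The inclusion of a summand of the middle part of the associated graded space. -/
abbrev lofM (P : Subgroup G) (C : CochainComplex (Rep.{u} F G) ℤ) (k : ℤ) :
    GrPiece P C k 1 →ₗ[F] ⨁ n, GrPiece P C n 1 :=
  DirectSum.lof F ℤ (fun n => GrPiece P C n 1) k

/-- Cocycles representing a basis of the middle part of the associated graded space, with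
polynomials representing their images in `Ext`. -/
structure Frame (R : ResData P E) (C : CochainComplex (Rep.{u} F G) ℤ) (e : ExtP P E C 0)
    (m n : ℕ) where
  wy : filCyc P C m 2
  wz : filCyc P C n 2
  span (k : ℤ) (g : GrPiece P C k 1) : ∃ α β : F, (α = 0 ∨ k = m) ∧ (β = 0 ∨ k = n) ∧
    lofM P C k g = α • lofM P C m (grCls P C m 1 wy) + β • lofM P C n (grCls P C n 1 wz)
  indep (α β : F) (h : α • lofM P C m (grCls P C m 1 wy) + β • lofM P C n (grCls P C n 1 wz) = 0) :
    α = 0 ∧ β = 0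
  y : Fin 2 → MvPolynomial (Fin 2) F
  z : Fin 2 → MvPolynomial (Fin 2) F
  homY (j : Fin 2) : (y j).IsHomogeneous m
  homZ (j : Fin 2) : (z j).IsHomogeneous n
  evY (j : Fin 2) : R.ev e (y j) = R.psiTot C m (lamCyc P C m j wy)
  evZ (j : Fin 2) : R.ev e (z j) = R.psiTot C n (lamCyc P C n j wz)

variable {R : ResData P E} {e : ExtP P E C 0} {m n t : ℕ}

lemma nonempty_frame (hs : R.HasShape C m n t) (hC : IsPerfect C) (he : e ≠ 0) :
    Nonempty (R.Frame C e m n) := by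
  have hfin := hC.finite_homology
  obtain ⟨gy, gz, h1, h2⟩ := exists_pair_spanning (F := F) (M := fun n => GrPiece P C n 1) hs.gr_one
  obtain ⟨wy, rfl⟩ := grCls_surjective 1 gy
  obtain ⟨wz, rfl⟩ := grCls_surjective 1 gz
  choose y hy hy' using fun j => hs.exists_ev hC he m (R.psi C m (lamCyc P C m j wy))
  choose z hz hz' using fun j => hs.exists_ev hC he n (R.psi C n (lamCyc P C n j wz))
  exact ⟨⟨wy, wz, h1, h2, y, z, hy, hz, hy', hz'⟩⟩

lemma gammaTot_lofM (k : ℤ) (w : filCyc P C k 2) :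
    R.gammaTot C (lofM P C k (grCls P C k 1 w)) = Submodule.mkQ _ (R.pairCls C k w) :=
  (DirectSum.toModule_lof _ _ _).trans (R.gamma_grCls w)

namespace Frame

variable (Φ : R.Frame C e m n)

/-- The first relation. -/
def relY : MvPolynomial (Fin 2) F := X 0 * Φ.y 0 + X 1 * Φ.y 1

/-- The second relation. -/
def relZ : MvPolynomial (Fin 2) F := X 0 * Φ.z 0 + X 1 * Φ.z 1

/-- The determinant of the coefficients of the relations. -/
def det : MvPolynomial (Fin 2) F := Φ.y 0 * Φ.z 1 - Φ.y 1 * Φ.z 0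

lemma isHomogeneous_relY : Φ.relY.IsHomogeneous (m + 1) := by
  rw [add_comm]
  exact ((isHomogeneous_X F 0).mul (Φ.homY 0)).add ((isHomogeneous_X F 1).mul (Φ.homY 1))

lemma isHomogeneous_relZ : Φ.relZ.IsHomogeneous (n + 1) := by
  rw [add_comm]
  exact ((isHomogeneous_X F 0).mul (Φ.homZ 0)).add ((isHomogeneous_X F 1).mul (Φ.homZ 1))

lemma isHomogeneous_det : Φ.det.IsHomogeneous (m + n) := by
  refine ((Φ.homY 0).mul (Φ.homZ 1)).sub ?_
  exact (Φ.homY 1).mul (Φ.homZ 0)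

lemma pairCls_wy : R.pairCls C m Φ.wy = (R.ev e (Φ.y 0), R.ev e (Φ.y 1)) :=
  Prod.ext (Φ.evY 0).symm (Φ.evY 1).symm

lemma pairCls_wz : R.pairCls C n Φ.wz = (R.ev e (Φ.z 0), R.ev e (Φ.z 1)) :=
  Prod.ext (Φ.evZ 0).symm (Φ.evZ 1).symm

lemma ev_relY : R.ev e Φ.relY = 0 := by
  rw [relY, ← relMap_ev, ← pairCls_wy, relMap_pairCls]

lemma ev_relZ : R.ev e Φ.relZ = 0 := by
  rw [relZ, ← relMap_ev, ← pairCls_wz, relMap_pairCls]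

lemma span_total (g : ⨁ n, GrPiece P C n 1) : ∃ α β : F,
    g = α • lofM P C m (grCls P C m 1 Φ.wy) + β • lofM P C n (grCls P C n 1 Φ.wz) := by
  induction g using DirectSum.induction_on with
  | zero => exact ⟨0, 0, by rw [zero_smul, zero_smul, add_zero]⟩
  | add g h hg hh =>
    obtain ⟨α, β, rfl⟩ := hg
    obtain ⟨α', β', rfl⟩ := hh
    exact ⟨α + α', β + β', by rw [add_smul, add_smul, add_add_add_comm]⟩
  | of k g =>
    obtain ⟨α, β, -, -, h⟩ := Φ.span k g
    exact ⟨α, β, h⟩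

lemma gammaTot_combination (α β : F) :
    R.gammaTot C (α • lofM P C m (grCls P C m 1 Φ.wy) + β • lofM P C n (grCls P C n 1 Φ.wz)) =
      Submodule.mkQ _ (R.ev e (MvPolynomial.C α * Φ.y 0 + MvPolynomial.C β * Φ.z 0),
        R.ev e (MvPolynomial.C α * Φ.y 1 + MvPolynomial.C β * Φ.z 1)) := by
  rw [map_add, map_smul, map_smul, gammaTot_lofM, gammaTot_lofM, pairCls_wy, pairCls_wz,
    ← map_smul, ← map_smul, ← map_add]
  refine congrArg _ ?_
  rw [C_mul', C_mul', C_mul', C_mul', map_add, map_smul, map_smul, map_add, map_smul, map_smul]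
  rfl

/-- Pulling back to polynomials, a pair is trivial exactly when it agrees modulo J with some (x_1h,
x_0h). -/
lemma mkQ_ev_eq_zero_iff (f g : MvPolynomial (Fin 2) F) (hs : R.HasShape C m n t)
    (hC : IsPerfect C) (he : e ≠ 0) :
    Submodule.mkQ (LinearMap.range (R.syzMap C)) (R.ev e f, R.ev e g) = 0 ↔
      ∃ h, R.ev e (f + X 1 * h) = 0 ∧ R.ev e (g + X 0 * h) = 0 := by
  rw [Submodule.mkQ_apply, Submodule.Quotient.mk_eq_zero]
  have h1 (h : MvPolynomial (Fin 2) F) : R.syzMap C (R.ev e h) = (R.ev e f, R.ev e g) ↔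
      R.ev e (f + X 1 * h) = 0 ∧ R.ev e (g + X 0 * h) = 0 := by
    rw [map_add, map_add, add_eq_zero_iff_of_charTwo F, add_eq_zero_iff_of_charTwo F, ev_X_mul,
      ev_X_mul, eq_comm]
    exact Prod.mk_inj
  constructor
  · rintro ⟨v, hv⟩
    obtain ⟨h, rfl⟩ := hs.ev_surjective hC he v
    exact ⟨h, (h1 h).1 hv⟩
  · rintro ⟨h, hh⟩
    exact ⟨_, (h1 h).2 hh⟩

/-- Elements of J, written x_0a + x_1b, are Koszul cycles (a, b) of S/J. Since gr covers the middle
homology, the pair is a combination of the two frame pairs up to J and a trivial syzygy. So y and z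
span J modulo (x_0, x_1)J. -/
lemma exists_of_ev_eq_zero (hs : R.HasShape C m n t) (hC : IsPerfect C) (he : e ≠ 0)
    {f : MvPolynomial (Fin 2) F} (hf : R.ev e f = 0) : ∃ α β : F, ∃ f0 f1,
      R.ev e f0 = 0 ∧ R.ev e f1 = 0 ∧
      f = MvPolynomial.C α * Φ.relY + MvPolynomial.C β * Φ.relZ + (X 0 * f0 + X 1 * f1) := by
  obtain ⟨a, b, hab⟩ := Ideal.mem_span_pair.1 (sub_C_constantCoeff_mem f)
  have hf1 : f = X 0 * a + X 1 * b + MvPolynomial.C (constantCoeff f) := by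
    linear_combination -hab
  -- A nonzero constant term would put e in the image of `relMap`.
  have hc : constantCoeff f = 0 := by
    by_contra hc
    rw [hf1, map_add, ← relMap_ev, ev_C, add_eq_zero_iff_of_charTwo F] at hf
    exact hs.notMem_range he ((Submodule.smul_mem_iff _ hc).1 ⟨_, hf⟩)
  rw [hc, map_zero, add_zero] at hf1
  have h1 : Submodule.mkQ (LinearMap.range (R.syzMap C)) (R.ev e a, R.ev e b) ∈
      LinearMap.range (R.gammaTot C) := by
    rw [hs.range_gammaTot]
    exact ⟨_, by rw [SetLike.mem_coe, LinearMap.mem_ker, relMap_ev, ← hf1, hf], rfl⟩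
  obtain ⟨g, hg⟩ := h1
  obtain ⟨α, β, rfl⟩ := Φ.span_total g
  rw [gammaTot_combination, ← sub_eq_zero, ← map_sub, ← neg_eq_zero, ← map_neg, neg_sub,
    Prod.mk_sub_mk, ← map_sub, ← map_sub, mkQ_ev_eq_zero_iff _ _ hs hC he] at hg
  obtain ⟨h, h0, h1⟩ := hg
  refine ⟨α, β, _, _, h0, h1, ?_⟩
  have h2 : X 0 * X 1 * h + X 0 * X 1 * h = 0 := add_self_of_charTwo F (X 0 * X 1 * h)
  rw [hf1, relY, relZ]
  linear_combination -h2

/-- Conversely, a combination of y and z in (x_0, x_1)J makes the corresponding combination of frame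
pairs trivial, and injectivity of `gammaTot` kills the coefficients. So y and z are minimal
generators. -/
lemma eq_zero_of_combination (hs : R.HasShape C m n t) (hC : IsPerfect C) (he : e ≠ 0)
    {α β : F} {f0 f1 : MvPolynomial (Fin 2) F} (h0 : R.ev e f0 = 0) (h1 : R.ev e f1 = 0)
    (h : MvPolynomial.C α * Φ.relY + MvPolynomial.C β * Φ.relZ = X 0 * f0 + X 1 * f1) :
    α = 0 ∧ β = 0 := by
  refine Φ.indep α β (hs.gammaTot_injective ?_)
  rw [map_zero, gammaTot_combination, mkQ_ev_eq_zero_iff _ _ hs hC he]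
  rw [relY, relZ] at h
  obtain ⟨l, hl0, hl1⟩ := exists_of_mul_eq_mul (isRelPrime_X (F := F)) (X_ne_zero 0)
    (c := MvPolynomial.C α * Φ.y 0 + MvPolynomial.C β * Φ.z 0 - f0)
    (d := f1 - (MvPolynomial.C α * Φ.y 1 + MvPolynomial.C β * Φ.z 1)) (by linear_combination h)
  have h2 : X 0 * l + X 0 * l = 0 := add_self_of_charTwo F (X 0 * l)
  have h3 : X 1 * l + X 1 * l = 0 := add_self_of_charTwo F (X 1 * l)
  refine ⟨l, ?_, ?_⟩
  · rw [show MvPolynomial.C α * Φ.y 0 + MvPolynomial.C β * Φ.z 0 + X 1 * l = f0 by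
      linear_combination hl0 + h3, h0]
  · rw [show MvPolynomial.C α * Φ.y 1 + MvPolynomial.C β * Φ.z 1 + X 0 * l = f1 by
      linear_combination -hl1, h1]

lemma comap_annIdeal (hs : R.HasShape C m n t) (hC : IsPerfect C) (he : e ≠ 0) :
    (annIdeal P E C).comap R.phi = Ideal.span {Φ.relY, Φ.relZ} := by
  have hJ (f : MvPolynomial (Fin 2) F) : f ∈ (annIdeal P E C).comap R.phi ↔ R.ev e f = 0 :=
    hs.phi_mem_annIdeal hC he
  refine le_antisymm (le_span_of_nakayama Φ.isHomogeneous_relY Φ.isHomogeneous_relZ ?_) ?_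
  · intro f hf
    obtain ⟨α, β, f0, f1, h0, h1, h⟩ := Φ.exists_of_ev_eq_zero hs hC he ((hJ f).1 hf)
    exact ⟨α, β, f0, (hJ _).2 h0, f1, (hJ _).2 h1, h⟩
  · rw [Ideal.span_le]
    rintro _ (rfl | rfl)
    · exact (hJ _).2 Φ.ev_relY
    · exact (hJ _).2 Φ.ev_relZ

lemma mem_span_iff (hs : R.HasShape C m n t) (hC : IsPerfect C) (he : e ≠ 0)
    {f : MvPolynomial (Fin 2) F} : f ∈ Ideal.span {Φ.relY, Φ.relZ} ↔ R.ev e f = 0 := by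
  rw [← Φ.comap_annIdeal hs hC he]
  exact hs.phi_mem_annIdeal hC he

lemma _root_.EquivExt.ResData.HasShape.ev_eq_zero (hs : R.HasShape C m n t) {d : ℕ} (hd : t < d)
    {f : MvPolynomial (Fin 2) F} (hf : f.IsHomogeneous d) : R.ev e f = 0 := by
  obtain ⟨x, hx⟩ := R.ev_mem e hf
  have := hs.subsingleton (i := d) (by lia)
  rw [← hx, Subsingleton.elim x 0, map_zero]

/-- Ext vanishes above degree t, so powers of degree t + 1 annihilate e. -/
lemma X_pow_mem (hs : R.HasShape C m n t) (hC : IsPerfect C) (he : e ≠ 0) (i : Fin 2) :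
    (X i : MvPolynomial (Fin 2) F) ^ (t + 1) ∈ Ideal.span {Φ.relY, Φ.relZ} := by
  rw [Φ.mem_span_iff hs hC he]
  exact hs.ev_eq_zero t.lt_succ_self (isHomogeneous_X_pow i (t + 1))

lemma isRelPrime (hs : R.HasShape C m n t) (hC : IsPerfect C) (he : e ≠ 0) :
    IsRelPrime Φ.relY Φ.relZ :=
  isRelPrime_of_X_pow_mem (Φ.X_pow_mem hs hC he)

lemma relY_ne_zero (hs : R.HasShape C m n t) (hC : IsPerfect C) (he : e ≠ 0) : Φ.relY ≠ 0 := by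
  intro h
  have h1 := (Φ.eq_zero_of_combination hs hC he (α := 1) (β := 0) (map_zero (R.ev e))
    (map_zero (R.ev e)) (by rw [h]; simp)).1
  exact one_ne_zero h1

/-- Cramer's rule: the determinant times a variable is a combination of y and z, so it represents a
socle element. -/
lemma X_mul_det (i : Fin 2) : X i * Φ.det ∈ Ideal.span {Φ.relY, Φ.relZ} := by
  rw [Ideal.mem_span_pair]
  fin_cases i
  · exact ⟨Φ.z 1, -Φ.y 1, by simp only [relY, relZ, det, Fin.zero_eta]; ring⟩
  · exact ⟨-Φ.z 0, Φ.y 0, by simp only [relY, relZ, det, Fin.mk_one]; ring⟩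

lemma ev_mul_det (hs : R.HasShape C m n t) (hC : IsPerfect C) (he : e ≠ 0)
    (h : MvPolynomial (Fin 2) F) :
    R.ev e (h * Φ.det) = constantCoeff h • R.ev e Φ.det := by
  obtain ⟨a, b, hab⟩ := Ideal.mem_span_pair.1 (sub_C_constantCoeff_mem h)
  have h1 : h * Φ.det = a * (X 0 * Φ.det) + b * (X 1 * Φ.det) +
      MvPolynomial.C (constantCoeff h) * Φ.det := by
    linear_combination -Φ.det * hab
  have h2 (i : Fin 2) := (Φ.mem_span_iff hs hC he).1 (Φ.X_mul_det i)
  rw [h1, map_add, map_add, ev_mul, h2, ev_mul, h2, smul_zero, smul_zero, add_zero, zero_add,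
    C_mul', map_smul]

/-- The top degree lies in the socle, and `exists_eq_det_add` says that the socle of S/J is spanned
by the determinant. -/
lemma exists_ev_eq_det (hs : R.HasShape C m n t) (hC : IsPerfect C) (he : e ≠ 0)
    (x : ExtP P E C t) : ∃ c : F, lofE P E C t x = c • R.ev e Φ.det := by
  obtain ⟨u, hu, hux⟩ := hs.exists_ev hC he t x
  have h1 (i : Fin 2) : X i * u ∈ Ideal.span {Φ.relY, Φ.relZ} := by
    rw [Φ.mem_span_iff hs hC he]
    exact hs.ev_eq_zero (by lia) ((isHomogeneous_X F i).mul hu)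
  obtain ⟨α, β, h2⟩ := Ideal.mem_span_pair.1 (h1 0)
  obtain ⟨γ, δ, h3⟩ := Ideal.mem_span_pair.1 (h1 1)
  obtain ⟨h, k, l, h4⟩ := exists_eq_det_add (isRelPrime_X (F := F)) (X_ne_zero 0)
    (Φ.isRelPrime hs hC he) (Φ.relY_ne_zero hs hC he) rfl rfl h2.symm h3.symm
  refine ⟨constantCoeff h, ?_⟩
  rw [← Φ.ev_mul_det hs hC he, ← hux, h4, map_add, map_add, ev_mul R e k, ev_mul R e l, ev_relY,
    ev_relZ, smul_zero, smul_zero, add_zero, add_zero]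
  rfl

lemma ev_det_ne_zero (hs : R.HasShape C m n t) (hC : IsPerfect C) (he : e ≠ 0) :
    R.ev e Φ.det ≠ 0 := by
  intro h
  obtain ⟨x, hx⟩ := @exists_ne _ hs.nontrivial_top 0
  obtain ⟨c, hc⟩ := Φ.exists_ev_eq_det hs hC he x
  rw [h, smul_zero] at hc
  exact hx (lofE_injective _ (hc.trans (map_zero _).symm))

/-- A nonzero class of degree t is a multiple of the class of the determinant, which has degree m +
n. -/
theorem top_eq (Φ : R.Frame C e m n) (hs : R.HasShape C m n t) (hC : IsPerfect C) (he : e ≠ 0) : t = m + n := by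
  obtain ⟨x, hx⟩ := @exists_ne _ hs.nontrivial_top 0
  obtain ⟨c, hc⟩ := Φ.exists_ev_eq_det hs hC he x
  obtain ⟨x', hx'⟩ := R.ev_mem e Φ.isHomogeneous_det
  by_contra h
  rw [← hx'] at hc
  have h1 := congrArg (fun y : ExtTot P E C => y t) hc
  refine hx ((lofE_apply _ x).symm.trans (h1.trans ?_))
  refine Eq.trans (congrArg (c • ·) (lofE_apply_ne (n := ((m + n : ℕ) : ℤ)) (k := (t : ℤ))
    (by exact_mod_cast h) x')) ?_
  exact smul_zero (A := ExtP P E C (t : ℤ)) c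

end Frame

end Frame

end ResData


/-! ### The tensor decomposition of Ext and the properties of S/J. -/

namespace ResData

open MvPolynomial

variable {F : Type u} [Field F] [CharP F 2] {G : Type u} [Group G] {P : Subgroup G}
  [IsKleinFour P] [P.Normal] {E C : CochainComplex (Rep.{u} F G) ℤ}

section Cyclic

/-- The action of `H*(BP) / J` on a class of degree zero. -/
def quotAct (x : ExtP P E C 0) : (CohRing P E ⧸ annIdeal P E C) →ₗ[CohRing P E] ExtTot P E C :=
  (annIdeal P E C).liftQ (LinearMap.toSpanSingleton (CohRing P E) (ExtTot P E C) (lofE P E C 0 x))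
    fun _ ha => Module.mem_annihilator.1 ha _

lemma quotAct_mk (x : ExtP P E C 0) (a : CohRing P E) :
    quotAct x (Submodule.Quotient.mk a) = a • lofE P E C 0 x := rfl

variable (P E C) in
/-- The multiplication map `Ext⁰ ⊗ H*(BP) / J → Ext*`. -/
def tensorMap : ExtP P E C 0 ⊗[F] (CohRing P E ⧸ annIdeal P E C) →ₗ[F] ExtTot P E C :=
  TensorProduct.lift (LinearMap.mk₂ F (fun x b => quotAct x b)
    (fun x x' b => by
      obtain ⟨a, rfl⟩ := Submodule.Quotient.mk_surjective _ b
      rw [quotAct_mk, quotAct_mk, quotAct_mk, map_add, smul_add])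
    (fun c x b => by
      obtain ⟨a, rfl⟩ := Submodule.Quotient.mk_surjective _ b
      rw [quotAct_mk, quotAct_mk, map_smul, smul_comm])
    (fun x b b' => map_add _ _ _)
    (fun c x b => by
      obtain ⟨a, rfl⟩ := Submodule.Quotient.mk_surjective _ b
      rw [← Submodule.Quotient.mk_smul, quotAct_mk, quotAct_mk, smul_assoc]))

lemma tensorMap_tprod (q : G ⧸ P) (w : ExtP P E C 0 ⊗[F] (CohRing P E ⧸ annIdeal P E C)) :
    tensorMap P E C ((extRep P E C 0).tprod (quotRep P E C) q w) =
      extTotRep P E C q (tensorMap P E C w) := by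
  induction w using TensorProduct.induction_on with
  | zero => rw [map_zero, map_zero, map_zero]
  | add v w hv hw => rw [map_add, map_add, hv, hw, map_add, map_add]
  | tmul x b =>
    obtain ⟨a, rfl⟩ := Submodule.Quotient.mk_surjective _ b
    have h1 := extTotRep_smul P E C q a (lofE P E C 0 x)
    have h2 : extTotRep P E C q (lofE P E C 0 x) = lofE P E C 0 (extRep P E C 0 q x) :=
      extTotRep_of P E C q 0 x
    rw [h2] at h1
    exact h1.symm

lemma smul_mem_extDeg {k : ℤ} {b : CohRing P E} (hb : b ∈ extDeg P E E k) (x : ExtP P E C 0) :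
    b • lofE P E C 0 x ∈ extDeg P E C k := by
  obtain ⟨a, rfl⟩ := hb
  have h : ∀ (i : ℤ) (_ : i = k) (v : ExtP P E C i), lofE P E C i v ∈ extDeg P E C k := by
    rintro _ rfl v
    exact ⟨v, rfl⟩
  have h1 := h (k + 0) (add_zero k) (HomCoh.comp k 0 a x)
  rwa [← show DirectSum.lof F ℤ (fun n => ExtP P E E n) k a • lofE P E C 0 x =
    lofE P E C (k + 0) (HomCoh.comp k 0 a x) from DirectSum.Gmodule.of_smul_of _ _ _ _] at h1

variable [Finite G] {R : ResData P E} {e : ExtP P E C 0}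

lemma HasShape.tmul_eq {m n t : ℤ} (hs : R.HasShape C m n t) (hC : IsPerfect C) (he : e ≠ 0)
    {V : Type*} [AddCommGroup V] [Module F V] (w : ExtP P E C 0 ⊗[F] V) :
    ∃ v, w = e ⊗ₜ[F] v := by
  induction w using TensorProduct.induction_on with
  | zero => exact ⟨0, (TensorProduct.tmul_zero _ _).symm⟩
  | add v w hv hw =>
    obtain ⟨v, rfl⟩ := hv
    obtain ⟨w, rfl⟩ := hw
    exact ⟨v + w, (TensorProduct.tmul_add _ _ _).symm⟩
  | tmul x v =>
    obtain ⟨c, rfl⟩ := hs.exists_smul hC he x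
    exact ⟨c • v, TensorProduct.smul_tmul _ _ _⟩

lemma HasShape.quotAct_injective {m n t : ℤ} (hs : R.HasShape C m n t) (hC : IsPerfect C)
    (he : e ≠ 0) : Function.Injective (quotAct (E := E) e) := by
  refine (injective_iff_map_eq_zero _).2 fun b hb => ?_
  obtain ⟨a, rfl⟩ := Submodule.Quotient.mk_surjective _ b
  obtain ⟨f, rfl⟩ := R.phi.surjective a
  exact (Submodule.Quotient.mk_eq_zero _).2 ((hs.phi_mem_annIdeal hC he).2 hb)

/-- As Ext⁰ is the line through e, every tensor is e ⊗ b, and the map is the action of S/J on the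
generator e. -/
lemma HasShape.tensorMap_bijective {m n t : ℤ} (hs : R.HasShape C m n t) (hC : IsPerfect C) :
    Function.Bijective (tensorMap P E C) := by
  obtain ⟨e, he⟩ := @exists_ne _ hs.nontrivial_zero 0
  constructor
  · refine (injective_iff_map_eq_zero _).2 fun w hw => ?_
    obtain ⟨b, rfl⟩ := hs.tmul_eq hC he w
    rw [(injective_iff_map_eq_zero _).1 (hs.quotAct_injective hC he) b hw, TensorProduct.tmul_zero]
  · intro x
    obtain ⟨f, rfl⟩ := hs.ev_surjective hC he x
    exact ⟨e ⊗ₜ[F] Submodule.Quotient.mk (R.phi f), rfl⟩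

lemma HasShape.exists_equiv_ext {m n t : ℤ} (hs : R.HasShape C m n t) (hC : IsPerfect C) :
    ∃ e : ExtP P E C 0 ⊗[F] (CohRing P E ⧸ annIdeal P E C) ≃ₗ[F] ExtTot P E C,
      (∀ (a : CohRing P E) (x : ExtP P E C 0) (b : CohRing P E ⧸ annIdeal P E C),
        e (x ⊗ₜ[F] (a • b)) = a • e (x ⊗ₜ[F] b)) ∧
      (∀ (k : ℤ) (x : ExtP P E C 0), ∀ b ∈ extDeg P E E k,
        e (x ⊗ₜ[F] Submodule.Quotient.mk b) ∈ extDeg P E C k) ∧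
      (∀ (q : G ⧸ P) z,
        e ((extRep P E C 0).tprod (quotRep P E C) q z) = extTotRep P E C q (e z)) :=
  ⟨LinearEquiv.ofBijective (tensorMap P E C) (hs.tensorMap_bijective hC),
    fun a x b => (quotAct x).map_smul a b, fun _ x _ hb => smul_mem_extDeg hb x, tensorMap_tprod⟩

lemma HasShape.finite_quotient {m n t : ℤ} (hs : R.HasShape C m n t) (hC : IsPerfect C) :
    Module.Finite F (CohRing P E ⧸ annIdeal P E C) := by
  obtain ⟨e, he⟩ := @exists_ne _ hs.nontrivial_zero 0
  have := R.finite_extTot hC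
  exact Module.Finite.of_injective ((quotAct e).restrictScalars F) (hs.quotAct_injective hC he)

namespace Frame

variable {m n t : ℕ} (Φ : R.Frame C e m n)

lemma annIdeal_eq (hs : R.HasShape C m n t) (hC : IsPerfect C) (he : e ≠ 0) :
    annIdeal P E C = Ideal.span {R.phi Φ.relY, R.phi Φ.relZ} := by
  have h1 : Function.Surjective R.phi.toRingEquiv.toRingHom := R.phi.surjective
  rw [← Ideal.map_comap_of_surjective _ h1 (annIdeal P E C)]
  refine (congrArg (Ideal.map R.phi.toRingEquiv.toRingHom) (Φ.comap_annIdeal hs hC he)).trans ?_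
  rw [Ideal.map_span, Set.image_pair]
  rfl

lemma isRegular (hs : R.HasShape C m n t) (hC : IsPerfect C) (he : e ≠ 0) :
    RingTheory.Sequence.IsRegular (MvPolynomial (Fin 2) F) [Φ.relY, Φ.relZ] :=
  isRegular_pair m.succ_pos n.succ_pos Φ.isHomogeneous_relY Φ.isHomogeneous_relZ
    (Φ.relY_ne_zero hs hC he) (Φ.isRelPrime hs hC he)

lemma constantCoeff_eq_zero {f : MvPolynomial (Fin 2) F} {d : ℕ} (hf : f.IsHomogeneous (d + 1)) :
    constantCoeff f = 0 := by
  rw [constantCoeff_eq, hf.coeff_eq_zero (by rw [map_zero]; exact d.succ_ne_zero.symm)]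

lemma isCompleteIntersection (Φ : R.Frame C e m n) (hs : R.HasShape C m n t) (hC : IsPerfect C)
    (he : e ≠ 0) : IsCompleteIntersectionLocalRing
      (MvPolynomial (Fin 2) F ⧸ (annIdeal P E C).comap R.phi) :=
  isCompleteIntersectionLocalRing_quotient (Φ.comap_annIdeal hs hC he)
    (constantCoeff_eq_zero Φ.isHomogeneous_relY) (constantCoeff_eq_zero Φ.isHomogeneous_relZ)
    (Φ.relY_ne_zero hs hC he) fun i => by
      rw [Φ.comap_annIdeal hs hC he]
      exact Φ.X_pow_mem hs hC he i

end Frame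

end Cyclic

end ResData


/-! ### The exterior algebra of a graded plane. -/

section Exterior

variable {F : Type*} [Field F] {V : Type*} [AddCommGroup V] [Module F V]
  (b : Module.Basis (Fin 2) F V)

lemma finset_fin_two (s : Finset (Fin 2)) : s = ∅ ∨ s = {0} ∨ s = {1} ∨ s = {0, 1} := by
  decide +revert

lemma exteriorBasis_empty : b.ExteriorAlgebra ∅ = 1 := by
  rw [ExteriorAlgebra.basis_apply_ofCard b (n := 0) rfl]
  simp [ExteriorAlgebra.ιMulti_family]

lemma exteriorBasis_singleton (i : Fin 2) : b.ExteriorAlgebra {i} = ExteriorAlgebra.ι F (b i) := by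
  have hc : ({i} : Finset (Fin 2)).card = 1 := Finset.card_singleton i
  rw [ExteriorAlgebra.basis_apply_ofCard b hc, ExteriorAlgebra.ιMulti_family,
    ExteriorAlgebra.ιMulti_apply, List.ofFn_succ, List.ofFn_zero, List.prod_singleton]
  have h := (Set.powersetCard.mem_range_ofFinEmbEquiv_symm_iff_mem (Set.powersetCard.ofCard hc)
    (Set.powersetCard.ofFinEmbEquiv.symm (Set.powersetCard.ofCard hc) 0)).1 ⟨0, rfl⟩
  exact congrArg (fun j => ExteriorAlgebra.ι F (b j)) (Finset.mem_singleton.1 h)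

lemma exteriorBasis_pair : b.ExteriorAlgebra {0, 1} =
    ExteriorAlgebra.ι F (b 0) * ExteriorAlgebra.ι F (b 1) := by
  have hc : ({0, 1} : Finset (Fin 2)).card = 2 := rfl
  rw [ExteriorAlgebra.basis_apply_ofCard b hc, ExteriorAlgebra.ιMulti_family,
    ExteriorAlgebra.ιMulti_apply, List.ofFn_succ, List.ofFn_succ, List.ofFn_zero, List.prod_cons,
    List.prod_singleton]
  have h := (Set.powersetCard.ofFinEmbEquiv.symm (Set.powersetCard.ofCard hc)).strictMono
    (show (0 : Fin 2) < 1 by decide)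
  have h' : ∀ x y : Fin 2, x < y → x = 0 ∧ y = 1 := by decide
  obtain ⟨h0, h1⟩ := h' _ _ h
  exact congrArg₂ (· * ·) (congrArg (fun j => ExteriorAlgebra.ι F (b j)) h0)
    (congrArg (fun j => ExteriorAlgebra.ι F (b j)) h1)

lemma iota_mul_self (v : V) : ExteriorAlgebra.ι F v * ExteriorAlgebra.ι F v = 0 :=
  ExteriorAlgebra.ι_sq_zero v

/-- The span of the basis elements of a given degree. -/
def exteriorDeg (dg : Fin 2 → ℤ) (d : ℤ) : Submodule F (ExteriorAlgebra F V) :=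
  Submodule.span F {w | ∃ s : Finset (Fin 2), ∑ i ∈ s, dg i = d ∧ w = b.ExteriorAlgebra s}

variable {b}

lemma exteriorBasis_mem {dg : Fin 2 → ℤ} (s : Finset (Fin 2)) {d : ℤ} (h : ∑ i ∈ s, dg i = d) :
    b.ExteriorAlgebra s ∈ exteriorDeg b dg d := Submodule.subset_span ⟨s, h, rfl⟩

lemma ι_mul_exteriorBasis_mem {dg : Fin 2 → ℤ} (i : Fin 2) (s : Finset (Fin 2)) :
    ExteriorAlgebra.ι F (b i) * b.ExteriorAlgebra s ∈ exteriorDeg b dg (dg i + ∑ j ∈ s, dg j) := by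
  have hanti : ExteriorAlgebra.ι F (b 1) * ExteriorAlgebra.ι F (b 0) =
      -(ExteriorAlgebra.ι F (b 0) * ExteriorAlgebra.ι F (b 1)) :=
    eq_neg_of_add_eq_zero_left (ExteriorAlgebra.ι_add_mul_swap _ _)
  have h0 := iota_mul_self (F := F) (b 0)
  have h1 := iota_mul_self (F := F) (b 1)
  rcases finset_fin_two s with rfl | rfl | rfl | rfl <;> fin_cases i
  · rw [exteriorBasis_empty, mul_one, ← exteriorBasis_singleton]
    exact exteriorBasis_mem _ (by simp)
  · rw [exteriorBasis_empty, mul_one, ← exteriorBasis_singleton]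
    exact exteriorBasis_mem _ (by simp)
  · rw [exteriorBasis_singleton]
    exact h0.symm ▸ zero_mem _
  · rw [exteriorBasis_singleton]
    refine hanti.symm ▸ neg_mem ?_
    rw [← exteriorBasis_pair]
    exact exteriorBasis_mem _ (by simp [add_comm])
  · rw [exteriorBasis_singleton]
    refine (exteriorBasis_pair b) ▸ exteriorBasis_mem _ (by simp)
  · rw [exteriorBasis_singleton]
    exact h1.symm ▸ zero_mem _
  · rw [exteriorBasis_pair, ← mul_assoc]
    refine (congrArg (· * _) h0).trans (zero_mul _) ▸ zero_mem _
  · rw [exteriorBasis_pair, ← mul_assoc]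
    refine ((congrArg (· * _) hanti).trans ?_ : _ = (0 : ExteriorAlgebra F V)) ▸ zero_mem _
    rw [neg_mul, mul_assoc, h1, mul_zero, neg_zero]

/-- Multiplying a basis monomial by a basis vector gives zero or, up to sign, the monomial of the
added degree. -/
lemma extAlgDeg_le {dg : Fin 2 → ℤ} {𝒱 : ℤ → Submodule F V}
    (h : ∀ i, ∀ v ∈ 𝒱 i, ∃ α β : F, (α = 0 ∨ i = dg 0) ∧ (β = 0 ∨ i = dg 1) ∧
      v = α • b 0 + β • b 1) (d : ℤ) : extAlgDeg 𝒱 d ≤ exteriorDeg b dg d := by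
  refine Submodule.span_le.2 ?_
  rintro _ ⟨l, hl, rfl⟩
  induction l generalizing d with
  | nil =>
    rw [List.map_nil, List.sum_nil] at hl
    rw [List.map_nil, List.prod_nil, ← exteriorBasis_empty b]
    exact exteriorBasis_mem _ (by rw [Finset.sum_empty, hl])
  | cons v l ih =>
    rw [List.map_cons, List.sum_cons] at hl
    rw [List.map_cons, List.prod_cons]
    have h1 := ih _ rfl
    obtain ⟨i, v, hv⟩ := v
    have hmul (j : Fin 2) (w) (hw : w ∈ exteriorDeg b dg (l.map Sigma.fst).sum) :
        ExteriorAlgebra.ι F (b j) * w ∈ exteriorDeg b dg (dg j + (l.map Sigma.fst).sum) := by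
      refine Submodule.span_induction ?_ ?_ (fun x y _ _ hx hy => ?_) (fun c x _ hx => ?_) hw
      · rintro _ ⟨s, hs, rfl⟩
        rw [← hs]
        exact ι_mul_exteriorBasis_mem j s
      · rw [mul_zero]; exact zero_mem _
      · rw [mul_add]; exact add_mem hx hy
      · rw [mul_smul_comm]; exact Submodule.smul_mem _ _ hx
    obtain ⟨α, β, hα, hβ, hαβ⟩ := h i v hv
    have hsm (γ : F) (j : Fin 2) (hγ : γ = 0 ∨ i = dg j) :
        γ • (ExteriorAlgebra.ι F (b j) * (l.map fun v => ExteriorAlgebra.ι F (v.2 : V)).prod) ∈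
          exteriorDeg b dg d := by
      rcases hγ with rfl | hγ
      · rw [zero_smul]; exact zero_mem _
      · have h2 := hmul j _ h1
        rw [← hγ, hl] at h2
        exact Submodule.smul_mem _ _ h2
    change ExteriorAlgebra.ι F v * _ ∈ exteriorDeg b dg d
    rw [hαβ, map_add, map_smul, map_smul, add_mul, smul_mul_assoc, smul_mul_assoc]
    exact add_mem (hsm α 0 hα) (hsm β 1 hβ)

end Exterior


/-! ### The action of Q on polynomials and on J modulo decomposables. -/

lemma conjCoef_det {F : Type u} [Field F] [CharP F 2] {G : Type u} [Group G] {P : Subgroup G}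
    [IsKleinFour P] [P.Normal] (g : G) : conjCoef F P g 0 0 * conjCoef F P g 1 1 -
      conjCoef F P g 0 1 * conjCoef F P g 1 0 = 1 := by
  have h1 (i j : Fin 2) : conjCoef F P g 0 j * conjCoef F P g⁻¹ i 0 +
      conjCoef F P g 1 j * conjCoef F P g⁻¹ i 1 = if j = i then 1 else 0 := by
    rw [← chi_gen (H := P) F j i]
    have h2 := chi_comp (F := F) (MulAut.conjNormal (H := P) g⁻¹).toMonoidHom j
      (MulAut.conjNormal (H := P) g⁻¹⁻¹ (gen P i))
    rw [Fin.sum_univ_two] at h2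
    refine h2.symm.trans (congrArg (chi F j) ?_)
    rw [MulEquiv.coe_toMonoidHom, ← MulAut.mul_apply, ← map_mul, mul_inv_cancel, map_one,
      MulAut.one_apply]
  -- The matrices of g and g⁻¹ are inverse to each other, so the determinant is invertible.
  have h2 : (conjCoef F P g 0 0 * conjCoef F P g 1 1 - conjCoef F P g 0 1 * conjCoef F P g 1 0) *
      (conjCoef F P g⁻¹ 0 0 * conjCoef F P g⁻¹ 1 1 -
        conjCoef F P g⁻¹ 0 1 * conjCoef F P g⁻¹ 1 0) = 1 := by
    have h00 := h1 0 0
    have h01 := h1 0 1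
    have h10 := h1 1 0
    have h11 := h1 1 1
    rw [if_pos rfl] at h00 h11
    rw [if_neg (by decide)] at h01 h10
    linear_combination (conjCoef F P g 0 1 * conjCoef F P g⁻¹ 1 0 +
      conjCoef F P g 1 1 * conjCoef F P g⁻¹ 1 1) * h00 + h11 -
      (conjCoef F P g 0 0 * conjCoef F P g⁻¹ 1 0 + conjCoef F P g 1 0 * conjCoef F P g⁻¹ 1 1) * h01
  -- The entries come from the prime field with two elements, whose only unit is 1.
  have h3 : ∃ d : ZMod 2, ZMod.castHom (dvd_refl 2) F d =
      conjCoef F P g 0 0 * conjCoef F P g 1 1 - conjCoef F P g 0 1 * conjCoef F P g 1 0 :=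
    ⟨_, (map_sub _ _ _).trans (congrArg₂ _ (map_mul _ _ _) (map_mul _ _ _))⟩
  obtain ⟨d, hd⟩ := h3
  rw [← hd] at h2 ⊢
  have h4 : ∀ d : ZMod 2, d = 0 ∨ d = 1 := by decide
  rcases h4 d with rfl | rfl
  · rw [map_zero, zero_mul] at h2
    exact absurd h2 zero_ne_one
  · exact map_one _

namespace ResData

open MvPolynomial

variable {F : Type u} [Field F] [CharP F 2] {G : Type u} [Group G] [Finite G] {P : Subgroup G}
  [IsKleinFour P] [P.Normal] {E C : CochainComplex (Rep.{u} F G) ℤ}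

section Twist

variable (R : ResData P E)

/-- The action of the quotient group on polynomials. -/
def twist (q : G ⧸ P) : MvPolynomial (Fin 2) F →ₗ[F] MvPolynomial (Fin 2) F :=
  R.phi.symm.toLinearMap ∘ₗ extTotRep P E E q ∘ₗ R.phi.toLinearMap

lemma phi_twist (q : G ⧸ P) (f : MvPolynomial (Fin 2) F) :
    R.phi (R.twist q f) = extTotRep P E E q (R.phi f) := R.phi.apply_symm_apply _

lemma twist_mul (q : G ⧸ P) (f g : MvPolynomial (Fin 2) F) :
    R.twist q (f * g) = R.twist q f * R.twist q g := by
  apply R.phi.injective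
  rw [map_mul R.phi, phi_twist, phi_twist, phi_twist, map_mul R.phi, extTotRep_mul]

lemma twist_X (g : G) (j : Fin 2) : R.twist (g : G ⧸ P) (X j) =
    MvPolynomial.C (conjCoef F P g 0 j) * X 0 + MvPolynomial.C (conjCoef F P g 1 j) * X 1 := by
  apply R.phi.injective
  rw [phi_twist, phi_X, extTotRep_x, Fin.sum_univ_two, map_add, C_mul', C_mul', map_smul, map_smul,
    phi_X, phi_X]

variable {R} {e : ExtP P E C 0}

lemma extTotRep_ev {q : G ⧸ P} {c : F} (hc : extRep P E C 0 q e = c • e)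
    (f : MvPolynomial (Fin 2) F) :
    extTotRep P E C q (R.ev e f) = c • R.ev e (R.twist q f) := by
  rw [ev_apply, ev_apply, extTotRep_smul, phi_twist]
  have h2 : extTotRep P E C q (lofE P E C 0 e) = lofE P E C 0 (extRep P E C 0 q e) :=
    extTotRep_of P E C q 0 e
  rw [h2, hc, map_smul, smul_comm]

/-- The element q acts on the line Ext⁰ by an invertible scalar, so J is stable under the twist. -/
lemma ev_twist_eq_zero {q : G ⧸ P} {c : F} (hc : extRep P E C 0 q e = c • e) (he : e ≠ 0)
    {f : MvPolynomial (Fin 2) F} (hf : R.ev e f = 0) : R.ev e (R.twist q f) = 0 := by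
  have h1 := extTotRep_ev (R := R) hc f
  rw [hf, map_zero, eq_comm, smul_eq_zero] at h1
  refine h1.resolve_left fun h0 => he ?_
  rw [h0, zero_smul] at hc
  have h2 := congrArg (extRep P E C 0 q⁻¹) hc
  rwa [Representation.inv_self_apply, map_zero] at h2

end Twist

section Generators

variable {R : ResData P E} {e : ExtP P E C 0} {m n t : ℕ} (Φ : R.Frame C e m n)

/-- The class of a polynomial in `J` modulo decomposables. -/
def jCls (R : ResData P E) (f : MvPolynomial (Fin 2) F) (hf : R.phi f ∈ annIdeal P E C) :
    JQuot P E C := (decSub P E C).mkQ ⟨R.phi f, hf⟩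

/-- The ideal of positive degree is (x_0, x_1), so decomposability is a statement about polynomials.
-/
lemma jCls_eq_zero_iff {f : MvPolynomial (Fin 2) F} (hf : R.phi f ∈ annIdeal P E C) :
    R.jCls f hf = 0 ↔ ∃ f0 f1, R.phi f0 ∈ annIdeal P E C ∧ R.phi f1 ∈ annIdeal P E C ∧
      f = X 0 * f0 + X 1 * f1 := by
  refine (Submodule.Quotient.mk_eq_zero (decSub P E C) (x := ⟨R.phi f, hf⟩)).trans ?_
  refine (Iff.rfl : _ ↔ R.phi f ∈ posIdeal P E * annIdeal P E C).trans ?_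
  constructor
  · intro h
    have h2 : ∀ a ∈ posIdeal P E * annIdeal P E C, ∃ f0 f1, R.phi f0 ∈ annIdeal P E C ∧
        R.phi f1 ∈ annIdeal P E C ∧ a = R.phi (X 0 * f0 + X 1 * f1) := by
      intro a ha
      refine Submodule.smul_induction_on ha (fun a ha b hb => ?_) (fun a b ha hb => ?_)
      · rw [R.posIdeal_eq, Ideal.mem_span_pair] at ha
        obtain ⟨c, d, rfl⟩ := ha
        obtain ⟨c, rfl⟩ := R.phi.surjective c
        obtain ⟨d, rfl⟩ := R.phi.surjective d
        obtain ⟨b, rfl⟩ := R.phi.surjective b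
        refine ⟨c * b, d * b, ?_, ?_, ?_⟩
        · rw [map_mul]; exact Ideal.mul_mem_left _ _ hb
        · rw [map_mul]; exact Ideal.mul_mem_left _ _ hb
        · rw [← phi_X, ← phi_X, ← map_mul, ← map_mul, ← map_add, smul_eq_mul, ← map_mul]
          exact congrArg _ (by ring)
      · obtain ⟨a0, a1, ha0, ha1, rfl⟩ := ha
        obtain ⟨b0, b1, hb0, hb1, rfl⟩ := hb
        refine ⟨a0 + b0, a1 + b1, ?_, ?_, ?_⟩
        · rw [map_add]; exact add_mem ha0 hb0
        · rw [map_add]; exact add_mem ha1 hb1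
        · rw [← map_add]; exact congrArg _ (by ring)
    obtain ⟨f0, f1, h0, h1, h⟩ := h2 _ h
    exact ⟨f0, f1, h0, h1, R.phi.injective h⟩
  · rintro ⟨f0, f1, h0, h1, rfl⟩
    rw [map_add, map_mul, map_mul, phi_X, phi_X, R.posIdeal_eq]
    exact add_mem (Ideal.mul_mem_mul (Ideal.subset_span (Or.inl rfl)) h0)
      (Ideal.mul_mem_mul (Ideal.subset_span (Or.inr rfl)) h1)

lemma jCls_surjective (v : JQuot P E C) : ∃ f hf, R.jCls f hf = v := by
  obtain ⟨⟨a, ha⟩, rfl⟩ := Submodule.mkQ_surjective _ v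
  obtain ⟨f, rfl⟩ := R.phi.surjective a
  exact ⟨f, ha, rfl⟩

lemma jCls_combination {f g : MvPolynomial (Fin 2) F} (hf : R.phi f ∈ annIdeal P E C)
    (hg : R.phi g ∈ annIdeal P E C) (α β : F) : ∃ h, α • R.jCls f hf + β • R.jCls g hg =
      R.jCls (MvPolynomial.C α * f + MvPolynomial.C β * g) h := by
  have h1 : R.phi (MvPolynomial.C α * f + MvPolynomial.C β * g) = α • R.phi f + β • R.phi g := by
    rw [C_mul', C_mul', map_add, map_smul, map_smul]
  have h2 : α • R.phi f + β • R.phi g ∈ annSub P E C :=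
    add_mem (Submodule.smul_mem _ α hf) (Submodule.smul_mem _ β hg)
  refine ⟨h1 ▸ h2, ?_⟩
  rw [jCls, jCls, ← map_smul, ← map_smul, ← map_add]
  exact congrArg _ (Subtype.ext h1.symm)

lemma jCls_sub {f g : MvPolynomial (Fin 2) F} (hf : R.phi f ∈ annIdeal P E C)
    (hg : R.phi g ∈ annIdeal P E C) : ∃ h, R.jCls f hf - R.jCls g hg = R.jCls (f - g) h := by
  have h1 := map_sub R.phi f g
  have h2 : R.phi f - R.phi g ∈ annIdeal P E C := sub_mem hf hg
  refine ⟨h1 ▸ h2, ?_⟩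
  rw [jCls, jCls, ← map_sub]
  exact congrArg _ (Subtype.ext h1.symm)

lemma jQuotRep_jCls (q : G ⧸ P) {f : MvPolynomial (Fin 2) F} (hf : R.phi f ∈ annIdeal P E C) :
    ∃ h, jQuotRep P E C q (R.jCls f hf) = R.jCls (R.twist q f) h := by
  have h1 := extTotRep_mem_ann P E C q _ hf
  rw [← phi_twist] at h1
  refine ⟨h1, ?_⟩
  exact congrArg (decSub P E C).mkQ (Subtype.ext (R.phi_twist q f).symm)

namespace Frame

/-- The classes of the two relations. -/
def gens (hs : R.HasShape C m n t) (hC : IsPerfect C) (he : e ≠ 0) : Fin 2 → JQuot P E C :=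
  ![R.jCls Φ.relY ((hs.phi_mem_annIdeal hC he).2 Φ.ev_relY),
    R.jCls Φ.relZ ((hs.phi_mem_annIdeal hC he).2 Φ.ev_relZ)]

lemma jCls_eq_combination (hs : R.HasShape C m n t) (hC : IsPerfect C) (he : e ≠ 0)
    {f : MvPolynomial (Fin 2) F} (hf : R.phi f ∈ annIdeal P E C) {α β : F}
    {f0 f1 : MvPolynomial (Fin 2) F} (h0 : R.ev e f0 = 0) (h1 : R.ev e f1 = 0)
    (h : f = MvPolynomial.C α * Φ.relY + MvPolynomial.C β * Φ.relZ + (X 0 * f0 + X 1 * f1)) :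
    R.jCls f hf = α • Φ.gens hs hC he 0 + β • Φ.gens hs hC he 1 := by
  obtain ⟨h2, h3⟩ := jCls_combination ((hs.phi_mem_annIdeal hC he).2 Φ.ev_relY)
    ((hs.phi_mem_annIdeal hC he).2 Φ.ev_relZ) α β
  obtain ⟨h4, h5⟩ := jCls_sub hf h2
  refine (sub_eq_zero.1 (h5.trans ?_)).trans h3.symm
  exact (jCls_eq_zero_iff _).2 ⟨f0, f1, (hs.phi_mem_annIdeal hC he).2 h0,
    (hs.phi_mem_annIdeal hC he).2 h1, by rw [h]; ring⟩

/-- The basis of `J` modulo decomposables formed by the classes of the two relations. -/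
def genBasis (hs : R.HasShape C m n t) (hC : IsPerfect C) (he : e ≠ 0) :
    Module.Basis (Fin 2) F (JQuot P E C) :=
  Module.Basis.mk (v := Φ.gens hs hC he) (by
    refine Fintype.linearIndependent_iff.2 fun g hg => ?_
    rw [Fin.sum_univ_two] at hg
    obtain ⟨h2, h3⟩ := jCls_combination ((hs.phi_mem_annIdeal hC he).2 Φ.ev_relY)
      ((hs.phi_mem_annIdeal hC he).2 Φ.ev_relZ) (g 0) (g 1)
    obtain ⟨f0, f1, h0, h1, h⟩ := (jCls_eq_zero_iff _).1 (h3.symm.trans hg)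
    obtain ⟨h4, h5⟩ := Φ.eq_zero_of_combination hs hC he ((hs.phi_mem_annIdeal hC he).1 h0)
      ((hs.phi_mem_annIdeal hC he).1 h1) h
    intro i
    fin_cases i
    · exact h4
    · exact h5) (by
    rintro v -
    obtain ⟨f, hf, rfl⟩ := R.jCls_surjective v
    obtain ⟨α, β, f0, f1, h0, h1, h⟩ :=
      Φ.exists_of_ev_eq_zero hs hC he ((hs.phi_mem_annIdeal hC he).1 hf)
    rw [Φ.jCls_eq_combination hs hC he hf h0 h1 h]
    exact add_mem (Submodule.smul_mem _ _ (Submodule.subset_span ⟨0, rfl⟩))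
      (Submodule.smul_mem _ _ (Submodule.subset_span ⟨1, rfl⟩)))

lemma genBasis_apply (hs : R.HasShape C m n t) (hC : IsPerfect C) (he : e ≠ 0) (i : Fin 2) :
    Φ.genBasis hs hC he i = Φ.gens hs hC he i := Module.Basis.mk_apply _ _ _

end Frame

/-- Evaluation at a class of degree zero preserves degrees; hence J is homogeneous. -/
lemma ev_homogeneousComponent (d : ℕ) (f : MvPolynomial (Fin 2) F) :
    R.ev e (homogeneousComponent d f) = lofE P E C d (R.ev e f d) := by
  have key (k : ℕ) (f : MvPolynomial (Fin 2) F) (hf : f.IsHomogeneous k) :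
      R.ev e (homogeneousComponent d f) = lofE P E C d (R.ev e f d) := by
    rw [homogeneousComponent_of_mem hf]
    obtain ⟨x, hx⟩ := R.ev_mem e hf
    split_ifs with h
    · subst h
      rw [← hx]
      exact congrArg _ (lofE_apply _ x).symm
    · rw [map_zero, ← hx]
      refine Eq.trans (map_zero (lofE P E C d)).symm (congrArg _ ?_)
      exact (lofE_apply_ne (by exact_mod_cast h) x).symm
  rw [← sum_homogeneousComponent f, map_sum, map_sum, map_sum]
  refine Eq.trans (Finset.sum_congr rfl fun k _ => key k _ (homogeneousComponent_isHomogeneous k f))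
    (Eq.trans (map_sum (lofE P E C d) _ _).symm (congrArg _ ?_))
  exact (DFinsupp.finsetSum_apply _ _ _).symm

lemma Frame.jQuotDeg_le (hs : R.HasShape C m n t) (hC : IsPerfect C) (he : e ≠ 0) (i : ℤ)
    (v : JQuot P E C) (hv : v ∈ jQuotDeg P E C i) : ∃ α β : F, (α = 0 ∨ i = m) ∧
      (β = 0 ∨ i = n) ∧ v = α • Φ.gens hs hC he 0 + β • Φ.gens hs hC he 1 := by
  obtain ⟨⟨a, ha⟩, hai, rfl⟩ := hv
  have hai' : a ∈ extDeg P E E (i + 1) := hai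
  obtain ⟨f, rfl⟩ := R.phi.surjective a
  rcases lt_or_ge i 0 with hi | hi
  · have hf0 : f = 0 := by
      rcases lt_or_ge (i + 1) 0 with hi' | hi'
      · have := subsingleton_ext_of_neg (P := P) R.isRes hi'
        obtain ⟨x, hx⟩ := hai'
        rw [Subsingleton.elim x 0, map_zero] at hx
        exact (map_eq_zero_iff _ R.phi.injective).1 hx.symm
      · have hf := R.isHomogeneous_phi_symm (m := 0) (a := R.phi f) (by
          rwa [show i + 1 = ((0 : ℕ) : ℤ) by lia] at hai')
        rw [AlgEquiv.symm_apply_apply] at hf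
        obtain ⟨α, β, f0, f1, h0, h1, h⟩ :=
          Φ.exists_of_ev_eq_zero hs hC he ((hs.phi_mem_annIdeal hC he).1 ha)
        have h2 := congrArg (homogeneousComponent 0) h
        rwa [map_add, map_add, map_add, homogeneousComponent_zero_X_mul,
          homogeneousComponent_zero_X_mul, homogeneousComponent_of_mem hf, if_pos rfl,
          homogeneousComponent_C_mul, homogeneousComponent_C_mul,
          homogeneousComponent_of_mem Φ.isHomogeneous_relY, if_neg m.succ_ne_zero.symm,
          homogeneousComponent_of_mem Φ.isHomogeneous_relZ, if_neg n.succ_ne_zero.symm,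
          mul_zero, mul_zero, add_zero, add_zero] at h2
    refine ⟨0, 0, Or.inl rfl, Or.inl rfl, ?_⟩
    rw [zero_smul, zero_smul, add_zero]
    exact (congrArg (decSub P E C).mkQ (Subtype.ext
      ((congrArg R.phi hf0).trans (map_zero R.phi)))).trans
      (map_zero _)
  obtain ⟨d, rfl⟩ := Int.eq_ofNat_of_zero_le hi
  have hf : f.IsHomogeneous (d + 1) := by
    have h1 := R.isHomogeneous_phi_symm (m := d + 1) (by exact_mod_cast hai')
    rwa [AlgEquiv.symm_apply_apply] at h1
  obtain ⟨α, β, f0, f1, h0, h1, h⟩ :=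
      Φ.exists_of_ev_eq_zero hs hC he ((hs.phi_mem_annIdeal hC he).1 ha)
  -- In the component of degree d + 1, y survives only for d = m and z only for d = n; the
  -- desuspension accounts for the shift by one.
  have h2 := congrArg (homogeneousComponent (d + 1)) h
  rw [map_add, map_add, map_add, homogeneousComponent_succ_X_mul, homogeneousComponent_succ_X_mul,
    homogeneousComponent_of_mem hf, if_pos rfl, homogeneousComponent_C_mul,
    homogeneousComponent_C_mul, homogeneousComponent_of_mem Φ.isHomogeneous_relY,
    homogeneousComponent_of_mem Φ.isHomogeneous_relZ] at h2
  have h3 (f : MvPolynomial (Fin 2) F) (hf : R.ev e f = 0) :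
      R.ev e (homogeneousComponent d f) = 0 := by
    rw [ev_homogeneousComponent, hf]
    exact map_zero _
  refine ⟨if d = m then α else 0, if d = n then β else 0, ?_, ?_,
    Φ.jCls_eq_combination hs hC he ha (h3 f0 h0) (h3 f1 h1) ?_⟩
  · split_ifs with hd
    · exact Or.inr (by exact_mod_cast hd)
    · exact Or.inl rfl
  · split_ifs with hd
    · exact Or.inr (by exact_mod_cast hd)
    · exact Or.inl rfl
  · rw [h2]
    congr 2
    · by_cases hd : d = m
      · rw [if_pos hd, if_pos (by rw [hd])]
      · rw [if_neg hd, if_neg (by lia), mul_zero, map_zero, zero_mul]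
    · by_cases hd : d = n
      · rw [if_pos hd, if_pos (by rw [hd])]
      · rw [if_neg hd, if_neg (by lia), mul_zero, map_zero, zero_mul]

end Generators

end ResData


/-! ### Equivariance of the comparison maps. -/

variable {F : Type u} [Field F] [CharP F 2] {G : Type u} [Group G] {P : Subgroup G}
  [IsKleinFour P] [P.Normal] {E C : CochainComplex (Rep.{u} F G) ℤ}

lemma lamP_lamP_rho {X : Rep.{u} F G} (g : G) (x : X) :
    lamP P X 0 (lamP P X 1 (X.ρ g x)) = X.ρ g (lamP P X 0 (lamP P X 1 x)) := by
  rw [lamP_rho X g 1, lamP_rho X g 0]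
  have h0 : lamP P X 0 (lamP P X 0 x) = 0 := lam_lam_self _ _ _
  have h1 : lamP P X 1 (lamP P X 1 x) = 0 := lam_lam_self _ _ _
  have h2 : lamP P X 1 (lamP P X 0 x) = lamP P X 0 (lamP P X 1 x) := lam_comm _ _
  simp only [map_add, map_smul, h0, h1, h2, lam_norm, smul_zero, add_zero, zero_add, smul_smul,
    ← add_smul]
  rw [← sub_eq_add_of_charTwo F, conjCoef_det, one_smul]

namespace ResData

section Equivariance

variable [Finite G] {R : ResData P E}

lemma extRep_psi {n : ℤ} (g : G) (c : fixedCocycles P C n) :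
    extRep P E C n (g : G ⧸ P) (R.psi C n c) =
      R.psi C n ⟨(C.X n).ρ g c.1, rho_mem_fixedCocycles g c.2⟩ :=
  extRepG_fixedClass R.η n g c

lemma extTotRep_psiTot {n : ℤ} (g : G) (c : fixedCocycles P C n) :
    extTotRep P E C (g : G ⧸ P) (R.psiTot C n c) =
      R.psiTot C n ⟨(C.X n).ρ g c.1, rho_mem_fixedCocycles g c.2⟩ :=
  (extTotRep_of P E C (g : G ⧸ P) n _).trans (congrArg (lofE P E C n) (extRep_psi g c))

lemma mem_filCyc_one {n : ℤ} {c : C.X n} : c ∈ filCyc P C n 1 ↔ c ∈ fixedCocycles P C n :=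
  (and_congr_left fun _ => mem_filMod_one).trans mem_fixedCocycles_iff.symm

lemma grPieceRep_iota (hC : IsPerfect C) {n : ℤ} (g : G) (x : ExtP P E C n) :
    grPieceRep P C n 0 (g : G ⧸ P) (R.iota hC n x) =
      R.iota hC n (extRep P E C n (g : G ⧸ P) x) := by
  obtain ⟨c, rfl⟩ := R.psi_surjective hC x
  rw [extRep_psi]
  refine (congrArg _ (R.iota_psi hC c.1 c.2 (mem_filCyc_one.2 c.2))).trans ?_
  exact (grPieceRep_grCls g 0 _).trans (R.iota_psi hC _ _ _).symm

lemma iota_surjective (hC : IsPerfect C) (n : ℤ) : Function.Surjective (R.iota hC n) := by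
  intro x
  obtain ⟨c, rfl⟩ := grCls_surjective 0 x
  exact ⟨_, R.iota_psi hC c.1 (mem_filCyc_one.1 c.2) c.2⟩

lemma trace_grPieceRep (hC : IsPerfect C) {n : ℤ} (g : G) (x : GrPiece P C n 2) :
    R.trace hC n (grPieceRep P C n 2 (g : G ⧸ P) x) =
      extRep P E C n (g : G ⧸ P) (R.trace hC n x) := by
  obtain ⟨z, rfl⟩ := grCls_surjective 2 x
  refine (congrArg _ (grPieceRep_grCls g 2 z)).trans ?_
  refine (R.trace_grCls hC _).trans (Eq.trans ?_ (congrArg _ (R.trace_grCls hC z)).symm)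
  refine Eq.trans (congrArg _ (Subtype.ext ?_)) (extRep_psi g _).symm
  exact lamP_lamP_rho g z.1

end Equivariance

end ResData

open MvPolynomial

/-! ### Transformation of relations and of their determinant. -/

section Rotation

variable [Finite G] (R : ResData P E)

namespace ResData

/-- The action of a group element on pairs of polynomials representing relations. -/
def rot (g : G) (Y : Fin 2 → MvPolynomial (Fin 2) F) (i : Fin 2) : MvPolynomial (Fin 2) F :=
  MvPolynomial.C (conjCoef F P g i 0) * R.twist (g : G ⧸ P) (Y 0) +
    MvPolynomial.C (conjCoef F P g i 1) * R.twist (g : G ⧸ P) (Y 1)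

/-- The matrix acting on the pair of classes [λ_i w] is the transpose of the one acting on the x_j,
so the relation attached to the rotated pair is the twisted relation. -/
lemma X_mul_rot (g : G) (Y : Fin 2 → MvPolynomial (Fin 2) F) :
    X 0 * R.rot g Y 0 + X 1 * R.rot g Y 1 = R.twist (g : G ⧸ P) (X 0 * Y 0 + X 1 * Y 1) := by
  rw [map_add, twist_mul, twist_mul, twist_X, twist_X, rot, rot]
  ring

/-- The rotation multiplies the determinant of two pairs by the determinant of the conjugation
matrix, which is one. -/
lemma rot_det (g : G) (Y Z : Fin 2 → MvPolynomial (Fin 2) F) :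
    R.rot g Y 0 * R.rot g Z 1 - R.rot g Y 1 * R.rot g Z 0 =
      R.twist (g : G ⧸ P) (Y 0 * Z 1 - Y 1 * Z 0) := by
  have h := congrArg (MvPolynomial.C (σ := Fin 2)) (conjCoef_det (F := F) (P := P) g)
  rw [map_sub, map_mul, map_mul, map_one] at h
  rw [map_sub, twist_mul, twist_mul, rot, rot, rot, rot]
  linear_combination (R.twist (g : G ⧸ P) (Y 0) * R.twist (g : G ⧸ P) (Z 1) -
    R.twist (g : G ⧸ P) (Y 1) * R.twist (g : G ⧸ P) (Z 0)) * h

variable {R} {e : ExtP P E C 0}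

lemma pairCls_rho {g : G} {c : F} (hc : extRep P E C 0 (g : G ⧸ P) e = c • e) {n : ℤ}
    (w : filCyc P C n 2) {Y : Fin 2 → MvPolynomial (Fin 2) F}
    (hY : ∀ j, R.ev e (Y j) = R.psiTot C n (lamCyc P C n j w)) :
    R.pairCls C n ⟨(C.X n).ρ g w.1, rho_mem_filCyc g w.2⟩ =
      c • (R.ev e (R.rot g Y 0), R.ev e (R.rot g Y 1)) := by
  have key (i : Fin 2) : R.psiTot C n (lamCyc P C n i ⟨(C.X n).ρ g w.1, rho_mem_filCyc g w.2⟩) =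
      c • R.ev e (R.rot g Y i) := by
    have h1 : lamCyc P C n i ⟨(C.X n).ρ g w.1, rho_mem_filCyc g w.2⟩ =
        conjCoef F P g i 0 • ⟨_, rho_mem_fixedCocycles g (lamCyc P C n 0 w).2⟩ +
          conjCoef F P g i 1 • ⟨_, rho_mem_fixedCocycles g (lamCyc P C n 1 w).2⟩ := by
      refine Subtype.ext ((lamP_rho (C.X n) g i w.1).trans ?_)
      have h2 : lamP P (C.X n) 0 (lamP P (C.X n) 1 w.1) = 0 := mem_filMod_two.1 w.2.1
      rw [h2, smul_zero, add_zero, map_add, map_smul, map_smul]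
      rfl
    rw [h1, map_add, map_smul, map_smul, ← extTotRep_psiTot, ← extTotRep_psiTot, ← hY, ← hY,
      extTotRep_ev hc, extTotRep_ev hc, rot, map_add, C_mul', C_mul', map_smul, map_smul, smul_add,
      smul_comm c, smul_comm c]
  exact Prod.ext (key 0) (key 1)

namespace Frame

variable {m n t : ℕ} (Φ : R.Frame C e m n)

/-- Two pairs with the same relation modulo (x_0, x_1)J differ by elements of J and a multiple of
the trivial syzygy (x_1, x_0). -/
lemma exists_syzygy
    {α β : F} {Y0 Y1 f0 f1 : MvPolynomial (Fin 2) F} (h0 : R.ev e f0 = 0) (h1 : R.ev e f1 = 0)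
    (h : X 0 * Y0 + X 1 * Y1 = MvPolynomial.C α * Φ.relY + MvPolynomial.C β * Φ.relZ +
      (X 0 * f0 + X 1 * f1)) : ∃ l,
      R.ev e (Y0 - (MvPolynomial.C α * Φ.y 0 + MvPolynomial.C β * Φ.z 0) + X 1 * l) = 0 ∧
      R.ev e (Y1 - (MvPolynomial.C α * Φ.y 1 + MvPolynomial.C β * Φ.z 1) + X 0 * l) = 0 := by
  rw [relY, relZ] at h
  obtain ⟨l, hl0, hl1⟩ := exists_of_mul_eq_mul (isRelPrime_X (F := F)) (X_ne_zero 0)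
    (c := Y0 - (MvPolynomial.C α * Φ.y 0 + MvPolynomial.C β * Φ.z 0) - f0)
    (d := f1 - (Y1 - (MvPolynomial.C α * Φ.y 1 + MvPolynomial.C β * Φ.z 1)))
    (by linear_combination h)
  have h2 : X 1 * l + X 1 * l = 0 := add_self_of_charTwo F (X 1 * l)
  refine ⟨l, ?_, ?_⟩
  · rw [← h0]
    exact congrArg _ (by linear_combination hl0 + h2)
  · rw [← h1]
    exact congrArg _ (by linear_combination -hl1)

/-- Injectivity of `gammaTot` allows the comparison to be made on pairs, where the matrix of the
action on the middle of gr is that on J modulo decomposables, up to the scalar by which g acts on e.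
-/
lemma lofM_grPieceRep (hs : R.HasShape C m n t) (hC : IsPerfect C) (he : e ≠ 0) {g : G} {c : F}
    (hc : extRep P E C 0 (g : G ⧸ P) e = c • e) {k : ℤ}
    (w : filCyc P C k 2) {Y : Fin 2 → MvPolynomial (Fin 2) F}
    (hY : ∀ j, R.ev e (Y j) = R.psiTot C k (lamCyc P C k j w))
    {α β : F} {f0 f1 : MvPolynomial (Fin 2) F} (h0 : R.ev e f0 = 0) (h1 : R.ev e f1 = 0)
    (h : R.twist (g : G ⧸ P) (X 0 * Y 0 + X 1 * Y 1) =
      MvPolynomial.C α * Φ.relY + MvPolynomial.C β * Φ.relZ + (X 0 * f0 + X 1 * f1)) :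
    lofM P C k (grPieceRep P C k 1 (g : G ⧸ P) (grCls P C k 1 w)) =
      c • (α • lofM P C m (grCls P C m 1 Φ.wy) + β • lofM P C n (grCls P C n 1 Φ.wz)) := by
  rw [← X_mul_rot] at h
  apply hs.gammaTot_injective
  rw [map_smul, gammaTot_combination]
  refine (congrArg (fun x => R.gammaTot C (lofM P C k x)) (grPieceRep_grCls g 1 w)).trans ?_
  refine (gammaTot_lofM k _).trans ?_
  rw [pairCls_rho hc w hY, map_smul]
  refine congrArg _ (sub_eq_zero.1 ?_)
  rw [← map_sub, Prod.mk_sub_mk, ← map_sub, ← map_sub, mkQ_ev_eq_zero_iff _ _ hs hC he]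
  exact Φ.exists_syzygy h0 h1 h

/-- Modulo J the twisted pairs are combinations of the frame pairs up to trivial syzygies. A trivial
syzygy changes the determinant only by multiples of y and z, so the determinant of the coefficients
comes out. -/
lemma ev_twist_det (hs : R.HasShape C m n t) (hC : IsPerfect C) (he : e ≠ 0) {g : G}
    {α β γ δ : F} {f0 f1 f2 f3 : MvPolynomial (Fin 2) F} (h0 : R.ev e f0 = 0) (h1 : R.ev e f1 = 0)
    (h2 : R.ev e f2 = 0) (h3 : R.ev e f3 = 0) (hY : R.twist (g : G ⧸ P) Φ.relY =
      MvPolynomial.C α * Φ.relY + MvPolynomial.C β * Φ.relZ + (X 0 * f0 + X 1 * f1))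
    (hZ : R.twist (g : G ⧸ P) Φ.relZ =
      MvPolynomial.C γ * Φ.relY + MvPolynomial.C δ * Φ.relZ + (X 0 * f2 + X 1 * f3)) :
    R.ev e (R.twist (g : G ⧸ P) Φ.det) = (α * δ - γ * β) • R.ev e Φ.det := by
  rw [relY, ← X_mul_rot] at hY
  rw [relZ, ← X_mul_rot] at hZ
  obtain ⟨l, hY0, hY1⟩ := Φ.exists_syzygy h0 h1 hY
  obtain ⟨k, hZ0, hZ1⟩ := Φ.exists_syzygy h2 h3 hZ
  rw [← Φ.mem_span_iff hs hC he] at hY0 hY1 hZ0 hZ1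
  have hy : Φ.relY ∈ Ideal.span {Φ.relY, Φ.relZ} := Ideal.subset_span (Or.inl rfl)
  have hz : Φ.relZ ∈ Ideal.span {Φ.relY, Φ.relZ} := Ideal.subset_span (Or.inr rfl)
  rw [← map_smul, ← sub_eq_zero, ← map_sub, ← Φ.mem_span_iff hs hC he, det, ← rot_det, ← C_mul',
    map_sub, map_mul, map_mul]
  have htwo : (2 : MvPolynomial (Fin 2) F) = 0 := CharTwo.two_eq_zero
  have key := add_mem (sub_mem (sub_mem (add_mem (Ideal.mul_mem_right (R.rot g Φ.z 1) _ hY0)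
    (Ideal.mul_mem_left _ (MvPolynomial.C α * Φ.y 0 + MvPolynomial.C β * Φ.z 0 - X 1 * l) hZ1))
    (Ideal.mul_mem_right (R.rot g Φ.z 0) _ hY1))
    (Ideal.mul_mem_left _ (MvPolynomial.C α * Φ.y 1 + MvPolynomial.C β * Φ.z 1 - X 0 * l) hZ0))
    (add_mem (Ideal.mul_mem_left _ (l * MvPolynomial.C γ - k * MvPolynomial.C α) hy)
      (Ideal.mul_mem_left _ (l * MvPolynomial.C δ - k * MvPolynomial.C β) hz))
  refine (congrArg (· ∈ Ideal.span {Φ.relY, Φ.relZ}) ?_).mpr key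
  rw [relY, relZ]
  linear_combination (k * X 1 * (MvPolynomial.C α * Φ.y 1 + MvPolynomial.C β * Φ.z 1) -
    l * X 1 * (MvPolynomial.C γ * Φ.y 1 + MvPolynomial.C δ * Φ.z 1)) * htwo

end Frame

end ResData

end Rotation


/-! ### Bases of a bigraded space with pieces of dimensions 1, 2 and 1. -/

section Bigraded

variable {F : Type*} [Field F] {M : ℤ → ℕ → Type*} [∀ n k, AddCommGroup (M n k)]
  [∀ n k, Module F (M n k)]

variable (F M) in
/-- The inclusion of the part of second degree `k` in a bigraded space. -/
def incBi (k : ℕ) : (⨁ n, M n k) →ₗ[F] ⨁ n, ⨁ k, M n k :=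
  DirectSum.lmap fun n => DirectSum.lof F ℕ (M n) k

variable (F M) in
/-- The projection to the part of second degree `k` of a bigraded space. -/
def prBi (k : ℕ) : (⨁ n, ⨁ k, M n k) →ₗ[F] ⨁ n, M n k :=
  DirectSum.lmap fun n => DirectSum.component F ℕ (M n) k

lemma incBi_lof (k : ℕ) (n : ℤ) (x : M n k) : incBi F M k (DirectSum.lof F ℤ (M · k) n x) =
    DirectSum.lof F ℤ (fun n => ⨁ k, M n k) n (DirectSum.lof F ℕ (M n) k x) :=
  DirectSum.lmap_lof _ _ _

lemma prBi_lof (k : ℕ) (n : ℤ) (x : ⨁ k, M n k) :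
    prBi F M k (DirectSum.lof F ℤ (fun n => ⨁ k, M n k) n x) =
      DirectSum.lof F ℤ (M · k) n (x k) :=
  DirectSum.lmap_lof _ _ _

lemma prBi_incBi_self (k : ℕ) (x : ⨁ n, M n k) : prBi F M k (incBi F M k x) = x := by
  induction x using DirectSum.induction_on with
  | zero => rw [map_zero, map_zero]
  | add x y hx hy => rw [map_add, map_add, hx, hy]
  | of n x =>
    refine (congrArg _ (incBi_lof (F := F) k n x)).trans ((prBi_lof k n _).trans ?_)
    exact congrArg _ (DirectSum.lof_apply F k x)

lemma prBi_incBi_of_ne {j k : ℕ} (h : j ≠ k) (x : ⨁ n, M n j) :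
    prBi F M k (incBi F M j x) = 0 := by
  induction x using DirectSum.induction_on with
  | zero => rw [map_zero, map_zero]
  | add x y hx hy => rw [map_add, map_add, hx, hy, add_zero]
  | of n x =>
    refine (congrArg _ (incBi_lof (F := F) j n x)).trans ((prBi_lof k n _).trans ?_)
    exact (congrArg _ (DFinsupp.single_eq_of_ne h.symm)).trans (map_zero _)

/-- The family of elements of a bigraded space indexed by subsets of a two-element set, by
cardinality. -/
def bigradedFamily (a : ⨁ n, M n 0) (b : Fin 2 → ⨁ n, M n 1) (d : ⨁ n, M n 2)
    (s : Finset (Fin 2)) : ⨁ n, ⨁ k, M n k :=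
  if s = ∅ then incBi F M 0 a else if s = {0} then incBi F M 1 (b 0) else
    if s = {1} then incBi F M 1 (b 1) else incBi F M 2 d

variable {a : ⨁ n, M n 0} {b : Fin 2 → ⨁ n, M n 1} {d : ⨁ n, M n 2}

lemma bigradedFamily_empty : bigradedFamily (F := F) a b d ∅ = incBi F M 0 a := rfl

lemma bigradedFamily_zero : bigradedFamily (F := F) a b d {0} = incBi F M 1 (b 0) := rfl

lemma bigradedFamily_one : bigradedFamily (F := F) a b d {1} = incBi F M 1 (b 1) := rfl

lemma bigradedFamily_pair : bigradedFamily (F := F) a b d {0, 1} = incBi F M 2 d := rfl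

lemma linearIndependent_bigradedFamily (ha : a ≠ 0)
    (hb : ∀ α β : F, α • b 0 + β • b 1 = 0 → α = 0 ∧ β = 0) (hd : d ≠ 0) :
    LinearIndependent F (bigradedFamily (F := F) a b d) := by
  refine Fintype.linearIndependent_iff.2 fun g hg => ?_
  rw [show (Finset.univ : Finset (Finset (Fin 2))) = {∅, {0}, {1}, {0, 1}} by decide,
    Finset.sum_insert (by decide), Finset.sum_insert (by decide), Finset.sum_insert (by decide),
    Finset.sum_singleton, bigradedFamily_empty, bigradedFamily_zero, bigradedFamily_one,
    bigradedFamily_pair] at hg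
  have h0 := congrArg (prBi F M 0) hg
  have h1 := congrArg (prBi F M 1) hg
  have h2 := congrArg (prBi F M 2) hg
  simp only [map_add, map_smul, map_zero, prBi_incBi_self] at h0 h1 h2
  rw [prBi_incBi_of_ne one_ne_zero, prBi_incBi_of_ne one_ne_zero, prBi_incBi_of_ne two_ne_zero] at h0
  rw [prBi_incBi_of_ne zero_ne_one, prBi_incBi_of_ne (by decide)] at h1
  rw [prBi_incBi_of_ne (by decide), prBi_incBi_of_ne (by decide), prBi_incBi_of_ne (by decide)] at h2
  simp only [smul_zero, add_zero, zero_add] at h0 h1 h2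
  obtain ⟨h3, h4⟩ := hb _ _ h1
  intro s
  rcases finset_fin_two s with rfl | rfl | rfl | rfl
  · exact (smul_eq_zero.1 h0).resolve_right ha
  · exact h3
  · exact h4
  · exact (smul_eq_zero.1 h2).resolve_right hd

lemma span_bigradedFamily (ha : ∀ n (x : M n 0), ∃ c : F, DirectSum.lof F ℤ (M · 0) n x = c • a)
    (hb : ∀ n (x : M n 1), ∃ α β : F,
      DirectSum.lof F ℤ (M · 1) n x = α • b 0 + β • b 1)
    (hd : ∀ n (x : M n 2), ∃ c : F, DirectSum.lof F ℤ (M · 2) n x = c • d)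
    (h : ∀ n k, 3 ≤ k → Subsingleton (M n k)) :
    ⊤ ≤ Submodule.span F (Set.range (bigradedFamily (F := F) a b d)) := by
  have key (n : ℤ) (k : ℕ) (x : M n k) : incBi F M k (DirectSum.lof F ℤ (M · k) n x) ∈
      Submodule.span F (Set.range (bigradedFamily (F := F) a b d)) := by
    have hs (s : Finset (Fin 2)) (c : F) : c • bigradedFamily (F := F) a b d s ∈
        Submodule.span F (Set.range (bigradedFamily (F := F) a b d)) :=
      Submodule.smul_mem _ _ (Submodule.subset_span ⟨s, rfl⟩)
    match k, x with
    | 0, x =>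
      obtain ⟨c, hc⟩ := ha n x
      rw [hc, map_smul]
      exact hs ∅ c
    | 1, x =>
      obtain ⟨α, β, hc⟩ := hb n x
      have h0 := hs {0} α
      have h1 := hs {1} β
      rw [bigradedFamily_zero] at h0
      rw [bigradedFamily_one] at h1
      rw [hc, map_add, map_smul, map_smul]
      exact add_mem h0 h1
    | 2, x =>
      obtain ⟨c, hc⟩ := hd n x
      rw [hc, map_smul]
      exact hs {0, 1} c
    | k + 3, x =>
      have := h n (k + 3) (Nat.le_add_left _ _)
      rw [Subsingleton.elim x 0, map_zero, map_zero]
      exact zero_mem _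
  rintro x -
  induction x using DirectSum.induction_on with
  | zero => exact zero_mem _
  | add x y hx hy => exact add_mem hx hy
  | of n x =>
    induction x using DirectSum.induction_on with
    | zero => rw [map_zero]; exact zero_mem _
    | add x y hx hy => rw [map_add]; exact add_mem hx hy
    | of k x => exact (incBi_lof (F := F) k n x) ▸ key n k x

end Bigraded

/-! ### Tensoring with a line; equivariance on an exterior algebra. -/

section Line

variable {F : Type*} [Field F] {U V W : Type*} [AddCommGroup U] [Module F U] [AddCommGroup V]
  [Module F V] [AddCommMonoid W] [Module F W] {e : U}

/-- Tensoring with a line spanned by a given vector. -/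
def lineTensorEquiv (he : Function.Bijective (LinearMap.toSpanSingleton F U e)) (f : V ≃ₗ[F] W) :
    U ⊗[F] V ≃ₗ[F] W :=
  TensorProduct.congr (LinearEquiv.ofBijective _ he).symm (LinearEquiv.refl F V) ≪≫ₗ
    TensorProduct.lid F V ≪≫ₗ f

lemma lineTensorEquiv_smul_tmul (he : Function.Bijective (LinearMap.toSpanSingleton F U e))
    (f : V ≃ₗ[F] W) (c : F) (v : V) : lineTensorEquiv he f ((c • e) ⊗ₜ[F] v) = c • f v := by
  have h1 : (LinearEquiv.ofBijective _ he).symm (c • e) = c :=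
    (LinearEquiv.ofBijective _ he).symm_apply_apply c
  refine Eq.trans ?_ (map_smul f c v)
  exact congrArg (fun a => f (a • v)) h1

end Line

section ExteriorEquivariance

variable {F : Type*} [Field F] {V W : Type*} [AddCommGroup V] [Module F V] [AddCommMonoid W]
  [Module F W] (b : Module.Basis (Fin 2) F V) {B : Module.Basis (Finset (Fin 2)) F W}

variable (B) in
/-- The isomorphism from the exterior algebra of a plane determined by bases. -/
def exteriorEquiv : ExteriorAlgebra F V ≃ₗ[F] W :=
  b.ExteriorAlgebra.equiv B (Equiv.refl _)

variable {b}

lemma exteriorEquiv_basis (s : Finset (Fin 2)) :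
    exteriorEquiv b B (b.ExteriorAlgebra s) = B s := by
  rw [exteriorEquiv, Module.Basis.equiv_apply, Equiv.refl_apply]

/-- It is enough to compare on the four basis monomials; on the product of the two basis vectors the
induced map is multiplication by the determinant. -/
lemma exteriorEquiv_map {ρ : V →ₗ[F] V} {T : W →ₗ[F] W} {α β γ δ c : F}
    (h0 : ρ (b 0) = α • b 0 + β • b 1) (h1 : ρ (b 1) = γ • b 0 + δ • b 1)
    (T0 : T (B ∅) = c • B ∅) (T1 : T (B {0}) = c • (α • B {0} + β • B {1}))
    (T2 : T (B {1}) = c • (γ • B {0} + δ • B {1}))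
    (T3 : T (B {0, 1}) = c • (α * δ - γ * β) • B {0, 1}) (w : ExteriorAlgebra F V) :
    T (exteriorEquiv b B w) = c • exteriorEquiv b B (ExteriorAlgebra.map ρ w) := by
  have key : T ∘ₗ (exteriorEquiv b B).toLinearMap =
      c • ((exteriorEquiv b B).toLinearMap ∘ₗ (ExteriorAlgebra.map ρ).toLinearMap) := by
    refine b.ExteriorAlgebra.ext fun s => ?_
    change T (exteriorEquiv b B _) = c • exteriorEquiv b B (ExteriorAlgebra.map ρ _)
    rw [exteriorEquiv_basis]
    rcases finset_fin_two s with rfl | rfl | rfl | rfl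
    · rw [T0, exteriorBasis_empty, map_one (ExteriorAlgebra.map ρ), ← exteriorBasis_empty b,
        exteriorEquiv_basis]
    · rw [T1, exteriorBasis_singleton, ExteriorAlgebra.map_apply_ι, h0, map_add, map_smul, map_smul,
        ← exteriorBasis_singleton, ← exteriorBasis_singleton, map_add, map_smul, map_smul,
        exteriorEquiv_basis, exteriorEquiv_basis]
    · rw [T2, exteriorBasis_singleton, ExteriorAlgebra.map_apply_ι, h1, map_add, map_smul, map_smul,
        ← exteriorBasis_singleton, ← exteriorBasis_singleton, map_add, map_smul, map_smul,
        exteriorEquiv_basis, exteriorEquiv_basis]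
    · have h2 : ExteriorAlgebra.map ρ (b.ExteriorAlgebra {0, 1}) =
          (α * δ - γ * β) • b.ExteriorAlgebra {0, 1} := by
        have hanti : ExteriorAlgebra.ι F (b 1) * ExteriorAlgebra.ι F (b 0) =
            -(ExteriorAlgebra.ι F (b 0) * ExteriorAlgebra.ι F (b 1)) :=
          eq_neg_of_add_eq_zero_left (ExteriorAlgebra.ι_add_mul_swap _ _)
        rw [exteriorBasis_pair, map_mul, ExteriorAlgebra.map_apply_ι, ExteriorAlgebra.map_apply_ι,
          h0, h1, map_add, map_add, map_smul, map_smul, map_smul, map_smul, add_mul, mul_add,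
          mul_add, smul_mul_smul_comm, smul_mul_smul_comm, smul_mul_smul_comm, smul_mul_smul_comm,
          iota_mul_self, iota_mul_self, hanti, smul_zero, smul_zero, zero_add, add_zero, smul_neg,
          ← sub_eq_add_neg, ← sub_smul, mul_comm β γ]
      rw [T3, h2, map_smul, exteriorEquiv_basis]
  exact LinearMap.congr_fun key w

end ExteriorEquivariance


/-! ### The isomorphism with gr H*(C). -/

namespace ResData

open MvPolynomial

variable {F : Type u} [Field F] [CharP F 2] {G : Type u} [Group G] [Finite G] {P : Subgroup G}
  [IsKleinFour P] [P.Normal] {E C : CochainComplex (Rep.{u} F G) ℤ}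

section Graded

lemma grRep_incBi (q : G ⧸ P) (k : ℕ) (n : ℤ) (x : GrPiece P C n k) :
    grRep P C q (incBi F (GrPiece P C) k (DirectSum.lof F ℤ (fun n => GrPiece P C n k) n x)) =
      incBi F (GrPiece P C) k
        (DirectSum.lof F ℤ (fun n => GrPiece P C n k) n (grPieceRep P C n k q x)) := by
  rw [incBi_lof, incBi_lof]
  refine (DirectSum.lmap_lof _ _ _).trans (congrArg _ ?_)
  exact DirectSum.lmap_lof _ _ _

lemma lof_eq_smul_of_finrank_eq_count {M : ℤ → Type*} [∀ n, AddCommGroup (M n)]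
    [∀ n, Module F (M n)] [∀ n, Module.Finite F (M n)] {s : ℤ}
    (h : ∀ i, Module.finrank F (M i) = Multiset.count i {s}) {v : M s} (hv : v ≠ 0) (n : ℤ)
    (x : M n) : ∃ c : F, DirectSum.lof F ℤ M n x = c • DirectSum.lof F ℤ M s v := by
  by_cases hn : n = s
  · subst hn
    have h1 := h n
    rw [Multiset.count_singleton_self] at h1
    obtain ⟨c, rfl⟩ := (finrank_eq_one_iff_of_nonzero' v hv).1 h1 x
    exact ⟨c, map_smul _ _ _⟩
  · have h1 := h n
    rw [Multiset.count_singleton, if_neg hn] at h1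
    have := Module.finrank_zero_iff.1 h1
    exact ⟨0, by rw [Subsingleton.elim x 0, map_zero, zero_smul]⟩

variable {R : ResData P E} {e : ExtP P E C 0} {m n t : ℕ} (Φ : R.Frame C e m n)

/-- The bottom piece in degree zero is one-dimensional and is the image of Ext⁰ = F e. -/
lemma HasShape.iota_ne_zero (hs : R.HasShape C m n t) (hC : IsPerfect C) (he : e ≠ 0) :
    R.iota hC 0 e ≠ 0 := by
  intro h
  have h1 := hs.gr_zero 0
  rw [Multiset.count_singleton_self] at h1
  have h2 : Subsingleton (GrPiece P C 0 0) := subsingleton_of_forall_eq 0 fun x => by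
    obtain ⟨y, rfl⟩ := iota_surjective (R := R) hC 0 x
    obtain ⟨c, rfl⟩ := hs.exists_smul hC he y
    rw [map_smul, h, smul_zero]
  rw [Module.finrank_zero_of_subsingleton] at h1
  exact zero_ne_one h1

/-- Ext vanishes above t, so the norm is onto the nonzero space Ext^t; its source is a line. -/
lemma HasShape.trace_bijective (hs : R.HasShape C m n t) (hC : IsPerfect C) :
    Function.Bijective (R.trace hC t) := by
  have hfin := hC.finite_homology
  have := hs.subsingleton (i := t + 1) (Or.inr (lt_add_one _))
  have h1 := R.trace_surjective hC t
  refine ⟨?_, h1⟩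
  obtain ⟨v, hv⟩ := @exists_ne _ hs.nontrivial_top 0
  obtain ⟨g, rfl⟩ := h1 v
  have h2 := hs.gr_two t
  rw [Multiset.count_singleton_self] at h2
  refine (injective_iff_map_eq_zero _).2 fun x hx => ?_
  obtain ⟨c, rfl⟩ := (finrank_eq_one_iff_of_nonzero' g fun h => hv (by rw [h, map_zero])).1 h2 x
  rw [map_smul, smul_eq_zero] at hx
  rw [hx.resolve_right hv, zero_smul]

namespace Frame

/-- The determinant has degree m + n = t, so its class is the norm of some top class. This choice is
the one that makes the isomorphism equivariant. -/
lemma exists_top (hs : R.HasShape C m n t) (hC : IsPerfect C) (he : e ≠ 0) :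
    ∃ g : GrPiece P C t 2, g ≠ 0 ∧ lofE P E C t (R.trace hC t g) = R.ev e Φ.det := by
  have hdet := R.ev_mem e Φ.isHomogeneous_det
  rw [← Φ.top_eq hs hC he] at hdet
  obtain ⟨x, hx⟩ := hdet
  obtain ⟨g, rfl⟩ := (hs.trace_bijective hC).2 x
  refine ⟨g, ?_, hx⟩
  rintro rfl
  refine Φ.ev_det_ne_zero hs hC he ?_
  rw [← hx, map_zero, map_zero]

/-- The elements of the associated graded space spanning its middle part. -/
def middle : Fin 2 → ⨁ n, GrPiece P C n 1 :=
  ![lofM P C m (grCls P C m 1 Φ.wy), lofM P C n (grCls P C n 1 Φ.wz)]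

/-- The elements of the associated graded space corresponding to subsets of a two-element set. -/
def grFamily (hC : IsPerfect C) (g : GrPiece P C t 2) : Finset (Fin 2) → Gr P C :=
  bigradedFamily (F := F) (M := GrPiece P C)
    (DirectSum.lof F ℤ (fun n => GrPiece P C n 0) 0 (R.iota hC 0 e)) Φ.middle
    (DirectSum.lof F ℤ (fun n => GrPiece P C n 2) t g)

lemma span_grFamily (hs : R.HasShape C m n t) (hC : IsPerfect C) (he : e ≠ 0)
    {g : GrPiece P C t 2} (hg : g ≠ 0) :
    ⊤ ≤ Submodule.span F (Set.range (Φ.grFamily hC g)) := by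
  have hfin := hC.finite_homology
  exact span_bigradedFamily
    (lof_eq_smul_of_finrank_eq_count (M := fun n => GrPiece P C n 0) hs.gr_zero
      (hs.iota_ne_zero hC he))
    (fun k x => by
      obtain ⟨α, β, -, -, h⟩ := Φ.span k x
      exact ⟨α, β, h⟩)
    (lof_eq_smul_of_finrank_eq_count (M := fun n => GrPiece P C n 2) hs.gr_two hg)
    fun n k hk => subsingleton_grPiece hk

lemma linearIndependent_grFamily (hs : R.HasShape C m n t) (hC : IsPerfect C) (he : e ≠ 0)
    {g : GrPiece P C t 2} (hg : g ≠ 0) : LinearIndependent F (Φ.grFamily hC g) :=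
  linearIndependent_bigradedFamily
    (fun h => hs.iota_ne_zero hC he (DirectSum.of_injective (β := fun n => GrPiece P C n 0) 0
      (h.trans (map_zero _).symm))) Φ.indep
    (fun h => hg (DirectSum.of_injective (β := fun n => GrPiece P C n 2) (t : ℤ)
      (h.trans (map_zero _).symm)))

/-- The basis of the associated graded space indexed by subsets of a two-element set. -/
def grBasis (hs : R.HasShape C m n t) (hC : IsPerfect C) (he : e ≠ 0) {g : GrPiece P C t 2}
    (hg : g ≠ 0) : Module.Basis (Finset (Fin 2)) F (Gr P C) :=
  Module.Basis.mk (Φ.linearIndependent_grFamily hs hC he hg) (Φ.span_grFamily hs hC he hg)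

variable (hs : R.HasShape C m n t) (hC : IsPerfect C) (he : e ≠ 0) {g : GrPiece P C t 2}
    (hg : g ≠ 0)

lemma grBasis_empty : Φ.grBasis hs hC he hg ∅ = incBi F (GrPiece P C) 0
    (DirectSum.lof F ℤ (fun n => GrPiece P C n 0) 0 (R.iota hC 0 e)) :=
  (Module.Basis.mk_apply _ _ _).trans bigradedFamily_empty

lemma grBasis_zero : Φ.grBasis hs hC he hg {0} = incBi F (GrPiece P C) 1
    (lofM P C m (grCls P C m 1 Φ.wy)) :=
  (Module.Basis.mk_apply _ _ _).trans bigradedFamily_zero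

lemma grBasis_one : Φ.grBasis hs hC he hg {1} = incBi F (GrPiece P C) 1
    (lofM P C n (grCls P C n 1 Φ.wz)) :=
  (Module.Basis.mk_apply _ _ _).trans bigradedFamily_one

lemma grBasis_pair : Φ.grBasis hs hC he hg {0, 1} = incBi F (GrPiece P C) 2
    (DirectSum.lof F ℤ (fun n => GrPiece P C n 2) t g) :=
  (Module.Basis.mk_apply _ _ _).trans bigradedFamily_pair

lemma grBasis_mem (s : Finset (Fin 2)) : Φ.grBasis hs hC he hg s ∈
    LinearMap.range (DirectSum.lof F ℤ (GrDeg P C) (∑ i ∈ s, ![(m : ℤ), (n : ℤ)] i)) := by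
  have key {k : ℕ} {i j : ℤ} (h : i = j) (x : GrPiece P C i k) : incBi F (GrPiece P C) k
      (DirectSum.lof F ℤ (fun n => GrPiece P C n k) i x) ∈
        LinearMap.range (DirectSum.lof F ℤ (GrDeg P C) j) := by
    subst h
    exact ⟨_, (incBi_lof (F := F) (M := GrPiece P C) k i x).symm⟩
  rcases finset_fin_two s with rfl | rfl | rfl | rfl
  · rw [grBasis_empty]
    exact key rfl _
  · rw [grBasis_zero]
    exact key (by simp) _
  · rw [grBasis_one]
    exact key (by simp) _
  · rw [grBasis_pair]
    exact key (by simp [Φ.top_eq hs hC he]) _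

/-- The isomorphism from the exterior algebra on `J` modulo decomposables to the associated graded
space. -/
def grEquiv : ExteriorAlgebra F (JQuot P E C) ≃ₗ[F] Gr P C :=
  exteriorEquiv (Φ.genBasis hs hC he) (Φ.grBasis hs hC he hg)

lemma grEquiv_mem {k : ℤ} {w : ExteriorAlgebra F (JQuot P E C)}
    (hw : w ∈ extAlgDeg (jQuotDeg P E C) k) :
    Φ.grEquiv hs hC he hg w ∈ LinearMap.range (DirectSum.lof F ℤ (GrDeg P C) k) := by
  have h1 := extAlgDeg_le (b := Φ.genBasis hs hC he) (dg := ![(m : ℤ), (n : ℤ)])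
    (𝒱 := jQuotDeg P E C) (fun i v hv => by
      rw [genBasis_apply, genBasis_apply]
      exact Φ.jQuotDeg_le hs hC he i v hv) k hw
  refine Submodule.span_induction ?_ ?_ (fun x y _ _ hx hy => ?_) (fun c x _ hx => ?_) h1
  · rintro _ ⟨s, rfl, rfl⟩
    rw [grEquiv, exteriorEquiv_basis]
    exact Φ.grBasis_mem hs hC he hg s
  · rw [map_zero]; exact zero_mem _
  · rw [map_add]; exact add_mem hx hy
  · rw [map_smul]; exact Submodule.smul_mem _ _ hx

/-- On all three pieces of gr, q acts by its scalar on e times its action on the exterior powers of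
J modulo decomposables: trivial on the bottom, a 2 × 2 matrix in the middle, the determinant of that
matrix on the top. -/
lemma grRep_grEquiv (hdet : lofE P E C t (R.trace hC t g) = R.ev e Φ.det) {q : G ⧸ P} {c : F}
    (hc : extRep P E C 0 q e = c • e) (w : ExteriorAlgebra F (JQuot P E C)) :
    grRep P C q (Φ.grEquiv hs hC he hg w) =
      c • Φ.grEquiv hs hC he hg (extAlgRep (jQuotRep P E C) q w) := by
  obtain ⟨g', rfl⟩ := QuotientGroup.mk_surjective q
  obtain ⟨α, β, f0, f1, h0, h1, hY⟩ :=
    Φ.exists_of_ev_eq_zero hs hC he (ev_twist_eq_zero hc he Φ.ev_relY)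
  obtain ⟨γ, δ, f2, f3, h2, h3, hZ⟩ :=
    Φ.exists_of_ev_eq_zero hs hC he (ev_twist_eq_zero hc he Φ.ev_relZ)
  refine exteriorEquiv_map (α := α) (β := β) (γ := γ) (δ := δ) ?_ ?_ ?_ ?_ ?_ ?_ w
  · rw [genBasis_apply, genBasis_apply]
    obtain ⟨h4, h5⟩ := jQuotRep_jCls (g' : G ⧸ P) ((hs.phi_mem_annIdeal hC he).2 Φ.ev_relY)
    exact h5.trans (Φ.jCls_eq_combination hs hC he h4 h0 h1 hY)
  · rw [genBasis_apply, genBasis_apply]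
    obtain ⟨h4, h5⟩ := jQuotRep_jCls (g' : G ⧸ P) ((hs.phi_mem_annIdeal hC he).2 Φ.ev_relZ)
    exact h5.trans (Φ.jCls_eq_combination hs hC he h4 h2 h3 hZ)
  · rw [grBasis_empty, grRep_incBi, grPieceRep_iota, hc, map_smul, map_smul, map_smul]
  · rw [grBasis_zero, grBasis_one, grRep_incBi,
      Φ.lofM_grPieceRep hs hC he hc Φ.wy Φ.evY h0 h1 hY, map_smul, map_add, map_smul, map_smul]
  · rw [grBasis_zero, grBasis_one, grRep_incBi,
      Φ.lofM_grPieceRep hs hC he hc Φ.wz Φ.evZ h2 h3 hZ, map_smul, map_add, map_smul, map_smul]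
  · rw [grBasis_pair, grRep_incBi, ← map_smul, ← map_smul, ← map_smul, ← map_smul]
    -- The top piece is compared after applying the injective norm, which turns it into the action
    -- on the determinant times e.
    refine congrArg _ (congrArg _ ((hs.trace_bijective hC).1 ?_))
    apply lofE_injective
    rw [trace_grPieceRep, map_smul, map_smul, map_smul, map_smul, hdet,
      ← Φ.ev_twist_det hs hC he h0 h1 h2 h3 hY hZ, ← extTotRep_ev hc, ← hdet]
    exact (extTotRep_of P E C (g' : G ⧸ P) t _).symm

end Frame

lemma HasShape.smul_bijective (hs : R.HasShape C m n t) (hC : IsPerfect C) (he : e ≠ 0) :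
    Function.Bijective (LinearMap.toSpanSingleton F (ExtP P E C 0) e) := by
  constructor
  · refine (injective_iff_map_eq_zero _).2 fun c hc => ?_
    exact (smul_eq_zero.1 hc).resolve_right he
  · intro x
    obtain ⟨c, rfl⟩ := hs.exists_smul hC he x
    exact ⟨c, rfl⟩

namespace Frame

variable (hs : R.HasShape C m n t) (hC : IsPerfect C) (he : e ≠ 0) {g : GrPiece P C t 2}
  (hg : g ≠ 0)

/-- The isomorphism from the exterior algebra on `J` modulo decomposables, tensored with `Ext⁰`, to
the associated graded space. -/
def tensorGrEquiv : ExtP P E C 0 ⊗[F] ExteriorAlgebra F (JQuot P E C) ≃ₗ[F] Gr P C :=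
  lineTensorEquiv (hs.smul_bijective hC he) (Φ.grEquiv hs hC he hg)

lemma tensorGrEquiv_smul_tmul (c : F) (w : ExteriorAlgebra F (JQuot P E C)) :
    Φ.tensorGrEquiv hs hC he hg ((c • e) ⊗ₜ[F] w) = c • Φ.grEquiv hs hC he hg w :=
  lineTensorEquiv_smul_tmul _ _ c w

lemma tensorGrEquiv_mem {k : ℤ} (x : ExtP P E C 0) {w : ExteriorAlgebra F (JQuot P E C)}
    (hw : w ∈ extAlgDeg (jQuotDeg P E C) k) : Φ.tensorGrEquiv hs hC he hg (x ⊗ₜ[F] w) ∈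
      LinearMap.range (DirectSum.lof F ℤ (GrDeg P C) k) := by
  obtain ⟨c, rfl⟩ := hs.exists_smul hC he x
  rw [tensorGrEquiv_smul_tmul]
  exact Submodule.smul_mem _ _ (Φ.grEquiv_mem hs hC he hg hw)

set_option maxHeartbeats 1000000 in
lemma tensorGrEquiv_tprod (hdet : lofE P E C t (R.trace hC t g) = R.ev e Φ.det) (q : G ⧸ P)
    (z : ExtP P E C 0 ⊗[F] ExteriorAlgebra F (JQuot P E C)) :
    Φ.tensorGrEquiv hs hC he hg ((extRep P E C 0).tprod (extAlgRep (jQuotRep P E C)) q z) =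
      grRep P C q (Φ.tensorGrEquiv hs hC he hg z) := by
  obtain ⟨w, rfl⟩ := hs.tmul_eq hC he z
  obtain ⟨c, hc⟩ := hs.exists_smul hC he (extRep P E C 0 q e)
  have h1 := Φ.tensorGrEquiv_smul_tmul hs hC he hg 1 w
  rw [one_smul, one_smul] at h1
  have h2 : (extRep P E C 0).tprod (extAlgRep (jQuotRep P E C)) q (e ⊗ₜ[F] w) =
      (c • e) ⊗ₜ[F] extAlgRep (jQuotRep P E C) q w := by
    rw [← hc]
    exact TensorProduct.map_tmul _ _ _ _
  rw [h1, Φ.grRep_grEquiv hs hC he hg hdet hc, h2, tensorGrEquiv_smul_tmul]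

end Frame

lemma HasShape.exists_equiv_gr (hs : R.HasShape C m n t) (hC : IsPerfect C) :
    ∃ e : ExtP P E C 0 ⊗[F] ExteriorAlgebra F (JQuot P E C) ≃ₗ[F] Gr P C,
      (∀ (k : ℤ) (x : ExtP P E C 0), ∀ w ∈ extAlgDeg (jQuotDeg P E C) k,
        e (x ⊗ₜ[F] w) ∈ LinearMap.range (DirectSum.lof F ℤ (GrDeg P C) k)) ∧
      (∀ (q : G ⧸ P) z,
        e ((extRep P E C 0).tprod (extAlgRep (jQuotRep P E C)) q z) = grRep P C q (e z)) := by
  have he := (@exists_ne _ hs.nontrivial_zero 0).choose_spec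
  have Φ := (nonempty_frame hs hC he).some
  have hg := (Φ.exists_top hs hC he).choose_spec
  exact ⟨Φ.tensorGrEquiv hs hC he hg.1, fun k x w hw => Φ.tensorGrEquiv_mem hs hC he hg.1 x hw,
    Φ.tensorGrEquiv_tprod hs hC he hg.1 hg.2⟩

end Graded

end ResData

end EquivExt
end

theorem mainTheorem3 {F : Type u} [Field F] [CharP F 2] {G : Type u} [Group G] [Finite G]
    (P : Subgroup G) [P.Normal] [IsKleinFour P]
    (E : CochainComplex (Rep.{u} F G) ℤ) (hE : IsProjectiveResolution E)
    (C : CochainComplex (Rep.{u} F G) ℤ) (hC : IsPerfect C)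
    (m n t : ℕ) (hmn : m ≤ n) (hnt : n ≤ t)
    (hH : ∀ i : ℤ, Module.finrank F (C.homology i) =
      Multiset.count i {0, (m : ℤ), (n : ℤ), (t : ℤ)}) :
    ∃ φ : MvPolynomial (Fin 2) F ≃ₐ[F] CohRing P E,
      -- `H*(BP) = F[x₁, x₂]` with `x₁, x₂` of degree one
      (∀ i, φ (MvPolynomial.X i) ∈ extDeg P E E 1) ∧
      posIdeal P E = Ideal.span {φ (MvPolynomial.X 0), φ (MvPolynomial.X 1)} ∧
      -- (i) the isomorphism of graded `H*(BP)`-modules with `Q`-action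
      (∃ e : ExtP P E C 0 ⊗[F] (CohRing P E ⧸ annIdeal P E C) ≃ₗ[F] ExtTot P E C,
        (∀ (a : CohRing P E) (x : ExtP P E C 0) (b : CohRing P E ⧸ annIdeal P E C),
          e (x ⊗ₜ[F] (a • b)) = a • e (x ⊗ₜ[F] b)) ∧
        (∀ (k : ℤ) (x : ExtP P E C 0), ∀ b ∈ extDeg P E E k,
          e (x ⊗ₜ[F] Submodule.Quotient.mk b) ∈ extDeg P E C k) ∧
        (∀ (q : G ⧸ P) z,
          e ((extRep P E C 0).tprod (quotRep P E C) q z) = extTotRep P E C q (e z))) ∧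
      -- (ii) `J` is generated by a regular sequence of two parameters
      (∃ (y z : MvPolynomial (Fin 2) F) (a b : ℕ), 0 < a ∧ 0 < b ∧
        y.IsHomogeneous a ∧ z.IsHomogeneous b ∧
        annIdeal P E C = Ideal.span {φ y, φ z} ∧
        RingTheory.Sequence.IsRegular (MvPolynomial (Fin 2) F) [y, z] ∧
        Module.Finite F (CohRing P E ⧸ annIdeal P E C)) ∧
      -- (iii) `H*(BP) / J` is a complete intersection
      IsCompleteIntersectionLocalRing
        (MvPolynomial (Fin 2) F ⧸ (annIdeal P E C).comap φ) ∧
      -- (iv) the isomorphism of graded `F[Q]`-modules with `gr H*(C)`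
      (∃ e : ExtP P E C 0 ⊗[F] ExteriorAlgebra F (JQuot P E C) ≃ₗ[F] Gr P C,
        (∀ (k : ℤ) (x : ExtP P E C 0), ∀ w ∈ extAlgDeg (jQuotDeg P E C) k,
          e (x ⊗ₜ[F] w) ∈ LinearMap.range (DirectSum.lof F ℤ (GrDeg P C) k)) ∧
        (∀ (q : G ⧸ P) z,
          e ((extRep P E C 0).tprod (extAlgRep (jQuotRep P E C)) q z) =
            grRep P C q (e z))) ∧
      -- (v)
      t = m + n := by
  have R := (nonempty_resData (P := P) hE).some
  have hs : R.HasShape C m n t := R.hasShape hC (Int.natCast_nonneg m) (Int.ofNat_le.2 hmn)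
    (Int.ofNat_le.2 hnt) hH
  have h1 : posIdeal P E = Ideal.span {R.phi (MvPolynomial.X 0), R.phi (MvPolynomial.X 1)} := by
    rw [R.posIdeal_eq, R.phi_X, R.phi_X]
  have he := (@exists_ne _ hs.nontrivial_zero 0).choose_spec
  have Φ := (ResData.nonempty_frame hs hC he).some
  exact ⟨R.phi, fun i => R.phi_mem_extDeg (MvPolynomial.isHomogeneous_X F i), h1,
    hs.exists_equiv_ext hC,
    ⟨Φ.relY, Φ.relZ, m + 1, n + 1, m.succ_pos, n.succ_pos, Φ.isHomogeneous_relY,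
      Φ.isHomogeneous_relZ, Φ.annIdeal_eq hs hC he, Φ.isRegular hs hC he, hs.finite_quotient hC⟩,
    Φ.isCompleteIntersection hs hC he, hs.exists_equiv_gr hC, Φ.top_eq hs hC he⟩
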